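/- Fix a dimension $d\ge 1$. For a closed axis-aligned box $b=\prod_{i=1}^d[\ell_i,u_i]\subset\mathbb R^d$, its $i$-sides are the sets of points $p\in b$ with $p_i=\ell_i$, respectively $p_i=u_i$. For a finite set $A$ of boxes let $V(A)$ be the set of vertices of its arrangement, i.e. the points that lie, for every axis $i$, on an $i$-side of some box of $A$. For a finite multiset $S$ of boxes, the doubling weight of a point $p$ is $\hat w(p,S)=2^{k}$, where $k$ is the number of boxes of $S$, counted with multiplicity, that contain $p$; for a finite set $X$ of points, $\hat w(X,S)=\sum_{p\in X}\hat w(p,S)$. The model of computation is the real RAM: exact unit-cost arithmetic ($+,-,\times,/$) and comparisons on real numbers, natural numbers with addition, truncated subtraction and halving for addresses, indirect addressing, and a generator of independent random numbers uniform in $[0,1]$. A set of boxes is in general position if, on every axis, the $2n$ endpoints of the projections of its $n$ boxes are pairwise distinct. There are fixed programs and a constant, depending only on $d$, such that the following holds for every $n\ge 2$ and every set $\mathcal B$ of $n$ closed axis-aligned boxes in $\mathbb R^d$ in general position. In $O(n^{(d+1)/2}\log n)$ time one can build from $\mathcal B$ a data structure that maintains a set $A\subseteq\mathcal B$ of active boxes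 and a finite multiset $S$ of update boxes from $\mathcal B$, both initially empty, and supports each of the following operations in $O(n^{(d-1)/2}\log n)$ time: * weight$(b)$, for an arbitrary closed axis-aligned box $b$ in $\mathbb R^d$: return $\hat w(V(A)\cap b,S)$; * double$(b)$, for $b\in\mathcal B$: add a copy of $b$ to $S$; * halve$(b)$, for $b\in\mathcal B$: remove a copy of $b$ from $S$ (if there is one); * insert$(b)$, for $b\in\mathcal B$: add $b$ to the set $A$; * delete$(b)$, for $b\in\mathcal B$: remove $b$ from the set $A$; and the following operation in $O(\log n)$ time: * sample, when $V(A)\ne\emptyset$: return a random point of $V(A)$, which is $p$ with probability $\hat w(p,S)/\hat w(V(A),S)$ for every $p\in V(A)$, using fresh random numbers in every call. All time bounds are worst-case bounds per operation and hold for every outcome of the random numbers, and boxes are passed to the operations by their coordinates. -/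

import Mathlib

open MeasureTheory

/-! ### A real RAM

Words are natural numbers (used for addresses) or real numbers.  The instruction set is that of the
usual real RAM: exact unit-cost field operations and comparisons on reals, addition, truncated
subtraction and halving of naturals, indirect addressing, and independent uniform random
numbers from `[0, 1]`.  There is no conversion from reals to naturals (no floor function) and no
multiplication of naturals. -/

namespace RealRAM

/-- A configuration: finitely many of the registers occur in a given program, the two heaps are
addressed indirectly, `draws` is the number of random numbers drawn so far. -/
structure State where
  nreg : ℕ → ℕ
  rreg : ℕ → ℝ
  nheap : ℕ → ℕ
  rheap : ℕ → ℝ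
  draws : ℕ

/-- Natural-number expressions. -/
inductive NExp where
  | const (k : ℕ)
  | reg (i : ℕ)
  | heap (a : NExp)
  | add (a b : NExp)
  | sub (a b : NExp)
  | half (a : NExp)

/-- Real expressions. -/
inductive RExp where
  | reg (i : ℕ)
  | heap (a : NExp)
  | cast (a : NExp)
  | add (x y : RExp)
  | sub (x y : RExp)
  | mul (x y : RExp)
  | div (x y : RExp)

/-- Tests. -/
inductive BExp where
  | nlt (a b : NExp)
  | rlt (x y : RExp)
  | not (p : BExp)
  | and (p q : BExp)

namespace NExp

def eval (σ : State) : NExp → ℕ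
  | const k => k
  | reg i => σ.nreg i
  | heap a => σ.nheap (a.eval σ)
  | add a b => a.eval σ + b.eval σ
  | sub a b => a.eval σ - b.eval σ
  | half a => a.eval σ / 2

/-- The number of machine operations needed to evaluate the expression. -/
def cost : NExp → ℕ
  | const _ => 1
  | reg _ => 1
  | heap a => a.cost + 1
  | add a b => a.cost + b.cost + 1
  | sub a b => a.cost + b.cost + 1
  | half a => a.cost + 1

end NExp

namespace RExp

noncomputable def eval (σ : State) : RExp → ℝ
  | reg i => σ.rreg i
  | heap a => σ.rheap (a.eval σ)
  | cast a => (a.eval σ : ℝ)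
  | add x y => x.eval σ + y.eval σ
  | sub x y => x.eval σ - y.eval σ
  | mul x y => x.eval σ * y.eval σ
  | div x y => x.eval σ / y.eval σ

def cost : RExp → ℕ
  | reg _ => 1
  | heap a => a.cost + 1
  | cast a => a.cost + 1
  | add x y => x.cost + y.cost + 1
  | sub x y => x.cost + y.cost + 1
  | mul x y => x.cost + y.cost + 1
  | div x y => x.cost + y.cost + 1

end RExp

namespace BExp

def Holds (σ : State) : BExp → Prop
  | nlt a b => a.eval σ < b.eval σ
  | rlt x y => x.eval σ < y.eval σ
  | not p => ¬ p.Holds σ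
  | and p q => p.Holds σ ∧ q.Holds σ

def cost : BExp → ℕ
  | nlt a b => a.cost + b.cost + 1
  | rlt x y => x.cost + y.cost + 1
  | not p => p.cost + 1
  | and p q => p.cost + q.cost + 1

end BExp

/-- Programs. -/
inductive Prog where
  | skip
  | setN (i : ℕ) (a : NExp)
  | setR (i : ℕ) (x : RExp)
  | storeN (addr : NExp) (a : NExp)
  | storeR (addr : NExp) (x : RExp)
  | rand (i : ℕ)
  | seq (P Q : Prog)
  | ite (p : BExp) (P Q : Prog)
  | loop (p : BExp) (P : Prog)

/-- The outcomes of the successive draws of the random number generator. -/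
abbrev Tape := ℕ → unitInterval

/-- The law of the random tape: independent, uniform on `[0, 1]`. -/
noncomputable def tapeLaw : Measure Tape :=
  Measure.infinitePi fun _ : ℕ => (volume : Measure unitInterval)

/-- `Exec ω P σ t τ`: with random tape `ω`, the program `P` started in `σ` halts in `τ` after
exactly `t` steps. -/
inductive Exec (ω : Tape) : Prog → State → ℕ → State → Prop
  | skip (σ : State) : Exec ω Prog.skip σ 1 σ
  | setN (σ : State) (i : ℕ) (a : NExp) :
      Exec ω (Prog.setN i a) σ (a.cost + 1)
        { σ with nreg := Function.update σ.nreg i (a.eval σ) }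
  | setR (σ : State) (i : ℕ) (x : RExp) :
      Exec ω (Prog.setR i x) σ (x.cost + 1)
        { σ with rreg := Function.update σ.rreg i (x.eval σ) }
  | storeN (σ : State) (addr a : NExp) :
      Exec ω (Prog.storeN addr a) σ (addr.cost + a.cost + 1)
        { σ with nheap := Function.update σ.nheap (addr.eval σ) (a.eval σ) }
  | storeR (σ : State) (addr : NExp) (x : RExp) :
      Exec ω (Prog.storeR addr x) σ (addr.cost + x.cost + 1)
        { σ with rheap := Function.update σ.rheap (addr.eval σ) (x.eval σ) }
  | rand (σ : State) (i : ℕ) :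
      Exec ω (Prog.rand i) σ 1
        { σ with
          rreg := Function.update σ.rreg i (ω σ.draws : ℝ)
          draws := σ.draws + 1 }
  | seq {P Q : Prog} {σ τ υ : State} {s t : ℕ} :
      Exec ω P σ s τ → Exec ω Q τ t υ → Exec ω (Prog.seq P Q) σ (s + t) υ
  | ite_true {p : BExp} {P Q : Prog} {σ τ : State} {t : ℕ} :
      p.Holds σ → Exec ω P σ t τ → Exec ω (Prog.ite p P Q) σ (p.cost + t) τ
  | ite_false {p : BExp} {P Q : Prog} {σ τ : State} {t : ℕ} :
      ¬ p.Holds σ → Exec ω Q σ t τ → Exec ω (Prog.ite p P Q) σ (p.cost + t) τ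
  | loop_done {p : BExp} {P : Prog} {σ : State} :
      ¬ p.Holds σ → Exec ω (Prog.loop p P) σ p.cost σ
  | loop_step {p : BExp} {P : Prog} {σ τ υ : State} {s t : ℕ} :
      p.Holds σ → Exec ω P σ s τ → Exec ω (Prog.loop p P) τ t υ →
        Exec ω (Prog.loop p P) σ (p.cost + s + t) υ

/-- Whatever the random draws are, `P` started in `σ` halts within `T` steps, in a configuration
satisfying `Q`. -/
def HaltsWithin (P : Prog) (σ : State) (T : ℝ) (Q : State → Prop) : Prop :=
  ∀ ω : Tape, ∃ (t : ℕ) (τ : State), Exec ω P σ t τ ∧ (t : ℝ) ≤ T ∧ Q τ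

end RealRAM

/-! ### Boxes, arrangements, doubling weights -/

/-- Closed axis-aligned boxes `{x | fst ≤ x ≤ snd}` in `ℝ^d`, where `fst ≤ snd`. -/
abbrev AABox (d : ℕ) := NonemptyInterval (Fin d → ℝ)

namespace AABox

variable {d n : ℕ}

/-- General position: on every axis, the `2n` endpoints of the projections of the boxes are
pairwise distinct. -/
def GeneralPosition (B : Fin n → AABox d) : Prop :=
  ∀ i : Fin d, Function.Injective
    fun q : Fin n × Bool => if q.2 then (B q.1).snd i else (B q.1).fst i

/-- The facet(s) of `b` orthogonal to the `i`-th axis. -/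
def sides (b : AABox d) (i : Fin d) : Set (Fin d → ℝ) :=
  {p | p ∈ b ∧ (p i = b.fst i ∨ p i = b.snd i)}

/-- The vertices of the arrangement of the boxes `B j`, `j ∈ A`: the points where facets
orthogonal to all the `d` axes meet. -/
def vertices (B : Fin n → AABox d) (A : Finset (Fin n)) : Set (Fin d → ℝ) :=
  {p | ∀ i : Fin d, ∃ j ∈ A, p ∈ (B j).sides i}

/-- There are finitely many vertices, so that the sums below are genuine sums. -/
theorem vertices_finite (B : Fin n → AABox d) (A : Finset (Fin n)) : (vertices B A).Finite := by
  refine Set.Finite.subset (Set.Finite.pi' (t := fun i : Fin d =>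
    ((fun j => (B j).fst i) '' (A : Set (Fin n))) ∪ ((fun j => (B j).snd i) '' (A : Set (Fin n))))
    fun i => (A.finite_toSet.image _).union (A.finite_toSet.image _)) ?_
  intro p hp i
  obtain ⟨j, hj, -, h | h⟩ := hp i
  · exact Or.inl ⟨j, hj, h.symm⟩
  · exact Or.inr ⟨j, hj, h.symm⟩

open Classical in
/-- The doubling weight `2 ^ #{j ∈ S | p ∈ B j}` of a point, for a multiset `S` of boxes. -/
noncomputable def weight (B : Fin n → AABox d) (S : Multiset (Fin n)) (p : Fin d → ℝ) : ℝ :=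
  2 ^ S.countP fun j => p ∈ B j

/-- The total doubling weight of a finite set of points. -/
noncomputable def totalWeight (B : Fin n → AABox d) (S : Multiset (Fin n))
    (X : Set (Fin d → ℝ)) : ℝ :=
  ∑ᶠ p ∈ X, weight B S p

/-- The list `fst 0, snd 0, fst 1, snd 1, …` of the `2d` coordinates of a box, padded by `0`. -/
noncomputable def coords (b : AABox d) (r : ℕ) : ℝ :=
  if h : r / 2 < d then (if r % 2 = 0 then b.fst ⟨r / 2, h⟩ else b.snd ⟨r / 2, h⟩) else 0

end AABox

/-! ### Input and output conventions -/

namespace RealRAM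

/-- The initial configuration on input `B`: the number `n` is in natural register `0`, the
coordinates of the boxes are listed consecutively in the real heap; everything else is `0`. -/
noncomputable def initState {d n : ℕ} (B : Fin n → AABox d) : State where
  nreg := fun i => if i = 0 then n else 0
  rreg := fun _ => 0
  nheap := fun _ => 0
  rheap := fun a =>
    if h : a / (2 * d) < n then (B ⟨a / (2 * d), h⟩).coords (a % (2 * d)) else 0
  draws := 0

/-- Passing a box as argument: its coordinates are put into the real registers `0, …, 2d - 1`. -/
noncomputable def State.withBox {d : ℕ} (σ : State) (b : AABox d) : State :=
  { σ with rreg := fun r => if r < 2 * d then b.coords r else σ.rreg r }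

/-- Returning a point: its coordinates are in the real registers `0, …, d - 1`. -/
def State.point (d : ℕ) (σ : State) : Fin d → ℝ := fun i => σ.rreg i

end RealRAM

/-! Replace coordinates by ranks. In general position the `2n` endpoints on an axis are distinct, so
vertices become points of the grid `[0, 2n)^d` and boxes become products of rank intervals. The grid
is cut into cells, axis after axis. An entry of level `m` is a product of intervals on the first `m`
axes. It is subdivided along axis `m` into at most `K = (4d+3)s` intervals of length at most `s`,
where `s` is the square root of `n` rounded up. In addition, a rank is isolated in an interval of
its own if its box already has an endpoint in an earlier interval of the entry. By `card_special`
there are at most `2sm` such special ranks, so isolating them only costs a constant factor in `K`.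

The gain is `single_of_endIn`: if a box has endpoints in two intervals of a cell, the interval on
the later axis is a single rank. Hence a box that meets a cell covers it on all axes except at most
one (`eq_of_not_cover`). It acts there like a slab, so inside a cell the doubling weight is a
product of functions of the single coordinates. By `vert_iff` the vertices in a cell also form a
product set. The weight of the vertices of a cell in any box is therefore a product of `d`
one-dimensional sums (`sum_cell`). Each of these is kept in a binary tree with multiplicative lazy
tags. One more tree has the cells as leaves: its leaf values are the products of the root sums of
the cells, its tags are multipliers common to whole cells.

An operation visits the entries of level `d-1`, at most `K^(d-1)` in number (`card_level`). If no
side of the box falls into the first `d-1` intervals of an entry, only the two cells at the ends on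
the last axis need individual treatment, and the cells between them are consecutive leaves of the
tree over all cells. Otherwise all its at most `K` cells are treated, but by `card_through` there
are only `O(K^(d-2))` such entries. So `traverse` makes `O(K^(d-1))` tree operations of cost `O(log
n)`, which is `O(n^((d-1)/2) log n)`. Doubling and halving multiply ranges of leaves, insertion and
deletion rewrite the leaves of the sides of one box, and a weight query adds up products of range
sums.

For sampling, a cell is drawn with the tree over all cells, then a rank on each axis independently
with the trees of this cell; since weights factor, the probabilities multiply to the required one
(`sample_law`).

For building, the endpoints are sorted with a tournament tree, and each of the `O(K^(d-1))` entries
to be subdivided is handled by one scan over the `2n` ranks. The trees occupy far more addresses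
than the time bound allows to touch, but they need no initialisation: tags are stored minus one, so
zeroed memory already represents trees with all tags `1` and all sums `0`.

Running times are tracked by `Fast`: the cost of a program is a constant read off from its text
times a bound `U` for the lengths of its loops. -/

namespace RealRAM

/-! ### Program logic -/

infixr:60 " ;; " => Prog.seq

/-- With random tape `ω`, the program `P` started in `σ` halts within `T` steps in a configuration
satisfying `Q`. -/
def Runs (ω : Tape) (P : Prog) (σ : State) (T : ℕ) (Q : State → Prop) : Prop :=
  ∃ t τ, Exec ω P σ t τ ∧ t ≤ T ∧ Q τ

namespace Runs

variable {ω : Tape} {P R : Prog} {σ : State} {T T₁ T₂ : ℕ} {Q Q' : State → Prop}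

theorem mono (h : Runs ω P σ T₁ Q) (hT : T₁ ≤ T₂) (hQ : ∀ τ, Q τ → Q' τ) : Runs ω P σ T₂ Q' := by
  obtain ⟨t, τ, he, ht, hq⟩ := h
  exact ⟨t, τ, he, ht.trans hT, hQ τ hq⟩

theorem seq (h : Runs ω P σ T₁ (fun τ => Runs ω R τ T₂ Q)) : Runs ω (P ;; R) σ (T₁ + T₂) Q := by
  obtain ⟨t, τ, he, ht, t', τ', he', ht', hq⟩ := h
  exact ⟨_, τ', Exec.seq he he', by omega, hq⟩

theorem seq' (h : Runs ω P σ T₁ Q') (h' : ∀ τ, Q' τ → Runs ω R τ T₂ Q) (hT : T₁ + T₂ ≤ T) :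
    Runs ω (P ;; R) σ T Q :=
  (seq (h.mono le_rfl h')).mono hT fun _ => id

theorem ite {p : BExp} (h₁ : p.Holds σ → Runs ω P σ T Q) (h₂ : ¬ p.Holds σ → Runs ω R σ T Q) :
    Runs ω (Prog.ite p P R) σ (p.cost + T) Q := by
  by_cases hp : p.Holds σ
  · obtain ⟨t, τ, he, ht, hq⟩ := h₁ hp
    exact ⟨_, τ, Exec.ite_true hp he, by omega, hq⟩
  · obtain ⟨t, τ, he, ht, hq⟩ := h₂ hp
    exact ⟨_, τ, Exec.ite_false hp he, by omega, hq⟩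

/-- Loop rule: `I k σ` says that at most `k` iterations remain; the iteration entered with bound
`k + 1` costs at most `c k`. -/
theorem loop {p : BExp} (I : ℕ → State → Prop) (c : ℕ → ℕ)
    (hstep : ∀ k σ, I k σ → p.Holds σ → ∃ k', k = k' + 1 ∧ Runs ω P σ (c k') (I k'))
    (hdone : ∀ k σ, I k σ → ¬ p.Holds σ → Q σ) :
    ∀ k σ, I k σ →
      Runs ω (Prog.loop p P) σ (∑ i ∈ Finset.range k, (p.cost + c i) + p.cost) Q := by
  intro k
  induction k with
  | zero =>
    intro σ hI
    by_cases hp : p.Holds σ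
    · obtain ⟨k', hk, -⟩ := hstep _ _ hI hp
      omega
    · exact ⟨_, σ, Exec.loop_done hp, by simp, hdone _ _ hI hp⟩
  | succ k ih =>
    intro σ hI
    by_cases hp : p.Holds σ
    · obtain ⟨k', hk, t, τ, he, ht, hτ⟩ := hstep _ _ hI hp
      obtain rfl : k = k' := by omega
      obtain ⟨t', τ', he', ht', hq⟩ := ih τ hτ
      refine ⟨_, τ', Exec.loop_step hp he he', ?_, hq⟩
      rw [Finset.sum_range_succ]
      omega
    · exact ⟨_, σ, Exec.loop_done hp, by omega, hdone _ _ hI hp⟩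

/-- Loop rule with a uniform bound for the cost of an iteration. -/
theorem loop_uniform {p : BExp} (I : ℕ → State → Prop) (c : ℕ)
    (hstep : ∀ k σ, I k σ → p.Holds σ → ∃ k', k = k' + 1 ∧ Runs ω P σ c (I k'))
    (hdone : ∀ k σ, I k σ → ¬ p.Holds σ → Q σ) (k : ℕ) (σ : State) (hI : I k σ) :
    Runs ω (Prog.loop p P) σ ((k + 1) * (p.cost + c)) Q := by
  refine (loop I (fun _ => c) hstep hdone k σ hI).mono ?_ fun _ => id
  simp only [Finset.sum_const, Finset.card_range, smul_eq_mul]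
  nlinarith

end Runs

/-- The event in the sampling law speaks of some halting run. Determinism allows it to be evaluated
on the one run that `sample_spec` provides. -/
theorem Exec.deterministic {ω : Tape} {P : Prog} {σ τ τ' : State} {t t' : ℕ}
    (h : Exec ω P σ t τ) (h' : Exec ω P σ t' τ') : τ = τ' := by
  induction h generalizing t' τ' with
  | skip => cases h'; rfl
  | setN => cases h'; rfl
  | setR => cases h'; rfl
  | storeN => cases h'; rfl
  | storeR => cases h'; rfl
  | rand => cases h'; rfl
  | seq _ _ ih₁ ih₂ =>
    cases h' with
    | seq h₁ h₂ => obtain rfl := ih₁ h₁; exact ih₂ h₂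
  | ite_true hp _ ih =>
    cases h' with
    | ite_true _ h₁ => exact ih h₁
    | ite_false hn _ => exact absurd hp hn
  | ite_false hp _ ih =>
    cases h' with
    | ite_true hn _ => exact absurd hn hp
    | ite_false _ h₁ => exact ih h₁
  | loop_done hp =>
    cases h' with
    | loop_done => rfl
    | loop_step hn _ _ => exact absurd hn hp
  | loop_step hp _ _ ih₁ ih₂ =>
    cases h' with
    | loop_done hn => exact absurd hp hn
    | loop_step _ h₁ h₂ => obtain rfl := ih₁ h₁; exact ih₂ h₂

theorem HaltsWithin.of_runs {P : Prog} {σ : State} {T : ℕ} {T' : ℝ} {Q : State → Prop}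
    (h : ∀ ω, Runs ω P σ T Q) (hT : (T : ℝ) ≤ T') : HaltsWithin P σ T' Q := by
  intro ω
  obtain ⟨t, τ, he, ht, hq⟩ := h ω
  exact ⟨t, τ, he, le_trans (by exact_mod_cast ht) hT, hq⟩

/-! ### Expressions and arrays -/

abbrev nv (i : ℕ) : NExp := .reg i
abbrev nc (k : ℕ) : NExp := .const k
abbrev rv (i : ℕ) : RExp := .reg i
abbrev rc (k : ℕ) : RExp := .cast (.const k)

instance : Add NExp := ⟨.add⟩
instance : Sub NExp := ⟨.sub⟩
instance : Add RExp := ⟨.add⟩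
instance : Sub RExp := ⟨.sub⟩
instance : Mul RExp := ⟨.mul⟩
instance : Div RExp := ⟨.div⟩

section eval
variable (σ : State) (a b : NExp) (x y : RExp)
@[simp] theorem NExp.eval_add : (a + b).eval σ = a.eval σ + b.eval σ := rfl
@[simp] theorem NExp.eval_sub : (a - b).eval σ = a.eval σ - b.eval σ := rfl
@[simp] theorem NExp.eval_reg (i : ℕ) : (NExp.reg i).eval σ = σ.nreg i := rfl
@[simp] theorem NExp.eval_const (i : ℕ) : (NExp.const i).eval σ = i := rfl
@[simp] theorem NExp.eval_half : (NExp.half a).eval σ = a.eval σ / 2 := rfl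
@[simp] theorem RExp.eval_add : (x + y).eval σ = x.eval σ + y.eval σ := rfl
@[simp] theorem RExp.eval_sub : (x - y).eval σ = x.eval σ - y.eval σ := rfl
@[simp] theorem RExp.eval_mul : (x * y).eval σ = x.eval σ * y.eval σ := rfl
@[simp] theorem RExp.eval_div : (x / y).eval σ = x.eval σ / y.eval σ := rfl
@[simp] theorem RExp.eval_reg (i : ℕ) : (RExp.reg i).eval σ = σ.rreg i := rfl
@[simp] theorem RExp.eval_cast : (RExp.cast a).eval σ = (a.eval σ : ℝ) := rfl
@[simp] theorem BExp.holds_nlt : (BExp.nlt a b).Holds σ ↔ a.eval σ < b.eval σ := Iff.rfl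
@[simp] theorem BExp.holds_rlt : (BExp.rlt x y).Holds σ ↔ x.eval σ < y.eval σ := Iff.rfl
@[simp] theorem BExp.holds_not (p : BExp) : p.not.Holds σ ↔ ¬ p.Holds σ := Iff.rfl
@[simp] theorem BExp.holds_and (p q : BExp) : (p.and q).Holds σ ↔ p.Holds σ ∧ q.Holds σ := Iff.rfl
end eval

/-- `a ≤ b` as a test. -/
def BExp.nle (a b : NExp) : BExp := (BExp.nlt b a).not
/-- `a = b` as a test. -/
def BExp.neq (a b : NExp) : BExp := (BExp.nle a b).and (BExp.nle b a)

@[simp] theorem BExp.holds_nle (σ : State) (a b : NExp) :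
    (BExp.nle a b).Holds σ ↔ a.eval σ ≤ b.eval σ := by simp [BExp.nle]
@[simp] theorem BExp.holds_neq (σ : State) (a b : NExp) :
    (BExp.neq a b).Holds σ ↔ a.eval σ = b.eval σ := by simp [BExp.neq, le_antisymm_iff]

/-- Multiplication by a constant. -/
def NExp.times : ℕ → NExp → NExp
  | 0, _ => .const 0
  | k + 1, a => times k a + a

@[simp] theorem NExp.eval_times (σ : State) (k : ℕ) (a : NExp) :
    (NExp.times k a).eval σ = k * a.eval σ := by
  induction k with
  | zero => simp [NExp.times]
  | succ k ih => simp [NExp.times, ih]; ring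

/-- The address of the `k`-th word of the `f`-th array. -/
def slot (f k : ℕ) : ℕ := 2 ^ f * (2 * k + 1)

theorem slot_succ (f k : ℕ) : slot (f + 1) k = 2 * slot f k := by
  simp only [slot, pow_succ]; ring

theorem slot_zero (k : ℕ) : slot 0 k = 2 * k + 1 := by simp [slot]

/-- A positive number is in only one way a power of two times an odd number. So arbitrarily many
unbounded arrays share one heap, and for a fixed array the address needs only additions, natural
multiplication not being available. -/
theorem slot_inj {f k f' k' : ℕ} : slot f k = slot f' k' ↔ f = f' ∧ k = k' := by
  constructor
  · intro h
    induction f generalizing f' with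
    | zero =>
      cases f' with
      | zero => simp only [slot_zero] at h; omega
      | succ f' => rw [slot_zero, slot_succ] at h; omega
    | succ f ih =>
      cases f' with
      | zero => rw [slot_zero, slot_succ] at h; omega
      | succ f' =>
        have := ih (f' := f') (by rw [slot_succ, slot_succ] at h; omega)
        omega
  · rintro ⟨rfl, rfl⟩; rfl

def slotE : ℕ → NExp → NExp
  | 0, k => k + k + .const 1
  | f + 1, k => slotE f k + slotE f k

@[simp] theorem eval_slotE (σ : State) (f : ℕ) (k : NExp) :
    (slotE f k).eval σ = slot f (k.eval σ) := by
  induction f with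
  | zero => simp [slotE, slot]; ring
  | succ f ih => simp only [slotE, NExp.eval_add, ih]; simp only [slot, pow_succ]; ring

namespace State

/-- The arrays of natural numbers. -/
def na (σ : State) (f k : ℕ) : ℕ := σ.nheap (slot f k)
/-- The arrays of real numbers; they start after the address in register `1`. -/
noncomputable def ra (σ : State) (f k : ℕ) : ℝ := σ.rheap (σ.nreg 1 + slot f k)

def setN (σ : State) (i v : ℕ) : State := { σ with nreg := Function.update σ.nreg i v }
noncomputable def setR (σ : State) (i : ℕ) (v : ℝ) : State :=
  { σ with rreg := Function.update σ.rreg i v }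
def putNA (σ : State) (f k v : ℕ) : State :=
  { σ with nheap := Function.update σ.nheap (slot f k) v }
noncomputable def putRA (σ : State) (f k : ℕ) (v : ℝ) : State :=
  { σ with rheap := Function.update σ.rheap (σ.nreg 1 + slot f k) v }
/-- Draw a random number into register `i`. -/
noncomputable def drawR (σ : State) (ω : Tape) (i : ℕ) : State :=
  { σ with rreg := Function.update σ.rreg i (ω σ.draws : ℝ), draws := σ.draws + 1 }

section proj
variable (σ : State) (i f k v j f' k' : ℕ) (x : ℝ) (ω : Tape)

@[simp] theorem setN_nreg : (σ.setN i v).nreg j = if j = i then v else σ.nreg j := by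
  simp [setN, Function.update_apply]
@[simp] theorem setN_rreg : (σ.setN i v).rreg = σ.rreg := rfl
@[simp] theorem setN_na : (σ.setN i v).na = σ.na := rfl
@[simp] theorem setN_rheap : (σ.setN i v).rheap = σ.rheap := rfl
@[simp] theorem setN_draws : (σ.setN i v).draws = σ.draws := rfl
@[simp] theorem setN_ra (h : i ≠ 1) : (σ.setN i v).ra = σ.ra := by
  funext f k; simp [ra, h.symm]
@[simp] theorem setR_nreg : (σ.setR i x).nreg = σ.nreg := rfl
@[simp] theorem setR_rreg : (σ.setR i x).rreg j = if j = i then x else σ.rreg j := by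
  simp [setR, Function.update_apply]
@[simp] theorem setR_na : (σ.setR i x).na = σ.na := rfl
@[simp] theorem setR_ra : (σ.setR i x).ra = σ.ra := rfl
@[simp] theorem setR_rheap : (σ.setR i x).rheap = σ.rheap := rfl
@[simp] theorem setR_draws : (σ.setR i x).draws = σ.draws := rfl
@[simp] theorem putNA_nreg : (σ.putNA f k v).nreg = σ.nreg := rfl
@[simp] theorem putNA_rreg : (σ.putNA f k v).rreg = σ.rreg := rfl
@[simp] theorem putNA_ra : (σ.putNA f k v).ra = σ.ra := rfl
@[simp] theorem putNA_rheap : (σ.putNA f k v).rheap = σ.rheap := rfl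
@[simp] theorem putNA_draws : (σ.putNA f k v).draws = σ.draws := rfl
@[simp] theorem putNA_na :
    (σ.putNA f k v).na f' k' = if f' = f ∧ k' = k then v else σ.na f' k' := by
  simp [na, putNA, Function.update_apply, slot_inj]
@[simp] theorem putRA_nreg : (σ.putRA f k x).nreg = σ.nreg := rfl
@[simp] theorem putRA_rreg : (σ.putRA f k x).rreg = σ.rreg := rfl
@[simp] theorem putRA_na : (σ.putRA f k x).na = σ.na := rfl
@[simp] theorem putRA_draws : (σ.putRA f k x).draws = σ.draws := rfl
@[simp] theorem putRA_ra :
    (σ.putRA f k x).ra f' k' = if f' = f ∧ k' = k then x else σ.ra f' k' := by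
  simp [ra, putRA, Function.update_apply, slot_inj]
theorem putRA_rheap {a : ℕ} (h : a < σ.nreg 1) : (σ.putRA f k x).rheap a = σ.rheap a := by
  simp [putRA, Function.update_apply]; omega
@[simp] theorem drawR_nreg : (σ.drawR ω i).nreg = σ.nreg := rfl
@[simp] theorem drawR_rreg :
    (σ.drawR ω i).rreg j = if j = i then (ω σ.draws : ℝ) else σ.rreg j := by
  simp [drawR, Function.update_apply]
@[simp] theorem drawR_na : (σ.drawR ω i).na = σ.na := rfl
@[simp] theorem drawR_ra : (σ.drawR ω i).ra = σ.ra := rfl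
@[simp] theorem drawR_draws : (σ.drawR ω i).draws = σ.draws + 1 := rfl
end proj

end State

def NExp.arr (f : ℕ) (k : NExp) : NExp := .heap (slotE f k)
def RExp.arr (f : ℕ) (k : NExp) : RExp := .heap (.reg 1 + slotE f k)
def putN (f : ℕ) (k a : NExp) : Prog := .storeN (slotE f k) a
def putR (f : ℕ) (k : NExp) (x : RExp) : Prog := .storeR (.reg 1 + slotE f k) x

@[simp] theorem NExp.eval_arr (σ : State) (f : ℕ) (k : NExp) :
    (NExp.arr f k).eval σ = σ.na f (k.eval σ) := by
  simp [NExp.arr, NExp.eval, State.na]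
@[simp] theorem RExp.eval_arr (σ : State) (f : ℕ) (k : NExp) :
    (RExp.arr f k).eval σ = σ.ra f (k.eval σ) := by
  simp [RExp.arr, RExp.eval, State.ra]
@[simp] theorem NExp.eval_heap (σ : State) (a : NExp) :
    (NExp.heap a).eval σ = σ.nheap (a.eval σ) := rfl
@[simp] theorem RExp.eval_heap (σ : State) (a : NExp) :
    (RExp.heap a).eval σ = σ.rheap (a.eval σ) := rfl

/-! ### Weakest preconditions of loop-free programs -/

/-- Weakest precondition of a loop-free program. -/
def wp (ω : Tape) : Prog → (State → Prop) → State → Prop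
  | .skip, Q, σ => Q σ
  | .setN i a, Q, σ => Q (σ.setN i (a.eval σ))
  | .setR i x, Q, σ => Q (σ.setR i (x.eval σ))
  | .storeN a v, Q, σ => Q { σ with nheap := Function.update σ.nheap (a.eval σ) (v.eval σ) }
  | .storeR a v, Q, σ => Q { σ with rheap := Function.update σ.rheap (a.eval σ) (v.eval σ) }
  | .rand i, Q, σ => Q (σ.drawR ω i)
  | .seq P R, Q, σ => wp ω P (wp ω R Q) σ
  | .ite p P R, Q, σ => (p.Holds σ → wp ω P Q σ) ∧ (¬ p.Holds σ → wp ω R Q σ)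
  | .loop _ _, _, _ => False

/-- The cost of a program all of whose loops are run once. -/
def Prog.wcost : Prog → ℕ
  | .skip => 1
  | .setN _ a => a.cost + 1
  | .setR _ x => x.cost + 1
  | .storeN a v => a.cost + v.cost + 1
  | .storeR a v => a.cost + v.cost + 1
  | .rand _ => 1
  | .seq P R => P.wcost + R.wcost
  | .ite p P R => p.cost + P.wcost + R.wcost
  | .loop p P => p.cost + P.wcost

section wp
variable (ω : Tape) (Q : State → Prop) (σ : State)
@[simp] theorem wp_skip : wp ω .skip Q σ = Q σ := rfl
@[simp] theorem wp_setN (i a) : wp ω (.setN i a) Q σ = Q (σ.setN i (a.eval σ)) := rfl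
@[simp] theorem wp_setR (i x) : wp ω (.setR i x) Q σ = Q (σ.setR i (x.eval σ)) := rfl
@[simp] theorem wp_rand (i) : wp ω (.rand i) Q σ = Q (σ.drawR ω i) := rfl
@[simp] theorem wp_seq (P R) : wp ω (P ;; R) Q σ = wp ω P (wp ω R Q) σ := rfl
@[simp] theorem wp_ite (p P R) : wp ω (.ite p P R) Q σ =
    ((p.Holds σ → wp ω P Q σ) ∧ (¬ p.Holds σ → wp ω R Q σ)) := rfl
@[simp] theorem wp_putN (f : ℕ) (k a : NExp) :
    wp ω (putN f k a) Q σ = Q (σ.putNA f (k.eval σ) (a.eval σ)) := by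
  simp [putN, wp, State.putNA]
@[simp] theorem wp_putR (f : ℕ) (k : NExp) (x : RExp) :
    wp ω (putR f k x) Q σ = Q (σ.putRA f (k.eval σ) (x.eval σ)) := by
  simp [putR, wp, State.putRA]
end wp

theorem wp_mono {ω : Tape} {P : Prog} {Q Q' : State → Prop} (hQ : ∀ τ, Q τ → Q' τ) {σ : State}
    (h : wp ω P Q σ) : wp ω P Q' σ := by
  induction P generalizing σ Q Q' with
  | seq P R ih₁ ih₂ => exact ih₁ (fun τ hτ => ih₂ hQ hτ) h
  | ite p P R ih₁ ih₂ => exact ⟨fun hp => ih₁ hQ (h.1 hp), fun hp => ih₂ hQ (h.2 hp)⟩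
  | loop => exact h.elim
  | _ => exact hQ _ h

theorem Runs.of_wp {ω : Tape} {P : Prog} {σ : State} {Q : State → Prop} (h : wp ω P Q σ) :
    Runs ω P σ P.wcost Q := by
  induction P generalizing σ Q with
  | skip => exact ⟨_, _, Exec.skip σ, le_rfl, h⟩
  | setN i a => exact ⟨_, _, Exec.setN σ i a, le_rfl, h⟩
  | setR i a => exact ⟨_, _, Exec.setR σ i a, le_rfl, h⟩
  | storeN i a => exact ⟨_, _, Exec.storeN σ i a, le_rfl, h⟩
  | storeR i a => exact ⟨_, _, Exec.storeR σ i a, le_rfl, h⟩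
  | rand i => exact ⟨_, _, Exec.rand σ i, le_rfl, h⟩
  | seq P R ih₁ ih₂ => exact Runs.seq ((ih₁ h).mono le_rfl fun τ hτ => ih₂ hτ)
  | ite p P R ih₁ ih₂ =>
    refine (Runs.ite (T := P.wcost + R.wcost) (fun hp => ?_) fun hp => ?_).mono
      (by simp only [Prog.wcost]; omega) fun _ => id
    · exact (ih₁ (h.1 hp)).mono (by omega) fun _ => id
    · exact (ih₂ (h.2 hp)).mono (by omega) fun _ => id
  | loop => exact h.elim

/-- `P` runs in time proportional to `U`, the constant being given by the text of `P`. -/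
def Fast (ω : Tape) (U : ℕ) (P : Prog) (σ : State) (Q : State → Prop) : Prop :=
  Runs ω P σ (P.wcost * U) Q

namespace Fast
variable {ω : Tape} {U : ℕ} {P R : Prog} {σ : State} {Q Q' : State → Prop}

theorem mono (h : Fast ω U P σ Q) (hQ : ∀ τ, Q τ → Q' τ) : Fast ω U P σ Q' :=
  Runs.mono h le_rfl hQ

theorem of_wp (hU : 1 ≤ U) (h : wp ω P Q σ) : Fast ω U P σ Q :=
  (Runs.of_wp h).mono (Nat.le_mul_of_pos_right _ hU) fun _ => id

theorem seq (h : Fast ω U P σ (fun τ => Fast ω U R τ Q)) : Fast ω U (P ;; R) σ Q :=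
  (Runs.seq h).mono (by simp only [Prog.wcost, add_mul]; exact le_rfl) fun _ => id

theorem seq_wp (hU : 1 ≤ U) (h : wp ω P (fun τ => Fast ω U R τ Q) σ) : Fast ω U (P ;; R) σ Q :=
  seq (of_wp hU h)

theorem ite {p : BExp} (hU : 1 ≤ U) (h₁ : p.Holds σ → Fast ω U P σ Q)
    (h₂ : ¬ p.Holds σ → Fast ω U R σ Q) : Fast ω U (.ite p P R) σ Q := by
  refine (Runs.ite (T := P.wcost * U + R.wcost * U) (fun hp => ?_) fun hp => ?_).mono
    (by simp only [Prog.wcost]; nlinarith) fun _ => id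
  · exact Runs.mono (h₁ hp) (by omega) fun _ => id
  · exact Runs.mono (h₂ hp) (by omega) fun _ => id

/-- The index of the invariant bounds the iterations that remain; the strict inequality `k < U` also
pays for the last, failing test. -/
theorem loop {p : BExp} (I : ℕ → State → Prop)
    (hstep : ∀ k σ, I k σ → p.Holds σ → ∃ k', k = k' + 1 ∧ wp ω P (I k') σ)
    (hdone : ∀ k σ, I k σ → ¬ p.Holds σ → Q σ) {k : ℕ} (hk : k < U) (hI : I k σ) :
    Fast ω U (.loop p P) σ Q := by
  refine (Runs.loop_uniform I P.wcost (fun k σ h hp => ?_) hdone k σ hI).mono ?_ fun _ => id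
  · obtain ⟨k', h₁, h₂⟩ := hstep k σ h hp
    exact ⟨k', h₁, Runs.of_wp h₂⟩
  · simp only [Prog.wcost]
    rw [mul_comm]
    exact Nat.mul_le_mul_left _ hk

end Fast

/-- The programs `f 0, …, f (m - 1)`, one after the other. -/
def forAx (f : ℕ → Prog) : ℕ → Prog
  | 0 => .skip
  | m + 1 => forAx f m ;; f m

theorem wp_forAx {ω : Tape} {f : ℕ → Prog} (I : ℕ → State → Prop) {m : ℕ} {σ : State}
    (hstep : ∀ i < m, ∀ σ, I i σ → wp ω (f i) (I (i + 1)) σ) (h : I 0 σ) :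
    wp ω (forAx f m) (I m) σ := by
  induction m with
  | zero => exact h
  | succ m ih =>
    exact wp_mono (fun τ hτ => hstep m (by omega) τ hτ) (ih fun i hi => hstep i (by omega))

theorem Fast.forAx {ω : Tape} {U : ℕ} {f : ℕ → Prog} (hU : 1 ≤ U) (I : ℕ → State → Prop) {m : ℕ}
    {σ : State} (hstep : ∀ i < m, ∀ σ, I i σ → Fast ω U (f i) σ (I (i + 1))) (h : I 0 σ) :
    Fast ω U (forAx f m) σ (I m) := by
  induction m with
  | zero => exact Fast.of_wp hU h
  | succ m ih =>
    exact Fast.seq ((ih fun i hi => hstep i (by omega)).mono fun τ hτ => hstep m (by omega) τ hτ)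

end RealRAM

namespace RealRAM

/-! ### Trees with multiplicative tags -/

/-- The product of the tags of a node and of all its ancestors. -/
noncomputable def tagProd (t : ℕ → ℝ) : ℕ → ℝ
  | 0 => 1
  | x + 1 => t (x + 1) * tagProd t ((x + 1) / 2)
decreasing_by omega

theorem tagProd_zero (t : ℕ → ℝ) : tagProd t 0 = 1 := by rw [tagProd]

theorem tagProd_of_pos (t : ℕ → ℝ) {x : ℕ} (hx : 1 ≤ x) :
    tagProd t x = t x * tagProd t (x / 2) := by
  obtain ⟨x, rfl⟩ : ∃ y, x = y + 1 := ⟨x - 1, by omega⟩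
  rw [tagProd]

-- The tag of `y` is a factor of `tagProd` exactly at the nodes of the subtree of `y`, and these are
-- the `u` that reach `y` by repeated halving.
open Classical in
theorem tagProd_update (t : ℕ → ℝ) {y : ℕ} (hy : 1 ≤ y) (c : ℝ) (u : ℕ) :
    tagProd (Function.update t y (t y * c)) u =
      (if ∃ j, u / 2 ^ j = y then c else 1) * tagProd t u := by
  induction u using Nat.strong_induction_on with
  | _ u ih =>
    rcases Nat.eq_zero_or_pos u with rfl | hu
    · rw [if_neg (by simp; omega), tagProd_zero, tagProd_zero, one_mul]
    · rw [tagProd_of_pos _ hu, tagProd_of_pos t hu, ih (u / 2) (by omega)]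
      have hdiv : ∀ j, u / 2 / 2 ^ j = u / 2 ^ (j + 1) := fun j => by
        rw [Nat.div_div_eq_div_mul, pow_succ, mul_comm]
      by_cases huy : u = y
      · subst huy
        rw [Function.update_self, if_neg, if_pos ⟨0, by simp⟩]
        · ring
        · rintro ⟨j, hj⟩
          have := Nat.div_le_self (u / 2) (2 ^ j)
          omega
      · rw [Function.update_of_ne huy]
        have : (∃ j, u / 2 / 2 ^ j = y) ↔ ∃ j, u / 2 ^ j = y := by
          constructor
          · rintro ⟨j, hj⟩; exact ⟨j + 1, by rw [← hdiv, hj]⟩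
          · rintro ⟨j, hj⟩
            cases j with
            | zero => simp at hj; omega
            | succ j => exact ⟨j, by rw [hdiv, hj]⟩
        simp only [this]
        ring

/-- Proper ancestors of a node. -/
def Anc (v x : ℕ) : Prop := ∃ k, x = v / 2 ^ (k + 1)

theorem anc_iff (v x : ℕ) : Anc v x ↔ x = v / 2 ∨ Anc (v / 2) x := by
  constructor
  · rintro ⟨k, rfl⟩
    cases k with
    | zero => left; simp
    | succ k => right; exact ⟨k, by rw [Nat.div_div_eq_div_mul, pow_succ' 2 (k + 1)]⟩
  · rintro (rfl | ⟨k, rfl⟩)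
    · exact ⟨0, by simp⟩
    · exact ⟨k + 1, by rw [Nat.div_div_eq_div_mul, pow_succ' 2 (k + 1)]⟩

/-- The tags `t`, the sums `s` and the leaf values `b` satisfy the tree equations at all nodes
which are not `bad`. -/
structure IsTree (M : ℕ) (t s b : ℕ → ℝ) (bad : ℕ → Prop) : Prop where
  pos : ∀ x, 1 ≤ x → x < 2 * M → 0 < t x
  eq : ∀ x, 1 ≤ x → x < 2 * M → ¬ bad x →
    s x = t x * (if x < M then s (2 * x) + s (2 * x + 1) else b (x - M))

/-- Scaling tag and sum together keeps the equation of the left sibling `2 * w`. Only the equation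
of the parent `w` can break, and `w` is a proper ancestor of `v = 2 * w + 1`, hence exempt. -/
theorem IsTree.scale {M : ℕ} {t s b : ℕ → ℝ} {v w : ℕ} {c : ℝ} (h : IsTree M t s b (Anc v))
    (hc : 0 < c) (hv : v = 2 * w + 1) (hw : 1 ≤ w) :
    IsTree M (Function.update t (2 * w) (t (2 * w) * c))
      (Function.update s (2 * w) (s (2 * w) * c)) b (Anc v) := by
  refine ⟨fun x hx hx' => ?_, fun x hx hx' hbad => ?_⟩
  · rw [Function.update_apply]
    split_ifs with h1
    · exact mul_pos (h.pos _ (by omega) (by omega)) hc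
    · exact h.pos _ hx hx'
  · have hxw : x ≠ w := fun e => hbad ((anc_iff _ _).2 (Or.inl (by omega)))
    have := h.eq x hx hx' hbad
    by_cases hxy : x = 2 * w
    · subst hxy
      rw [Function.update_self, Function.update_self, this, Function.update_of_ne (by omega),
        Function.update_of_ne (by omega)]
      ring
    · rw [Function.update_of_ne hxy, Function.update_of_ne hxy, this,
        Function.update_of_ne (by omega), Function.update_of_ne (by omega)]

/-- Once `w` is recomputed, the only equations that may fail are those of its proper ancestors: the
defect moves up by one level. -/
theorem IsTree.pull {M : ℕ} {t s b : ℕ → ℝ} {v w : ℕ} (h : IsTree M t s b (Anc v))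
    (hv : w = v / 2) (hw : 1 ≤ w) (hM : w < M) :
    IsTree M t (Function.update s w (t w * (s (2 * w) + s (2 * w + 1)))) b (Anc w) := by
  refine ⟨h.pos, fun x hx hx' hbad => ?_⟩
  by_cases hxw : x = w
  · subst hxw
    rw [Function.update_self, if_pos hM, Function.update_of_ne (by omega),
      Function.update_of_ne (by omega)]
  · have h1 : ¬ Anc v x := by rw [anc_iff, ← hv]; tauto
    have h2 : x ≠ w / 2 := fun e => hbad ((anc_iff _ _).2 (Or.inl e))
    rw [Function.update_of_ne hxw, h.eq x hx hx' h1, Function.update_of_ne (by omega),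
      Function.update_of_ne (by omega)]

/-- The tree with tags `t` and sums `s` represents the leaf values `b` with multipliers `g`. -/
structure TreeRep (H : ℕ) (t s g b : ℕ → ℝ) : Prop where
  tree : IsTree (2 ^ H) t s b (fun _ => False)
  tags : ∀ q < 2 ^ H, tagProd t (2 ^ H + q) = g q

section nodeWeight
variable {H : ℕ} {t s g b : ℕ → ℝ}

/-- The total weight of the leaves below a node. -/
noncomputable def nodeWeight (t s : ℕ → ℝ) (x : ℕ) : ℝ := s x * tagProd t (x / 2)

/-- The tag of `x` enters on the left through `s x` and on the right through `tagProd`, so it need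
not be pushed down to the children. -/
theorem nodeWeight_split (h : TreeRep H t s g b) {x : ℕ} (hx : 1 ≤ x) (hM : x < 2 ^ H) :
    nodeWeight t s x = nodeWeight t s (2 * x) + nodeWeight t s (2 * x + 1) := by
  have e1 : 2 * x / 2 = x := by omega
  have e2 : (2 * x + 1) / 2 = x := by omega
  rw [nodeWeight, nodeWeight, nodeWeight, e1, e2, h.tree.eq x hx (by omega) (by simp), if_pos hM,
    tagProd_of_pos t hx]
  ring

theorem nodeWeight_leaf (h : TreeRep H t s g b) {q : ℕ} (hq : q < 2 ^ H) :
    nodeWeight t s (2 ^ H + q) = b q * g q := by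
  have hp : 0 < 2 ^ H := by positivity
  rw [nodeWeight, h.tree.eq _ (by omega) (by omega) (by simp), if_neg (by omega), ← h.tags q hq,
    tagProd_of_pos t (by omega : 1 ≤ 2 ^ H + q), Nat.add_sub_cancel_left]
  ring

/-- Replacing nodes by their two children does not change the total weight to the left of a
position. This transfers prefix sums between levels in both `queryWalk` and `descend`. -/
theorem sum_nodeWeight_double (h : TreeRep H t s g b) {k w : ℕ} (hk : k < H) (h1 : 2 ^ k ≤ w)
    (h2 : w ≤ 2 ^ (k + 1)) :
    ∑ u ∈ Finset.Ico (2 ^ (k + 1)) (2 * w), nodeWeight t s u =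
      ∑ u ∈ Finset.Ico (2 ^ k) w, nodeWeight t s u := by
  have hp : 0 < 2 ^ k := by positivity
  have hH : 2 ^ (k + 1) ≤ 2 ^ H := Nat.pow_le_pow_right (by norm_num) hk
  induction w, h1 using Nat.le_induction with
  | base => rw [pow_succ]; simp [mul_comm]
  | succ w hw ih =>
    rw [Finset.sum_Ico_succ_top hw, ← ih (by omega), nodeWeight_split h (by omega) (by omega),
      show 2 * (w + 1) = 2 * w + 1 + 1 by ring,
      Finset.sum_Ico_succ_top (by rw [pow_succ]; omega),
      Finset.sum_Ico_succ_top (by rw [pow_succ]; omega)]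
    ring

theorem sum_nodeWeight_level (h : TreeRep H t s g b) {k : ℕ} (hk : k ≤ H) :
    ∑ u ∈ Finset.Ico (2 ^ k) (2 ^ (k + 1)), nodeWeight t s u = s 1 := by
  induction k with
  | zero => simp [nodeWeight, tagProd_zero]
  | succ k ih =>
    rw [← ih (by omega), ← sum_nodeWeight_double h (by omega : k < H)
      (Nat.pow_le_pow_right (by norm_num) (by omega)) le_rfl, pow_succ _ (k + 1), mul_comm 2]

theorem sum_leaves (h : TreeRep H t s g b) {r : ℕ} (hr : r ≤ 2 ^ H) :
    ∑ u ∈ Finset.Ico (2 ^ H) (2 ^ H + r), nodeWeight t s u = ∑ q ∈ Finset.range r, b q * g q := by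
  rw [Finset.sum_Ico_eq_sum_range, Nat.add_sub_cancel_left]
  refine Finset.sum_congr rfl fun q hq => nodeWeight_leaf h ?_
  exact (Finset.mem_range.1 hq).trans_le hr

theorem TreeRep.root (h : TreeRep H t s g b) : s 1 = ∑ q ∈ Finset.range (2 ^ H), b q * g q := by
  rw [← sum_leaves h le_rfl, ← sum_nodeWeight_level h le_rfl]
  congr 2
  rw [pow_succ]; ring

end nodeWeight

theorem TreeRep.g_pos {H : ℕ} {t s g b : ℕ → ℝ} (h : TreeRep H t s g b) {q : ℕ} (hq : q < 2 ^ H) :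
    0 < g q := by
  rw [← h.tags q hq]
  have key : ∀ x, x < 2 * 2 ^ H → 0 < tagProd t x := by
    intro x
    induction x using Nat.strong_induction_on with
    | _ x ih =>
      intro hx
      rcases Nat.eq_zero_or_pos x with rfl | h0
      · rw [tagProd_zero]; exact one_pos
      · rw [tagProd_of_pos t h0]
        exact mul_pos (h.tree.pos x h0 hx) (ih _ (by omega) (by omega))
  exact key _ (by omega)

/-! ### Trees in memory -/

/-- The tag of node `x` of the tree at address `β`. -/
noncomputable def State.tag (σ : State) (β x : ℕ) : ℝ := 1 + σ.ra 0 (β + x)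
/-- The sum at node `x` of the tree at address `β`. -/
noncomputable def State.sum (σ : State) (β x : ℕ) : ℝ := σ.ra 1 (β + x)

def tagE (a : NExp) : RExp := rc 1 + .arr 0 a
def sumE (a : NExp) : RExp := .arr 1 a

@[simp] theorem eval_tagE (σ : State) (a : NExp) :
    (tagE a).eval σ = 1 + σ.ra 0 (a.eval σ) := by simp [tagE]
@[simp] theorem eval_sumE (σ : State) (a : NExp) :
    (sumE a).eval σ = σ.ra 1 (a.eval σ) := by simp [sumE]

/-- Multiply the weights of all leaves left of the leaf in register `91` by real register `10`,
and restore the tree equations at the ancestors of this leaf. -/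
def updWalk : Prog :=
  .loop (.nlt (nc 1) (nv 91)) (
    .setN 92 (.half (nv 91)) ;;
    .ite (.nlt (nv 92 + nv 92) (nv 91))
      (putR 0 (nv 90 + (nv 92 + nv 92)) (tagE (nv 90 + (nv 92 + nv 92)) * rv 10 - rc 1) ;;
       putR 1 (nv 90 + (nv 92 + nv 92)) (sumE (nv 90 + (nv 92 + nv 92)) * rv 10))
      .skip ;;
    .setN 91 (nv 92) ;;
    putR 1 (nv 90 + nv 92) (tagE (nv 90 + nv 92) *
      (sumE (nv 90 + (nv 92 + nv 92)) + sumE (nv 90 + (nv 92 + nv 92 + nc 1)))))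

/-- `τ` arises from `σ` by an operation on the tree of size `M` at address `β`. -/
structure TreeFrame (M β : ℕ) (σ τ : State) : Prop where
  nreg : ∀ i, i ≠ 91 → i ≠ 92 → τ.nreg i = σ.nreg i
  rreg : τ.rreg = σ.rreg
  na : τ.na = σ.na
  draws : τ.draws = σ.draws
  ra : ∀ f k, (2 ≤ f ∨ k < β ∨ β + 2 * M ≤ k) → τ.ra f k = σ.ra f k

theorem TreeFrame.refl (M β : ℕ) (σ : State) : TreeFrame M β σ σ :=
  ⟨fun _ _ _ => rfl, rfl, rfl, rfl, fun _ _ _ => rfl⟩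

theorem level_of_div {u H k : ℕ} (hu : 2 ^ H ≤ u) (hu' : u < 2 ^ (H + 1)) (hk : k ≤ H) :
    2 ^ k ≤ u / 2 ^ (H - k) ∧ u / 2 ^ (H - k) < 2 ^ (k + 1) := by
  have e : 2 ^ k * 2 ^ (H - k) = 2 ^ H := by rw [← pow_add]; congr 1; omega
  constructor
  · rw [Nat.le_div_iff_mul_le (by positivity), e]; exact hu
  · rw [Nat.div_lt_iff_lt_mul (by positivity), pow_succ 2 k, mul_right_comm, e, ← pow_succ]
    exact hu'

/-- The levels are disjoint dyadic ranges, so the number of halvings from a leaf to a node of level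
`k` is forced to be `H - k`. -/
theorem exists_div_eq_iff {u H k y : ℕ} (hu : 2 ^ H ≤ u) (hu' : u < 2 ^ (H + 1)) (hk : k ≤ H)
    (hy : 2 ^ k ≤ y) (hy' : y < 2 ^ (k + 1)) : (∃ j, u / 2 ^ j = y) ↔ u / 2 ^ (H - k) = y := by
  refine ⟨?_, fun h => ⟨_, h⟩⟩
  rintro ⟨j, hj⟩
  have hjH : j ≤ H := by
    by_contra hlt
    have : u / 2 ^ j = 0 := Nat.div_eq_of_lt (hu'.trans_le (Nat.pow_le_pow_right (by norm_num)
      (by omega)))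
    have : 0 < 2 ^ k := by positivity
    omega
  have h1 := level_of_div hu hu' (k := H - j) (by omega)
  rw [show H - (H - j) = j by omega, hj] at h1
  have h2 : k < H - j + 1 := (Nat.pow_lt_pow_iff_right (by norm_num)).1 (hy.trans_lt h1.2)
  have h3 : H - j < k + 1 := (Nat.pow_lt_pow_iff_right (by norm_num)).1 (h1.1.trans_lt hy')
  rw [show H - k = j by omega, hj]

/-- The leaves left of `r` are the disjoint union of the subtrees of the left siblings met on the
way from leaf `r` to the root. Invariant: if the walk is at node `v` of level `k`, the leaves whose
ancestor of level `k` is less than `v` still lack the factor `c`, and only proper ancestors of `v`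
violate the tree equations. At the root nothing is missing any more. -/
theorem updWalk_spec {ω : Tape} {U H β r : ℕ} {c : ℝ} {g b : ℕ → ℝ} {σ : State} (hU : H < U)
    (hc : 0 < c) (hβ : σ.nreg 90 = β) (hr : r < 2 ^ H) (hv : σ.nreg 91 = 2 ^ H + r)
    (hf : σ.rreg 10 = c) (ht : IsTree (2 ^ H) (σ.tag β) (σ.sum β) b (Anc (2 ^ H + r)))
    (hg : ∀ q < 2 ^ H, tagProd (σ.tag β) (2 ^ H + q) = g q) :
    Fast ω U updWalk σ fun τ => TreeFrame (2 ^ H) β σ τ ∧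
      TreeRep H (τ.tag β) (τ.sum β) (fun q => if q < r then c * g q else g q) b := by
  classical
  refine Fast.loop (fun k τ => ∃ v, 2 ^ k ≤ v ∧ v < 2 ^ (k + 1) ∧ k ≤ H ∧ τ.nreg 91 = v ∧
      TreeFrame (2 ^ H) β σ τ ∧ IsTree (2 ^ H) (τ.tag β) (τ.sum β) b (Anc v) ∧
      ∀ q < 2 ^ H, tagProd (τ.tag β) (2 ^ H + q) *
        (if (2 ^ H + q) / 2 ^ (H - k) < v then c else 1) = if q < r then c * g q else g q)
    ?_ ?_ hU ⟨2 ^ H + r, by omega, by rw [pow_succ]; omega, le_rfl, hv, TreeFrame.refl _ _ _, ht,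
      fun q hq => ?_⟩
  · rintro k τ ⟨v, h1, h2, hkH, hv, hfr, htr, hq⟩ hp
    simp only [BExp.holds_nlt, NExp.eval_const, NExp.eval_reg, hv] at hp
    obtain ⟨k, rfl⟩ : ∃ k', k = k' + 1 := by
      cases k with
      | zero => simp at h2; omega
      | succ k => exact ⟨k, rfl⟩
    refine ⟨k, rfl, ?_⟩
    have hpw : 2 ^ (k + 1) ≤ 2 ^ H := Nat.pow_le_pow_right (by norm_num) hkH
    have hpk : 0 < 2 ^ k := by positivity
    have hps : 2 ^ (k + 1) = 2 * 2 ^ k := by rw [pow_succ]; ring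
    have hps' : 2 ^ (k + 1 + 1) = 4 * 2 ^ k := by rw [pow_succ, pow_succ]; ring
    obtain ⟨w, hw⟩ : ∃ w, w = v / 2 := ⟨_, rfl⟩
    have h90 : τ.nreg 90 = β := by rw [hfr.nreg 90 (by norm_num) (by norm_num), hβ]
    have h10 : τ.rreg 10 = c := by rw [hfr.rreg, hf]
    have hdd : ∀ q, (2 ^ H + q) / 2 ^ (H - k) = (2 ^ H + q) / 2 ^ (H - (k + 1)) / 2 := fun q => by
      rw [Nat.div_div_eq_div_mul, ← pow_succ]; congr 2; omega
    -- The common end of both cases: with the left sibling dealt with, move to the parent `w` and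
    -- recompute its sum.
    have hmid : ∀ τ' : State, TreeFrame (2 ^ H) β σ τ' → τ'.nreg 92 = w →
        IsTree (2 ^ H) (τ'.tag β) (τ'.sum β) b (Anc v) →
        (∀ q < 2 ^ H, tagProd (τ'.tag β) (2 ^ H + q) *
          (if (2 ^ H + q) / 2 ^ (H - k) < w then c else 1) = if q < r then c * g q else g q) →
        wp ω (.setN 91 (nv 92) ;; putR 1 (nv 90 + nv 92) (tagE (nv 90 + nv 92) *
          (sumE (nv 90 + (nv 92 + nv 92)) + sumE (nv 90 + (nv 92 + nv 92 + nc 1)))))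
          (fun τ => ∃ v, 2 ^ k ≤ v ∧ v < 2 ^ (k + 1) ∧ k ≤ H ∧ τ.nreg 91 = v ∧
          TreeFrame (2 ^ H) β σ τ ∧ IsTree (2 ^ H) (τ.tag β) (τ.sum β) b (Anc v) ∧
          ∀ q < 2 ^ H, tagProd (τ.tag β) (2 ^ H + q) *
            (if (2 ^ H + q) / 2 ^ (H - k) < v then c else 1) = if q < r then c * g q else g q)
          τ' := by
      intro τ' hfr' h92 htr' hq'
      have h90' : τ'.nreg 90 = β := by rw [hfr'.nreg 90 (by norm_num) (by norm_num), hβ]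
      simp only [wp_seq, wp_setN, wp_putR]
      refine ⟨w, by omega, by omega, by omega, ?_, ?_, ?_, ?_⟩
      · simp [h92]
      · refine ⟨fun i hi1 hi2 => ?_, hfr'.rreg, hfr'.na, hfr'.draws, fun f k' hk' => ?_⟩
        · simp [hi1, hfr'.nreg i hi1 hi2]
        · simp [h90', h92]
          rw [if_neg (by omega), hfr'.ra f k' hk']
      · convert htr'.pull hw (by omega) (by omega) using 1
        · funext x; simp [State.tag]
        · funext x
          simp only [State.sum, State.tag, Function.update_apply]
          simp [h90', h92, two_mul]
      · intro q hqH
        rw [← hq' q hqH]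
        congr 2
        funext x; simp [State.tag]
    simp only [wp_seq, wp_setN, wp_ite, wp_skip]
    refine ⟨fun hodd => ?_, fun hev => ?_⟩
    · simp [hv, ← hw] at hodd
      have hvw : v = 2 * w + 1 := by omega
      have etag : ((((τ.setN 92 w).putRA 0 (β + (w + w)) (τ.tag β (2 * w) * c - 1)).putRA 1
          (β + (w + w)) (τ.sum β (2 * w) * c)).tag β) =
          Function.update (τ.tag β) (2 * w) (τ.tag β (2 * w) * c) := by
        funext x
        simp [State.tag, Function.update_apply, two_mul]
        split_ifs <;> ring
      have esum : ((((τ.setN 92 w).putRA 0 (β + (w + w)) (τ.tag β (2 * w) * c - 1)).putRA 1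
          (β + (w + w)) (τ.sum β (2 * w) * c)).sum β) =
          Function.update (τ.sum β) (2 * w) (τ.sum β (2 * w) * c) := by
        funext x
        simp [State.sum, Function.update_apply, two_mul]
      have := hmid (((τ.setN 92 w).putRA 0 (β + (w + w)) (τ.tag β (2 * w) * c - 1)).putRA 1
          (β + (w + w)) (τ.sum β (2 * w) * c)) ?_ ?_ ?_ ?_
      · simp only [wp_putR, wp_seq] at this ⊢
        convert this using 2 <;> simp [hv, ← hw, h90, h10, State.tag, State.sum, two_mul]
      · refine ⟨fun i hi1 hi2 => ?_, hfr.rreg, hfr.na, hfr.draws, fun f k' hk' => ?_⟩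
        · simp [hi2, hfr.nreg i hi1 hi2]
        · simp
          rw [if_neg (by omega), if_neg (by omega), hfr.ra f k' hk']
      · simp
      · rw [etag, esum]
        exact htr.scale hc hvw (by omega)
      · intro q hqH
        rw [etag, tagProd_update _ (by omega), ← hq q hqH]
        have hlv := exists_div_eq_iff (u := 2 ^ H + q) (H := H) (k := k + 1) (y := 2 * w) (by omega)
          (by rw [pow_succ]; omega) hkH (by omega) (by omega)
        rw [hdd q]
        simp only [hlv]
        generalize (2 ^ H + q) / 2 ^ (H - (k + 1)) = a
        rcases lt_trichotomy a (2 * w) with h | h | h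
        · rw [if_neg (by omega), if_pos (by omega), if_pos (by omega)]; ring
        · rw [if_pos (by omega), if_neg (by omega), if_pos (by omega)]; ring
        · rw [if_neg (by omega), if_neg (by omega), if_neg (by omega)]; ring
    · simp [hv, ← hw] at hev
      have hvw : v = 2 * w := by omega
      have etag : ((τ.setN 92 w).tag β) = τ.tag β := by funext x; simp [State.tag]
      have esum : ((τ.setN 92 w).sum β) = τ.sum β := by funext x; simp [State.sum]
      have := hmid (τ.setN 92 w) ?_ ?_ ?_ ?_
      · rwa [show NExp.eval τ (nv 91).half = w by simp [hv, hw]]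
      · refine ⟨fun i hi1 hi2 => ?_, hfr.rreg, hfr.na, hfr.draws, fun f k' hk' => ?_⟩
        · simp [hi2, hfr.nreg i hi1 hi2]
        · simp [hfr.ra f k' hk']
      · simp
      · rw [etag, esum]; exact htr
      · intro q hqH
        rw [etag, ← hq q hqH, hdd q]
        generalize (2 ^ H + q) / 2 ^ (H - (k + 1)) = a
        rcases lt_or_ge a (2 * w) with h | h
        · rw [if_pos (by omega), if_pos (by omega)]
        · rw [if_neg (by omega), if_neg (by omega)]
  · rintro k τ ⟨v, h1, h2, hkH, hv, hfr, htr, hq⟩ hp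
    simp [hv] at hp
    have : 0 < 2 ^ k := by positivity
    obtain rfl : v = 1 := by omega
    obtain rfl : k = 0 := by
      by_contra hk
      have : 2 ^ 1 ≤ 2 ^ k := Nat.pow_le_pow_right (by norm_num) (by omega)
      omega
    refine ⟨hfr, ⟨htr.pos, fun x hx hx' _ => htr.eq x hx hx' ?_⟩, fun q hqH => ?_⟩
    · rintro ⟨k, rfl⟩
      have : 1 / 2 ^ (k + 1) = 0 := Nat.div_eq_of_lt (Nat.one_lt_two_pow (by omega))
      omega
    · rw [← hq q hqH, if_neg, mul_one]
      have := (level_of_div (u := 2 ^ H + q) (H := H) (k := 0) (by omega)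
          (by rw [pow_succ]; omega) (by omega)).1
      simpa using this
  · rw [hg q hq]
    simp only [Nat.sub_self, pow_zero, Nat.div_one, add_lt_add_iff_left]
    split_ifs <;> ring

/-- Put into real register `11` the total weight of the leaves left of the leaf in register `91`,
plus the multiplier of this leaf times real register `16`. -/
def queryWalk : Prog :=
  .setR 11 (rv 16 * tagE (nv 90 + nv 91)) ;;
  .loop (.nlt (nc 1) (nv 91)) (
    .setN 92 (.half (nv 91)) ;;
    .ite (.nlt (nv 92 + nv 92) (nv 91))
      (.setR 11 (rv 11 + sumE (nv 90 + (nv 92 + nv 92)))) .skip ;;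
    .setN 91 (nv 92) ;;
    .setR 11 (rv 11 * tagE (nv 90 + nv 91)))

/-- `τ` arises from `σ` by changing registers from `91` on and the real registers `11` and `12`. -/
structure ReadFrame (σ τ : State) : Prop where
  nreg : ∀ i, i ≠ 91 → i ≠ 92 → τ.nreg i = σ.nreg i
  rreg : ∀ i, i ≠ 11 → i ≠ 12 → τ.rreg i = σ.rreg i
  na : τ.na = σ.na
  draws : τ.draws = σ.draws
  ra : τ.ra = σ.ra

/-- Register `11` holds the part collected inside the subtree of the current node `v`, with the tags
of its proper ancestors still missing. Multiplied by `tagProd` of the parent and added to the weight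
left of `v` on the same level, it gives a quantity that does not change along the walk. -/
theorem queryWalk_spec {ω : Tape} {U H β r : ℕ} {g b : ℕ → ℝ} {σ : State} (hU : H < U)
    (hβ : σ.nreg 90 = β) (hr : r < 2 ^ H) (hv : σ.nreg 91 = 2 ^ H + r)
    (ht : TreeRep H (σ.tag β) (σ.sum β) g b) :
    Fast ω U queryWalk σ fun τ => ReadFrame σ τ ∧
      τ.rreg 11 = ∑ q ∈ Finset.range r, b q * g q + σ.rreg 16 * g r := by
  have hM : 0 < 2 ^ H := by positivity
  refine Fast.seq_wp (by omega) ?_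
  rw [wp_setR]
  refine Fast.loop (fun k τ => ∃ v, 2 ^ k ≤ v ∧ v < 2 ^ (k + 1) ∧ k ≤ H ∧ τ.nreg 91 = v ∧
      ReadFrame σ τ ∧
      ∑ u ∈ Finset.Ico (2 ^ k) v, nodeWeight (σ.tag β) (σ.sum β) u +
        τ.rreg 11 * tagProd (σ.tag β) (v / 2) =
        ∑ q ∈ Finset.range r, b q * g q + σ.rreg 16 * g r)
    ?_ ?_ hU ⟨2 ^ H + r, by omega, by rw [pow_succ]; omega, le_rfl, by simp [hv], ?_, ?_⟩
  · rintro k τ ⟨v, h1, h2, hkH, hv, hfr, hq⟩ hp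
    simp only [BExp.holds_nlt, NExp.eval_const, NExp.eval_reg, hv] at hp
    obtain ⟨k, rfl⟩ : ∃ k', k = k' + 1 := by
      cases k with
      | zero => simp at h2; omega
      | succ k => exact ⟨k, rfl⟩
    refine ⟨k, rfl, ?_⟩
    have hpw : 2 ^ (k + 1) ≤ 2 ^ H := Nat.pow_le_pow_right (by norm_num) hkH
    have hpk : 0 < 2 ^ k := by positivity
    have hps : 2 ^ (k + 1) = 2 * 2 ^ k := by rw [pow_succ]; ring
    have hps' : 2 ^ (k + 1 + 1) = 4 * 2 ^ k := by rw [pow_succ, pow_succ]; ring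
    obtain ⟨w, hw⟩ : ∃ w, w = v / 2 := ⟨_, rfl⟩
    have h90 : τ.nreg 90 = β := by rw [hfr.nreg 90 (by norm_num) (by norm_num), hβ]
    have htg : tagProd (σ.tag β) w = (1 + σ.ra 0 (β + w)) * tagProd (σ.tag β) (w / 2) := by
      rw [tagProd_of_pos _ (by omega), State.tag]
    have hdb := sum_nodeWeight_double ht (k := k) (w := w) (by omega) (by omega) (by omega)
    simp only [wp_seq, wp_setN, wp_ite, wp_skip, wp_setR]
    refine ⟨fun hodd => ?_, fun hev => ?_⟩
    · simp [hv, ← hw] at hodd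
      have hvw : v = 2 * w + 1 := by omega
      refine ⟨w, by omega, by omega, by omega, by simp [hv, hw], ⟨fun i hi1 hi2 => ?_,
        fun i hi1 hi2 => ?_, hfr.na, hfr.draws, ?_⟩, ?_⟩
      · simp [hi1, hi2, hfr.nreg i hi1 hi2]
      · simp [hi1, hfr.rreg i hi1 hi2]
      · simp [hfr.ra]
      · rw [← hq, hvw, Finset.sum_Ico_succ_top (by omega), hdb, nodeWeight]
        simp only [show 2 * w / 2 = w by omega, show (2 * w + 1) / 2 = w by omega, htg]
        simp [hv, ← hw, h90, hfr.ra, State.sum, two_mul]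
        ring
    · simp [hv, ← hw] at hev
      have hvw : v = 2 * w := by omega
      refine ⟨w, by omega, by omega, by omega, by simp [hv, hw], ⟨fun i hi1 hi2 => ?_,
        fun i hi1 hi2 => ?_, hfr.na, hfr.draws, ?_⟩, ?_⟩
      · simp [hi1, hi2, hfr.nreg i hi1 hi2]
      · simp [hi1, hfr.rreg i hi1 hi2]
      · simp [hfr.ra]
      · rw [← hq, hvw, hdb]
        simp only [show 2 * w / 2 = w by omega, htg]
        simp [hv, ← hw, h90, hfr.ra]
        ring
  · rintro k τ ⟨v, h1, h2, hkH, hv, hfr, hq⟩ hp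
    simp [hv] at hp
    have : 0 < 2 ^ k := by positivity
    obtain rfl : v = 1 := by omega
    obtain rfl : k = 0 := by
      by_contra hk
      have : 2 ^ 1 ≤ 2 ^ k := Nat.pow_le_pow_right (by norm_num) (by omega)
      omega
    refine ⟨hfr, ?_⟩
    rw [← hq]
    simp [tagProd_zero]
  · exact ⟨fun i _ _ => rfl, fun i hi _ => by simp [hi], rfl, rfl, by simp⟩
  · rw [sum_leaves ht hr.le, ← ht.tags r hr, tagProd_of_pos _ (by omega : 1 ≤ 2 ^ H + r)]
    simp [hβ, hv, State.tag]
    ring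

/-- Find the leaf at which the prefix sums of the weights exceed real register `12`. -/
def descend : Prog :=
  .setN 91 (nc 1) ;;
  .setR 12 (rv 12 / tagE (nv 90 + nv 91)) ;;
  .loop (.nlt (nv 91) (nv 4)) (
    .setN 91 (nv 91 + nv 91) ;;
    .ite (.rlt (rv 12) (sumE (nv 90 + nv 91))) .skip
      (.setR 12 (rv 12 - sumE (nv 90 + nv 91)) ;; .setN 91 (nv 91 + nc 1)) ;;
    .setR 12 (rv 12 / tagE (nv 90 + nv 91)))

/-- On entering a node the residue in register `12` is divided by its tag, so it can be compared
directly with the stored sums of the children, which include their own tags but none of the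
ancestors'. At a leaf the residue lies in `[0, b q)`, and multiplication by `g q` turns this into
the two bounds by prefix sums. -/
theorem descend_spec {ω : Tape} {U H β : ℕ} {g b : ℕ → ℝ} {σ : State} (hU : H + 1 < U)
    (hM : σ.nreg 4 = 2 ^ H) (hβ : σ.nreg 90 = β)
    (ht : TreeRep H (σ.tag β) (σ.sum β) g b) (h0 : 0 ≤ σ.rreg 12)
    (h1 : σ.rreg 12 < ∑ q ∈ Finset.range (2 ^ H), b q * g q) :
    Fast ω U descend σ fun τ => ReadFrame σ τ ∧ ∃ q < 2 ^ H, τ.nreg 91 = 2 ^ H + q ∧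
      ∑ p ∈ Finset.range q, b p * g p ≤ σ.rreg 12 ∧
      σ.rreg 12 < ∑ p ∈ Finset.range (q + 1), b p * g p := by
  have hMp : 0 < 2 ^ H := by positivity
  obtain ⟨t, htdef⟩ : ∃ t, t = σ.tag β := ⟨_, rfl⟩
  obtain ⟨s, hsdef⟩ : ∃ s, s = σ.sum β := ⟨_, rfl⟩
  rw [← htdef, ← hsdef] at ht
  have htx : ∀ x, 1 + σ.ra 0 (β + x) = t x := fun x => by rw [htdef, State.tag]
  have hsx : ∀ x, σ.ra 1 (β + x) = s x := fun x => by rw [hsdef, State.sum]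
  refine Fast.seq_wp (by omega) ?_
  rw [wp_setN]
  refine Fast.seq_wp (by omega) ?_
  rw [wp_setR]
  refine Fast.loop (fun k τ => ∃ h v, h + k = H ∧ 2 ^ h ≤ v ∧ v < 2 ^ (h + 1) ∧ τ.nreg 91 = v ∧
      ReadFrame σ τ ∧ 0 ≤ τ.rreg 12 ∧
      τ.rreg 12 < (if v < 2 ^ H then s (2 * v) + s (2 * v + 1) else b (v - 2 ^ H)) ∧
      ∑ u ∈ Finset.Ico (2 ^ h) v, nodeWeight t s u + τ.rreg 12 * tagProd t v = σ.rreg 12)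
    ?_ ?_ (k := H) (by omega) ⟨0, 1, by omega, le_rfl, by norm_num, by simp, ?_, ?_, ?_, ?_⟩
  · rintro k τ ⟨h, v, hk, h1, h2, hv, hfr, hp0, hlt, hq⟩ hp
    have h4 : τ.nreg 4 = 2 ^ H := by rw [hfr.nreg 4 (by norm_num) (by norm_num), hM]
    simp only [BExp.holds_nlt, NExp.eval_reg, hv, h4] at hp
    obtain ⟨k, rfl⟩ : ∃ k', k = k' + 1 := by
      cases k with
      | zero => obtain rfl : h = H := by omega
                omega
      | succ k => exact ⟨k, rfl⟩
    refine ⟨k, rfl, ?_⟩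
    have hph : 0 < 2 ^ h := by positivity
    have hps : 2 ^ (h + 1) = 2 * 2 ^ h := by rw [pow_succ]; ring
    have hps' : 2 ^ (h + 1 + 1) = 4 * 2 ^ h := by rw [pow_succ, pow_succ]; ring
    have hpw : 2 ^ (h + 1) ≤ 2 ^ H := Nat.pow_le_pow_right (by norm_num) (by omega)
    have h90 : τ.nreg 90 = β := by rw [hfr.nreg 90 (by norm_num) (by norm_num), hβ]
    have hdb := sum_nodeWeight_double ht (k := h) (w := v) (by omega) (by omega) (by omega)
    rw [if_pos hp] at hlt
    have ht1 := ht.tree.pos (2 * v) (by omega) (by omega)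
    have ht2 := ht.tree.pos (2 * v + 1) (by omega) (by omega)
    have hg1 : tagProd t (2 * v) = t (2 * v) * tagProd t v := by
      rw [tagProd_of_pos _ (by omega)]; congr 2; omega
    have hg2 : tagProd t (2 * v + 1) = t (2 * v + 1) * tagProd t v := by
      rw [tagProd_of_pos _ (by omega)]; congr 2; omega
    have hs1 := ht.tree.eq (2 * v) (by omega) (by omega) (by simp)
    have hs2 := ht.tree.eq (2 * v + 1) (by omega) (by omega) (by simp)
    have hvv : v + v = 2 * v := by ring
    have hra : ∀ f j, τ.ra f j = σ.ra f j := fun f j => by rw [hfr.ra]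
    simp only [wp_seq, wp_setN, wp_ite, wp_skip, wp_setR]
    refine ⟨fun hl => ?_, fun hl => ?_⟩
    · simp [hv, h90, hvv, hra, hsx] at hl
      refine ⟨h + 1, 2 * v, by omega, by omega, by omega, by simp [hv, hvv],
        ⟨fun i hi1 hi2 => ?_, fun i hi1 hi2 => ?_, hfr.na, hfr.draws, ?_⟩, ?_, ?_, ?_⟩
      · simp [hi1, hfr.nreg i hi1 hi2]
      · simp [hi2, hfr.rreg i hi1 hi2]
      · simp [hfr.ra]
      · simp [hv, h90, hvv, hra, htx]; positivity
      · simp [hv, h90, hvv, hra, htx]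
        rw [div_lt_iff₀ ht1, mul_comm, ← hs1]; exact hl
      · simp [hv, h90, hvv, hra, htx]
        rw [← hq, hdb, hg1]; field_simp
    · simp [hv, h90, hvv, hra, hsx] at hl
      refine ⟨h + 1, 2 * v + 1, by omega, by omega, by omega, by simp [hv, hvv],
        ⟨fun i hi1 hi2 => ?_, fun i hi1 hi2 => ?_, hfr.na, hfr.draws, ?_⟩, ?_, ?_, ?_⟩
      · simp [hi1, hfr.nreg i hi1 hi2]
      · simp [hi2, hfr.rreg i hi1 hi2]
      · simp [hfr.ra]
      · simp [hv, h90, hvv, hra, htx, hsx]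
        exact div_nonneg (by linarith) ht2.le
      · simp [hv, h90, hvv, hra, htx, hsx]
        rw [div_lt_iff₀ ht2, mul_comm _ (t _), ← hs2]; linarith
      · simp [hv, h90, hvv, hra, htx, hsx]
        rw [← hq, Finset.sum_Ico_succ_top (by omega), hdb, hg2, nodeWeight,
          show 2 * v / 2 = v by omega]
        field_simp; ring
  · rintro k τ ⟨h, v, hk, h1, h2, hv, hfr, hp0, hlt, hq⟩ hp
    have h4 : τ.nreg 4 = 2 ^ H := by rw [hfr.nreg 4 (by norm_num) (by norm_num), hM]
    simp [hv, h4] at hp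
    obtain rfl : h = H := by
      by_contra hne
      have : 2 ^ (h + 1) ≤ 2 ^ H := Nat.pow_le_pow_right (by norm_num) (by omega)
      omega
    obtain ⟨q, rfl⟩ : ∃ q, v = 2 ^ h + q := ⟨v - 2 ^ h, by omega⟩
    have hqH : q < 2 ^ h := by rw [pow_succ] at h2; omega
    have hgp := ht.g_pos hqH
    rw [if_neg (by omega), Nat.add_sub_cancel_left] at hlt
    rw [sum_leaves ht hqH.le, ht.tags q hqH] at hq
    refine ⟨hfr, q, hqH, hv, ?_, ?_⟩
    · have := mul_nonneg hp0 hgp.le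
      linarith
    · rw [Finset.sum_range_succ]
      have := mul_lt_mul_of_pos_right hlt hgp
      linarith
  · exact ⟨fun i hi _ => by simp [hi], fun i _ hi => by simp [hi], rfl, rfl, by simp⟩
  · simp [hβ, htx]
    exact div_nonneg h0 (ht.tree.pos 1 le_rfl (by omega)).le
  · have hr := ht.root
    have := ht.tree.eq 1 le_rfl (by omega) (by simp)
    simp only [State.setR_rreg, if_true]
    simp [hβ, htx, -mul_one]
    rw [div_lt_iff₀ (ht.tree.pos 1 le_rfl (by omega)), mul_comm]
    refine lt_of_lt_of_eq (lt_of_lt_of_eq h1 (hr.symm.trans this)) (by norm_num)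
  · have := ht.tree.pos 1 le_rfl (by omega)
    rw [tagProd_of_pos t le_rfl]
    simp [hβ, htx, tagProd_zero]
    field_simp

end RealRAM

namespace RealRAM

/-! ### The decomposition of the grid of ranks -/

/-- The endpoints `2 j` and `2 j + 1` of box `j` on axis `i` have ranks `pos i (2 j)` and
`pos i (2 j + 1)`, the inverse of `pos i` is `Q i`, and `X i` lists the coordinates in increasing
order.  The entries `start m ≤ e < start (m + 1)` of level `m` have the intervals `[A i e, B i e)`
on the axes `i < m`; the children of `e` are the entries from `first e` to `first (e + 1)`, and
`pt e r` is the child whose interval on axis `m` contains `r`.  The trees have `2 ^ H` leaves. -/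
structure Layout where
  N : ℕ
  H : ℕ
  start : ℕ → ℕ
  Q : ℕ → ℕ → ℕ
  pos : ℕ → ℕ → ℕ
  X : ℕ → ℕ → ℝ
  A : ℕ → ℕ → ℕ
  B : ℕ → ℕ → ℕ
  first : ℕ → ℕ
  pt : ℕ → ℕ → ℕ

namespace Layout

variable {d n : ℕ} {L : Layout} {K : ℕ}

/-- The box with an endpoint of rank `r` on axis `i`. -/
def own (L : Layout) (i r : ℕ) : ℕ := L.Q i r / 2

/-- Box `j` has an endpoint in the `i`-th interval of entry `e`. -/
def EndIn (L : Layout) (i j e : ℕ) : Prop :=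
  (L.A i e ≤ L.pos i (2 * j) ∧ L.pos i (2 * j) < L.B i e) ∨
    (L.A i e ≤ L.pos i (2 * j + 1) ∧ L.pos i (2 * j + 1) < L.B i e)

structure Ranks (L : Layout) (Bx : Fin n → AABox d) : Prop where
  N_eq : L.N = 2 * n
  pos_lt : ∀ i < d, ∀ q < L.N, L.pos i q < L.N
  Q_lt : ∀ i < d, ∀ r < L.N, L.Q i r < L.N
  Q_pos : ∀ i < d, ∀ q < L.N, L.Q i (L.pos i q) = q
  pos_Q : ∀ i < d, ∀ r < L.N, L.pos i (L.Q i r) = r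
  mono : ∀ i < d, ∀ r r', r < r' → r' < L.N → L.X i r < L.X i r'
  lo : ∀ (i : Fin d) (j : Fin n), L.X i (L.pos i (2 * j)) = (Bx j).fst i
  hi : ∀ (i : Fin d) (j : Fin n), L.X i (L.pos i (2 * j + 1)) = (Bx j).snd i

structure Decomp (L : Layout) (d K : ℕ) : Prop where
  start_zero : L.start 0 = 0
  start_one : L.start 1 = 1
  start_le : ∀ m ≤ d, L.start m ≤ L.start (m + 1)
  first_start : ∀ m ≤ d, L.first (L.start m) = L.start (m + 1)
  first_le : ∀ m < d, ∀ e, L.start m ≤ e → e < L.start (m + 1) → L.first e ≤ L.first (e + 1)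
  count : ∀ m < d, ∀ e, L.start m ≤ e → e < L.start (m + 1) → L.first (e + 1) ≤ L.first e + K
  inherit : ∀ m < d, ∀ e, L.start m ≤ e → e < L.start (m + 1) →
    ∀ f, L.first e ≤ f → f < L.first (e + 1) → ∀ i < m, L.A i f = L.A i e ∧ L.B i f = L.B i e
  interval : ∀ m < d, ∀ e, L.start m ≤ e → e < L.start (m + 1) →
    ∀ f, L.first e ≤ f → f < L.first (e + 1) → L.A m f < L.B m f ∧ L.B m f ≤ L.N
  pt_mem : ∀ m < d, ∀ e, L.start m ≤ e → e < L.start (m + 1) → ∀ r < L.N,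
    L.first e ≤ L.pt e r ∧ L.pt e r < L.first (e + 1)
  pt_iff : ∀ m < d, ∀ e, L.start m ≤ e → e < L.start (m + 1) → ∀ r < L.N,
    ∀ f, L.first e ≤ f → f < L.first (e + 1) → (L.A m f ≤ r ∧ r < L.B m f ↔ L.pt e r = f)
  pt_mono : ∀ m < d, ∀ e, L.start m ≤ e → e < L.start (m + 1) → ∀ r r', r ≤ r' → r' < L.N →
    L.pt e r ≤ L.pt e r'
  single : ∀ m < d, ∀ e, L.start m ≤ e → e < L.start (m + 1) →
    ∀ f, L.first e ≤ f → f < L.first (e + 1) → ∀ x, L.A m f ≤ x → x < L.B m f →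
      ∀ i < m, L.EndIn i (L.own m x) e → L.B m f = L.A m f + 1

/-- `c` is an entry of the last level. -/
def IsCell (L : Layout) (d c : ℕ) : Prop := L.start d ≤ c ∧ c < L.start (d + 1)

namespace Decomp

theorem first_mono (h : L.Decomp d K) {m : ℕ} (hm : m < d) {e e' : ℕ} (he : L.start m ≤ e)
    (hee : e ≤ e') (he' : e' ≤ L.start (m + 1)) : L.first e ≤ L.first e' := by
  induction e', hee using Nat.le_induction with
  | base => exact le_rfl
  | succ e' h1 ih =>
    exact (ih (by omega)).trans (h.first_le m hm e' (by omega) (by omega))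

theorem child_level (h : L.Decomp d K) {m : ℕ} (hm : m < d) {e f : ℕ} (he : L.start m ≤ e)
    (he' : e < L.start (m + 1)) (hf : L.first e ≤ f) (hf' : f < L.first (e + 1)) :
    L.start (m + 1) ≤ f ∧ f < L.start (m + 2) := by
  have h1 := h.first_mono hm le_rfl he (by omega)
  have h2 := h.first_mono hm (by omega : L.start m ≤ e + 1) (by omega) le_rfl
  rw [h.first_start m hm.le] at h1
  rw [h.first_start (m + 1) (by omega)] at h2
  change _ ≤ L.start (m + 2) at h2
  omega

theorem exists_parent (h : L.Decomp d K) {m : ℕ} (hm : m < d) {f : ℕ} (hf : L.start (m + 1) ≤ f)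
    (hf' : f < L.start (m + 2)) :
    ∃ e, L.start m ≤ e ∧ e < L.start (m + 1) ∧ L.first e ≤ f ∧ f < L.first (e + 1) := by
  have key : ∀ e', L.start m ≤ e' → e' ≤ L.start (m + 1) → f < L.first e' →
      ∃ e, L.start m ≤ e ∧ e < e' ∧ L.first e ≤ f ∧ f < L.first (e + 1) := by
    intro e' he'
    induction e', he' using Nat.le_induction with
    | base =>
      intro _ h1
      rw [h.first_start m hm.le] at h1
      omega
    | succ e' h1 ih =>
      intro h2 h3
      by_cases h4 : f < L.first e'
      · obtain ⟨e, he, hee, h5⟩ := ih (by omega) h4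
        exact ⟨e, he, by omega, h5⟩
      · exact ⟨e', h1, by omega, by omega, h3⟩
  exact key _ (h.start_le m hm.le) le_rfl (by rw [h.first_start (m + 1) (by omega)]; exact hf')

/-- Every level partitions the grid: an entry containing `p` has its parent among the entries
containing `p` on the earlier axes, unique by induction, and `pt` singles out the child. -/
theorem existsUnique_entry (h : L.Decomp d K) (p : Fin d → ℕ) (hp : ∀ i, p i < L.N) {m : ℕ}
    (hm : m ≤ d) : ∃! e, (L.start m ≤ e ∧ e < L.start (m + 1)) ∧
      ∀ i : Fin d, (i : ℕ) < m → L.A i e ≤ p i ∧ p i < L.B i e := by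
  induction m with
  | zero =>
    refine ⟨0, ⟨⟨by rw [h.start_zero], by rw [h.start_one]; omega⟩, fun i hi => by omega⟩, ?_⟩
    rintro e ⟨⟨-, h2⟩, -⟩
    rw [h.start_one] at h2
    omega
  | succ m ih =>
    obtain ⟨e, ⟨⟨he, he'⟩, hep⟩, huniq⟩ := ih (by omega)
    have hr := hp ⟨m, by omega⟩
    obtain ⟨h1, h2⟩ := h.pt_mem m (by omega) e he he' _ hr
    refine ⟨L.pt e (p ⟨m, by omega⟩), ⟨h.child_level (by omega) he he' h1 h2, fun i hi => ?_⟩, ?_⟩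
    · by_cases him : (i : ℕ) = m
      · rw [show p i = p ⟨m, by omega⟩ from congrArg p (Fin.ext him), him]
        exact (h.pt_iff m (by omega) e he he' _ hr _ h1 h2).2 rfl
      · obtain ⟨h3, h4⟩ := h.inherit m (by omega) e he he' _ h1 h2 i (by omega)
        rw [h3, h4]
        exact hep i (by omega)
    · rintro f ⟨⟨hf, hf'⟩, hfp⟩
      obtain ⟨e', h3, h4, h5, h6⟩ := h.exists_parent (by omega) hf hf'
      obtain rfl : e' = e := by
        refine huniq e' ⟨⟨h3, h4⟩, fun i hi => ?_⟩
        obtain ⟨h7, h8⟩ := h.inherit m (by omega) e' h3 h4 _ h5 h6 i hi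
        rw [← h7, ← h8]
        exact hfp i (by omega)
      exact ((h.pt_iff m (by omega) e' h3 h4 _ hr _ h5 h6).1 (hfp ⟨m, by omega⟩ (by simp))).symm

/-- Go up to the ancestor whose subdivision created the `i'`-th interval. Its `i`-th interval is the
same, since intervals are inherited, so box `j` already had an endpoint there. The endpoint of `j`
on axis `i'` was thus special, and `single` applies. -/
theorem single_of_endIn (hR : ∀ i < d, ∀ q < L.N, L.pos i q < L.N ∧ L.Q i (L.pos i q) = q)
    (h : L.Decomp d K) {m : ℕ} (hm : m ≤ d) {e : ℕ} (he : L.start m ≤ e)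
    (he' : e < L.start (m + 1)) {i i' j : ℕ} (hi : i < i') (hi' : i' < m) (hj : 2 * j + 1 < L.N)
    (h1 : L.EndIn i j e) (h2 : L.EndIn i' j e) : L.B i' e = L.A i' e + 1 := by
  induction m generalizing e with
  | zero => omega
  | succ m ih =>
    obtain ⟨e₀, h3, h4, h5, h6⟩ := h.exists_parent (by omega) he he'
    have hinh := h.inherit m (by omega) e₀ h3 h4 _ h5 h6
    by_cases him : i' = m
    · subst him
      have h1' : L.EndIn i j e₀ := by
        rwa [EndIn, (hinh i hi).1, (hinh i hi).2] at h1
      rcases h2 with h2 | h2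
      · refine h.single i' (by omega) e₀ h3 h4 e h5 h6 _ h2.1 h2.2 i hi ?_
        rwa [own, (hR i' (by omega) _ (by omega)).2, Nat.mul_div_cancel_left _ (by omega)]
      · refine h.single i' (by omega) e₀ h3 h4 e h5 h6 _ h2.1 h2.2 i hi ?_
        rwa [own, (hR i' (by omega) _ (by omega)).2, show (2 * j + 1) / 2 = j by omega]
    · have e1 := hinh i (by omega)
      have e2 := hinh i' (by omega)
      rw [EndIn, e1.1, e1.2] at h1
      rw [EndIn, e2.1, e2.2] at h2
      rw [e2.1, e2.2]
      exact ih (by omega) h3 h4 (by omega) h1 h2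

theorem entry_interval (h : L.Decomp d K) {m : ℕ} (hm : m ≤ d) {e : ℕ} (he : L.start m ≤ e)
    (he' : e < L.start (m + 1)) {i : ℕ} (hi : i < m) : L.A i e < L.B i e ∧ L.B i e ≤ L.N := by
  induction m generalizing e with
  | zero => omega
  | succ m ih =>
    obtain ⟨e₀, h3, h4, h5, h6⟩ := h.exists_parent (by omega) he he'
    by_cases him : i = m
    · subst him
      exact h.interval i (by omega) e₀ h3 h4 e h5 h6
    · obtain ⟨h7, h8⟩ := h.inherit m (by omega) e₀ h3 h4 _ h5 h6 i (by omega)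
      rw [h7, h8]
      exact ih (by omega) h3 h4 (by omega)

theorem card_level (h : L.Decomp d K) {m : ℕ} (hm : m ≤ d) :
    L.start (m + 1) ≤ L.start m + K ^ m := by
  induction m with
  | zero => simp [h.start_zero, h.start_one]
  | succ m ih =>
    have key : ∀ e, L.start m ≤ e → e ≤ L.start (m + 1) →
        L.first e ≤ L.start (m + 1) + K * (e - L.start m) := by
      intro e he
      induction e, he using Nat.le_induction with
      | base => intro _; rw [h.first_start m (by omega)]; omega
      | succ e h1 ih' =>
        intro h2
        have h3 := ih' (by omega)
        have h4 := h.count m (by omega) e h1 (by omega)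
        rw [show e + 1 - L.start m = e - L.start m + 1 by omega, mul_add]
        omega
    have h5 := key _ (h.start_le m (by omega)) le_rfl
    rw [h.first_start (m + 1) hm] at h5
    have h6 : K * (L.start (m + 1) - L.start m) ≤ K * K ^ m :=
      Nat.mul_le_mul_left _ (by have := ih (by omega); omega)
    rw [pow_succ, mul_comm (K ^ m)]
    show L.start (m + 1 + 1) ≤ _
    omega

/-- The entries of level `m` whose `i`-th interval contains `r`. -/
def through (L : Layout) (m i r : ℕ) : Finset ℕ :=
  (Finset.Ico (L.start m) (L.start (m + 1))).filter fun e => L.A i e ≤ r ∧ r < L.B i e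

/-- Subdividing along axis `i` itself gives one child containing rank `r` per entry; only the other
axes contribute a factor `K` each. This saved factor is where the exponent `(d - 1) / 2` comes from.
-/
theorem card_through (h : L.Decomp d K) {m i r : ℕ} (hm : m ≤ d) (hi : i < m) (hr : r < L.N) :
    (through L m i r).card ≤ K ^ (m - 1) := by
  induction m with
  | zero => omega
  | succ m ih =>
    by_cases him : i = m
    · subst him
      have hsub : through L (i + 1) i r ⊆
          (Finset.Ico (L.start i) (L.start (i + 1))).image fun e => L.pt e r := by
        intro f hf
        simp only [through, Finset.mem_filter, Finset.mem_Ico] at hf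
        obtain ⟨e, h3, h4, h5, h6⟩ := h.exists_parent (by omega) hf.1.1 hf.1.2
        exact Finset.mem_image.2 ⟨e, Finset.mem_Ico.2 ⟨h3, h4⟩,
          (h.pt_iff i (by omega) e h3 h4 r hr f h5 h6).1 hf.2⟩
      refine (Finset.card_le_card hsub).trans (Finset.card_image_le.trans ?_)
      have := h.card_level (m := i) (by omega)
      simp only [Nat.card_Ico, Nat.add_sub_cancel]
      omega
    · have hsub : through L (m + 1) i r ⊆ (through L m i r).biUnion fun e =>
          Finset.Ico (L.first e) (L.first (e + 1)) := by
        intro f hf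
        simp only [through, Finset.mem_filter, Finset.mem_Ico] at hf
        obtain ⟨e, h3, h4, h5, h6⟩ := h.exists_parent (by omega) hf.1.1 hf.1.2
        obtain ⟨h7, h8⟩ := h.inherit m (by omega) e h3 h4 _ h5 h6 i (by omega)
        refine Finset.mem_biUnion.2 ⟨e, ?_, Finset.mem_Ico.2 ⟨h5, h6⟩⟩
        simp only [through, Finset.mem_filter, Finset.mem_Ico]
        exact ⟨⟨h3, h4⟩, by rw [← h7, ← h8]; exact hf.2⟩
      refine (Finset.card_le_card hsub).trans ((Finset.card_biUnion_le_card_mul _ _ K ?_).trans ?_)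
      · intro e he
        simp only [through, Finset.mem_filter, Finset.mem_Ico] at he
        have := h.count m (by omega) e he.1.1 he.1.2
        rw [Nat.card_Ico]
        omega
      · have h9 := Nat.mul_le_mul_right K (ih (by omega) (by omega))
        rwa [← pow_succ, show m - 1 + 1 = m + 1 - 1 by omega] at h9

end Decomp

/-- The rank point `p` lies in box `j`. -/
def InBox (L : Layout) (j : ℕ) (p : Fin d → ℕ) : Prop :=
  ∀ i : Fin d, L.pos i (2 * j) ≤ p i ∧ p i ≤ L.pos i (2 * j + 1)

/-- The rank point `p` is a vertex. -/
def Vert (L : Layout) (A : Finset (Fin n)) (p : Fin d → ℕ) : Prop :=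
  ∀ i : Fin d, ∃ j ∈ A, L.own i (p i) = (j : ℕ) ∧ L.InBox j p

/-- The side with rank `r` on axis `i` can contribute vertices to cell `c`. -/
def Cand (L : Layout) (d c i r : ℕ) : Prop :=
  ∀ i' < d, i' ≠ i →
    (L.B i c ≠ L.A i c + 1 →
      L.pos i' (2 * L.own i r) ≤ L.A i' c ∧ L.A i' c ≤ L.pos i' (2 * L.own i r + 1)) ∧
    (L.B i' c = L.A i' c + 1 → L.pos i (2 * L.own i' (L.A i' c)) ≤ r ∧
      r ≤ L.pos i (2 * L.own i' (L.A i' c) + 1))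

/-- The side with rank `r` on axis `i` contributes vertices to cell `c`. -/
def Active (L : Layout) (d : ℕ) (A : Finset (Fin n)) (c i r : ℕ) : Prop :=
  (L.A i c ≤ r ∧ r < L.B i c) ∧ L.Cand d c i r ∧ ∃ j ∈ A, L.own i r = (j : ℕ)

/-- The rank point `p` lies in the cell `c`. -/
def InCell (L : Layout) (c : ℕ) (p : Fin d → ℕ) : Prop := ∀ i : Fin d, L.A i c ≤ p i ∧ p i < L.B i c

namespace Ranks

variable {Bx : Fin n → AABox d}

theorem X_lt_iff (hR : L.Ranks Bx) {i r r' : ℕ} (hi : i < d) (hr : r < L.N) (hr' : r' < L.N) :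
    L.X i r < L.X i r' ↔ r < r' := by
  refine ⟨fun h => ?_, fun h => hR.mono i hi r r' h hr'⟩
  by_contra hle
  rcases (not_lt.1 hle).eq_or_lt with e | e
  · rw [e] at h; exact lt_irrefl _ h
  · exact lt_asymm h (hR.mono i hi _ _ e hr)

theorem X_le_iff (hR : L.Ranks Bx) {i r r' : ℕ} (hi : i < d) (hr : r < L.N) (hr' : r' < L.N) :
    L.X i r ≤ L.X i r' ↔ r ≤ r' := by
  rw [← not_lt, ← not_lt, hR.X_lt_iff hi hr' hr]

theorem own_lt (hR : L.Ranks Bx) {i r : ℕ} (hi : i < d) (hr : r < L.N) : L.own i r < n := by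
  have := hR.Q_lt i hi r hr
  have := hR.N_eq
  rw [own]; omega

theorem end_lt (hR : L.Ranks Bx) (j : Fin n) : 2 * (j : ℕ) + 1 < L.N := by
  have := hR.N_eq
  omega

theorem lo_lt_hi (hR : L.Ranks Bx) {i : ℕ} (hi : i < d) {j : ℕ} (hj : j < n) :
    L.pos i (2 * j) < L.pos i (2 * j + 1) := by
  have hN := hR.N_eq
  have h1 := hR.pos_lt i hi (2 * j) (by omega)
  have h2 := hR.pos_lt i hi (2 * j + 1) (by omega)
  refine lt_of_le_of_ne ((hR.X_le_iff hi h1 h2).1 ?_) fun e => ?_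
  · have h3 := hR.lo ⟨i, hi⟩ ⟨j, hj⟩
    have h4 := hR.hi ⟨i, hi⟩ ⟨j, hj⟩
    simp only at h3 h4
    rw [h3, h4]
    exact (Bx ⟨j, hj⟩).fst_le_snd _
  · have h3 := hR.Q_pos i hi (2 * j) (by omega)
    have h4 := hR.Q_pos i hi (2 * j + 1) (by omega)
    rw [e] at h3
    omega

theorem rank_eq (hR : L.Ranks Bx) {i r : ℕ} (hi : i < d) (hr : r < L.N) :
    r = L.pos i (2 * L.own i r) ∨ r = L.pos i (2 * L.own i r + 1) := by
  have h := hR.pos_Q i hi r hr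
  rw [own]
  rcases Nat.even_or_odd' (L.Q i r) with ⟨k, hk | hk⟩
  · left; rw [show 2 * (L.Q i r / 2) = L.Q i r by omega, h]
  · right; rw [show 2 * (L.Q i r / 2) + 1 = L.Q i r by omega, h]

theorem rank_between (hR : L.Ranks Bx) {i r : ℕ} (hi : i < d) (hr : r < L.N) :
    L.pos i (2 * L.own i r) ≤ r ∧ r ≤ L.pos i (2 * L.own i r + 1) := by
  have h1 := hR.lo_lt_hi hi (hR.own_lt hi hr)
  rcases hR.rank_eq hi hr with h | h <;> omega

theorem endIn_own (hR : L.Ranks Bx) {i r e : ℕ} (hi : i < d) (hr : r < L.N)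
    (h : L.A i e ≤ r ∧ r < L.B i e) : L.EndIn i (L.own i r) e := by
  rcases hR.rank_eq hi hr with h' | h'
  · left; rwa [← h']
  · right; rwa [← h']

theorem single_of_endIn (hR : L.Ranks Bx) (hD : L.Decomp d K) {c : ℕ} (hc : L.IsCell d c)
    {i i' j : ℕ} (hi : i < i') (hi' : i' < d) (hj : j < n)
    (h1 : L.EndIn i j c) (h2 : L.EndIn i' j c) : L.B i' c = L.A i' c + 1 :=
  Decomp.single_of_endIn (fun i hi q hq => ⟨hR.pos_lt i hi q hq, hR.Q_pos i hi q hq⟩) hD le_rfl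
    hc.1 hc.2 hi hi' (by have := hR.N_eq; omega) h1 h2

/-- Being a vertex is a condition on pairs of axes: the box owning `p i` must contain `p` on every
axis `i'`. Inside a cell it decouples. If the `i`-th interval is a single rank, the box is known
from the cell alone and the condition concerns `p i'` only. If not, either the box has no endpoint
in the `i'`-th interval, so containing its first rank means covering it, or that interval is a
single rank. In both cases only `p i` matters. `Cand` collects exactly these conditions. -/
theorem vert_iff (hR : L.Ranks Bx) (hD : L.Decomp d K) {c : ℕ} (hc : L.IsCell d c)
    {A : Finset (Fin n)} {p : Fin d → ℕ} (hp : L.InCell c p) :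
    L.Vert A p ↔ ∀ i : Fin d, L.Active d A c i (p i) := by
  have hpN : ∀ i, p i < L.N := fun i =>
    (hp i).2.trans_le (hD.entry_interval le_rfl hc.1 hc.2 i.2).2
  have hown : ∀ i : Fin d, L.own i (p i) < n := fun i => hR.own_lt i.2 (hpN i)
  have hend : ∀ i : Fin d, L.EndIn i (L.own i (p i)) c := fun i =>
    hR.endIn_own i.2 (hpN i) (hp i)
  -- One of the two axes, the later one, has a one-rank interval; as it is not `i`, it is `i'`,
  -- whatever their order.
  have hconf : ∀ i i' : Fin d, i' ≠ i → L.B i c ≠ L.A i c + 1 → L.EndIn i' (L.own i (p i)) c →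
      L.B i' c = L.A i' c + 1 := by
    intro i i' hne h1 h2
    rcases lt_or_gt_of_ne (Fin.val_ne_of_ne hne) with hlt | hlt
    · exact absurd (hR.single_of_endIn hD hc hlt i.2 (hown i) h2 (hend i)) h1
    · exact hR.single_of_endIn hD hc hlt i'.2 (hown i) (hend i) h2
  constructor
  · intro hV i
    have hin : ∀ i : Fin d, L.InBox (L.own i (p i)) p := fun i => by
      obtain ⟨j, -, hj, hb⟩ := hV i
      rwa [hj]
    refine ⟨hp i, fun i' hi' hne => ⟨fun h1 => ?_, fun h1 => ?_⟩, ?_⟩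
    · obtain ⟨h2, h3⟩ := hin i ⟨i', hi'⟩
      have h4 := hp ⟨i', hi'⟩
      simp only at h2 h3 h4
      by_cases h5 : L.EndIn i' (L.own i (p i)) c
      · have := hconf i ⟨i', hi'⟩ (fun e => hne (by rw [← e])) h1 h5
        simp only at this
        omega
      · rw [EndIn] at h5
        omega
    · have h4 := hp ⟨i', hi'⟩
      have h5 : p ⟨i', hi'⟩ = L.A i' c := by simp only at h4; omega
      have := hin ⟨i', hi'⟩ i
      rwa [h5] at this
    · obtain ⟨j, hj, hj', -⟩ := hV i
      exact ⟨j, hj, hj'⟩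
  · intro hA i
    obtain ⟨-, hcand, j, hj, hj'⟩ := hA i
    refine ⟨j, hj, hj', fun i' => ?_⟩
    rw [← hj']
    by_cases hii : i' = i
    · subst hii
      exact hR.rank_between i'.2 (hpN i')
    by_cases h1 : L.B i c = L.A i c + 1
    · have h2 := ((hA i').2.1 i i.2 (fun e => hii (Fin.ext e.symm))).2 h1
      have h3 := hp i
      rwa [show L.A i c = p i by omega] at h2
    · have h2 := (hcand i' i'.2 (fun e => hii (Fin.ext e))).1 h1
      have h3 := hp i'
      by_cases h4 : L.EndIn i' (L.own i (p i)) c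
      · have := hconf i i' hii h1 h4
        omega
      · rw [EndIn] at h4
        omega

/-- A box which meets a cell covers it on all axes but one. -/
theorem eq_of_not_cover (hR : L.Ranks Bx) (hD : L.Decomp d K) {c : ℕ} (hc : L.IsCell d c)
    {j : ℕ} (hj : j < n)
    (hmeet : ∀ i < d, L.A i c < L.pos i (2 * j + 1) + 1 ∧ L.pos i (2 * j) < L.B i c)
    {i i' : ℕ} (hi : i < d) (hi' : i' < d)
    (h1 : L.A i c < L.pos i (2 * j) ∨ L.pos i (2 * j + 1) + 1 < L.B i c)
    (h2 : L.A i' c < L.pos i' (2 * j) ∨ L.pos i' (2 * j + 1) + 1 < L.B i' c) : i = i' := by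
  -- A box that meets an interval without covering it has an endpoint in it. Two such axes would
  -- make the later interval a single rank, and a single rank that is met is covered.
  have key : ∀ i i', i < i' → i' < d →
      (L.A i c < L.pos i (2 * j) ∨ L.pos i (2 * j + 1) + 1 < L.B i c) →
      (L.A i' c < L.pos i' (2 * j) ∨ L.pos i' (2 * j + 1) + 1 < L.B i' c) → False := by
    intro i i' hlt hi' h1 h2
    have m1 := hmeet i (by omega)
    have m2 := hmeet i' hi'
    have e1 : L.EndIn i j c := by rw [EndIn]; omega
    have e2 : L.EndIn i' j c := by rw [EndIn]; omega
    have := hR.single_of_endIn hD hc hlt hi' hj e1 e2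
    omega
  rcases lt_trichotomy i i' with h | h | h
  · exact (key i i' h hi' h1 h2).elim
  · exact h
  · exact (key i' i h hi h2 h1).elim

end Ranks

end Layout

end RealRAM

/-! ### From real points to rank points, and the product formula for the weight of a cell. -/

namespace RealRAM

namespace Layout

variable {d n : ℕ} {L : Layout} {K : ℕ} {Bx : Fin n → AABox d}

/-- The point with given ranks. -/
def toPoint (L : Layout) (p : Fin d → ℕ) : Fin d → ℝ := fun i => L.X i (p i)

/-- All the rank points. -/
def grid (L : Layout) (d : ℕ) : Finset (Fin d → ℕ) := Fintype.piFinset fun _ => Finset.range L.N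

theorem mem_grid {p : Fin d → ℕ} : p ∈ L.grid d ↔ ∀ i, p i < L.N := by
  simp [grid, Fintype.mem_piFinset]

/-- The rank points of a cell. -/
def cellBox (L : Layout) (d c : ℕ) : Finset (Fin d → ℕ) :=
  Fintype.piFinset fun i => Finset.Ico (L.A i c) (L.B i c)

theorem mem_cellBox {c : ℕ} {p : Fin d → ℕ} : p ∈ L.cellBox d c ↔ L.InCell c p := by
  simp [cellBox, Fintype.mem_piFinset, InCell]

open Classical in
/-- The doubling weight of a rank point. -/
noncomputable def rankWeight (L : Layout) (S : Multiset (Fin n)) (p : Fin d → ℕ) : ℝ :=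
  2 ^ S.countP fun j : Fin n => L.InBox j p

theorem toPoint_mem_box (hR : L.Ranks Bx) {p : Fin d → ℕ} (hp : p ∈ L.grid d) (j : Fin n) :
    L.toPoint p ∈ Bx j ↔ L.InBox j p := by
  rw [mem_grid] at hp
  have hN := hR.end_lt j
  have h1 : ∀ i : Fin d, (Bx j).fst i ≤ L.toPoint p i ↔ L.pos i (2 * j) ≤ p i := fun i => by
    rw [← hR.lo i j, toPoint, hR.X_le_iff i.2 (hR.pos_lt i i.2 _ (by omega)) (hp i)]
  have h2 : ∀ i : Fin d, L.toPoint p i ≤ (Bx j).snd i ↔ p i ≤ L.pos i (2 * j + 1) := fun i => by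
    rw [← hR.hi i j, toPoint, hR.X_le_iff i.2 (hp i) (hR.pos_lt i i.2 _ (by omega))]
  rw [NonemptyInterval.mem_def, Pi.le_def, Pi.le_def, InBox, ← forall_and]
  exact forall_congr' fun i => and_congr (h1 i) (h2 i)

theorem toPoint_injOn (hR : L.Ranks Bx) : Set.InjOn (L.toPoint (d := d)) (L.grid d) := by
  intro p hp p' hp' h
  rw [Finset.mem_coe, mem_grid] at hp hp'
  funext i
  have hi : L.X i (p i) = L.X i (p' i) := congrFun h i
  exact le_antisymm ((hR.X_le_iff i.2 (hp i) (hp' i)).1 hi.le)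
    ((hR.X_le_iff i.2 (hp' i) (hp i)).1 hi.ge)

open Classical in
/-- The rank points which are vertices. -/
noncomputable def verts (L : Layout) (d : ℕ) (A : Finset (Fin n)) : Finset (Fin d → ℕ) :=
  (L.grid d).filter (L.Vert A)

/-- A vertex has on each axis an endpoint of a box as coordinate, and by strict monotonicity of `X`
this endpoint has just one rank; the rank in turn names the box through `own`. -/
theorem vertices_eq (hR : L.Ranks Bx) (A : Finset (Fin n)) :
    AABox.vertices Bx A = L.toPoint '' (L.verts d A : Set (Fin d → ℕ)) := by
  ext v
  constructor
  · intro hv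
    choose j hjA hjv hside using hv
    have hex : ∀ i : Fin d, ∃ r, r < L.N ∧ L.own i r = (j i : ℕ) ∧ L.X i r = v i := by
      intro i
      have hN := hR.end_lt (j i)
      rcases hside i with h | h
      · refine ⟨_, hR.pos_lt i i.2 (2 * j i) (by omega), ?_, by rw [hR.lo i (j i), h]⟩
        rw [own, hR.Q_pos i i.2 _ (by omega)]; omega
      · refine ⟨_, hR.pos_lt i i.2 (2 * j i + 1) (by omega), ?_, by rw [hR.hi i (j i), h]⟩
        rw [own, hR.Q_pos i i.2 _ (by omega)]; omega
    choose p hpN hown hX using hex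
    have hpt : L.toPoint p = v := funext hX
    have hg : p ∈ L.grid d := mem_grid.2 hpN
    refine ⟨p, ?_, hpt⟩
    simp only [verts, Finset.coe_filter, Set.mem_ofPred_eq]
    refine ⟨hg, fun i => ⟨j i, hjA i, hown i, ?_⟩⟩
    rw [← toPoint_mem_box hR hg, hpt]
    exact hjv i
  · rintro ⟨p, hp, rfl⟩ i
    simp only [verts, Finset.coe_filter, Set.mem_ofPred_eq] at hp
    obtain ⟨j, hj, hown, hbox⟩ := hp.2 i
    refine ⟨j, hj, (toPoint_mem_box hR hp.1 j).2 hbox, ?_⟩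
    rcases hR.rank_eq i.2 (mem_grid.1 hp.1 i) with h | h
    · left; rw [toPoint, h, hown, hR.lo i j]
    · right; rw [toPoint, h, hown, hR.hi i j]

theorem weight_toPoint (hR : L.Ranks Bx) (S : Multiset (Fin n)) {p : Fin d → ℕ}
    (hp : p ∈ L.grid d) : AABox.weight Bx S (L.toPoint p) = L.rankWeight S p := by
  classical
  rw [AABox.weight, rankWeight]
  congr 1
  exact Multiset.countP_congr rfl fun j _ => propext (toPoint_mem_box hR hp j)

theorem totalWeight_image (hR : L.Ranks Bx) (S : Multiset (Fin n)) {F : Finset (Fin d → ℕ)}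
    (hF : F ⊆ L.grid d) :
    AABox.totalWeight Bx S (L.toPoint '' (F : Set (Fin d → ℕ))) = ∑ p ∈ F, L.rankWeight S p := by
  rw [AABox.totalWeight, finsum_mem_image ((toPoint_injOn hR).mono (Finset.coe_subset.2 hF)),
    finsum_mem_coe_finset]
  exact Finset.sum_congr rfl fun p hp => weight_toPoint hR S (hF hp)

/-- The rank intervals `[lo i, hi i)` describe the box `b`. -/
def Locates (L : Layout) (lo hi : ℕ → ℕ) (b : AABox d) : Prop :=
  ∀ i : Fin d, lo i ≤ L.N ∧ hi i ≤ L.N ∧ (∀ r < L.N, L.X i r < b.fst i ↔ r < lo i) ∧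
    ∀ r < L.N, L.X i r ≤ b.snd i ↔ r < hi i

open Classical in
theorem totalWeight_inter (hR : L.Ranks Bx) (A : Finset (Fin n)) (S : Multiset (Fin n))
    {lo hi : ℕ → ℕ} {b : AABox d} (hb : L.Locates lo hi b) :
    AABox.totalWeight Bx S (AABox.vertices Bx A ∩ (b : Set (Fin d → ℝ))) =
      ∑ p ∈ (L.verts d A).filter (fun p : Fin d → ℕ => ∀ i : Fin d, lo i ≤ p i ∧ p i < hi i),
        L.rankWeight S p := by
  rw [← totalWeight_image hR S (F := (L.verts d A).filter _)
    ((Finset.filter_subset _ _).trans (Finset.filter_subset _ _)), vertices_eq hR]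
  congr 1
  ext v
  simp only [Set.mem_inter_iff, Set.mem_image, SetLike.mem_coe, Finset.mem_filter]
  have key : ∀ p ∈ L.verts d A, (L.toPoint p ∈ b ↔ ∀ i : Fin d, lo i ≤ p i ∧ p i < hi i) := by
    intro p hp
    have hpN := mem_grid.1 (Finset.mem_filter.1 hp).1
    rw [NonemptyInterval.mem_def, Pi.le_def, Pi.le_def, ← forall_and]
    refine forall_congr' fun i => and_congr ?_ ((hb i).2.2.2 _ (hpN i))
    rw [← not_lt, ← not_lt]
    exact not_congr ((hb i).2.2.1 _ (hpN i))
  constructor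
  · rintro ⟨⟨p, hp, rfl⟩, hvb⟩
    exact ⟨p, ⟨hp, (key p hp).1 hvb⟩, rfl⟩
  · rintro ⟨p, ⟨hp, hin⟩, rfl⟩
    exact ⟨⟨p, hp, rfl⟩, (key p hp).2 hin⟩

/-- For an input box the search ends exactly at the ranks of its own endpoints. The `+ 1` turns the
closed upper side into a half-open bound. -/
theorem Locates.of_box (hR : L.Ranks Bx) {lo hi : ℕ → ℕ} {j : Fin n}
    (hb : L.Locates lo hi (Bx j)) (i : Fin d) :
    lo i = L.pos i (2 * j) ∧ hi i = L.pos i (2 * j + 1) + 1 := by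
  obtain ⟨h1, h2, h3, h4⟩ := hb i
  have hN := hR.end_lt j
  have hl := hR.pos_lt i i.2 (2 * j) (by omega)
  have hh := hR.pos_lt i i.2 (2 * j + 1) (by omega)
  have h3' : ∀ r < L.N, r < L.pos i (2 * j) ↔ r < lo i := fun r hr => by
    rw [← h3 r hr, ← hR.lo i j, hR.X_lt_iff i.2 hr hl]
  have h4' : ∀ r < L.N, r ≤ L.pos i (2 * j + 1) ↔ r < hi i := fun r hr => by
    rw [← h4 r hr, ← hR.hi i j, hR.X_le_iff i.2 hr hh]
  constructor
  · rcases lt_trichotomy (lo i) (L.pos i (2 * j)) with h | h | h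
    · have := h3' (lo i) (by omega); omega
    · exact h
    · have := h3' _ hl; omega
  · have a1 := (h4' _ hh).1 le_rfl
    by_contra hne
    have := h4' (L.pos i (2 * j + 1) + 1) (by omega)
    omega

theorem grid_eq_biUnion (hD : L.Decomp d K) :
    L.grid d = (Finset.Ico (L.start d) (L.start (d + 1))).biUnion (L.cellBox d) := by
  ext p
  rw [Finset.mem_biUnion]
  constructor
  · intro hp
    obtain ⟨c, ⟨hc, hcp⟩, -⟩ := hD.existsUnique_entry p (mem_grid.1 hp) le_rfl
    exact ⟨c, Finset.mem_Ico.2 hc, mem_cellBox.2 fun i => hcp i i.2⟩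
  · rintro ⟨c, hc, hcp⟩
    rw [Finset.mem_Ico] at hc
    rw [mem_cellBox] at hcp
    exact mem_grid.2 fun i => (hcp i).2.trans_le (hD.entry_interval le_rfl hc.1 hc.2 i.2).2

theorem cell_unique (hD : L.Decomp d K) {c c' : ℕ} (hc : L.IsCell d c) (hc' : L.IsCell d c')
    {p : Fin d → ℕ} (hp : L.InCell c p) (hp' : L.InCell c' p) : c = c' :=
  (hD.existsUnique_entry p (fun i => (hp i).2.trans_le
    (hD.entry_interval le_rfl hc.1 hc.2 i.2).2) le_rfl).unique ⟨hc, fun i _ => hp i⟩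
    ⟨hc', fun i _ => hp' i⟩

theorem sum_grid (hD : L.Decomp d K) (F : (Fin d → ℕ) → ℝ) :
    ∑ p ∈ L.grid d, F p =
      ∑ c ∈ Finset.Ico (L.start d) (L.start (d + 1)), ∑ p ∈ L.cellBox d c, F p := by
  classical
  rw [grid_eq_biUnion hD, Finset.sum_biUnion]
  intro c hc c' hc' hne
  rw [Finset.mem_coe, Finset.mem_Ico] at hc hc'
  refine Finset.disjoint_left.2 fun p hp hp' => hne ?_
  exact cell_unique hD hc hc' (mem_cellBox.1 hp) (mem_cellBox.1 hp')

open Classical in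
/-- The leaf values of the tree for axis `i` of cell `c`. -/
noncomputable def actVal (L : Layout) (d : ℕ) (A : Finset (Fin n)) (c i r : ℕ) : ℝ :=
  if L.Active d A c i r then 1 else 0

open Classical in
theorem prod_actVal (hR : L.Ranks Bx) (hD : L.Decomp d K) {c : ℕ} (hc : L.IsCell d c)
    (A : Finset (Fin n)) {p : Fin d → ℕ} (hp : L.InCell c p) :
    ∏ i : Fin d, L.actVal d A c i (p i) = if L.Vert A p then 1 else 0 := by
  simp only [actVal, Finset.prod_boole, Finset.mem_univ, true_imp_iff]
  simp only [hR.vert_iff hD hc hp]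

open Classical in
/-- The weight of the vertices of a cell in a box is a product over the axes. -/
theorem sum_cell (hR : L.Ranks Bx) (hD : L.Decomp d K) {c : ℕ} (hc : L.IsCell d c)
    (A : Finset (Fin n)) {w : (Fin d → ℕ) → ℝ} {G : ℝ} {g : ℕ → ℕ → ℝ}
    (hg : ∀ p : Fin d → ℕ, L.InCell c p → G * ∏ i : Fin d, g i (p i) = w p) {lo hi : ℕ → ℕ}
    (hlh : ∀ i : Fin d, lo i ≤ hi i) :
    ∑ p ∈ (L.cellBox d c).filter (fun p => L.Vert A p ∧ ∀ i : Fin d, lo i ≤ p i ∧ p i < hi i),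
      w p = G * ∏ i : Fin d, (∑ r ∈ Finset.range (hi i), L.actVal d A c i r * g i r -
        ∑ r ∈ Finset.range (lo i), L.actVal d A c i r * g i r) := by
  have h1 : ∀ i : Fin d, (∑ r ∈ Finset.range (hi i), L.actVal d A c i r * g i r -
      ∑ r ∈ Finset.range (lo i), L.actVal d A c i r * g i r) =
      ∑ r ∈ Finset.Ico (L.A i c) (L.B i c),
        L.actVal d A c i r * g i r * if lo i ≤ r ∧ r < hi i then 1 else 0 := by
    intro i
    rw [← Finset.sum_Ico_eq_sub _ (hlh i)]
    simp only [mul_ite, mul_one, mul_zero]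
    rw [← Finset.sum_filter]
    symm
    -- Restricting the sum to the interval of the cell is harmless: `actVal` vanishes outside.
    refine Finset.sum_subset ?_ ?_
    · intro r hr
      simp only [Finset.mem_filter, Finset.mem_Ico] at hr ⊢
      exact hr.2
    · intro r hr hr'
      simp only [Finset.mem_filter, Finset.mem_Ico, not_and] at hr hr'
      rw [actVal, if_neg, zero_mul]
      rintro ⟨h, -⟩
      exact hr' h hr.1 hr.2
  -- Distributivity: the product of the sums over the intervals is the sum over the points of the
  -- cell of the products over the axes.
  rw [Finset.prod_congr rfl fun i _ => h1 i, Finset.prod_univ_sum, Finset.mul_sum,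
    Finset.sum_filter]
  refine Finset.sum_congr rfl fun p hp => ?_
  have hp' := mem_cellBox.1 hp
  rw [Finset.prod_mul_distrib, Finset.prod_mul_distrib, prod_actVal hR hD hc A hp']
  simp only [Finset.prod_boole, Finset.mem_univ, true_imp_iff]
  rw [← hg p hp']
  by_cases hV : L.Vert A p <;> by_cases hb : ∀ i : Fin d, lo i ≤ p i ∧ p i < hi i <;>
    simp [hV, hb]

end Layout

end RealRAM

namespace RealRAM

/-! ### Operations on one tree -/

theorem tagProd_congr {t t' : ℕ → ℝ} {M : ℕ} (h : ∀ x, 1 ≤ x → x < M → t' x = t x) {u : ℕ}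
    (hu : u < M) : tagProd t' u = tagProd t u := by
  induction u using Nat.strong_induction_on with
  | _ u ih =>
    rcases Nat.eq_zero_or_pos u with rfl | h0
    · rw [tagProd_zero, tagProd_zero]
    · rw [tagProd_of_pos _ h0, tagProd_of_pos _ h0, h u h0 hu, ih _ (by omega) (by omega)]

theorem TreeRep.congr {H : ℕ} {t s t' s' g b : ℕ → ℝ} (h : TreeRep H t s g b)
    (ht : ∀ x, 1 ≤ x → x < 2 * 2 ^ H → t' x = t x) (hs : ∀ x, 1 ≤ x → x < 2 * 2 ^ H → s' x = s x) :
    TreeRep H t' s' g b := by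
  refine ⟨⟨fun x h1 h2 => by rw [ht x h1 h2]; exact h.tree.pos x h1 h2, fun x h1 h2 h3 => ?_⟩,
    fun q hq => ?_⟩
  · rw [hs x h1 h2, ht x h1 h2, h.tree.eq x h1 h2 h3]
    split_ifs with hx
    · rw [hs _ (by omega) (by omega), hs _ (by omega) (by omega)]
    · rfl
  · rw [tagProd_congr ht (by omega), h.tags q hq]

theorem TreeRep.congr_g {H : ℕ} {t s g b g' : ℕ → ℝ} (h : TreeRep H t s g b)
    (hg : ∀ q < 2 ^ H, g' q = g q) : TreeRep H t s g' b :=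
  ⟨h.tree, fun q hq => by rw [h.tags q hq, hg q hq]⟩

theorem IsTree.setLeaf {M r : ℕ} {t s b : ℕ → ℝ} {x : ℝ}
    (h : IsTree M t s b fun _ => False) :
    IsTree M t (Function.update s (M + r) (t (M + r) * x)) (Function.update b r x)
      (Anc (M + r)) := by
  refine ⟨h.pos, fun y hy hy' hbad => ?_⟩
  have h1 : y ≠ (M + r) / 2 := fun e => hbad ((anc_iff _ _).2 (Or.inl e))
  by_cases hyr : y = M + r
  · subst hyr
    rw [Function.update_self, if_neg (by omega), Nat.add_sub_cancel_left, Function.update_self]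
  · rw [Function.update_of_ne hyr, h.eq y hy hy' (by simp)]
    split_ifs with hyM
    · rw [Function.update_of_ne (by omega), Function.update_of_ne (by omega)]
    · rw [Function.update_of_ne (by omega)]

/-- The addresses of the tree of size `M` at `β`. -/
def region (M β : ℕ) : Set ℕ := {k | β ≤ k ∧ k < β + 2 * M}

/-- `τ` arises from `σ` by changing natural registers from `m` on, real registers outside
`k, …, 15`, and tree nodes with addresses in `R`. -/
structure OpFrame (m k : ℕ) (R : Set ℕ) (σ τ : State) : Prop where
  nreg : ∀ i < m, τ.nreg i = σ.nreg i
  rreg : ∀ i, k ≤ i → i < 16 → τ.rreg i = σ.rreg i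
  na : τ.na = σ.na
  draws : τ.draws = σ.draws
  ra : ∀ f j, (2 ≤ f ∨ j ∉ R) → τ.ra f j = σ.ra f j

namespace OpFrame
variable {m k m' k' : ℕ} {R R' : Set ℕ} {σ τ υ : State}

theorem refl (m k : ℕ) (R : Set ℕ) (σ : State) : OpFrame m k R σ σ :=
  ⟨fun _ _ => rfl, fun _ _ _ => rfl, rfl, rfl, fun _ _ _ => rfl⟩

theorem trans (h : OpFrame m k R σ τ) (h' : OpFrame m k R τ υ) : OpFrame m k R σ υ :=
  ⟨fun i hi => (h'.nreg i hi).trans (h.nreg i hi),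
    fun i h1 h2 => (h'.rreg i h1 h2).trans (h.rreg i h1 h2), h'.na.trans h.na,
    h'.draws.trans h.draws, fun f j hj => (h'.ra f j hj).trans (h.ra f j hj)⟩

theorem mono (h : OpFrame m k R σ τ) (hm : m' ≤ m) (hk : k ≤ k') (hR : R ⊆ R') :
    OpFrame m' k' R' σ τ :=
  ⟨fun i hi => h.nreg i (by omega), fun i h1 h2 => h.rreg i (by omega) h2, h.na, h.draws,
    fun f j hj => h.ra f j (hj.imp id fun h1 h2 => h1 (hR h2))⟩

theorem of_tree {M β : ℕ} (h : TreeFrame M β σ τ) : OpFrame 90 13 (region M β) σ τ :=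
  ⟨fun i hi => h.nreg i (by omega) (by omega), fun i _ _ => by rw [h.rreg], h.na, h.draws,
    fun f j hj => h.ra f j (by simp only [region, Set.mem_ofPred_eq] at hj; omega)⟩

theorem of_read (h : ReadFrame σ τ) : OpFrame 90 13 R σ τ :=
  ⟨fun i hi => h.nreg i (by omega) (by omega), fun i _ _ => h.rreg i (by omega) (by omega), h.na,
    h.draws, fun f j _ => by rw [h.ra]⟩

theorem setN (h : OpFrame m k R σ τ) {i v : ℕ} (hi : m ≤ i) (h1 : i ≠ 1) :
    OpFrame m k R σ (τ.setN i v) :=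
  ⟨fun j hj => by rw [State.setN_nreg, if_neg (by omega), h.nreg j hj], h.rreg, h.na, h.draws,
    by rw [State.setN_ra _ _ _ h1]; exact h.ra⟩

theorem setR (h : OpFrame m k R σ τ) {i : ℕ} {v : ℝ} (hi : i < k ∨ 16 ≤ i) :
    OpFrame m k R σ (τ.setR i v) :=
  ⟨h.nreg, fun j hj hj' => by rw [State.setR_rreg, if_neg (by omega), h.rreg j hj hj'], h.na,
    h.draws, h.ra⟩

theorem putRA (h : OpFrame m k R σ τ) {f j : ℕ} {v : ℝ} (hf : f < 2) (hj : j ∈ R) :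
    OpFrame m k R σ (τ.putRA f j v) :=
  ⟨h.nreg, h.rreg, h.na, h.draws, fun f' j' hj' => by
    rw [State.putRA_ra, if_neg, h.ra f' j' hj']
    rintro ⟨rfl, rfl⟩
    rcases hj' with h1 | h1
    · omega
    · exact h1 hj⟩

/-- Trees outside the changed addresses are unchanged. -/
theorem treeRep (h : OpFrame m k R σ τ) {H β : ℕ} {g b : ℕ → ℝ}
    (ht : TreeRep H (σ.tag β) (σ.sum β) g b) (hβ : ∀ x, x < 2 * 2 ^ H → β + x ∉ R) :
    TreeRep H (τ.tag β) (τ.sum β) g b :=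
  ht.congr (fun x _ hx => by rw [State.tag, State.tag, h.ra _ _ (Or.inr (hβ x hx))])
    (fun x _ hx => by rw [State.sum, State.sum, h.ra _ _ (Or.inr (hβ x hx))])

end OpFrame

/-- Set the value of the leaf in register `91` to real register `xi`. -/
def setLeaf (xi : ℕ) : Prog :=
  putR 1 (nv 90 + nv 91) (tagE (nv 90 + nv 91) * rv xi) ;; .setR 10 (rc 1) ;; updWalk

/-- Writing the new sum of a leaf spoils only the equations of its proper ancestors. A walk with
factor `1` repairs them without changing any weight. -/
theorem setLeaf_spec {ω : Tape} {U H β r xi : ℕ} {g b : ℕ → ℝ} {σ : State} (hU : H < U)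
    (hβ : σ.nreg 90 = β) (hr : r < 2 ^ H) (hv : σ.nreg 91 = 2 ^ H + r)
    (ht : TreeRep H (σ.tag β) (σ.sum β) g b) :
    Fast ω U (setLeaf xi) σ fun τ => OpFrame 90 13 (region (2 ^ H) β) σ τ ∧
      TreeRep H (τ.tag β) (τ.sum β) g (Function.update b r (σ.rreg xi)) := by
  refine Fast.seq_wp (by omega) ?_
  rw [wp_putR]
  refine Fast.seq_wp (by omega) ?_
  rw [wp_setR]
  have etag : ∀ (a x : ℝ), State.tag (((σ.putRA 1 (β + (2 ^ H + r)) a)).setR 10 x) β = σ.tag β :=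
    fun a x => by funext y; simp [State.tag]
  have esum : ∀ (a x : ℝ), State.sum (((σ.putRA 1 (β + (2 ^ H + r)) a)).setR 10 x) β =
      Function.update (σ.sum β) (2 ^ H + r) a :=
    fun a x => by funext y; simp [State.sum, Function.update_apply]
  simp only [NExp.eval_add, NExp.eval_reg, hβ, hv, RExp.eval_mul, eval_tagE, RExp.eval_reg]
  refine (updWalk_spec (H := H) (β := β) (r := r) (c := 1) (g := g)
    (b := Function.update b r (σ.rreg xi)) hU one_pos (by simpa using hβ) hr (by simpa using hv)
    (by simp) ?_ ?_).mono ?_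
  · rw [etag, esum]
    exact ht.tree.setLeaf
  · rw [etag]
    exact ht.tags
  · rintro τ ⟨h1, h2⟩
    refine ⟨OpFrame.trans ?_ (OpFrame.of_tree h1), by simpa using h2⟩
    have hmem : β + (2 ^ H + r) ∈ region (2 ^ H) β := ⟨by omega, by omega⟩
    exact ((OpFrame.refl _ _ _ _).putRA (by norm_num) hmem).setR (by norm_num)

/-- The value of `a` is not changed by operations on trees. -/
def NExp.Stable (a : NExp) (v : ℕ) (σ : State) : Prop :=
  ∀ τ : State, (∀ i < 90, τ.nreg i = σ.nreg i) → τ.na = σ.na → a.eval τ = v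

/-- Multiply the weights of the leaves from `lo` to `hi` by real register `14`. -/
def rangeScale (base hi lo : NExp) : Prog :=
  (.setN 90 base ;; .setN 91 (nv 4 + hi) ;; .setR 10 (rv 14)) ;; updWalk ;;
  (.setN 91 (nv 4 + lo) ;; .setR 10 (rc 1 / rv 14)) ;; updWalk

/-- Scaling a range is scaling two prefixes: by `c` up to `h`, then by `1 / c` up to `l`. This works
because `c` is positive. The bounds are evaluated at different moments, hence the requirement
`Stable`. -/
theorem rangeScale_spec {ω : Tape} {U H β l h : ℕ} {c : ℝ} {g b : ℕ → ℝ} {σ : State}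
    {base hi lo : NExp} (hU : H < U) (hM : σ.nreg 4 = 2 ^ H) (hc : 0 < c) (h14 : σ.rreg 14 = c)
    (hβ : base.eval σ = β) (hhi : hi.Stable h σ) (hlo : lo.Stable l σ) (hh : h < 2 ^ H)
    (hl : l ≤ h) (ht : TreeRep H (σ.tag β) (σ.sum β) g b) :
    Fast ω U (rangeScale base hi lo) σ fun τ => OpFrame 90 13 (region (2 ^ H) β) σ τ ∧
      TreeRep H (τ.tag β) (τ.sum β) (fun q => if l ≤ q ∧ q < h then c * g q else g q) b := by
  refine Fast.seq_wp (by omega) ?_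
  simp only [wp_seq, wp_setN, wp_setR]
  set σ₁ := ((σ.setN 90 (base.eval σ)).setN 91 ((nv 4 + hi).eval (σ.setN 90 (base.eval σ)))).setR 10
    ((rv 14).eval ((σ.setN 90 (base.eval σ)).setN 91
      ((nv 4 + hi).eval (σ.setN 90 (base.eval σ))))) with hσ₁
  have f1 : OpFrame 90 13 (region (2 ^ H) β) σ σ₁ :=
    (((OpFrame.refl _ _ _ _).setN (by norm_num) (by norm_num)).setN (by norm_num)
      (by norm_num)).setR (by norm_num)
  have hra : σ₁.ra = σ.ra := by simp [hσ₁]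
  refine Fast.seq ((updWalk_spec (H := H) (β := β) (r := h) (c := c) (g := g) (b := b) hU hc
    (by simp [hσ₁, hβ]) hh ?_ (by simp [hσ₁, h14]) ?_ ?_).mono ?_)
  · have := hhi (σ.setN 90 (base.eval σ)) (fun i hi => by simp; omega) (by simp)
    simp [hσ₁, hM, this]
  · have : IsTree (2 ^ H) (σ.tag β) (σ.sum β) b (Anc (2 ^ H + h)) :=
      ⟨ht.tree.pos, fun x h1 h2 _ => ht.tree.eq x h1 h2 (by simp)⟩
    convert this using 1 <;> funext x <;> simp [State.tag, State.sum, hra]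
  · have := ht.tags
    convert this using 4
    funext x; simp [State.tag, hra]
  · rintro τ ⟨h1, h2⟩
    have f2 := f1.trans (OpFrame.of_tree h1)
    refine Fast.seq_wp (by omega) ?_
    simp only [wp_seq, wp_setN, wp_setR]
    have hlo' := hlo τ f2.nreg f2.na
    have h4 := f2.nreg 4 (by norm_num)
    have h14' := f2.rreg 14 (by norm_num) (by norm_num)
    have h90 : τ.nreg 90 = β := by
      rw [h1.nreg 90 (by norm_num) (by norm_num)]; simp [hσ₁, hβ]
    set τ₁ := (τ.setN 91 ((nv 4 + lo).eval τ)).setR 10 ((rc 1 / rv 14).eval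
      (τ.setN 91 ((nv 4 + lo).eval τ))) with hτ₁
    have hra' : τ₁.ra = τ.ra := by simp [hτ₁]
    have f3 : OpFrame 90 13 (region (2 ^ H) β) τ τ₁ :=
      (((OpFrame.refl _ _ _ _).setN (by norm_num) (by norm_num)).setR (by norm_num))
    refine (updWalk_spec (H := H) (β := β) (r := l) (c := 1 / c)
      (g := fun q => if q < h then c * g q else g q) (b := b) hU (by positivity)
      (by simp [hτ₁, h90]) (by omega) (by simp [hτ₁, h4, hM, hlo']) (by simp [hτ₁, h14', h14])
      ?_ ?_).mono ?_
    · have : IsTree (2 ^ H) (τ.tag β) (τ.sum β) b (Anc (2 ^ H + l)) :=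
        ⟨h2.tree.pos, fun x h1 h3 _ => h2.tree.eq x h1 h3 (by simp)⟩
      convert this using 1 <;> funext x <;> simp [State.tag, State.sum, hra']
    · have := h2.tags
      convert this using 4
      funext x; simp [State.tag, hra']
    · rintro υ ⟨h3, h4⟩
      refine ⟨(f2.trans f3).trans (OpFrame.of_tree h3), h4.congr_g fun q hq => ?_⟩
      by_cases a : q < l
      · rw [if_neg (by omega), if_pos a, if_pos (by omega)]
        field_simp
      · rw [if_neg a]
        by_cases a' : q < h
        · rw [if_pos a', if_pos (by omega)]
        · rw [if_neg a', if_neg (by omega)]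

/-- Put the total weight of the leaves from `lo` to `hi` into real register `11`. -/
def rangeQuery (base hi lo : NExp) : Prog :=
  (.setR 16 (rc 0) ;; .setN 90 base ;; .setN 91 (nv 4 + lo)) ;; queryWalk ;;
  (.setR 17 (rv 11) ;; .setN 91 (nv 4 + hi)) ;; queryWalk ;; .setR 11 (rv 11 - rv 17)

theorem rangeQuery_spec {ω : Tape} {U H β l h : ℕ} {g b : ℕ → ℝ} {σ : State}
    {base hi lo : NExp} {R : Set ℕ} (hU : H < U) (hM : σ.nreg 4 = 2 ^ H)
    (hβ : base.Stable β σ) (hhi : hi.Stable h σ) (hlo : lo.Stable l σ) (hh : h < 2 ^ H)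
    (hl : l < 2 ^ H) (ht : TreeRep H (σ.tag β) (σ.sum β) g b) :
    Fast ω U (rangeQuery base hi lo) σ fun τ => OpFrame 90 13 R σ τ ∧ τ.ra = σ.ra ∧
      τ.rreg 11 = ∑ q ∈ Finset.range h, b q * g q - ∑ q ∈ Finset.range l, b q * g q := by
  refine Fast.seq_wp (by omega) ?_
  simp only [wp_seq, wp_setN, wp_setR]
  have e1 := hβ (σ.setR 16 0) (fun i hi => by simp) (by simp)
  have e2 := hlo ((σ.setR 16 0).setN 90 β) (fun i hi => by simp; omega) (by simp)
  simp only [RExp.eval_cast, NExp.eval_const, Nat.cast_zero, NExp.eval_add, NExp.eval_reg, e1, e2]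
  set σ₁ := ((σ.setR 16 0).setN 90 β).setN 91 (((σ.setR 16 0).setN 90 β).nreg 4 + l) with hσ₁
  have f1 : OpFrame 90 13 R σ σ₁ :=
    (((OpFrame.refl _ _ _ _).setR (by norm_num)).setN (by norm_num) (by norm_num)).setN
      (by norm_num) (by norm_num)
  have hra : σ₁.ra = σ.ra := by simp [hσ₁]
  refine Fast.seq ((queryWalk_spec (H := H) (β := β) (r := l) (g := g) (b := b) hU
    (by simp [hσ₁]) hl (by simp [hσ₁, hM]) ?_).mono ?_)
  · exact ht.congr (fun x _ _ => by simp [State.tag, hra]) fun x _ _ => by simp [State.sum, hra]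
  · rintro τ ⟨h1, h2⟩
    have f2 := f1.trans (OpFrame.of_read h1)
    refine Fast.seq_wp (by omega) ?_
    simp only [wp_seq, wp_setN, wp_setR]
    have e3 := hhi (τ.setR 17 (τ.rreg 11)) (fun i hi => by simp [f2.nreg i hi]) (by simp [f2.na])
    simp only [RExp.eval_reg, NExp.eval_add, NExp.eval_reg, e3]
    set τ₁ := (τ.setR 17 (τ.rreg 11)).setN 91 ((τ.setR 17 (τ.rreg 11)).nreg 4 + h) with hτ₁
    have f3 : OpFrame 90 13 R σ τ₁ :=
      (f2.setR (by norm_num)).setN (by norm_num) (by norm_num)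
    have hra' : τ₁.ra = σ.ra := by simp [hτ₁, h1.ra, hra]
    have h16 : τ.rreg 16 = 0 := by
      rw [h1.rreg 16 (by norm_num) (by norm_num)]; simp [hσ₁]
    have h90 : τ.nreg 90 = β := by
      rw [h1.nreg 90 (by norm_num) (by norm_num)]; simp [hσ₁]
    refine Fast.seq ((queryWalk_spec (H := H) (β := β) (r := h) (g := g) (b := b) hU
      (by simp [hτ₁, h90]) hh
      (by have := f2.nreg 4 (by norm_num); simp [hτ₁, this, hM]) ?_).mono ?_)
    · exact ht.congr (fun x _ _ => by simp [State.tag, hra']) fun x _ _ => by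
        simp [State.sum, hra']
    · rintro υ ⟨h3, h4⟩
      refine Fast.of_wp (by omega) ?_
      rw [wp_setR]
      refine ⟨(f3.trans (OpFrame.of_read h3)).setR (by norm_num), by simp [h3.ra, hra'], ?_⟩
      have h17 : υ.rreg 17 = τ.rreg 11 := by
        rw [h3.rreg 17 (by norm_num) (by norm_num)]; simp [hτ₁]
      have h16' : τ₁.rreg 16 = 0 := by simp [hτ₁, h16]
      have h16'' : σ₁.rreg 16 = 0 := by simp [hσ₁]
      simp [h4, h17, h2, h16', h16'']

end RealRAM

namespace RealRAM

theorem State.setN_setN (σ : State) (i v w : ℕ) : (σ.setN i v).setN i w = σ.setN i w := by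
  simp [State.setN]
theorem State.setR_setR (σ : State) (i : ℕ) (v w : ℝ) : (σ.setR i v).setR i w = σ.setR i w := by
  simp [State.setR]

theorem TreeRep.congr_b {H : ℕ} {t s g b b' : ℕ → ℝ} (h : TreeRep H t s g b)
    (hb : ∀ q < 2 ^ H, b' q = b q) : TreeRep H t s g b' := by
  refine ⟨⟨h.tree.pos, fun x h1 h2 h3 => ?_⟩, h.tags⟩
  rw [h.tree.eq x h1 h2 h3]
  split_ifs with hx
  · rfl
  · rw [hb _ (by omega)]

theorem State.setN_comm (σ : State) {i j : ℕ} (h : i ≠ j) (v w : ℕ) :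
    (σ.setN i v).setN j w = (σ.setN j w).setN i v := by
  simp only [State.setN, Function.update_comm h]

/-! ### The trees of a cell -/

variable {d n : ℕ} {L : Layout} {K : ℕ}

/-- The address of the `t`-th tree. -/
def Layout.base (L : Layout) (t : ℕ) : ℕ := t * (2 * 2 ^ L.H)

theorem Layout.base_succ (L : Layout) (t : ℕ) : L.base (t + 1) = L.base t + 2 * 2 ^ L.H := by
  rw [base, base, add_mul, one_mul]

theorem Layout.base_mono (L : Layout) {t t' : ℕ} (h : t ≤ t') : L.base t ≤ L.base t' :=
  Nat.mul_le_mul_right _ h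

theorem Layout.base_add (L : Layout) (t i : ℕ) :
    L.base (t + i) = L.base t + i * (2 * 2 ^ L.H) := by
  rw [base, base, add_mul]

/-- The contents of memory that are fixed once the data structure is built. -/
structure Static (L : Layout) (d : ℕ) (σ : State) : Prop where
  r2 : σ.nreg 2 = L.N
  r4 : σ.nreg 4 = 2 ^ L.H
  r5 : σ.nreg 5 = L.start (d - 1)
  r6 : σ.nreg 6 = L.start d
  first : ∀ e, σ.na 1 e = L.first e
  pt : ∀ e r, L.start (d - 1) ≤ e → e < L.start d → r < L.N → σ.na 3 (σ.na 2 e + r) = L.pt e r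
  cb : ∀ c, L.IsCell d c → σ.na 4 c = L.base (d * c + 1)
  Q : ∀ i < d, ∀ r, σ.na (10 + 8 * i) r = L.Q i r
  pos : ∀ i < d, ∀ r, σ.na (11 + 8 * i) r = L.pos i r
  A : ∀ i < d, ∀ r, σ.na (12 + 8 * i) r = L.A i r
  B : ∀ i < d, ∀ r, σ.na (13 + 8 * i) r = L.B i r
  X : ∀ i < d, ∀ r, σ.ra (3 + i) r = L.X i r

theorem Static.of_frame {σ τ : State} (h : Static L d σ) (hn : ∀ i < 10, τ.nreg i = σ.nreg i)
    (ha : τ.na = σ.na) (hr : ∀ f j, 2 ≤ f → τ.ra f j = σ.ra f j) : Static L d τ := by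
  constructor
  · rw [hn _ (by norm_num), h.r2]
  · rw [hn _ (by norm_num), h.r4]
  · rw [hn _ (by norm_num), h.r5]
  · rw [hn _ (by norm_num), h.r6]
  · rw [ha]; exact h.first
  · rw [ha]; exact h.pt
  · rw [ha]; exact h.cb
  · rw [ha]; exact h.Q
  · rw [ha]; exact h.pos
  · rw [ha]; exact h.A
  · rw [ha]; exact h.B
  · intro i hi r; rw [hr _ _ (by omega), h.X i hi r]

theorem Static.of_opFrame {σ τ : State} {m k : ℕ} {R : Set ℕ} (h : Static L d σ) (hm : 10 ≤ m)
    (hf : OpFrame m k R σ τ) : Static L d τ :=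
  h.of_frame (fun i hi => hf.nreg i (by omega)) hf.na fun f j hj => hf.ra f j (Or.inl hj)

/-- The rank intervals of the box passed as argument. -/
def Located (d : ℕ) (lo hi : ℕ → ℕ) (σ : State) : Prop :=
  ∀ i < d, σ.na (14 + 8 * i) 0 = lo i ∧ σ.na (15 + 8 * i) 0 = hi i

theorem Located.of_na {lo hi : ℕ → ℕ} {σ τ : State} (h : Located d lo hi σ) (ha : τ.na = σ.na) :
    Located d lo hi τ := by
  intro i hi'; rw [ha]; exact h i hi'

/-- Arithmetic facts about the layout. -/
structure LayoutOK (L : Layout) (Bx : Fin n → AABox d) (K : ℕ) : Prop where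
  ranks : L.Ranks Bx
  decomp : L.Decomp d K
  size : L.start (d + 1) < 2 ^ L.H
  sizeN : L.N < 2 ^ L.H

/-- The trees of cell `c` have leaf values `a` and multipliers `g`. -/
def CellTrees (L : Layout) (d : ℕ) (σ : State) (c : ℕ) (a g : ℕ → ℕ → ℝ) : Prop :=
  ∀ i < d, TreeRep L.H (σ.tag (L.base (d * c + 1 + i))) (σ.sum (L.base (d * c + 1 + i))) (g i) (a i)

/-- The product of the total weights of the trees of a cell. -/
noncomputable def rootProd (L : Layout) (d : ℕ) (a g : ℕ → ℕ → ℝ) : ℝ :=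
  ∏ i ∈ Finset.range d, ∑ r ∈ Finset.range (2 ^ L.H), a i r * g i r

def cellRegion (L : Layout) (d c : ℕ) : Set ℕ :=
  {k | L.base (d * c + 1) ≤ k ∧ k < L.base (d * c + 1 + d)}

theorem region_subset_cellRegion {c i : ℕ} (hi : i < d) :
    region (2 ^ L.H) (L.base (d * c + 1 + i)) ⊆ cellRegion L d c := by
  rintro k ⟨h1, h2⟩
  have h3 := L.base_mono (by omega : d * c + 1 ≤ d * c + 1 + i)
  have h4 := L.base_mono (by omega : d * c + 1 + i + 1 ≤ d * c + 1 + d)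
  rw [L.base_succ] at h4
  exact ⟨by omega, by omega⟩

theorem not_mem_region {t t' x : ℕ} (h : t ≠ t') (hx : x < 2 * 2 ^ L.H) :
    L.base t + x ∉ region (2 ^ L.H) (L.base t') := by
  rintro ⟨h1, h2⟩
  rcases lt_or_gt_of_ne h with h3 | h3
  · have := L.base_mono (by omega : t + 1 ≤ t')
    rw [L.base_succ] at this
    omega
  · have := L.base_mono (by omega : t' + 1 ≤ t)
    rw [L.base_succ] at this
    omega

theorem CellTrees.of_opFrame {σ τ : State} {m k : ℕ} {c : ℕ} {a g : ℕ → ℕ → ℝ}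
    (h : CellTrees L d σ c a g) (hf : OpFrame m k (region (2 ^ L.H) (L.base 0)) σ τ) :
    CellTrees L d τ c a g :=
  fun i hi => hf.treeRep (h i hi) fun _ hx => not_mem_region (by omega) hx

/-- The address of the `i`-th tree of the cell whose first tree is at the address in register
`61`. -/
def baseI (i : ℕ) : NExp := nv 61 + NExp.times i (nv 4 + nv 4)

theorem eval_baseI {σ : State} {c i : ℕ} (h4 : σ.nreg 4 = 2 ^ L.H)
    (h61 : σ.nreg 61 = L.base (d * c + 1)) : (baseI i).eval σ = L.base (d * c + 1 + i) := by
  simp [baseI, h4, h61, L.base_add, two_mul]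

theorem baseI_stable {σ : State} {c i : ℕ} (h4 : σ.nreg 4 = 2 ^ L.H)
    (h61 : σ.nreg 61 = L.base (d * c + 1)) : (baseI i).Stable (L.base (d * c + 1 + i)) σ :=
  fun τ h _ => eval_baseI (by rw [h 4 (by norm_num), h4]) (by rw [h 61 (by norm_num), h61])

theorem arr_stable {σ : State} {f k : ℕ} : (NExp.arr f (nc k)).Stable (σ.na f k) σ :=
  fun τ _ h => by simp [h]

/-- Recompute the leaf of the cell in register `60` in the tree over all cells. -/
def refresh (d : ℕ) : Prog :=
  (.setR 13 (rc 1) ;; forAx (fun i => .setR 13 (rv 13 * sumE (baseI i + nc 1))) d ;;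
    .setN 90 (nc 0) ;; .setN 91 (nv 4 + nv 60)) ;; setLeaf 13

/-- The root sums are current, so their product is the weight of the cell up to the factor `G c`,
which lives in the tags of the tree over all cells and is left alone here. -/
theorem refresh_spec {ω : Tape} {U c : ℕ} {σ : State} {a g : ℕ → ℕ → ℝ} {G v : ℕ → ℝ}
    (hU : L.H < U) (h4 : σ.nreg 4 = 2 ^ L.H) (h60 : σ.nreg 60 = c)
    (h61 : σ.nreg 61 = L.base (d * c + 1)) (hc : c < 2 ^ L.H) (ht : CellTrees L d σ c a g)
    (hG : TreeRep L.H (σ.tag (L.base 0)) (σ.sum (L.base 0)) G v) :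
    Fast ω U (refresh d) σ fun τ => OpFrame 90 14 (region (2 ^ L.H) (L.base 0)) σ τ ∧
      TreeRep L.H (τ.tag (L.base 0)) (τ.sum (L.base 0)) G
        (Function.update v c (rootProd L d a g)) := by
  refine Fast.seq_wp (by omega) ?_
  rw [wp_seq, wp_setR, wp_seq]
  refine wp_mono ?_ (wp_forAx (fun m τ => τ = σ.setR 13
    (∏ i ∈ Finset.range m, ∑ r ∈ Finset.range (2 ^ L.H), a i r * g i r)) ?_ (by simp))
  · rintro τ rfl
    simp only [wp_seq, wp_setN]
    refine (setLeaf_spec (r := c) hU (β := L.base 0) (by simp [Layout.base]) hc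
      (by simp [h4, h60]) (g := G) (b := v) ?_).mono ?_
    · exact hG.congr (fun x _ _ => by simp [State.tag]) fun x _ _ => by simp [State.sum]
    · rintro τ ⟨h1, h2⟩
      refine ⟨OpFrame.trans ?_ (h1.mono le_rfl (by norm_num) le_rfl), by simpa [rootProd] using h2⟩
      exact (((OpFrame.refl _ _ _ _).setR (by norm_num)).setN (by norm_num) (by norm_num)).setN
        (by norm_num) (by norm_num)
  · rintro i hi τ rfl
    have hr := (ht i hi).root
    rw [wp_setR, State.setR_setR, Finset.prod_range_succ, ← hr]
    have hb : (baseI i).eval (σ.setR 13 (∏ i ∈ Finset.range i,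
        ∑ r ∈ Finset.range (2 ^ L.H), a i r * g i r)) = L.base (d * c + 1 + i) :=
      eval_baseI (by simp [h4]) (by simp [h61])
    simp [hb, State.sum]

/-! ### Multiplying the weights of a cell in a box -/

/-- In the cell in register `60`, multiply the weights of the points in the given box by real
register `14`. -/
def cellScale (d : ℕ) : Prog :=
  (.setN 61 (.arr 4 (nv 60)) ;; .setN 62 (nc (d - 1)) ;; .setN 63 (nc 0) ;;
    forAx (fun i =>
      .ite ((BExp.nlt (.arr (12 + 8 * i) (nv 60)) (.arr (15 + 8 * i) (nc 0))).and
          (.nlt (.arr (14 + 8 * i) (nc 0)) (.arr (13 + 8 * i) (nv 60))))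
        (.ite ((BExp.nle (.arr (14 + 8 * i) (nc 0)) (.arr (12 + 8 * i) (nv 60))).and
          (.nle (.arr (13 + 8 * i) (nv 60)) (.arr (15 + 8 * i) (nc 0))))
          .skip (.setN 62 (nc i)))
        (.setN 63 (nc 1))) d) ;;
  .ite (.nlt (nv 63) (nc 1))
    (forAx (fun i => .ite (.neq (nv 62) (nc i))
      (rangeScale (baseI i) (.arr (15 + 8 * i) (nc 0)) (.arr (14 + 8 * i) (nc 0))) .skip) d ;;
      refresh d)
    .skip

/-- The addresses changed by operations on cell `c`. -/
def opRegion (L : Layout) (d c : ℕ) : Set ℕ := region (2 ^ L.H) (L.base 0) ∪ cellRegion L d c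

-- By `huniq` the box fails to cover the cell on at most one axis `k`, so membership of a point of
-- the cell in the box is decided by its `k`-th rank. Scaling a range in the `k`-th tree alone
-- therefore has the desired effect on the product of the multipliers.
open Classical in
theorem cellScale_spec {ω : Tape} {U c : ℕ} {σ : State} {a g : ℕ → ℕ → ℝ} {G v : ℕ → ℝ} {f : ℝ}
    {lo hi : ℕ → ℕ} (hU : L.H < U) (hd : 1 ≤ d) (hS : Static L d σ) (hloc : Located d lo hi σ)
    (h60 : σ.nreg 60 = c) (hcell : L.IsCell d c) (hc : c < 2 ^ L.H) (hf : 0 < f)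
    (h14 : σ.rreg 14 = f) (hlh : ∀ i < d, lo i ≤ hi i ∧ hi i < 2 ^ L.H)
    (huniq : (∀ i < d, L.A i c < hi i ∧ lo i < L.B i c) → ∀ i < d, ∀ i' < d,
      (L.A i c < lo i ∨ hi i < L.B i c) → (L.A i' c < lo i' ∨ hi i' < L.B i' c) → i = i')
    (ht : CellTrees L d σ c a g)
    (hG : TreeRep L.H (σ.tag (L.base 0)) (σ.sum (L.base 0)) G v) (hv : v c = rootProd L d a g) :
    Fast ω U (cellScale d) σ fun τ => OpFrame 61 14 (opRegion L d c) σ τ ∧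
      ∃ g', CellTrees L d τ c a g' ∧ TreeRep L.H (τ.tag (L.base 0)) (τ.sum (L.base 0)) G
        (Function.update v c (rootProd L d a g')) ∧
      ∀ p : Fin d → ℕ, L.InCell c p → ∏ i : Fin d, g' i (p i) =
        (if ∀ i : Fin d, lo i ≤ p i ∧ p i < hi i then f else 1) * ∏ i : Fin d, g i (p i) := by
  refine Fast.seq_wp (by omega) ?_
  simp only [wp_seq, wp_setN]
  have hcb := hS.cb c hcell
  obtain ⟨σ₁, hσ₁⟩ : ∃ σ₁, σ₁ = σ.setN 61 (L.base (d * c + 1)) := ⟨_, rfl⟩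
  have f1 : OpFrame 61 13 (opRegion L d c) σ σ₁ := by
    rw [hσ₁]; exact (OpFrame.refl _ _ _ _).setN (by norm_num) (by norm_num)
  -- Register `62` holds an axis on which the box meets but does not cover the cell, with default `d
  -- - 1` when there is none; then scaling in that tree affects all ranks of the cell. Register `63`
  -- becomes nonzero when the box misses the cell.
  refine wp_mono ?_ (wp_forAx (fun m τ => ∃ k z, τ = (σ₁.setN 62 k).setN 63 z ∧
    (z = 0 ↔ ∀ i < m, L.A i c < hi i ∧ lo i < L.B i c) ∧
    ((∃ i < m, k = i ∧ (L.A i c < hi i ∧ lo i < L.B i c) ∧ (L.A i c < lo i ∨ hi i < L.B i c)) ∨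
      (k = d - 1 ∧ ∀ i < m, (L.A i c < hi i ∧ lo i < L.B i c) → lo i ≤ L.A i c ∧ L.B i c ≤ hi i)))
    ?_ ⟨d - 1, 0, by simp [hσ₁, h60, hcb], by simp, Or.inr ⟨rfl, by simp⟩⟩)
  · rintro τ ⟨k, z, rfl, hz, hk⟩
    have f2 : OpFrame 61 13 (opRegion L d c) σ ((σ₁.setN 62 k).setN 63 z) :=
      (f1.setN (by norm_num) (by norm_num)).setN (by norm_num) (by norm_num)
    have f2' : OpFrame 61 13 (region (2 ^ L.H) (L.base 0)) σ ((σ₁.setN 62 k).setN 63 z) := by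
      rw [hσ₁]
      exact (((OpFrame.refl _ _ _ _).setN (by norm_num) (by norm_num)).setN (by norm_num)
        (by norm_num)).setN (by norm_num) (by norm_num)
    have ht2 := ht.of_opFrame f2'
    have hG2 : TreeRep L.H (((σ₁.setN 62 k).setN 63 z).tag (L.base 0))
        (((σ₁.setN 62 k).setN 63 z).sum (L.base 0)) G v :=
      hG.congr (fun x _ _ => by simp [State.tag, hσ₁]) fun x _ _ => by simp [State.sum, hσ₁]
    refine Fast.ite (by omega) (fun hmeet => ?_) fun hmeet => ?_
    · simp at hmeet
      subst hmeet
      have hmeet := hz.1 rfl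
      have hkd : k < d := by
        rcases hk with ⟨i, hi, rfl, -⟩ | ⟨rfl, -⟩ <;> omega
      have hcov : ∀ i < d, i ≠ k → lo i ≤ L.A i c ∧ L.B i c ≤ hi i := by
        intro i hi hne
        by_contra hn
        rcases hk with ⟨i', hi', rfl, -, h2⟩ | ⟨rfl, h2⟩
        · exact hne (huniq hmeet i hi k hi' (by omega) h2)
        · exact hn (h2 i hi (hmeet i hi))
      obtain ⟨σ₂, hσ₂⟩ : ∃ σ₂, σ₂ = (σ₁.setN 62 k).setN 63 0 := ⟨_, rfl⟩
      rw [← hσ₂] at f2 ht2 hG2 ⊢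
      have h62 : σ₂.nreg 62 = k := by simp [hσ₂]
      have h61 : σ₂.nreg 61 = L.base (d * c + 1) := by simp [hσ₂, hσ₁]
      have h4 : σ₂.nreg 4 = 2 ^ L.H := by rw [f2.nreg 4 (by norm_num), hS.r4]
      have h14' : σ₂.rreg 14 = f := by rw [f2.rreg 14 (by norm_num) (by norm_num), h14]
      have hloc2 := hloc.of_na f2.na
      obtain ⟨g', hg'⟩ : ∃ g' : ℕ → ℕ → ℝ, g' = fun i r =>
        if i = k ∧ lo i ≤ r ∧ r < hi i then f * g i r else g i r := ⟨_, rfl⟩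
      refine Fast.seq ((Fast.forAx (by omega) (fun m τ => OpFrame 90 13 (cellRegion L d c) σ₂ τ ∧
        CellTrees L d τ c a (fun i => if i < m then g' i else g i)) ?_
        ⟨OpFrame.refl _ _ _ _, by simpa using ht2⟩).mono ?_)
      · rintro i hid τ ⟨h1, h2⟩
        refine Fast.ite (by omega) (fun hik => ?_) fun hik => ?_
        · simp only [BExp.holds_neq, NExp.eval_reg, NExp.eval_const, h1.nreg 62 (by norm_num), h62]
            at hik
          have hl := hloc2.of_na h1.na i hid
          refine (rangeScale_spec (c := f) (h := hi i) (l := lo i)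
            (β := L.base (d * c + 1 + i)) hU
            (by rw [h1.nreg 4 (by norm_num), h4]) hf
            (by rw [h1.rreg 14 (by norm_num) (by norm_num), h14'])
            (eval_baseI (by rw [h1.nreg 4 (by norm_num), h4])
              (by rw [h1.nreg 61 (by norm_num), h61]))
            (by rw [← hl.2]; exact arr_stable) (by rw [← hl.1]; exact arr_stable)
            (hlh i hid).2 (hlh i hid).1 (h2 i hid)).mono ?_
          rintro υ ⟨h3, h5⟩
          refine ⟨h1.trans (h3.mono le_rfl le_rfl (region_subset_cellRegion hid)), fun i' hi' => ?_⟩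
          by_cases hii : i' = i
          · subst hii
            simpa [hg', hik] using h5
          · have h6 := h3.treeRep (h2 i' hi') (fun x hx => not_mem_region (by omega) hx)
            have e : (i' < i + 1) = (i' < i) := by
              rw [eq_iff_iff]; omega
            simpa only [e] using h6
        · simp only [BExp.holds_neq, NExp.eval_reg, NExp.eval_const, h1.nreg 62 (by norm_num), h62]
            at hik
          refine Fast.of_wp (by omega) ?_
          rw [wp_skip]
          refine ⟨h1, fun i' hi' => ?_⟩
          have h6 := h2 i' hi'
          by_cases hii : i' = i
          · subst hii
            have e : g' i' = g i' := by
              funext r; simp [hg', Ne.symm hik]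
            simpa [e] using h6
          · have e : (i' < i + 1) = (i' < i) := by
              rw [eq_iff_iff]; omega
            simpa only [e] using h6
      · rintro τ ⟨h1, h2⟩
        have ht3 : CellTrees L d τ c a g' := fun i hi => by simpa [hi] using h2 i hi
        have hG3 : TreeRep L.H (τ.tag (L.base 0)) (τ.sum (L.base 0)) G v :=
          h1.treeRep hG2 fun x hx => by
            rintro ⟨h3, -⟩
            have := L.base_mono (by omega : 0 + 1 ≤ d * c + 1)
            rw [L.base_succ] at this
            omega
        refine (refresh_spec hU (by rw [h1.nreg 4 (by norm_num), h4])
          (by rw [h1.nreg 60 (by norm_num), f2.nreg 60 (by norm_num), h60])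
          (by rw [h1.nreg 61 (by norm_num), h61]) hc ht3 hG3).mono ?_
        rintro υ ⟨h3, h5⟩
        refine ⟨((f2.mono le_rfl (by norm_num) le_rfl).trans (h1.mono (by norm_num) (by norm_num)
          Set.subset_union_right)).trans (h3.mono (by norm_num) le_rfl Set.subset_union_left),
          g', ht3.of_opFrame h3, h5, fun p hp => ?_⟩
        -- All axes other than `k` are covered, so they impose nothing on points of the cell.
        have hin : (∀ i : Fin d, lo i ≤ p i ∧ p i < hi i) ↔
            (lo k ≤ p ⟨k, hkd⟩ ∧ p ⟨k, hkd⟩ < hi k) := by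
          refine ⟨fun h => h ⟨k, hkd⟩, fun h i => ?_⟩
          by_cases hik : (i : ℕ) = k
          · obtain rfl : i = ⟨k, hkd⟩ := Fin.ext hik
            exact h
          · have h6 := hcov i i.2 hik
            have h7 := hp i
            omega
        have hprod : ∏ i : Fin d, g' i (p i) = ∏ i : Fin d,
            ((if i = ⟨k, hkd⟩ then (if lo k ≤ p ⟨k, hkd⟩ ∧ p ⟨k, hkd⟩ < hi k then f else 1) else 1) *
              g i (p i)) := by
          refine Finset.prod_congr rfl fun i _ => ?_
          by_cases hik : i = ⟨k, hkd⟩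
          · subst hik
            simp only [hg', if_true, true_and]
            split_ifs <;> simp
          · have : (i : ℕ) ≠ k := fun e => hik (Fin.ext e)
            simp [hg', this, hik]
        rw [hprod, Finset.prod_mul_distrib, Finset.prod_ite_eq' Finset.univ, if_pos
          (Finset.mem_univ _)]
        simp only [hin]
    · simp only [BExp.holds_nlt, NExp.eval_reg, State.setN_nreg, if_true, NExp.eval_const,
        Nat.lt_one_iff, hz] at hmeet
      refine Fast.of_wp (by omega) ?_
      rw [wp_skip]
      refine ⟨f2.mono le_rfl (by norm_num) le_rfl, g, ht2, ?_, fun p hp => ?_⟩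
      · rwa [← hv, Function.update_eq_self]
      · rw [if_neg, one_mul]
        intro h
        refine hmeet fun i hi => ?_
        have h1 := h ⟨i, hi⟩
        have h2 := hp ⟨i, hi⟩
        simp only at h1 h2
        omega
  · rintro m hm τ ⟨k, z, rfl, hz, hk⟩
    have hA := hS.A m hm c
    have hB := hS.B m hm c
    obtain ⟨hlo, hhi⟩ := hloc m hm
    have h60' : σ₁.nreg 60 = c := by simp [hσ₁, h60]
    have hna : σ₁.na = σ.na := by simp [hσ₁]
    simp only [wp_ite, wp_skip, wp_setN]
    simp only [BExp.holds_and, BExp.holds_nlt, BExp.holds_nle, NExp.eval_arr, NExp.eval_reg,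
      NExp.eval_const, State.setN_nreg, State.setN_na, hna, hlo, hhi]
    simp only [show ¬ (60 = 62) by norm_num, show ¬ (60 = 63) by norm_num, if_false, h60', hA, hB]
    refine ⟨fun h1 => ⟨fun h2 => ⟨k, z, rfl, ?_, ?_⟩, fun h2 => ⟨m, z, ?_, ?_, ?_⟩⟩,
      fun h1 => ⟨k, 1, ?_, ?_, ?_⟩⟩
    · rw [hz, Nat.forall_lt_succ_right]; exact (and_iff_left h1).symm
    · rcases hk with ⟨i, hi', h3⟩ | ⟨h3, h4⟩
      · exact Or.inl ⟨i, by omega, h3⟩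
      · refine Or.inr ⟨h3, ?_⟩
        rw [Nat.forall_lt_succ_right]
        exact ⟨h4, fun _ => h2⟩
    · rw [State.setN_comm _ (by norm_num : (63 : ℕ) ≠ 62), State.setN_setN]
    · rw [hz, Nat.forall_lt_succ_right]; exact (and_iff_left h1).symm
    · exact Or.inl ⟨m, by omega, rfl, h1, by omega⟩
    · exact State.setN_setN _ _ _ _
    · simp only [one_ne_zero, false_iff]
      exact fun h => h1 (h m (by omega))
    · rcases hk with ⟨i, hi', h3⟩ | ⟨h3, h4⟩
      · exact Or.inl ⟨i, by omega, h3⟩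
      · refine Or.inr ⟨h3, ?_⟩
        rw [Nat.forall_lt_succ_right]
        exact ⟨h4, fun h => absurd h h1⟩

end RealRAM

namespace RealRAM

variable {d n : ℕ} {L : Layout} {K : ℕ}

/-! ### Switching the sides of a box in a cell -/

/-- Twice the index of the box whose side determines the `i`-th interval of the cell in
register `60`, if this interval has only one rank. -/
def ownE (i : ℕ) : NExp :=
  .half (.arr (10 + 8 * i) (.arr (12 + 8 * i) (nv 60))) +
    .half (.arr (10 + 8 * i) (.arr (12 + 8 * i) (nv 60)))

/-- Set register `63` to `1` unless the side with rank in register `64` on axis `i` of the given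
box can contribute vertices to the cell in register `60`. -/
def candTest (d i : ℕ) : Prog :=
  forAx (fun i' => if i' = i then .skip else
    .ite ((BExp.neq (.arr (13 + 8 * i) (nv 60)) (.arr (12 + 8 * i) (nv 60) + nc 1)).not.and
        ((BExp.nle (.arr (14 + 8 * i') (nc 0)) (.arr (12 + 8 * i') (nv 60))).and
          (.nlt (.arr (12 + 8 * i') (nv 60)) (.arr (15 + 8 * i') (nc 0)))).not)
      (.setN 63 (nc 1)) .skip ;;
    .ite ((BExp.neq (.arr (13 + 8 * i') (nv 60)) (.arr (12 + 8 * i') (nv 60) + nc 1)).and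
        ((BExp.nle (.arr (11 + 8 * i) (ownE i')) (nv 64)).and
          (.nle (nv 64) (.arr (11 + 8 * i) (ownE i' + nc 1)))).not)
      (.setN 63 (nc 1)) .skip) d

theorem candTest_spec {ω : Tape} {i r c j : ℕ} {σ : State} {lo hi : ℕ → ℕ} (hid : i < d)
    (hS : Static L d σ) (hloc : Located d lo hi σ) (h60 : σ.nreg 60 = c) (h63 : σ.nreg 63 = 0)
    (h64 : σ.nreg 64 = r) (hr : L.own i r = j)
    (hlh : ∀ i < d, lo i = L.pos i (2 * j) ∧ hi i = L.pos i (2 * j + 1) + 1) :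
    wp ω (candTest d i) (fun τ => ∃ z, τ = σ.setN 63 z ∧ (z = 0 ↔ L.Cand d c i r)) σ := by
  refine wp_mono ?_ (wp_forAx (fun m τ => ∃ z, τ = σ.setN 63 z ∧ (z = 0 ↔ ∀ i' < m, i' ≠ i →
    (L.B i c ≠ L.A i c + 1 → L.pos i' (2 * L.own i r) ≤ L.A i' c ∧
      L.A i' c ≤ L.pos i' (2 * L.own i r + 1)) ∧
    (L.B i' c = L.A i' c + 1 → L.pos i (2 * L.own i' (L.A i' c)) ≤ r ∧
      r ≤ L.pos i (2 * L.own i' (L.A i' c) + 1)))) ?_ ⟨0, ?_, by simp⟩)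
  · rintro τ ⟨z, rfl, hz⟩
    exact ⟨z, rfl, hz⟩
  · rintro i' hi' τ ⟨z, rfl, hz⟩
    by_cases hii : i' = i
    · rw [if_pos hii, wp_skip]
      refine ⟨z, rfl, ?_⟩
      rw [hz, Nat.forall_lt_succ_right]
      exact (and_iff_left fun h => absurd hii h).symm
    · rw [if_neg hii]
      have hown : L.Q i' (L.A i' c) / 2 + L.Q i' (L.A i' c) / 2 = 2 * L.own i' (L.A i' c) := by
        rw [Layout.own]; ring
      have e1 : ∀ z, (BExp.Holds (σ.setN 63 z)
          ((BExp.neq (.arr (13 + 8 * i) (nv 60)) (.arr (12 + 8 * i) (nv 60) + nc 1)).not.and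
          ((BExp.nle (.arr (14 + 8 * i') (nc 0)) (.arr (12 + 8 * i') (nv 60))).and
          (.nlt (.arr (12 + 8 * i') (nv 60)) (.arr (15 + 8 * i') (nc 0)))).not)) ↔
          ¬ (L.B i c ≠ L.A i c + 1 → L.pos i' (2 * L.own i r) ≤ L.A i' c ∧
            L.A i' c ≤ L.pos i' (2 * L.own i r + 1)) := by
        intro z
        simp [h60, hS.A i hid, hS.B i hid, hS.A i' hi', (hloc i' hi').1, (hloc i' hi').2,
          (hlh i' hi').1, (hlh i' hi').2, hr]
      have e2 : ∀ z, (BExp.Holds (σ.setN 63 z)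
          ((BExp.neq (.arr (13 + 8 * i') (nv 60)) (.arr (12 + 8 * i') (nv 60) + nc 1)).and
          ((BExp.nle (.arr (11 + 8 * i) (ownE i')) (nv 64)).and
          (.nle (nv 64) (.arr (11 + 8 * i) (ownE i' + nc 1)))).not)) ↔
          ¬ (L.B i' c = L.A i' c + 1 → L.pos i (2 * L.own i' (L.A i' c)) ≤ r ∧
            r ≤ L.pos i (2 * L.own i' (L.A i' c) + 1)) := by
        intro z
        simp [ownE, h60, h64, hS.pos i hid, hS.B i' hi', hS.A i' hi', hS.Q i' hi', hown]
      simp only [wp_seq, wp_ite, wp_setN, wp_skip, State.setN_setN, NExp.eval_const]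
      simp only [e1, e2]
      refine ⟨fun h1 => ⟨fun h2 => ⟨1, rfl, ?_⟩, fun h2 => ⟨1, rfl, ?_⟩⟩,
        fun h1 => ⟨fun h2 => ⟨1, rfl, ?_⟩, fun h2 => ⟨z, rfl, ?_⟩⟩⟩
      · simp only [one_ne_zero, false_iff]
        exact fun h => h1 (h i' (by omega) hii).1
      · simp only [one_ne_zero, false_iff]
        exact fun h => h1 (h i' (by omega) hii).1
      · simp only [one_ne_zero, false_iff]
        exact fun h => h2 (h i' (by omega) hii).2
      · rw [hz, Nat.forall_lt_succ_right]
        exact (and_iff_left fun _ => ⟨not_not.1 h1, not_not.1 h2⟩).symm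
  · rw [← h63]
    simp [State.setN]

/-- Set to real register `14` the leaf of rank `re` of the tree for axis `i` of the cell in
register `60`, if vertices are possible there. -/
def flagSide (d i : ℕ) (re : NExp) : Prog :=
  (.setN 64 re ;; .setN 63 (nc 0) ;; candTest d i) ;;
  .ite ((BExp.nle (.arr (12 + 8 * i) (nv 60)) (nv 64)).and
      ((BExp.nlt (nv 64) (.arr (13 + 8 * i) (nv 60))).and (.nlt (nv 63) (nc 1))))
    ((.setN 90 (baseI i) ;; .setN 91 (nv 4 + nv 64)) ;; setLeaf 14) .skip

open Classical in
theorem flagSide_spec {ω : Tape} {U i r c j : ℕ} {σ : State} {lo hi : ℕ → ℕ} {re : NExp}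
    {g b : ℕ → ℝ} (hU : L.H < U) (hid : i < d) (hS : Static L d σ) (hloc : Located d lo hi σ)
    (h60 : σ.nreg 60 = c) (h61 : σ.nreg 61 = L.base (d * c + 1)) (hre : re.eval σ = r)
    (hr : L.own i r = j) (hlh : ∀ i < d, lo i = L.pos i (2 * j) ∧ hi i = L.pos i (2 * j + 1) + 1)
    (hrM : r < 2 ^ L.H)
    (ht : TreeRep L.H (σ.tag (L.base (d * c + 1 + i))) (σ.sum (L.base (d * c + 1 + i))) g b) :
    Fast ω U (flagSide d i re) σ fun τ =>
      OpFrame 62 13 (region (2 ^ L.H) (L.base (d * c + 1 + i))) σ τ ∧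
      TreeRep L.H (τ.tag (L.base (d * c + 1 + i))) (τ.sum (L.base (d * c + 1 + i))) g
        (if (L.A i c ≤ r ∧ r < L.B i c) ∧ L.Cand d c i r then Function.update b r (σ.rreg 14)
          else b) := by
  refine Fast.seq_wp (by omega) ?_
  simp only [wp_seq, wp_setN]
  have fr : OpFrame 62 13 (region (2 ^ L.H) (L.base (d * c + 1 + i))) σ
      ((σ.setN 64 (re.eval σ)).setN 63 ((nc 0).eval (σ.setN 64 (re.eval σ)))) :=
    ((OpFrame.refl _ _ _ _).setN (by norm_num) (by norm_num)).setN (by norm_num) (by norm_num)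
  refine wp_mono ?_ (candTest_spec (L := L) (c := c) (r := r) (j := j) (lo := lo) (hi := hi) hid
    (hS.of_opFrame (by norm_num) fr) (hloc.of_na rfl) (by simp [h60]) (by simp) (by simp [hre])
    hr hlh)
  rintro τ ⟨z, rfl, hz⟩
  rw [State.setN_setN]
  set σ₁ := (σ.setN 64 (re.eval σ)).setN 63 z with hσ₁
  have f1 : OpFrame 62 13 (region (2 ^ L.H) (L.base (d * c + 1 + i))) σ σ₁ :=
    ((OpFrame.refl _ _ _ _).setN (by norm_num) (by norm_num)).setN (by norm_num) (by norm_num)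
  have ht1 : TreeRep L.H (σ₁.tag (L.base (d * c + 1 + i))) (σ₁.sum (L.base (d * c + 1 + i))) g b :=
    ht.congr (fun x _ _ => by simp [State.tag, hσ₁]) fun x _ _ => by simp [State.sum, hσ₁]
  have e : BExp.Holds σ₁ ((BExp.nle (.arr (12 + 8 * i) (nv 60)) (nv 64)).and
      ((BExp.nlt (nv 64) (.arr (13 + 8 * i) (nv 60))).and (.nlt (nv 63) (nc 1)))) ↔
      ((L.A i c ≤ r ∧ r < L.B i c) ∧ L.Cand d c i r) := by
    rw [← hz]
    simp [hσ₁, h60, hre, hS.A i hid, hS.B i hid, and_assoc]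
  refine Fast.ite (by omega) (fun h => ?_) fun h => ?_
  · rw [if_pos (e.1 h)]
    refine Fast.seq_wp (by omega) ?_
    simp only [wp_seq, wp_setN]
    have hb : (baseI i).eval σ₁ = L.base (d * c + 1 + i) :=
      eval_baseI (by rw [f1.nreg 4 (by norm_num), hS.r4]) (by rw [f1.nreg 61 (by norm_num), h61])
    refine (setLeaf_spec (r := r) (g := g) (b := b) (xi := 14) hU (β := L.base (d * c + 1 + i))
      (by simp [hb]) hrM (by simp [hσ₁, hre, hS.r4]) ?_).mono ?_
    · exact ht1.congr (fun x _ _ => by simp [State.tag]) fun x _ _ => by simp [State.sum]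
    · rintro τ ⟨h1, h2⟩
      refine ⟨OpFrame.trans ?_ (h1.mono (by norm_num) le_rfl le_rfl), by simpa [hσ₁] using h2⟩
      exact (f1.setN (by norm_num) (by norm_num)).setN (by norm_num) (by norm_num)
  · rw [if_neg (fun h' => h (e.2 h'))]
    exact Fast.of_wp (by omega) ⟨f1, ht1⟩

/-- Set to real register `14` the leaves of the sides of the given box in the trees of the cell in
register `60`. -/
def cellFlag (d : ℕ) : Prog :=
  .setN 61 (.arr 4 (nv 60)) ;;
  forAx (fun i => flagSide d i (.arr (14 + 8 * i) (nc 0)) ;;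
    flagSide d i (.arr (15 + 8 * i) (nc 0) - nc 1)) d ;; refresh d

/-- Activity of a rank depends on the active set only through the box owning this rank. Changing the
status of `j` thus affects, on each axis, only the leaves at the two ranks of `j`; all ranks with
another owner keep their value by `hA`. -/
theorem cellFlag_spec {ω : Tape} {U c : ℕ} {j : Fin n} {Bx : Fin n → AABox d} {σ : State}
    {lo hi : ℕ → ℕ} {A A' : Finset (Fin n)} {g : ℕ → ℕ → ℝ} {G v : ℕ → ℝ}
    (hU : L.H < U) (hL : LayoutOK L Bx K) (hS : Static L d σ) (hloc : Located d lo hi σ)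
    (h60 : σ.nreg 60 = c) (hcell : L.IsCell d c)
    (hlh : ∀ i < d, lo i = L.pos i (2 * j) ∧ hi i = L.pos i (2 * j + 1) + 1)
    (h14 : σ.rreg 14 = if j ∈ A' then 1 else 0) (hA : ∀ k, k ≠ j → (k ∈ A' ↔ k ∈ A))
    (ht : CellTrees L d σ c (L.actVal d A c) g)
    (hG : TreeRep L.H (σ.tag (L.base 0)) (σ.sum (L.base 0)) G v) :
    Fast ω U (cellFlag d) σ fun τ => OpFrame 61 14 (opRegion L d c) σ τ ∧
      CellTrees L d τ c (L.actVal d A' c) g ∧ TreeRep L.H (τ.tag (L.base 0)) (τ.sum (L.base 0)) G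
        (Function.update v c (rootProd L d (L.actVal d A' c) g)) := by
  classical
  have hc : c < 2 ^ L.H := hcell.2.trans hL.size
  refine Fast.seq_wp (by omega) ?_
  rw [wp_setN]
  obtain ⟨σ₁, hσ₁⟩ : ∃ σ₁, σ₁ = σ.setN 61 ((NExp.arr 4 (nv 60)).eval σ) := ⟨_, rfl⟩
  rw [← hσ₁]
  have f1 : OpFrame 61 14 (opRegion L d c) σ σ₁ := by
    rw [hσ₁]; exact (OpFrame.refl _ _ _ _).setN (by norm_num) (by norm_num)
  have h61 : σ₁.nreg 61 = L.base (d * c + 1) := by simp [hσ₁, h60, hS.cb c hcell]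
  have hS1 := hS.of_opFrame (by norm_num) f1
  have hN := hL.ranks.end_lt j
  refine Fast.seq ((Fast.forAx (by omega) (fun m τ => OpFrame 62 13 (cellRegion L d c) σ₁ τ ∧
    CellTrees L d τ c (fun i => if i < m then L.actVal d A' c i else L.actVal d A c i) g) ?_
    ⟨OpFrame.refl _ _ _ _, ?_⟩).mono ?_)
  · rintro i hid τ ⟨h1, h2⟩
    have hpl := hL.ranks.pos_lt i hid (2 * j) (by omega)
    have hph := hL.ranks.pos_lt i hid (2 * j + 1) (by omega)
    have hNM := hL.sizeN
    have hbi := h2 i hid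
    simp only [lt_irrefl, if_false] at hbi
    have hol : L.own i (L.pos i (2 * j)) = j := by
      rw [Layout.own, hL.ranks.Q_pos i hid _ (by omega)]; omega
    have hoh : L.own i (L.pos i (2 * j + 1)) = j := by
      rw [Layout.own, hL.ranks.Q_pos i hid _ (by omega)]; omega
    have hSτ := hS1.of_opFrame (by norm_num) h1
    have hlτ := (hloc.of_na f1.na).of_na h1.na
    refine Fast.seq ((flagSide_spec (r := L.pos i (2 * j)) (c := c) (j := j) (g := g i)
      (b := L.actVal d A c i) hU hid hSτ hlτ
      (by rw [h1.nreg 60 (by norm_num), f1.nreg 60 (by norm_num), h60])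
      (by rw [h1.nreg 61 (by norm_num), h61]) (by simp [(hlτ i hid).1, (hlh i hid).1]) hol hlh
      (by omega) hbi).mono ?_)
    rintro υ ⟨h3, h4⟩
    have h3' := h3.mono le_rfl le_rfl (region_subset_cellRegion hid)
    have hSυ := hSτ.of_opFrame (by norm_num) h3
    have hlυ := hlτ.of_na h3.na
    have hυ14 : υ.rreg 14 = σ.rreg 14 := by
      rw [h3.rreg 14 (by norm_num) (by norm_num), h1.rreg 14 (by norm_num) (by norm_num),
        f1.rreg 14 (by norm_num) (by norm_num)]
    have hτ14 : τ.rreg 14 = σ.rreg 14 := by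
      rw [h1.rreg 14 (by norm_num) (by norm_num), f1.rreg 14 (by norm_num) (by norm_num)]
    refine (flagSide_spec (r := L.pos i (2 * j + 1)) (c := c) (j := j) (g := g i) hU hid hSυ hlυ
      (by rw [h3.nreg 60 (by norm_num), h1.nreg 60 (by norm_num), f1.nreg 60 (by norm_num), h60])
      (by rw [h3.nreg 61 (by norm_num), h1.nreg 61 (by norm_num), h61])
      (by simp [(hlυ i hid).2, (hlh i hid).2]) hoh hlh (by omega) h4).mono ?_
    rintro φ ⟨h5, h6⟩
    refine ⟨(h1.trans h3').trans (h5.mono le_rfl le_rfl (region_subset_cellRegion hid)),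
      fun i' hi' => ?_⟩
    by_cases hii : i' = i
    · subst hii
      beta_reduce
      rw [if_pos (by omega)]
      refine h6.congr_b fun q hq => ?_
      rw [hυ14, hτ14, h14]
      have hact : ∀ B : Finset (Fin n), L.actVal d B c i' q =
          if (L.A i' c ≤ q ∧ q < L.B i' c) ∧ L.Cand d c i' q then
            (if ∃ k ∈ B, L.own i' q = (k : ℕ) then 1 else 0) else 0 := by
        intro B
        simp only [Layout.actVal, Layout.Active, ← ite_and, and_assoc]
      have hj : L.own i' q = (j : ℕ) → ∀ B : Finset (Fin n),
          ((∃ k ∈ B, L.own i' q = (k : ℕ)) ↔ j ∈ B) := by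
        intro h B
        constructor
        · rintro ⟨k, hk, hk'⟩
          rwa [show j = k from Fin.ext (h.symm.trans hk')]
        · exact fun h' => ⟨j, h', h⟩
      -- One call of `flagSide` gives the leaf at a rank of `j` its new activity if the rank is a
      -- candidate in the cell, and changes nothing else.
      have hfin : ∀ (r : ℕ) (b : ℕ → ℝ), L.own i' r = (j : ℕ) →
          ((if (L.A i' c ≤ r ∧ r < L.B i' c) ∧ L.Cand d c i' r then
            Function.update b r (if j ∈ A' then (1 : ℝ) else 0) else b) q =
            if q = r then (if (L.A i' c ≤ q ∧ q < L.B i' c) ∧ L.Cand d c i' q then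
              L.actVal d A' c i' q else b q) else b q) := by
        intro r b hr
        by_cases hqr : q = r
        · subst hqr
          rw [if_pos rfl, hact]
          split_ifs with h1 h2 h3 h4 <;> simp_all
        · rw [if_neg hqr]
          split_ifs <;> simp [Function.update_of_ne hqr]
      rw [hfin _ _ hoh, hfin _ _ hol]
      by_cases hx : (L.A i' c ≤ q ∧ q < L.B i' c) ∧ L.Cand d c i' q
      · simp only [hx, and_self, if_true]
        by_cases hq1 : q = L.pos i' (2 * j + 1)
        · rw [if_pos hq1]
        · rw [if_neg hq1]
          by_cases hq2 : q = L.pos i' (2 * j)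
          · rw [if_pos hq2]
          · rw [if_neg hq2]
            have hqN : q < L.N :=
              hx.1.2.trans_le (hL.decomp.entry_interval le_rfl hcell.1 hcell.2 hi').2
            have hne : L.own i' q ≠ j := fun h => by
              rcases hL.ranks.rank_eq hi' hqN with h' | h' <;> rw [h] at h' <;> tauto
            rw [hact, hact]
            congr 2
            rw [eq_iff_iff]
            refine exists_congr fun k => ?_
            by_cases hk : k = j
            · subst hk; tauto
            · rw [hA k hk]
      · rw [hact A', hact A, if_neg hx, if_neg hx]
        simp [hx]
    · have h7 := h5.treeRep (h3.treeRep (h2 i' hi') (fun x hx => not_mem_region (by omega) hx))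
        (fun x hx => not_mem_region (by omega) hx)
      have e : (i' < i + 1) = (i' < i) := by rw [eq_iff_iff]; omega
      simpa only [e] using h7
  · intro i hid
    refine (ht i hid).congr (fun x _ _ => by simp [State.tag, hσ₁]) fun x _ _ => by
      simp [State.sum, hσ₁]
  · rintro τ ⟨h1, h2⟩
    have ht3 : CellTrees L d τ c (L.actVal d A' c) g := fun i hi => by simpa [hi] using h2 i hi
    have hG1 : TreeRep L.H (σ₁.tag (L.base 0)) (σ₁.sum (L.base 0)) G v :=
      hG.congr (fun x _ _ => by simp [State.tag, hσ₁]) fun x _ _ => by simp [State.sum, hσ₁]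
    have hG3 : TreeRep L.H (τ.tag (L.base 0)) (τ.sum (L.base 0)) G v :=
      h1.treeRep hG1 fun x hx => by
        rintro ⟨h3, -⟩
        have := L.base_mono (by omega : 0 + 1 ≤ d * c + 1)
        rw [L.base_succ] at this
        omega
    refine (refresh_spec hU (by rw [h1.nreg 4 (by norm_num), hS1.r4])
      (by rw [h1.nreg 60 (by norm_num), f1.nreg 60 (by norm_num), h60])
      (by rw [h1.nreg 61 (by norm_num), h61]) hc ht3 hG3).mono ?_
    rintro υ ⟨h3, h5⟩
    exact ⟨(f1.trans (h1.mono (by norm_num) (by norm_num) Set.subset_union_right)).trans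
      (h3.mono (by norm_num) le_rfl Set.subset_union_left), ht3.of_opFrame h3, h5⟩

/-! ### The weight of a cell in a box -/

/-- Add to real register `15` the weight of the points of the cell in register `60` in the given
box. -/
def cellQuery (d : ℕ) : Prog :=
  (.setN 61 (.arr 4 (nv 60)) ;; .setR 13 (rc 1)) ;;
  forAx (fun i => rangeQuery (baseI i) (.arr (15 + 8 * i) (nc 0)) (.arr (14 + 8 * i) (nc 0)) ;;
    .setR 13 (rv 13 * rv 11)) d ;;
  (.setR 16 (rv 13) ;; .setN 90 (nc 0) ;; .setN 91 (nv 4 + nv 60)) ;; queryWalk ;;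
  (.setR 15 (rv 15 + rv 11) ;; .setR 16 (rc 0) ;; .setN 91 (nv 4 + nv 60)) ;; queryWalk ;;
  .setR 15 (rv 15 - rv 11)

/-- The multiplier `G c` is stored nowhere, being a product of tags along a path. It is obtained by
two walks from leaf `c`, one with the product of the range sums in register `16` and one with `0`
there: their difference is that product times `G c`. -/
theorem cellQuery_spec {ω : Tape} {U c : ℕ} {σ : State} {lo hi : ℕ → ℕ} {a g : ℕ → ℕ → ℝ}
    {G v : ℕ → ℝ} (hU : L.H < U) (hS : Static L d σ) (hloc : Located d lo hi σ)
    (h60 : σ.nreg 60 = c) (hcell : L.IsCell d c) (hc : c < 2 ^ L.H)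
    (hlh : ∀ i < d, lo i ≤ hi i ∧ hi i < 2 ^ L.H) (ht : CellTrees L d σ c a g)
    (hG : TreeRep L.H (σ.tag (L.base 0)) (σ.sum (L.base 0)) G v) :
    Fast ω U (cellQuery d) σ fun τ => OpFrame 61 16 ∅ σ τ ∧ τ.ra = σ.ra ∧
      τ.rreg 15 = σ.rreg 15 + G c * ∏ i ∈ Finset.range d,
        (∑ r ∈ Finset.range (hi i), a i r * g i r - ∑ r ∈ Finset.range (lo i), a i r * g i r) := by
  refine Fast.seq_wp (by omega) ?_
  simp only [wp_seq, wp_setN, wp_setR]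
  obtain ⟨σ₁, hσ₁⟩ : ∃ σ₁, σ₁ = (σ.setN 61 ((NExp.arr 4 (nv 60)).eval σ)).setR 13
    ((rc 1).eval (σ.setN 61 ((NExp.arr 4 (nv 60)).eval σ))) := ⟨_, rfl⟩
  rw [← hσ₁]
  have f1 : OpFrame 61 14 ∅ σ σ₁ := by
    rw [hσ₁]
    exact ((OpFrame.refl _ _ _ _).setN (by norm_num) (by norm_num)).setR (by norm_num)
  have h61 : σ₁.nreg 61 = L.base (d * c + 1) := by simp [hσ₁, h60, hS.cb c hcell]
  have hra : σ₁.ra = σ.ra := by simp [hσ₁]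
  have hS1 := hS.of_opFrame (by norm_num) f1
  have htr : ∀ {β : ℕ} {g b : ℕ → ℝ} {τ : State}, τ.ra = σ.ra →
      TreeRep L.H (σ.tag β) (σ.sum β) g b → TreeRep L.H (τ.tag β) (τ.sum β) g b :=
    fun h h' => h'.congr (fun x _ _ => by simp [State.tag, h]) fun x _ _ => by simp [State.sum, h]
  refine Fast.seq ((Fast.forAx (by omega) (fun m τ => OpFrame 90 14 ∅ σ₁ τ ∧ τ.ra = σ.ra ∧
    τ.rreg 13 = ∏ i ∈ Finset.range m, (∑ r ∈ Finset.range (hi i), a i r * g i r -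
      ∑ r ∈ Finset.range (lo i), a i r * g i r)) ?_
    ⟨OpFrame.refl _ _ _ _, hra, by simp [hσ₁]⟩).mono ?_)
  · rintro i hid τ ⟨h1, h2, h3⟩
    have hl := (hloc.of_na (h1.na.trans f1.na)) i hid
    refine Fast.seq ((rangeQuery_spec (R := ∅) (h := hi i) (l := lo i) (g := g i) (b := a i) hU
      (by rw [h1.nreg 4 (by norm_num), hS1.r4])
      (baseI_stable (d := d) (c := c) (by rw [h1.nreg 4 (by norm_num), hS1.r4])
        (by rw [h1.nreg 61 (by norm_num), h61]))
      (by rw [← hl.2]; exact arr_stable) (by rw [← hl.1]; exact arr_stable)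
      (hlh i hid).2 ((hlh i hid).1.trans_lt (hlh i hid).2) (htr h2 (ht i hid))).mono ?_)
    rintro υ ⟨h4, h5, h6⟩
    refine Fast.of_wp (by omega) ?_
    rw [wp_setR]
    refine ⟨(h1.trans (h4.mono le_rfl (by norm_num) le_rfl)).setR (by norm_num), by
      simp [h5, h2], ?_⟩
    rw [Finset.prod_range_succ, ← h3, ← h6, ← h4.rreg 13 (by norm_num) (by norm_num)]
    simp
  · rintro τ ⟨h1, h2, h3⟩
    refine Fast.seq_wp (by omega) ?_
    simp only [wp_seq, wp_setN, wp_setR]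
    obtain ⟨P, hP⟩ : ∃ P, P = τ.rreg 13 := ⟨_, rfl⟩
    simp only [RExp.eval_reg, NExp.eval_const, NExp.eval_add, NExp.eval_reg]
    set τ₁ := ((τ.setR 16 (τ.rreg 13)).setN 90 0).setN 91
      (((τ.setR 16 (τ.rreg 13)).setN 90 0).nreg 4 + ((τ.setR 16 (τ.rreg 13)).setN 90 0).nreg 60)
      with hτ₁
    have h4τ : τ.nreg 4 = 2 ^ L.H := by rw [h1.nreg 4 (by norm_num), hS1.r4]
    have h60τ : τ.nreg 60 = c := by
      rw [h1.nreg 60 (by norm_num), f1.nreg 60 (by norm_num), h60]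
    have f2 : OpFrame 61 14 ∅ σ τ := f1.trans (h1.mono (by norm_num) le_rfl le_rfl)
    have f3 : OpFrame 61 14 ∅ σ τ₁ :=
      ((f2.setR (by norm_num)).setN (by norm_num) (by norm_num)).setN (by norm_num) (by norm_num)
    refine Fast.seq ((queryWalk_spec (r := c) (g := G) (b := v) (β := L.base 0) hU
      (by simp [hτ₁, Layout.base]) hc (by simp [hτ₁, h4τ, h60τ])
      (htr (by simp [hτ₁, h2]) hG)).mono ?_)
    rintro υ ⟨h4, h5⟩
    refine Fast.seq_wp (by omega) ?_
    simp only [wp_seq, wp_setN, wp_setR]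
    have h4υ : υ.nreg 4 = 2 ^ L.H := by
      rw [h4.nreg 4 (by norm_num) (by norm_num)]; simp [hτ₁, h4τ]
    have h60υ : υ.nreg 60 = c := by
      rw [h4.nreg 60 (by norm_num) (by norm_num)]; simp [hτ₁, h60τ]
    have h90υ : υ.nreg 90 = L.base 0 := by
      rw [h4.nreg 90 (by norm_num) (by norm_num)]; simp [hτ₁, Layout.base]
    have h15υ : υ.rreg 15 = σ.rreg 15 := by
      rw [h4.rreg 15 (by norm_num) (by norm_num), f3.rreg 15 (by norm_num) (by norm_num)]
    have f4 : OpFrame 61 14 ∅ σ υ :=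
      f3.trans ((OpFrame.of_read h4).mono (by norm_num) (by norm_num) le_rfl)
    have hraυ : υ.ra = σ.ra := by rw [h4.ra]; simp [hτ₁, h2]
    refine Fast.seq ((queryWalk_spec (r := c) (g := G) (b := v) (β := L.base 0) hU
      (by simp [h90υ]) hc (by simp [h4υ, h60υ])
      (htr (by simp [hraυ]) hG)).mono ?_)
    rintro φ ⟨h6, h7⟩
    refine Fast.of_wp (by omega) ?_
    rw [wp_setR]
    have f5 : OpFrame 61 16 ∅ υ φ := by
      refine OpFrame.trans ?_ ((OpFrame.of_read h6).mono (by norm_num) (by norm_num) le_rfl)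
      exact (((OpFrame.refl _ _ _ _).setR (by norm_num)).setR (by norm_num)).setN (by norm_num)
        (by norm_num)
    refine ⟨((f4.mono le_rfl (by norm_num) le_rfl).trans f5).setR (by norm_num), by
      simp [h6.ra, hraυ], ?_⟩
    have h15 := h6.rreg 15 (by norm_num) (by norm_num)
    simp at h15 h7
    have h16 : τ₁.rreg 16 = τ.rreg 13 := by simp [hτ₁]
    simp only [RExp.eval_sub, RExp.eval_reg, State.setR_rreg, if_true, h15, h7, h5, h15υ, h16, h3]
    ring

end RealRAM

namespace RealRAM

variable {d n : ℕ} {L : Layout} {K : ℕ}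

/-! ### Traversing the cells met by the boundary of a box -/

/-- Record in register `34` that the box does not cover the entry in register `30`. -/
def coverTest (i : ℕ) : Prog :=
  .ite ((BExp.nle (.arr (14 + 8 * i) (nc 0)) (.arr (12 + 8 * i) (nv 30))).and
    (.nle (.arr (13 + 8 * i) (nv 30)) (.arr (15 + 8 * i) (nc 0)))) .skip (.setN 34 (nc 1))

/-- Register `33` tells whether the box has a side that crosses the entry in register `30`,
register `34` whether it does not cover the entry. -/
def crossTest (i : ℕ) : Prog :=
  .ite ((BExp.nle (.arr (12 + 8 * i) (nv 30)) (.arr (14 + 8 * i) (nc 0))).and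
    (.nlt (.arr (14 + 8 * i) (nc 0)) (.arr (13 + 8 * i) (nv 30)))) (.setN 33 (nc 1)) .skip ;;
  .ite ((BExp.nlt (.arr (12 + 8 * i) (nv 30)) (.arr (15 + 8 * i) (nc 0))).and
    (.nle (.arr (15 + 8 * i) (nc 0)) (.arr (13 + 8 * i) (nv 30)))) (.setN 33 (nc 1)) .skip ;;
  coverTest i

def entryHead (d : ℕ) : Prog :=
  .setN 31 (.arr 1 (nv 30)) ;; .setN 32 (.arr 1 (nv 30 + nc 1)) ;; .setN 33 (nc 0) ;;
  .setN 34 (nc 0) ;; forAx crossTest (d - 1)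

def crossingEntry (cellOp : Prog) : Prog :=
  .setN 60 (nv 31) ;; .loop (.nlt (nv 60) (nv 32)) (cellOp ;; .setN 60 (nv 60 + nc 1))

def plainEntry (d : ℕ) (cellOp rangeOp : Prog) : Prog :=
  (.setN 35 (.arr 3 (.arr 2 (nv 30) + .arr (14 + 8 * (d - 1)) (nc 0))) ;;
    .setN 36 (.arr 3 (.arr 2 (nv 30) + (.arr (15 + 8 * (d - 1)) (nc 0) - nc 1))) ;;
    .setN 60 (nv 35)) ;; cellOp ;;
  .ite (.nlt (nv 35) (nv 36))
    (.ite (.nlt (nv 34) (nc 1)) rangeOp .skip ;; .setN 60 (nv 36) ;; cellOp) .skip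

def entryBody (d : ℕ) (cellOp rangeOp : Prog) : Prog :=
  entryHead d ;; .ite (.nlt (nc 0) (nv 33)) (crossingEntry cellOp) (plainEntry d cellOp rangeOp) ;;
  .setN 30 (nv 30 + nc 1)

/-- Apply `cellOp` to all cells that contain a side of the given box, and `rangeOp` to the ranges
of cells covered by the box. -/
def traverse (d : ℕ) (cellOp rangeOp : Prog) : Prog :=
  .setN 30 (nv 5) ;; .loop (.nlt (nv 30) (nv 6)) (entryBody d cellOp rangeOp)

/-- A side of the box `[lo, hi)` lies in the `i`-th interval of entry `e`. -/
def SideIn (L : Layout) (lo hi : ℕ → ℕ) (e i : ℕ) : Prop :=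
  (L.A i e ≤ lo i ∧ lo i < L.B i e) ∨ (L.A i e < hi i ∧ hi i ≤ L.B i e)

/-- A side of the box `[lo, hi)` crosses entry `e`. -/
def Crossing (L : Layout) (d : ℕ) (lo hi : ℕ → ℕ) (e : ℕ) : Prop := ∃ i < d - 1, SideIn L lo hi e i

theorem entryHead_spec {ω : Tape} {e : ℕ} {σ : State} {lo hi : ℕ → ℕ} (hS : Static L d σ)
    (hloc : Located d lo hi σ) (h30 : σ.nreg 30 = e) :
    wp ω (entryHead d) (fun τ => ∃ x y,
      τ = (((σ.setN 31 (L.first e)).setN 32 (L.first (e + 1))).setN 33 x).setN 34 y ∧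
      (x = 0 ↔ ¬ Crossing L d lo hi e) ∧
      (y = 0 ↔ ∀ i < d - 1, lo i ≤ L.A i e ∧ L.B i e ≤ hi i)) σ := by
  simp only [entryHead, wp_seq, wp_setN]
  have hfirst := hS.first
  obtain ⟨σ₁, hσ₁⟩ : ∃ σ₁, σ₁ = (σ.setN 31 (L.first e)).setN 32 (L.first (e + 1)) := ⟨_, rfl⟩
  have h30' : σ₁.nreg 30 = e := by simp [hσ₁, h30]
  have hna : σ₁.na = σ.na := by simp [hσ₁]
  refine wp_mono ?_ (wp_forAx (fun m τ => ∃ x y, τ = (σ₁.setN 33 x).setN 34 y ∧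
      (x = 0 ↔ ∀ i < m, ¬ SideIn L lo hi e i) ∧
      (y = 0 ↔ ∀ i < m, lo i ≤ L.A i e ∧ L.B i e ≤ hi i)) ?_ ?_)
  · rintro τ ⟨x, y, rfl, hx, hy⟩
    refine ⟨x, y, by rw [hσ₁], ?_, hy⟩
    rw [hx, Crossing]
    push Not
    rfl
  · rintro i hi' τ ⟨x, y, rfl, hx, hy⟩
    have hid : i < d := by omega
    have hA := hS.A i hid e
    have hB := hS.B i hid e
    obtain ⟨hlo, hhi⟩ := hloc i hid
    have c1 : ∀ x y, BExp.Holds ((σ₁.setN 33 x).setN 34 y)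
        ((BExp.nle (.arr (12 + 8 * i) (nv 30)) (.arr (14 + 8 * i) (nc 0))).and
        (.nlt (.arr (14 + 8 * i) (nc 0)) (.arr (13 + 8 * i) (nv 30)))) ↔
        (L.A i e ≤ lo i ∧ lo i < L.B i e) := by
      intro x y; simp [h30', hna, hA, hB, hlo]
    have c2 : ∀ x y, BExp.Holds ((σ₁.setN 33 x).setN 34 y)
        ((BExp.nlt (.arr (12 + 8 * i) (nv 30)) (.arr (15 + 8 * i) (nc 0))).and
        (.nle (.arr (15 + 8 * i) (nc 0)) (.arr (13 + 8 * i) (nv 30)))) ↔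
        (L.A i e < hi i ∧ hi i ≤ L.B i e) := by
      intro x y; simp [h30', hna, hA, hB, hhi]
    have c3 : ∀ x y, BExp.Holds ((σ₁.setN 33 x).setN 34 y)
        ((BExp.nle (.arr (14 + 8 * i) (nc 0)) (.arr (12 + 8 * i) (nv 30))).and
        (.nle (.arr (13 + 8 * i) (nv 30)) (.arr (15 + 8 * i) (nc 0)))) ↔
        (lo i ≤ L.A i e ∧ L.B i e ≤ hi i) := by
      intro x y; simp [h30', hna, hA, hB, hlo, hhi]
    have hcomm : ∀ x y z, ((σ₁.setN 33 x).setN 34 y).setN 33 z = (σ₁.setN 33 z).setN 34 y :=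
      fun x y z => by rw [State.setN_comm _ (by norm_num : (34 : ℕ) ≠ 33), State.setN_setN]
    have hfin : ∀ x', (x' = 0 ↔ x = 0 ∧ ¬ SideIn L lo hi e i) →
        wp ω (coverTest i)
          (fun τ => ∃ x y, τ = (σ₁.setN 33 x).setN 34 y ∧
          (x = 0 ↔ ∀ j < i + 1, ¬ SideIn L lo hi e j) ∧
          (y = 0 ↔ ∀ j < i + 1, lo j ≤ L.A j e ∧ L.B j e ≤ hi j)) ((σ₁.setN 33 x').setN 34 y) := by
      intro x' hx'
      rw [hx] at hx'
      simp only [coverTest, wp_ite, wp_skip, wp_setN, State.setN_setN, c3, NExp.eval_const]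
      refine ⟨fun h => ⟨x', y, rfl, ?_, ?_⟩, fun h => ⟨x', 1, rfl, ?_, ?_⟩⟩
      · rw [hx', Nat.forall_lt_succ_right]
      · rw [hy, Nat.forall_lt_succ_right]; exact (and_iff_left h).symm
      · rw [hx', Nat.forall_lt_succ_right]
      · simp only [one_ne_zero, false_iff]
        exact fun h' => h (h' i (by omega))
    simp only [crossTest, wp_seq, wp_ite, wp_setN, wp_skip, hcomm, c1, c2, NExp.eval_const]
    refine ⟨fun h1 => ⟨fun h2 => hfin 1 ?_, fun h2 => hfin 1 ?_⟩,
      fun h1 => ⟨fun h2 => hfin 1 ?_, fun h2 => hfin x ?_⟩⟩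
    · simp [SideIn, h1]
    · simp [SideIn, h1]
    · simp [SideIn, h2]
    · rw [SideIn]; tauto
  · exact ⟨0, 0, by simp [hσ₁, h30, hfirst], by simp, by simp⟩

section
variable {ω : Tape} {U : ℕ} {Bx : Fin n → AABox d} {cellOp rangeOp : Prog} {lo hi : ℕ → ℕ}

/-- What `cellOp` and `rangeOp` have to do: `J k σ` says that the cells before `k` are done. -/
structure Visitor (ω : Tape) (U : ℕ) (L : Layout) (d : ℕ) (lo hi : ℕ → ℕ) (cellOp rangeOp : Prog)
    (J : ℕ → State → Prop) : Prop where
  static : ∀ k σ, J k σ → Static L d σ ∧ Located d lo hi σ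
  setN : ∀ k σ i v, 30 ≤ i → J k σ → J k (σ.setN i v)
  skip : ∀ k σ, L.IsCell d k → (∃ i < d, hi i ≤ L.A i k ∨ L.B i k ≤ lo i) →
    (∀ i < d, ¬ SideIn L lo hi k i) → J k σ → J (k + 1) σ
  cell : ∀ k σ, L.IsCell d k → J k σ → σ.nreg 60 = k →
    Fast ω U cellOp σ fun τ => J (k + 1) τ ∧ ∀ i < 61, τ.nreg i = σ.nreg i
  range : ∀ k₀ k₁ σ, k₀ < k₁ → L.IsCell d k₁ → (∀ k, k₀ < k → k < k₁ → L.IsCell d k ∧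
    (∀ i < d, lo i ≤ L.A i k ∧ L.B i k ≤ hi i) ∧ ∀ i < d, ¬ SideIn L lo hi k i) →
    σ.nreg 35 = k₀ → σ.nreg 36 = k₁ → J (k₀ + 1) σ →
    Fast ω U rangeOp σ fun τ => J k₁ τ ∧ ∀ i < 61, τ.nreg i = σ.nreg i

variable {J : ℕ → State → Prop}

/-- A cell may be passed over if it misses the box, so that no weight changes or is counted, and
contains no side of it, so that no activity changes. -/
theorem Visitor.skip_range (hV : Visitor ω U L d lo hi cellOp rangeOp J) {a b : ℕ} (hab : a ≤ b)
    {σ : State} (h : ∀ k, a ≤ k → k < b → L.IsCell d k ∧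
      (∃ i < d, hi i ≤ L.A i k ∨ L.B i k ≤ lo i) ∧ ∀ i < d, ¬ SideIn L lo hi k i)
    (hJ : J a σ) : J b σ := by
  induction b, hab using Nat.le_induction with
  | base => exact hJ
  | succ b hb ih =>
    obtain ⟨h1, h2, h3⟩ := h b hb (by omega)
    exact hV.skip b σ h1 h2 h3 (ih fun k hk hk' => h k hk (by omega))

theorem crossingEntry_spec (hV : Visitor ω U L d lo hi cellOp rangeOp J) {σ : State} {a b e : ℕ}
    (hab : a ≤ b) (hcell : ∀ k, a ≤ k → k < b → L.IsCell d k) (h31 : σ.nreg 31 = a)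
    (h32 : σ.nreg 32 = b) (h30 : σ.nreg 30 = e) (hJ : J a σ) (hU : 1 ≤ U) :
    Runs ω (crossingEntry cellOp) σ ((b - a + 1) * ((crossingEntry cellOp).wcost * U))
      fun τ => J b τ ∧ τ.nreg 30 = e := by
  refine Runs.mono (T₁ := (Prog.setN 60 (nv 31)).wcost + (b - a + 1) * ((BExp.nlt (nv 60)
    (nv 32)).cost + (cellOp ;; .setN 60 (nv 60 + nc 1)).wcost * U)) (Runs.seq' (Runs.of_wp (Q :=
    fun τ => J a τ ∧ τ.nreg 30 = e ∧ τ.nreg 60 = a ∧ τ.nreg 32 = b) ?_) (fun τ hτ => ?_) le_rfl)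
    ?_ fun _ => id
  · simp only [wp_setN]
    exact ⟨hV.setN _ _ _ _ (by norm_num) hJ, by simp [h30], by simp [h31], by simp [h32]⟩
  · obtain ⟨h1, h2, h3, h4⟩ := hτ
    refine Runs.loop_uniform (fun k τ => ∃ c, c + k = b ∧ a ≤ c ∧ τ.nreg 60 = c ∧ τ.nreg 30 = e ∧
      τ.nreg 32 = b ∧ J c τ) _ ?_ ?_ _ τ ⟨a, by omega, le_rfl, h3, h2, h4, h1⟩
    · rintro k υ ⟨c, hck, hac, h60, h30, h32, hJ⟩ hp
      simp only [BExp.holds_nlt, NExp.eval_reg, h60, h32] at hp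
      refine ⟨k - 1, by omega, ?_⟩
      refine Fast.seq ((hV.cell c υ (hcell c hac hp) hJ h60).mono ?_)
      rintro φ ⟨h5, h6⟩
      refine Fast.of_wp hU ?_
      rw [wp_setN]
      refine ⟨c + 1, by omega, by omega, by simp [h6 60 (by norm_num), h60],
        by simp [h6 30 (by norm_num), h30], by simp [h6 32 (by norm_num), h32],
        hV.setN _ _ _ _ (by norm_num) h5⟩
    · rintro k υ ⟨c, hck, hac, h60, h30, h32, hJ⟩ hp
      simp only [BExp.holds_nlt, NExp.eval_reg, h60, h32] at hp
      obtain rfl : c = b := by omega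
      exact ⟨hJ, h30⟩
  · have h1 : (crossingEntry cellOp).wcost * U = (Prog.setN 60 (nv 31)).wcost * U +
        ((BExp.nlt (nv 60) (nv 32)).cost * U + (cellOp ;; .setN 60 (nv 60 + nc 1)).wcost * U) := by
      simp only [crossingEntry, Prog.wcost]; ring
    rw [h1]
    generalize (cellOp ;; .setN 60 (nv 60 + nc 1)).wcost * U = x
    generalize (BExp.nlt (nv 60) (nv 32)).cost = y
    generalize (Prog.setN 60 (nv 31)).wcost = z
    have h2 : z ≤ z * U := Nat.le_mul_of_pos_right _ hU
    have h3 : y ≤ y * U := Nat.le_mul_of_pos_right _ hU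
    nlinarith [Nat.zero_le (b - a), Nat.mul_le_mul_left (b - a) h3, Nat.zero_le ((b - a) * z * U)]

/-- No side of the box falls into the intervals of `e` on the first `d - 1` axes, so sides occur in
its children only on the last axis, namely in the children `k₀` and `k₁` containing `lo` and `hi -
1`. Children are numbered along the last axis. Those before `k₀` or after `k₁` miss the box; those
strictly between are all covered, or all missed, according to the behaviour of the box on the
earlier axes. -/
theorem plainEntry_spec (hV : Visitor ω U L d lo hi cellOp rangeOp J) (hd : 1 ≤ d)
    (hD : L.Decomp d K) {σ : State} {e : ℕ} (he : L.start (d - 1) ≤ e) (he' : e < L.start d)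
    (hlh : ∀ i < d, lo i < hi i ∧ hi i ≤ L.N) (h30 : σ.nreg 30 = e)
    (hcr : ¬ Crossing L d lo hi e)
    (h34 : σ.nreg 34 = 0 ↔ ∀ i < d - 1, lo i ≤ L.A i e ∧ L.B i e ≤ hi i)
    (hJ : J (L.first e) σ) (hU : 1 ≤ U) :
    Fast ω U (plainEntry d cellOp rangeOp) σ fun τ => J (L.first (e + 1)) τ ∧ τ.nreg 30 = e := by
  obtain ⟨m, rfl⟩ : ∃ m, d = m + 1 := ⟨d - 1, by omega⟩
  simp only [Nat.add_sub_cancel] at he h34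
  have hm : m < m + 1 := by omega
  obtain ⟨hlm, hhm⟩ := hlh m hm
  obtain ⟨k₀, hk₀⟩ : ∃ k, k = L.pt e (lo m) := ⟨_, rfl⟩
  obtain ⟨k₁, hk₁⟩ : ∃ k, k = L.pt e (hi m - 1) := ⟨_, rfl⟩
  have hm₀ := hD.pt_mem m hm e he he' (lo m) (by omega)
  have hm₁ := hD.pt_mem m hm e he he' (hi m - 1) (by omega)
  rw [← hk₀] at hm₀
  rw [← hk₁] at hm₁
  have h01 : k₀ ≤ k₁ := by
    rw [hk₀, hk₁]
    exact hD.pt_mono m hm e he he' _ _ (by omega) (by omega)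
  have hcell : ∀ k, L.first e ≤ k → k < L.first (e + 1) → L.IsCell (m + 1) k := fun k h1 h2 =>
    hD.child_level hm he he' h1 h2
  have hinh : ∀ k, L.first e ≤ k → k < L.first (e + 1) → ∀ i < m,
      L.A i k = L.A i e ∧ L.B i k = L.B i e := fun k h1 h2 => hD.inherit m hm e he he' k h1 h2
  have hint : ∀ k, L.first e ≤ k → k < L.first (e + 1) → L.A m k < L.B m k ∧ L.B m k ≤ L.N :=
    fun k h1 h2 => hD.interval m hm e he he' k h1 h2
  have hpt : ∀ k, L.first e ≤ k → k < L.first (e + 1) → ∀ r < L.N,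
      (L.A m k ≤ r ∧ r < L.B m k ↔ L.pt e r = k) :=
    fun k h1 h2 r hr => hD.pt_iff m hm e he he' r hr k h1 h2
  have hnoside : ∀ k, L.first e ≤ k → k < L.first (e + 1) → k ≠ k₀ → k ≠ k₁ →
      ∀ i < m + 1, ¬ SideIn L lo hi k i := by
    intro k h1 h2 hne0 hne1 i hi' hs
    by_cases him : i = m
    · subst him
      rcases hs with hs | hs
      · exact hne0 (((hpt k h1 h2 _ (by omega)).1 hs).symm.trans hk₀.symm)
      · exact hne1 (((hpt k h1 h2 (hi i - 1) (by omega)).1 (by omega)).symm.trans hk₁.symm)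
    · refine hcr ⟨i, by omega, ?_⟩
      have := hinh k h1 h2 i (by omega)
      rwa [SideIn, this.1, this.2] at hs
  have hbelow : ∀ k, L.first e ≤ k → k < k₀ → L.B m k ≤ lo m := by
    intro k h1 h2
    have h3 := hint k h1 (by omega)
    by_contra hlt
    have h4 := (hpt k h1 (by omega) (L.B m k - 1) (by omega)).1 (by omega)
    have h5 := hD.pt_mono m hm e he he' (lo m) (L.B m k - 1) (by omega) (by omega)
    omega
  have habove : ∀ k, k₁ < k → k < L.first (e + 1) → hi m ≤ L.A m k := by
    intro k h1 h2
    have h3 := hint k (by omega) h2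
    by_contra hlt
    have h4 := (hpt k (by omega) h2 (L.A m k) (by omega)).1 (by omega)
    have h5 := hD.pt_mono m hm e he he' (L.A m k) (hi m - 1) (by omega) (by omega)
    omega
  have hbetween : ∀ k, k₀ < k → k < k₁ → lo m ≤ L.A m k ∧ L.B m k ≤ hi m := by
    intro k h1 h2
    have h3 := hint k (by omega) (by omega)
    constructor
    · by_contra hlt
      have h4 := (hpt k (by omega) (by omega) (L.A m k) (by omega)).1 (by omega)
      have h5 := hD.pt_mono m hm e he he' (L.A m k) (lo m) (by omega) (by omega)
      omega
    · by_contra hlt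
      have h4 := (hpt k (by omega) (by omega) (L.B m k - 1) (by omega)).1 (by omega)
      have h5 := hD.pt_mono m hm e he he' (hi m - 1) (L.B m k - 1) (by omega) (by omega)
      omega
  obtain ⟨hS, hloc⟩ := hV.static _ _ hJ
  have hl := hloc m hm
  have e0 : σ.na 3 (σ.na 2 e + lo m) = k₀ := by
    rw [hS.pt e _ (by simpa using he) he' (by omega), hk₀]
  have e1 : σ.na 3 (σ.na 2 e + (hi m - 1)) = k₁ := by
    rw [hS.pt e _ (by simpa using he) he' (by omega), hk₁]
  refine Fast.seq_wp hU ?_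
  simp only [wp_seq, wp_setN]
  obtain ⟨σ₁, hσ₁⟩ : ∃ σ₁, σ₁ = ((σ.setN 35 k₀).setN 36 k₁).setN 60 k₀ := ⟨_, rfl⟩
  have hJ1 : J (L.first e) σ₁ := by
    rw [hσ₁]
    exact hV.setN _ _ _ _ (by norm_num) (hV.setN _ _ _ _ (by norm_num)
      (hV.setN _ _ _ _ (by norm_num) hJ))
  have hJ2 : J k₀ σ₁ := hV.skip_range hm₀.1 (fun k h1 h2 => ⟨hcell k h1 (by omega),
    ⟨m, hm, Or.inr (hbelow k h1 h2)⟩, hnoside k h1 (by omega) (by omega) (by omega)⟩) hJ1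
  have hreg : (((σ.setN 35 (NExp.eval σ (.arr 3 (.arr 2 (nv 30) +
      .arr (14 + 8 * (m + 1 - 1)) (nc 0))))).setN 36 (NExp.eval (σ.setN 35 (NExp.eval σ (.arr 3
      (.arr 2 (nv 30) + .arr (14 + 8 * (m + 1 - 1)) (nc 0))))) (.arr 3 (.arr 2 (nv 30) +
      (.arr (15 + 8 * (m + 1 - 1)) (nc 0) - nc 1))))).setN 60 k₀) = σ₁ := by
    rw [hσ₁]
    congr 2
    · simp [h30, hl.1, e0]
    · simp [h30, hl.2, e1]
  have e35 : NExp.eval ((σ.setN 35 (NExp.eval σ (.arr 3 (.arr 2 (nv 30) +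
      .arr (14 + 8 * (m + 1 - 1)) (nc 0))))).setN 36 (NExp.eval (σ.setN 35 (NExp.eval σ (.arr 3
      (.arr 2 (nv 30) + .arr (14 + 8 * (m + 1 - 1)) (nc 0))))) (.arr 3 (.arr 2 (nv 30) +
      (.arr (15 + 8 * (m + 1 - 1)) (nc 0) - nc 1))))) (nv 35) = k₀ := by
    simp [h30, hl.1, e0]
  rw [e35, hreg]
  refine Fast.seq ((hV.cell k₀ σ₁ (hcell k₀ hm₀.1 hm₀.2) hJ2 (by simp [hσ₁])).mono ?_)
  rintro τ ⟨h1, h2⟩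
  have t30 : τ.nreg 30 = e := by rw [h2 30 (by norm_num)]; simp [hσ₁, h30]
  have t34 : τ.nreg 34 = σ.nreg 34 := by rw [h2 34 (by norm_num)]; simp [hσ₁]
  have t35 : τ.nreg 35 = k₀ := by rw [h2 35 (by norm_num)]; simp [hσ₁]
  have t36 : τ.nreg 36 = k₁ := by rw [h2 36 (by norm_num)]; simp [hσ₁]
  have hend : ∀ {υ : State}, J (k₁ + 1) υ → J (L.first (e + 1)) υ := fun h =>
    hV.skip_range (by omega) (fun k h1 h2 => ⟨hcell k (by omega) h2,
    ⟨m, hm, Or.inl (habove k (by omega) h2)⟩, hnoside k (by omega) h2 (by omega) (by omega)⟩) h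
  refine Fast.ite hU (fun hlt => ?_) fun hlt => ?_
  · simp only [BExp.holds_nlt, NExp.eval_reg, t35, t36] at hlt
    have hmid : Fast ω U (.ite (.nlt (nv 34) (nc 1)) rangeOp .skip) τ fun υ => J k₁ υ ∧
        ∀ i < 61, υ.nreg i = τ.nreg i := by
      refine Fast.ite hU (fun hy => ?_) fun hy => ?_
      · simp only [BExp.holds_nlt, NExp.eval_reg, NExp.eval_const, t34, Nat.lt_one_iff, h34] at hy
        refine hV.range k₀ k₁ τ hlt (hcell k₁ hm₁.1 hm₁.2) (fun k h3 h4 =>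
          ⟨hcell k (by omega) (by omega), fun i hi' => ?_, hnoside k (by omega) (by omega)
            (by omega) (by omega)⟩) t35 t36 h1
        by_cases him : i = m
        · subst him; exact hbetween k h3 h4
        · have := hinh k (by omega) (by omega) i (by omega)
          rw [this.1, this.2]
          exact hy i (by omega)
      · simp only [BExp.holds_nlt, NExp.eval_reg, NExp.eval_const, t34, Nat.lt_one_iff, h34] at hy
        refine Fast.of_wp hU ?_
        rw [wp_skip]
        push Not at hy
        obtain ⟨i, hi', hy⟩ := hy
        refine ⟨hV.skip_range (by omega) (fun k h3 h4 => ⟨hcell k (by omega) (by omega),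
          ⟨i, by omega, ?_⟩, hnoside k (by omega) (by omega) (by omega) (by omega)⟩) h1,
          fun _ _ => rfl⟩
        have h5 := hinh k (by omega) (by omega) i (by omega)
        rw [h5.1, h5.2]
        -- An interval that contains neither end of `[lo i, hi i)` is covered by it or disjoint from
        -- it; covering is excluded by the choice of `i`.
        have h6 : ¬ SideIn L lo hi e i := fun h => hcr ⟨i, by omega, h⟩
        rw [SideIn] at h6
        have h7 := hD.entry_interval (by omega : m ≤ m + 1) he he' (by omega : i < m)
        have h8 := hlh i (by omega)
        omega
    refine Fast.seq (hmid.mono ?_)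
    rintro υ ⟨h3, h4⟩
    refine Fast.seq_wp hU ?_
    rw [wp_setN]
    have h36 : υ.nreg 36 = k₁ := by rw [h4 36 (by norm_num), t36]
    refine (hV.cell k₁ _ (hcell k₁ hm₁.1 hm₁.2) (hV.setN _ _ _ _ (by norm_num) h3)
      (by simp [h36])).mono ?_
    rintro φ ⟨h5, h6⟩
    exact ⟨hend h5, by rw [h6 30 (by norm_num)]; simp [h4 30 (by norm_num), t30]⟩
  · simp only [BExp.holds_nlt, NExp.eval_reg, t35, t36] at hlt
    refine Fast.of_wp hU ?_
    rw [wp_skip]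
    obtain rfl : k₀ = k₁ := by omega
    exact ⟨hend h1, t30⟩

-- A crossed entry has, on one of the first `d - 1` axes, the rank `lo i` or `hi i - 1` in its
-- interval, so `2 (d - 1)` applications of `card_through` suffice.
open Classical in
theorem card_crossing (hD : L.Decomp d K) (hlh : ∀ i < d, lo i < hi i ∧ hi i ≤ L.N) :
    ((Finset.Ico (L.start (d - 1)) (L.start d)).filter (Crossing L d lo hi)).card ≤
      (d - 1) * (2 * K ^ (d - 1 - 1)) := by
  have hsub : (Finset.Ico (L.start (d - 1)) (L.start d)).filter (Crossing L d lo hi) ⊆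
      (Finset.range (d - 1)).biUnion fun i => Layout.Decomp.through L (d - 1) i (lo i) ∪
        Layout.Decomp.through L (d - 1) i (hi i - 1) := by
    intro e he
    obtain ⟨h1, i, hi', h2⟩ := Finset.mem_filter.1 he
    rw [Finset.mem_Ico] at h1
    refine Finset.mem_biUnion.2 ⟨i, Finset.mem_range.2 hi', ?_⟩
    simp only [Layout.Decomp.through, Finset.mem_union, Finset.mem_filter, Finset.mem_Ico,
      show d - 1 + 1 = d by omega]
    rcases h2 with h2 | h2
    · exact Or.inl ⟨h1, h2⟩
    · exact Or.inr ⟨h1, by omega⟩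
  refine (Finset.card_le_card hsub).trans ((Finset.card_biUnion_le_card_mul _ _ _ ?_).trans
    (by rw [Finset.card_range]))
  intro i hi'
  rw [Finset.mem_range] at hi'
  have h1 := hlh i (by omega)
  have h2 := hD.card_through (m := d - 1) (by omega) hi' (show lo i < L.N by omega)
  have h3 := hD.card_through (m := d - 1) (by omega) hi' (show hi i - 1 < L.N by omega)
  exact (Finset.card_union_le _ _).trans (by omega)

/-- Every entry of level `d - 1` costs a bounded number of operations on cells and ranges, the
crossed ones up to `K + 1` times as much. There are at most `K ^ (d - 1)` entries and about `K ^ (d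
- 2)` crossed ones, so both contributions are of order `K ^ (d - 1)`. The cost per entry has to be
summed, as the maximum over the entries would lose a factor `K`. -/
theorem traverse_spec (hV : Visitor ω U L d lo hi cellOp rangeOp J) (hd : 1 ≤ d)
    (hD : L.Decomp d K) (hK : 1 ≤ K) (hlh : ∀ i < d, lo i < hi i ∧ hi i ≤ L.N) (hU : 1 ≤ U)
    {σ : State} (hJ : J (L.start d) σ) :
    Runs ω (traverse d cellOp rangeOp) σ
      ((traverse d cellOp rangeOp).wcost * U * ((4 * d + 2) * K ^ (d - 1)))
      (J (L.start (d + 1))) := by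
  classical
  obtain ⟨w, hw⟩ : ∃ w, w = (entryBody d cellOp rangeOp).wcost := ⟨_, rfl⟩
  obtain ⟨q, hq⟩ : ∃ q, q = (BExp.nlt (nv 30) (nv 6)).cost := ⟨_, rfl⟩
  obtain ⟨z, hz⟩ : ∃ z, z = (Prog.setN 30 (nv 5)).wcost := ⟨_, rfl⟩
  obtain ⟨cst, hcst⟩ : ∃ cst : ℕ → ℕ, cst = fun e =>
    w * U * (1 + if Crossing L d lo hi e then K + 1 else 0) := ⟨_, rfl⟩
  obtain ⟨hS, -⟩ := hV.static _ _ hJ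
  have hds : d - 1 + 1 = d := by omega
  have hst := hD.start_le (d - 1) (by omega)
  rw [hds] at hst
  have hbody : ∀ e τ, L.start (d - 1) ≤ e → e < L.start d → τ.nreg 30 = e → J (L.first e) τ →
      Runs ω (entryBody d cellOp rangeOp) τ (cst e)
        fun υ => υ.nreg 30 = e + 1 ∧ J (L.first (e + 1)) υ := by
    intro e τ he he' h30 hJe
    obtain ⟨hSe, hloce⟩ := hV.static _ _ hJe
    have hfl := hD.first_le (d - 1) (by omega) e he (by rwa [hds])
    have hcount := hD.count (d - 1) (by omega) e he (by rwa [hds])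
    have hcost : (entryHead d).wcost + (((BExp.nlt (nc 0) (nv 33)).cost +
        (if Crossing L d lo hi e then (K + 1) * ((crossingEntry cellOp).wcost * U)
          else (plainEntry d cellOp rangeOp).wcost * U)) +
        (Prog.setN 30 (nv 30 + nc 1)).wcost) ≤ cst e := by
      rw [hcst, hw]
      simp only [entryBody, Prog.wcost]
      generalize (entryHead d).wcost = x1
      generalize (BExp.nlt (nc 0) (nv 33)).cost = x2
      generalize (crossingEntry cellOp).wcost = x3
      generalize (plainEntry d cellOp rangeOp).wcost = x4
      generalize NExp.cost _ = x5
      have h1 : x1 ≤ x1 * U := Nat.le_mul_of_pos_right _ hU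
      have h2 : x2 ≤ x2 * U := Nat.le_mul_of_pos_right _ hU
      have h5 : x5 + 1 ≤ (x5 + 1) * U := Nat.le_mul_of_pos_right _ hU
      have e1 : (x1 + (x2 + x3 + x4 + (x5 + 1))) * U =
        x1 * U + x2 * U + x3 * U + x4 * U + (x5 + 1) * U := by ring
      split_ifs
      · rw [mul_add, mul_one, e1]
        have : (K + 1) * (x3 * U) ≤
            (x1 * U + x2 * U + x3 * U + x4 * U + (x5 + 1) * U) * (K + 1) := by
          rw [mul_comm (K + 1)]
          exact Nat.mul_le_mul_right _ (by omega)
        omega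
      · rw [add_zero, mul_one, e1]
        omega
    refine Runs.mono (Q := fun υ => υ.nreg 30 = e + 1 ∧ J (L.first (e + 1)) υ)
      (Runs.seq' (Runs.of_wp (entryHead_spec hSe hloce h30)) ?_ le_rfl) hcost fun _ => id
    rintro τ₁ ⟨x, y, rfl, hx, hy⟩
    obtain ⟨τ₁, hτ₁⟩ : ∃ τ₁, τ₁ = (((τ.setN 31 (L.first e)).setN 32 (L.first (e + 1))).setN 33
      x).setN 34 y := ⟨_, rfl⟩
    rw [← hτ₁]
    have hJ1 : J (L.first e) τ₁ := by
      rw [hτ₁]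
      exact hV.setN _ _ _ _ (by norm_num) (hV.setN _ _ _ _ (by norm_num)
        (hV.setN _ _ _ _ (by norm_num) (hV.setN _ _ _ _ (by norm_num) hJe)))
    have h33 : τ₁.nreg 33 = x := by simp [hτ₁]
    refine Runs.seq' (Q' := fun υ => J (L.first (e + 1)) υ ∧ υ.nreg 30 = e)
      (Runs.ite (fun hp => ?_) fun hp => ?_) (fun υ hυ => Runs.of_wp ?_) le_rfl
    · simp only [BExp.holds_nlt, NExp.eval_const, NExp.eval_reg, h33] at hp
      have hcr : Crossing L d lo hi e := by
        by_contra h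
        exact hp.ne' (hx.2 h)
      rw [if_pos hcr]
      refine (crossingEntry_spec hV hfl (fun k h1 h2 => ?_) (by simp [hτ₁]) (by simp [hτ₁])
        (by simp [hτ₁, h30]) hJ1 hU).mono (Nat.mul_le_mul_right _ (by omega)) fun _ => id
      have := hD.child_level (m := d - 1) (by omega) he (by rwa [hds]) h1 h2
      rwa [hds, show d - 1 + 2 = d + 1 by omega] at this
    · simp only [BExp.holds_nlt, NExp.eval_const, NExp.eval_reg, h33] at hp
      have hcr : ¬ Crossing L d lo hi e := hx.1 (by omega)
      rw [if_neg hcr]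
      exact plainEntry_spec hV hd hD he he' hlh (by simp [hτ₁, h30]) hcr (by simpa [hτ₁] using hy)
        hJ1 hU
    · rw [wp_setN]
      exact ⟨by simp [hυ.2], hV.setN _ _ _ _ (by norm_num) hυ.1⟩
  refine Runs.mono (T₁ := z + (∑ i ∈ Finset.range (L.start d - L.start (d - 1)),
    (q + cst (L.start d - (i + 1))) + q)) (Runs.seq' (Runs.of_wp (Q := fun τ => J (L.start d) τ ∧
      τ.nreg 30 = L.start (d - 1)) ?_) (fun τ hτ => ?_) (by rw [hz])) ?_ fun _ => id
  · rw [wp_setN]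
    exact ⟨hV.setN _ _ _ _ (by norm_num) hJ, by simp [hS.r5]⟩
  · rw [hq]
    refine Runs.loop (fun k τ => ∃ e, e + k = L.start d ∧ L.start (d - 1) ≤ e ∧ τ.nreg 30 = e ∧
      J (L.first e) τ) (fun k => cst (L.start d - (k + 1))) ?_ ?_ _ τ
      ⟨L.start (d - 1), by omega, le_rfl, hτ.2, ?_⟩
    · rintro k υ ⟨e, hek, he, h30, hJe⟩ hp
      have h6 := (hV.static _ _ hJe).1.r6
      simp only [BExp.holds_nlt, NExp.eval_reg, h30, h6] at hp
      refine ⟨k - 1, by omega, ?_⟩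
      rw [show L.start d - (k - 1 + 1) = e by omega]
      refine (hbody e υ he hp h30 hJe).mono le_rfl ?_
      rintro φ ⟨h1, h2⟩
      exact ⟨e + 1, by omega, by omega, h1, h2⟩
    · rintro k υ ⟨e, hek, he, h30, hJe⟩ hp
      have h6 := (hV.static _ _ hJe).1.r6
      simp only [BExp.holds_nlt, NExp.eval_reg, h30, h6] at hp
      obtain rfl : e = L.start d := by omega
      rwa [hD.first_start d le_rfl] at hJe
    · rw [hD.first_start _ (by omega), hds]
      exact hτ.1
  -- The loop rule indexes costs by the number of iterations left; reflection turns this into a sum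
  -- over the entries.
  · have hreidx : ∑ i ∈ Finset.range (L.start d - L.start (d - 1)),
        (q + cst (L.start d - (i + 1))) =
        ∑ e ∈ Finset.Ico (L.start (d - 1)) (L.start d), (q + cst e) := by
      rw [Finset.sum_Ico_eq_sum_range, ← Finset.sum_range_reflect]
      refine Finset.sum_congr rfl fun i hi' => ?_
      rw [Finset.mem_range] at hi'
      congr 2
      omega
    rw [hreidx, Finset.sum_add_distrib, hcst]
    simp only [← Finset.mul_sum, Finset.sum_add_distrib, Finset.sum_const, Nat.card_Ico,
      smul_eq_mul, mul_one, ← Finset.sum_filter]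
    have hcc := card_crossing hD hlh
    have hlev := hD.card_level (m := d - 1) (by omega)
    rw [hds] at hlev
    obtain ⟨P, hP⟩ : ∃ P, P = K ^ (d - 1) := ⟨_, rfl⟩
    have hP1 : 1 ≤ P := by rw [hP]; exact Nat.one_le_pow _ _ hK
    -- For `d = 1` there are no crossed entries; otherwise `K + 1 ≤ 2 * K` and the truncated
    -- exponent `d - 1 - 1` is genuine.
    have hcr : ((Finset.Ico (L.start (d - 1)) (L.start d)).filter (Crossing L d lo hi)).card *
        (K + 1) ≤ 4 * d * P := by
      refine (Nat.mul_le_mul_right _ hcc).trans ?_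
      rcases Nat.eq_zero_or_pos (d - 1) with h0 | h0
      · rw [h0]; simp
      · have : K ^ (d - 1 - 1) * K = P := by rw [hP, ← pow_succ]; congr 1; omega
        calc (d - 1) * (2 * K ^ (d - 1 - 1)) * (K + 1)
            ≤ d * (2 * K ^ (d - 1 - 1)) * (K + K) := by gcongr; omega
          _ = 4 * d * (K ^ (d - 1 - 1) * K) := by ring
          _ = 4 * d * P := by rw [this]
    rw [← hP] at hlev ⊢
    have hx : L.start d - L.start (d - 1) ≤ P := by omega
    generalize L.start d - L.start (d - 1) = x at hx ⊢
    generalize Finset.card _ = y at hcr ⊢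
    have hW : (traverse d cellOp rangeOp).wcost = z + (q + w) := by
      simp only [traverse, Prog.wcost, hz, hq, hw]
    rw [hW]
    have h1 : w * U * (x + (y * K + y)) ≤ w * U * ((4 * d + 1) * P) :=
      Nat.mul_le_mul_left _ (by nlinarith)
    have h2 : x * q ≤ q * U * P := by
      calc x * q ≤ P * (q * U) := Nat.mul_le_mul hx (Nat.le_mul_of_pos_right _ hU)
        _ = q * U * P := by ring
    have h3 : q ≤ q * U * P := by
      calc q = q * 1 * 1 := by ring
        _ ≤ q * U * P := by gcongr
    have h4 : z ≤ z * U * P := by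
      calc z = z * 1 * 1 := by ring
        _ ≤ z * U * P := by gcongr
    have h5 : (z + (q + w)) * U * ((4 * d + 2) * P) =
      (4 * d + 2) * (z * U * P) + (4 * d + 2) * (q * U * P) + (4 * d + 2) * (w * U * P) := by ring
    have h6 : w * U * ((4 * d + 1) * P) = (4 * d + 1) * (w * U * P) := by ring
    rw [h5]
    rw [h6] at h1
    nlinarith [Nat.zero_le (d * (z * U * P)), Nat.zero_le (d * (q * U * P)),
      Nat.zero_le (w * U * P)]

end

end RealRAM

namespace RealRAM

variable {d n : ℕ} {L : Layout} {K : ℕ}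

/-! ### All the trees -/

open Classical in
/-- The trees in memory: `α c` are the active boxes taken into account in cell `c`, and `W c p` is
the weight of the point `p` of cell `c`. -/
structure Forest (L : Layout) (d : ℕ) (σ : State) (α : ℕ → Finset (Fin n))
    (W : ℕ → (Fin d → ℕ) → ℝ) (G : ℕ → ℝ) (g : ℕ → ℕ → ℕ → ℝ) : Prop where
  cells : ∀ c, L.IsCell d c → CellTrees L d σ c (L.actVal d (α c) c) (g c)
  glob : TreeRep L.H (σ.tag (L.base 0)) (σ.sum (L.base 0)) G
    fun c => if L.IsCell d c then rootProd L d (L.actVal d (α c) c) (g c) else 0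
  wt : ∀ c, L.IsCell d c → ∀ p : Fin d → ℕ, L.InCell c p → G c * ∏ i : Fin d, g c i (p i) = W c p

theorem not_mem_opRegion {c c' i x : ℕ} (h : c' ≠ c) (hi : i < d) (hx : x < 2 * 2 ^ L.H) :
    L.base (d * c' + 1 + i) + x ∉ opRegion L d c := by
  rintro (h1 | ⟨h1, h2⟩)
  · exact not_mem_region (by omega) hx h1
  · rcases lt_or_gt_of_ne h with h3 | h3
    · have h5 : d * c' + d ≤ d * c := by nlinarith
      have h4 := L.base_mono (by omega : d * c' + 1 + i + 1 ≤ d * c + 1)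
      rw [L.base_succ] at h4
      omega
    · have h5 : d * c + d ≤ d * c' := by nlinarith
      have h4 := L.base_mono (by omega : d * c + 1 + d ≤ d * c' + 1 + i)
      omega

namespace Forest
variable {σ τ : State} {α α' : ℕ → Finset (Fin n)} {W W' : ℕ → (Fin d → ℕ) → ℝ} {G : ℕ → ℝ}
  {g : ℕ → ℕ → ℕ → ℝ}

theorem of_ra (h : Forest L d σ α W G g) (hra : τ.ra = σ.ra) : Forest L d τ α W G g :=
  ⟨fun c hc i hi => (h.cells c hc i hi).congr (fun x _ _ => by simp [State.tag, hra])
    fun x _ _ => by simp [State.sum, hra],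
    h.glob.congr (fun x _ _ => by simp [State.tag, hra]) fun x _ _ => by simp [State.sum, hra],
    h.wt⟩

theorem congr_wt (h : Forest L d σ α W G g)
    (hW : ∀ c, L.IsCell d c → ∀ p : Fin d → ℕ, L.InCell c p → W' c p = W c p) :
    Forest L d σ α W' G g :=
  ⟨h.cells, h.glob, fun c hc p hp => by rw [hW c hc p hp, h.wt c hc p hp]⟩

-- An operation on cell `c` writes only into the trees of `c` and the tree over all cells. All other
-- cells are preserved by the frame, and one leaf of the common tree is replaced.
open Classical in
theorem step (h : Forest L d σ α W G g) {m k c : ℕ} (hc : L.IsCell d c) {a : Finset (Fin n)}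
    {g' : ℕ → ℕ → ℝ} {w : (Fin d → ℕ) → ℝ} (hf : OpFrame m k (opRegion L d c) σ τ)
    (ht : CellTrees L d τ c (L.actVal d a c) g')
    (hG : TreeRep L.H (τ.tag (L.base 0)) (τ.sum (L.base 0)) G (Function.update
      (fun c => if L.IsCell d c then rootProd L d (L.actVal d (α c) c) (g c) else 0) c
      (rootProd L d (L.actVal d a c) g')))
    (hw : ∀ p : Fin d → ℕ, L.InCell c p → G c * ∏ i : Fin d, g' i (p i) = w p) :
    Forest L d τ (Function.update α c a) (Function.update W c w) G (Function.update g c g') := by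
  refine ⟨fun c' hc' => ?_, ?_, fun c' hc' => ?_⟩
  · by_cases hcc : c' = c
    · subst hcc
      simpa using ht
    · rw [Function.update_of_ne hcc, Function.update_of_ne hcc]
      exact fun i hi => hf.treeRep (h.cells c' hc' i hi) fun x hx => not_mem_opRegion hcc hi hx
  · convert hG using 1
    funext c'
    by_cases hcc : c' = c
    · subst hcc
      simp [hc]
    · simp [Function.update_of_ne hcc]
  · by_cases hcc : c' = c
    · subst hcc
      simpa using hw
    · rw [Function.update_of_ne hcc, Function.update_of_ne hcc]
      exact h.wt c' hc'

open Classical in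
/-- Multiplying the weights of a range of cells in the tree over all cells. -/
theorem scale (h : Forest L d σ α W G g) {m k a b : ℕ} {f : ℝ}
    (hf : OpFrame m k (region (2 ^ L.H) (L.base 0)) σ τ)
    (hG : TreeRep L.H (τ.tag (L.base 0)) (τ.sum (L.base 0))
      (fun q => if a ≤ q ∧ q < b then f * G q else G q)
      fun c => if L.IsCell d c then rootProd L d (L.actVal d (α c) c) (g c) else 0) :
    Forest L d τ α (fun c p => if a ≤ c ∧ c < b then f * W c p else W c p)
      (fun q => if a ≤ q ∧ q < b then f * G q else G q) g := by
  refine ⟨fun c hc => (h.cells c hc).of_opFrame hf, hG, fun c hc p hp => ?_⟩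
  split_ifs
  · rw [← h.wt c hc p hp]; ring
  · exact h.wt c hc p hp

end Forest

/-- Finishing cell `k` is an update at one place, which is the form in which `Forest.step` delivers
it. -/
theorem update_lt {β : Type*} (x y : β) (k : ℕ) :
    Function.update (fun c => if c < k then x else y) k x = fun c => if c < k + 1 then x else y := by
  funext c
  rcases lt_trichotomy c k with h | h | h
  · simp [h.ne, h, h.trans (Nat.lt_succ_self k)]
  · simp [h]
  · simp [h.ne', show ¬ c < k by omega, show ¬ c < k + 1 by omega]

theorem update_const {β : Type*} (x : β) (k : ℕ) :
    Function.update (fun _ : ℕ => x) k x = fun _ => x := by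
  funext c; simp [Function.update_apply]

section
variable {ω : Tape} {U : ℕ} {Bx : Fin n → AABox d} {lo hi : ℕ → ℕ} {σ₀ : State} {j : Fin n}
  {A A' : Finset (Fin n)} {w : (Fin d → ℕ) → ℝ} {f : ℝ}

theorem lt_size_of_box (hL : LayoutOK L Bx K)
    (hlh : ∀ i < d, lo i = L.pos i (2 * j) ∧ hi i = L.pos i (2 * j + 1) + 1) {i : ℕ} (hi' : i < d) :
    lo i < hi i ∧ hi i ≤ L.N := by
  have h1 := hlh i hi'
  have h2 := hL.ranks.lo_lt_hi hi' j.2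
  have h3 := hL.ranks.end_lt j
  have h4 := hL.ranks.pos_lt i hi' (2 * j + 1) h3
  omega

-- In the invariant the cells before `k` carry the new weights and the others the old ones. In a
-- covered cell all points lie in the box, so the common multiplier of the cell can absorb the
-- factor `f`.
open Classical in
theorem scale_visitor (hU : L.H < U) (hd : 1 ≤ d) (hL : LayoutOK L Bx K) (hS : Static L d σ₀)
    (hloc : Located d lo hi σ₀)
    (hlh : ∀ i < d, lo i = L.pos i (2 * j) ∧ hi i = L.pos i (2 * j + 1) + 1) (hf : 0 < f)
    (h14 : σ₀.rreg 14 = f) :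
    Visitor ω U L d lo hi (cellScale d) (rangeScale (nc 0) (nv 36) (nv 35 + nc 1))
      (fun k τ => OpFrame 30 14 Set.univ σ₀ τ ∧ ∃ G g, Forest L d τ (fun _ => A) (fun c =>
        if c < k then fun p => (if ∀ i : Fin d, lo i ≤ p i ∧ p i < hi i then f else 1) * w p
        else w) G g) where
  static k σ h := ⟨hS.of_opFrame (by norm_num) h.1, hloc.of_na h.1.na⟩
  setN k σ i v hi h := ⟨h.1.setN hi (by omega), by
    obtain ⟨G, g, hF⟩ := h.2
    exact ⟨G, g, hF.of_ra (by rw [State.setN_ra _ _ _ (by omega)])⟩⟩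
  skip k σ hk hdis _ h := by
    obtain ⟨h1, G, g, hF⟩ := h
    refine ⟨h1, G, g, hF.congr_wt fun c hc p hp => ?_⟩
    by_cases hck : c = k
    · subst hck
      rw [if_pos (Nat.lt_succ_self c), if_neg (lt_irrefl c), if_neg, one_mul]
      obtain ⟨i, hi', hdis⟩ := hdis
      intro hin
      have h2 := hin ⟨i, hi'⟩
      have h3 := hp ⟨i, hi'⟩
      simp only at h2 h3
      omega
    · have e : (c < k + 1) = (c < k) := by rw [eq_iff_iff]; omega
      simp only [e]
  cell k σ hk h h60 := by
    obtain ⟨h1, G, g, hF⟩ := h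
    have hlt : ∀ i < d, lo i ≤ hi i ∧ hi i < 2 ^ L.H := fun i hi' => by
      have := lt_size_of_box hL hlh hi'
      have := hL.sizeN
      omega
    refine (cellScale_spec (f := f) hU hd (hS.of_opFrame (by norm_num) h1) (hloc.of_na h1.na) h60 hk
      (hk.2.trans hL.size) hf (by rw [h1.rreg 14 (by norm_num) (by norm_num), h14]) hlt ?_
      (hF.cells k hk) hF.glob (by rw [if_pos hk])).mono ?_
    · intro hm i hi' i' hi'' h2 h3
      have l1 := hlh i hi'
      have l2 := hlh i' hi''
      rw [l1.1, l1.2] at h2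
      rw [l2.1, l2.2] at h3
      refine hL.ranks.eq_of_not_cover hL.decomp hk j.2 (fun i hi' => ?_) hi' hi'' h2 h3
      have := hm i hi'
      rwa [(hlh i hi').1, (hlh i hi').2] at this
    · rintro τ ⟨h2, g', h3, h4, h5⟩
      refine ⟨⟨h1.trans (h2.mono (by norm_num) le_rfl (Set.subset_univ _)), G,
        Function.update g k g', ?_⟩, h2.nreg⟩
      rw [← update_lt, ← update_const A k]
      refine hF.step hk h2 h3 h4 fun p hp => ?_
      have h6 := hF.wt k hk p hp
      rw [if_neg (lt_irrefl k)] at h6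
      rw [h5 p hp, ← h6]
      ring
  range k₀ k₁ σ h01 hk₁ hcov h35 h36 h := by
    obtain ⟨h1, G, g, hF⟩ := h
    have h4 : σ.nreg 4 = 2 ^ L.H := by rw [h1.nreg 4 (by norm_num), hS.r4]
    refine (rangeScale_spec (c := f) (h := k₁) (l := k₀ + 1) (β := L.base 0) hU h4 hf
      (by rw [h1.rreg 14 (by norm_num) (by norm_num), h14]) (by simp [Layout.base])
      (fun τ h2 _ => by simp [h2 36 (by norm_num), h36])
      (fun τ h2 _ => by simp [h2 35 (by norm_num), h35]) (hk₁.2.trans hL.size) h01 hF.glob).mono ?_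
    rintro τ ⟨h2, h3⟩
    refine ⟨⟨h1.trans (h2.mono (by norm_num) (by norm_num) (Set.subset_univ _)), _, g,
      (hF.scale (f := f) h2 h3).congr_wt fun c hc p hp => ?_⟩, fun i hi => h2.nreg i (by omega)⟩
    · by_cases ha : k₀ + 1 ≤ c ∧ c < k₁
      · obtain ⟨-, hcov, -⟩ := hcov c (by omega) ha.2
        rw [if_pos ha, if_pos ha.2, if_neg (show ¬ c < k₀ + 1 by omega), if_pos]
        intro i
        have h5 := hcov i i.2
        have h6 := hp i
        omega
      · rw [if_neg ha]
        by_cases hc' : c < k₁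
        · rw [if_pos hc', if_pos (show c < k₀ + 1 by omega)]
        · rw [if_neg hc', if_neg (show ¬ c < k₀ + 1 by omega)]

theorem own_side (hR : L.Ranks Bx) {i r : ℕ} (hi : i < d) (hr : r < L.N) (hj : L.own i r = j) :
    r = L.pos i (2 * j) ∨ r = L.pos i (2 * j + 1) := by
  rw [← hj]; exact hR.rank_eq hi hr

/-- A change of the status of `j` is visible only at ranks owned by `j`, that is at its sides, and
none of them lies in the intervals of this cell. -/
theorem actVal_eq_of_no_side (hL : LayoutOK L Bx K)
    (hlh : ∀ i < d, lo i = L.pos i (2 * j) ∧ hi i = L.pos i (2 * j + 1) + 1)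
    (hA : ∀ k, k ≠ j → (k ∈ A' ↔ k ∈ A)) {c : ℕ} (hc : L.IsCell d c)
    (hside : ∀ i < d, ¬ SideIn L lo hi c i) {i : ℕ} (hi' : i < d) :
    L.actVal d A' c i = L.actVal d A c i := by
  classical
  funext r
  have key : L.Active d A' c i r ↔ L.Active d A c i r := by
    refine and_congr_right fun h1 => and_congr_right fun _ => ?_
    refine exists_congr fun k => ?_
    by_cases hk : k = j
    · subst hk
      refine and_congr_left fun h2 => ?_
      have hrN := h1.2.trans_le (hL.decomp.entry_interval le_rfl hc.1 hc.2 hi').2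
      have h3 := hside i hi'
      rw [SideIn, (hlh i hi').1, (hlh i hi').2] at h3
      rcases own_side hL.ranks hi' hrN h2 with h4 | h4 <;> omega
    · rw [hA k hk]
  simp only [Layout.actVal, key]

theorem CellTrees.congr_a {σ : State} {c : ℕ} {a a' g : ℕ → ℕ → ℝ} (h : CellTrees L d σ c a g)
    (ha : ∀ i < d, a' i = a i) : CellTrees L d σ c a' g :=
  fun i hi => by rw [ha i hi]; exact h i hi

theorem Forest.congr_act' {σ : State} {α α' : ℕ → Finset (Fin n)} {W : ℕ → (Fin d → ℕ) → ℝ}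
    {G : ℕ → ℝ} {g : ℕ → ℕ → ℕ → ℝ} (h : Forest L d σ α W G g)
    (hα : ∀ c, L.IsCell d c → ∀ i < d, L.actVal d (α' c) c i = L.actVal d (α c) c i) :
    Forest L d σ α' W G g := by
  refine ⟨fun c hc => (h.cells c hc).congr_a (hα c hc), h.glob.congr_b fun c _ => ?_, h.wt⟩
  by_cases hc : L.IsCell d c
  · simp only [if_pos hc, rootProd]
    refine Finset.prod_congr rfl fun i hi => ?_
    rw [hα c hc i (Finset.mem_range.1 hi)]
  · simp only [if_neg hc]

/-- Covered cells contain no side of the box, so their activities do not change and the range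
operation can be `skip`. -/
theorem flag_visitor (hU : L.H < U) (hL : LayoutOK L Bx K) (hS : Static L d σ₀)
    (hloc : Located d lo hi σ₀)
    (hlh : ∀ i < d, lo i = L.pos i (2 * j) ∧ hi i = L.pos i (2 * j + 1) + 1)
    (h14 : σ₀.rreg 14 = if j ∈ A' then 1 else 0) (hA : ∀ k, k ≠ j → (k ∈ A' ↔ k ∈ A)) :
    Visitor ω U L d lo hi (cellFlag d) .skip
      (fun k τ => OpFrame 30 14 Set.univ σ₀ τ ∧
        ∃ G g, Forest L d τ (fun c => if c < k then A' else A) (fun _ => w) G g) where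
  static k σ h := ⟨hS.of_opFrame (by norm_num) h.1, hloc.of_na h.1.na⟩
  setN k σ i v hi h := ⟨h.1.setN hi (by omega), by
    obtain ⟨G, g, hF⟩ := h.2
    exact ⟨G, g, hF.of_ra (by rw [State.setN_ra _ _ _ (by omega)])⟩⟩
  skip k σ hk _ hside h := by
    obtain ⟨h1, G, g, hF⟩ := h
    refine ⟨h1, G, g, hF.congr_act' fun c hc i hi' => ?_⟩
    by_cases hck : c = k
    · subst hck
      rw [if_pos (by omega), if_neg (by omega)]
      exact actVal_eq_of_no_side hL hlh hA hc hside hi'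
    · have e : (c < k + 1) = (c < k) := by rw [eq_iff_iff]; omega
      simp only [e]
  cell k σ hk h h60 := by
    obtain ⟨h1, G, g, hF⟩ := h
    have hct := hF.cells k hk
    rw [if_neg (lt_irrefl k)] at hct
    refine (cellFlag_spec (A := A) (A' := A') hU hL (hS.of_opFrame (by norm_num) h1)
      (hloc.of_na h1.na) h60 hk hlh (by rw [h1.rreg 14 (by norm_num) (by norm_num), h14]) hA
      hct hF.glob).mono ?_
    rintro τ ⟨h2, h3, h4⟩
    refine ⟨⟨h1.trans (h2.mono (by norm_num) le_rfl (Set.subset_univ _)), G,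
      Function.update g k (g k), ?_⟩, h2.nreg⟩
    rw [← update_lt, ← update_const w k]
    exact hF.step hk h2 h3 h4 (hF.wt k hk)
  range k₀ k₁ σ h01 _ hcov _ _ h := by
    obtain ⟨h1, G, g, hF⟩ := h
    refine Fast.of_wp (by omega) ⟨⟨h1, G, g, hF.congr_act' fun c hc i hi' => ?_⟩, fun _ _ => rfl⟩
    by_cases ha : k₀ + 1 ≤ c ∧ c < k₁
    · rw [if_pos ha.2, if_neg (by omega)]
      exact actVal_eq_of_no_side hL hlh hA hc (hcov c (by omega) ha.2).2.2 hi'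
    · have e : (c < k₁) = (c < k₀ + 1) := by rw [eq_iff_iff]; omega
      simp only [e]

end

end RealRAM

namespace RealRAM

variable {d n : ℕ} {L : Layout} {K : ℕ}

/-! ### The weight of a box -/

open Classical in
/-- The total weight of the vertices in cell `c` and in the box `[lo, hi)`. -/
noncomputable def cellSum (L : Layout) (d : ℕ) (A : Finset (Fin n)) (w : (Fin d → ℕ) → ℝ)
    (lo hi : ℕ → ℕ) (c : ℕ) : ℝ :=
  ∑ p ∈ (L.cellBox d c).filter (fun p => L.Vert A p ∧ ∀ i : Fin d, lo i ≤ p i ∧ p i < hi i), w p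

section
variable {ω : Tape} {U : ℕ} {Bx : Fin n → AABox d} {lo hi : ℕ → ℕ} {σ σ₀ : State}
  {A : Finset (Fin n)} {w : (Fin d → ℕ) → ℝ} {G : ℕ → ℝ} {g : ℕ → ℕ → ℕ → ℝ}

theorem cellSum_eq (hL : LayoutOK L Bx K) (hF : Forest L d σ (fun _ => A) (fun _ => w) G g) {c : ℕ}
    (hc : L.IsCell d c) (hlh : ∀ i < d, lo i ≤ hi i) :
    cellSum L d A w lo hi c = G c * ∏ i ∈ Finset.range d,
      (∑ r ∈ Finset.range (hi i), L.actVal d A c i r * g c i r -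
        ∑ r ∈ Finset.range (lo i), L.actVal d A c i r * g c i r) := by
  rw [cellSum, Layout.sum_cell hL.ranks hL.decomp hc A (hF.wt c hc) fun i => hlh i i.2,
    Finset.prod_range]

theorem cellSum_eq_zero {c : ℕ} (h : ∃ i < d, hi i ≤ L.A i c ∨ L.B i c ≤ lo i) :
    cellSum L d A w lo hi c = 0 := by
  classical
  rw [cellSum, Finset.filter_eq_empty_iff.2, Finset.sum_empty]
  rintro p hp ⟨-, hin⟩
  obtain ⟨i, hi', h⟩ := h
  have h1 := Layout.mem_cellBox.1 hp ⟨i, hi'⟩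
  have h2 := hin ⟨i, hi'⟩
  simp only at h1 h2
  omega

/-- For a covered cell the box may be replaced by the whole grid, and the range sums become root
sums; the contribution is the weight of a single leaf of the tree over all cells. -/
theorem cellSum_covered (hL : LayoutOK L Bx K) (hF : Forest L d σ (fun _ => A) (fun _ => w) G g)
    {c : ℕ} (hc : L.IsCell d c) (h : ∀ i < d, lo i ≤ L.A i c ∧ L.B i c ≤ hi i) :
    cellSum L d A w lo hi c = rootProd L d (L.actVal d A c) (g c) * G c := by
  classical
  have h1 : cellSum L d A w lo hi c = cellSum L d A w (fun _ => 0) (fun _ => 2 ^ L.H) c := by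
    rw [cellSum, cellSum]
    congr 1
    refine Finset.filter_congr fun p hp => and_congr_right fun _ => ?_
    rw [Layout.mem_cellBox] at hp
    refine ⟨fun _ i => ⟨Nat.zero_le _, ?_⟩, fun _ i => ?_⟩
    · have h1 := (hL.decomp.entry_interval le_rfl hc.1 hc.2 i.2).2
      have h2 := hL.sizeN
      exact (hp i).2.trans_le (h1.trans h2.le)
    · have h1 := h i i.2
      have h2 := hp i
      omega
  rw [h1, cellSum_eq hL hF hc fun _ _ => Nat.zero_le _]
  simp [rootProd, mul_comm]

open Classical in
theorem sum_cellSum (hL : LayoutOK L Bx K) (S : Multiset (Fin n)) {b : AABox d}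
    (hb : L.Locates lo hi b) :
    AABox.totalWeight Bx S (AABox.vertices Bx A ∩ (b : Set (Fin d → ℝ))) =
      ∑ c ∈ Finset.Ico (L.start d) (L.start (d + 1)), cellSum L d A (L.rankWeight S) lo hi c := by
  simp only [Layout.totalWeight_inter hL.ranks A S hb, cellSum, Layout.verts,
    Finset.filter_filter, Finset.sum_filter]
  exact Layout.sum_grid hL.decomp _

/-- Add the weight of the covered cells to real register `15`. -/
def addRange : Prog := rangeQuery (nc 0) (nv 36) (nv 35 + nc 1) ;; .setR 15 (rv 15 + rv 11)

/-- Register `15` accumulates the weights of the cells passed so far. A run of covered cells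
contributes one range sum of the tree over all cells. -/
theorem query_visitor (hU : L.H < U) (hL : LayoutOK L Bx K) (hS : Static L d σ₀)
    (hloc : Located d lo hi σ₀) (hlh : ∀ i < d, lo i < hi i ∧ hi i ≤ L.N)
    (hF : Forest L d σ₀ (fun _ => A) (fun _ => w) G g) :
    Visitor ω U L d lo hi (cellQuery d) addRange
      (fun k τ => OpFrame 30 16 ∅ σ₀ τ ∧ τ.ra = σ₀.ra ∧
        τ.rreg 15 = ∑ c ∈ Finset.Ico (L.start d) k, cellSum L d A w lo hi c) where
  static k σ h := ⟨hS.of_opFrame (by norm_num) h.1, hloc.of_na h.1.na⟩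
  setN k σ i v hi h := ⟨h.1.setN hi (by omega), by rw [State.setN_ra _ _ _ (by omega), h.2.1],
    by rw [State.setN_rreg, h.2.2]⟩
  skip k σ hk hdis _ h := by
    refine ⟨h.1, h.2.1, ?_⟩
    rw [Finset.sum_Ico_succ_top hk.1, cellSum_eq_zero hdis, add_zero, h.2.2]
  cell k σ hk h h60 := by
    obtain ⟨h1, h2, h3⟩ := h
    have hF' := hF.of_ra h2
    have hN := hL.sizeN
    refine (cellQuery_spec hU (hS.of_opFrame (by norm_num) h1) (hloc.of_na h1.na) h60 hk
      (hk.2.trans hL.size) (fun i hi' => by have := hlh i hi'; omega) (hF'.cells k hk)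
      hF'.glob).mono ?_
    rintro τ ⟨h4, h5, h6⟩
    refine ⟨⟨h1.trans (h4.mono (by norm_num) le_rfl le_rfl), h5.trans h2, ?_⟩, h4.nreg⟩
    rw [h6, h3, Finset.sum_Ico_succ_top hk.1,
      cellSum_eq hL hF' hk fun i hi' => (hlh i hi').1.le]
  range k₀ k₁ σ h01 hk₁ hcov h35 h36 h := by
    obtain ⟨h1, h2, h3⟩ := h
    have hF' := hF.of_ra h2
    have h4 : σ.nreg 4 = 2 ^ L.H := by rw [h1.nreg 4 (by norm_num), hS.r4]
    have hk := hk₁.2.trans hL.size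
    refine Fast.seq ((rangeQuery_spec (R := ∅) (h := k₁) (l := k₀ + 1) (β := L.base 0) hU h4
      (fun _ _ _ => by simp [Layout.base])
      (fun τ h2 _ => by simp [h2 36 (by norm_num), h36])
      (fun τ h2 _ => by simp [h2 35 (by norm_num), h35]) hk (by omega) hF'.glob).mono ?_)
    rintro τ ⟨h5, h6, h7⟩
    refine Fast.of_wp (by omega) ?_
    rw [wp_setR]
    refine ⟨⟨(h1.trans (h5.mono (by norm_num) (by norm_num) le_rfl)).setR (by norm_num),
      h6.trans h2, ?_⟩, fun i hi => h5.nreg i (by omega)⟩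
    have h15 : τ.rreg 15 = σ.rreg 15 := h5.rreg 15 (by norm_num) (by norm_num)
    simp only [State.setR_rreg, if_true, RExp.eval_add, RExp.eval_reg, h15, h7, h3]
    rw [← Finset.sum_Ico_eq_sub _ (by omega : k₀ + 1 ≤ k₁)]
    rcases Nat.lt_or_ge (k₀ + 1) k₁ with hlt | hge
    · rw [← Finset.sum_Ico_consecutive _ (hcov (k₀ + 1) (by omega) hlt).1.1 hlt.le]
      congr 1
      refine Finset.sum_congr rfl fun c hc => ?_
      rw [Finset.mem_Ico] at hc
      obtain ⟨hc1, hc2, -⟩ := hcov c (by omega) hc.2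
      rw [cellSum_covered hL hF' hc1 hc2, if_pos hc1]
    · obtain rfl : k₁ = k₀ + 1 := by omega
      simp

end

/-! ### Locating a box -/

/-- Put into register `40` the number of ranks that satisfy the test `t` (on register `42`), which
is satisfied by an initial segment of the ranks. -/
def bsearch (t : BExp) : Prog :=
  (.setN 40 (nc 0) ;; .setN 41 (nv 2)) ;; .loop (.nlt (nv 40) (nv 41))
    (.setN 42 (.half (nv 40 + nv 41)) ;; .ite t (.setN 40 (nv 42 + nc 1)) (.setN 41 (nv 42)))

/-- Before the answer lies between registers `40` and `41`, everything below is known to satisfy `p`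
and everything above not to. Each step halves the gap, which is less than `2 ^ k` with `k` steps
left. -/
theorem bsearch_spec {ω : Tape} {U H N : ℕ} {t : BExp} {σ : State} {p : ℕ → Prop} (hU : H < U)
    (h2 : σ.nreg 2 = N) (hN : N < 2 ^ H) (hp : ∀ r r', r ≤ r' → r' < N → p r' → p r)
    (ht : ∀ a b, ∀ r < N, t.Holds (((σ.setN 40 a).setN 41 b).setN 42 r) ↔ p r) :
    Fast ω U (bsearch t) σ fun τ => ∃ a b c, τ = ((σ.setN 40 a).setN 41 b).setN 42 c ∧ a ≤ N ∧
      ∀ r < N, p r ↔ r < a := by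
  refine Fast.seq_wp (by omega) ?_
  simp only [wp_seq, wp_setN]
  refine Fast.loop (fun k τ => ∃ a b c, τ = ((σ.setN 40 a).setN 41 b).setN 42 c ∧ b - a < 2 ^ k ∧
    a ≤ b ∧ b ≤ N ∧ (∀ r < a, p r) ∧ ∀ r, b ≤ r → r < N → ¬ p r) ?_ ?_ hU
    ⟨0, N, σ.nreg 42, ?_, by omega, by omega, le_rfl, by simp, fun r h1 h2 => by omega⟩
  · rintro k τ ⟨a, b, c, rfl, hk, hab, hbN, h1, h3⟩ hlt
    simp at hlt
    obtain ⟨k', rfl⟩ : ∃ k', k = k' + 1 := ⟨k - 1, by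
      rcases Nat.eq_zero_or_pos k with rfl | h
      · simp at hk; omega
      · omega⟩
    refine ⟨k', rfl, ?_⟩
    rw [pow_succ] at hk
    have hm : (a + b) / 2 < N := by omega
    have e : ((((σ.setN 40 a).setN 41 b).setN 42 c).setN 42 ((a + b) / 2)) =
        ((σ.setN 40 a).setN 41 b).setN 42 ((a + b) / 2) := State.setN_setN _ _ _ _
    have e1 : NExp.eval (((σ.setN 40 a).setN 41 b).setN 42 c) (.half (nv 40 + nv 41)) =
        (a + b) / 2 := by simp
    simp only [wp_seq, wp_setN, wp_ite, e1, e, ht a b _ hm]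
    refine ⟨fun hpm => ⟨(a + b) / 2 + 1, b, (a + b) / 2, ?_, by omega, by omega, hbN,
      fun r hr => hp r _ (by omega) hm hpm, h3⟩,
      fun hpm => ⟨a, (a + b) / 2, (a + b) / 2, ?_, by omega, by omega, by omega, h1,
      fun r hr hrN hpr => hpm (hp _ r hr hrN hpr)⟩⟩
    · rw [State.setN_comm _ (by norm_num : (42 : ℕ) ≠ 40),
        State.setN_comm _ (by norm_num : (41 : ℕ) ≠ 40), State.setN_setN]
      simp
    · rw [State.setN_comm _ (by norm_num : (42 : ℕ) ≠ 41), State.setN_setN]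
      simp
  · rintro k τ ⟨a, b, c, rfl, hk, hab, hbN, h1, h3⟩ hlt
    simp at hlt
    obtain rfl : a = b := by omega
    refine ⟨a, a, c, rfl, hbN, fun r hr => ⟨fun h => ?_, h1 r⟩⟩
    by_contra hle
    exact h3 r (by omega) hr h
  · simp only [NExp.eval_const, NExp.eval_reg, State.setN_nreg, h2]
    simp [State.setN]

/-- `τ` arises from `σ` by using scratch memory only. -/
structure SoftFrame (σ τ : State) : Prop where
  nreg : ∀ i < 40, τ.nreg i = σ.nreg i
  rreg : τ.rreg = σ.rreg
  ra : τ.ra = σ.ra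
  na : ∀ f k, (f < 10 ∨ (2 ≤ f % 8 ∧ f % 8 ≤ 5)) → τ.na f k = σ.na f k

/-- Axis `i` uses the arrays `10 + 8 * i` to `17 + 8 * i`: residues `2, 3, 4, 5` modulo `8` hold the
permanent tables, `6` and `7` the located box, `0` the sampled rank. Array `0` holds the counters,
so it is exempt here. -/
theorem Static.of_soft {σ τ : State} (h : Static L d σ) (hn : ∀ i < 10, τ.nreg i = σ.nreg i)
    (ha : ∀ f k, ((1 ≤ f ∧ f < 10) ∨ (10 ≤ f ∧ 2 ≤ f % 8 ∧ f % 8 ≤ 5)) → τ.na f k = σ.na f k)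
    (hr : ∀ f j, 2 ≤ f → τ.ra f j = σ.ra f j) : Static L d τ := by
  constructor
  · rw [hn _ (by norm_num), h.r2]
  · rw [hn _ (by norm_num), h.r4]
  · rw [hn _ (by norm_num), h.r5]
  · rw [hn _ (by norm_num), h.r6]
  · intro e; rw [ha _ _ (by omega), h.first]
  · intro e r h1 h2 h3
    rw [ha _ _ (by omega), ha _ _ (by omega), h.pt e r h1 h2 h3]
  · intro c hc; rw [ha _ _ (by omega), h.cb c hc]
  · intro i hi r; rw [ha _ _ (by omega), h.Q i hi]
  · intro i hi r; rw [ha _ _ (by omega), h.pos i hi]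
  · intro i hi r; rw [ha _ _ (by omega), h.A i hi]
  · intro i hi r; rw [ha _ _ (by omega), h.B i hi]
  · intro i hi r; rw [hr _ _ (by omega), h.X i hi r]

/-- The box in the real registers is located on axis `i`. -/
def locateAxis (i : ℕ) : Prog :=
  bsearch (.rlt (.arr (3 + i) (nv 42)) (rv (2 * i))) ;; putN (14 + 8 * i) (nc 0) (nv 40) ;;
  bsearch (BExp.rlt (rv (2 * i + 1)) (.arr (3 + i) (nv 42))).not ;;
  putN (15 + 8 * i) (nc 0) (nv 40)

def locate (d : ℕ) : Prog := forAx locateAxis d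

theorem locateAxis_spec {ω : Tape} {U i : ℕ} {Bx : Fin n → AABox d} {σ : State} (hi : i < d)
    (hU : L.H < U) (hL : LayoutOK L Bx K) (hS : Static L d σ) :
    Fast ω U (locateAxis i) σ fun τ => SoftFrame σ τ ∧
      (∀ f, f ≠ 14 + 8 * i → f ≠ 15 + 8 * i → τ.na f = σ.na f) ∧
      (τ.na (14 + 8 * i) 0 ≤ L.N ∧ τ.na (15 + 8 * i) 0 ≤ L.N ∧
        (∀ r < L.N, L.X i r < σ.rreg (2 * i) ↔ r < τ.na (14 + 8 * i) 0) ∧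
        ∀ r < L.N, L.X i r ≤ σ.rreg (2 * i + 1) ↔ r < τ.na (15 + 8 * i) 0) := by
  have hX : ∀ r r', r ≤ r' → r' < L.N → L.X i r ≤ L.X i r' := fun r r' h h' =>
    (hL.ranks.X_le_iff hi (by omega) h').2 h
  refine Fast.seq ((bsearch_spec (p := fun r => L.X i r < σ.rreg (2 * i)) hU hS.r2 hL.sizeN
    (fun r r' h h' hp => (hX r r' h h').trans_lt hp)
    (fun a b r _ => by simp [hS.X i hi])).mono ?_)
  rintro τ ⟨a, b, c, rfl, haN, ha⟩
  refine Fast.seq_wp (by omega) ?_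
  rw [wp_putN]
  obtain ⟨τ, hτ⟩ : ∃ τ, τ = (((σ.setN 40 a).setN 41 b).setN 42 c).putNA (14 + 8 * i) 0 a :=
    ⟨_, rfl⟩
  have e : (((σ.setN 40 a).setN 41 b).setN 42 c).putNA (14 + 8 * i) ((nc 0).eval
      (((σ.setN 40 a).setN 41 b).setN 42 c)) ((nv 40).eval (((σ.setN 40 a).setN 41 b).setN 42 c)) =
      τ := by simp [hτ]
  rw [e]
  refine Fast.seq ((bsearch_spec (p := fun r => L.X i r ≤ σ.rreg (2 * i + 1)) hU
    (by simp [hτ, hS.r2]) hL.sizeN (fun r r' h h' hp => (hX r r' h h').trans hp)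
    (fun a b r _ => by simp [hS.X i hi, hτ])).mono ?_)
  rintro υ ⟨a', b', c', rfl, haN', ha'⟩
  refine Fast.of_wp (by omega) ?_
  rw [wp_putN]
  refine ⟨⟨fun k hk => ?_, by simp [hτ], by simp [hτ], fun f k hf => ?_⟩, fun f h1 h2 => ?_, ?_⟩
  · simp only [State.putNA_nreg, State.setN_nreg, hτ]
    rw [if_neg (by omega), if_neg (by omega), if_neg (by omega), if_neg (by omega),
      if_neg (by omega), if_neg (by omega)]
  · simp only [State.putNA_na, State.setN_na, hτ]
    rw [if_neg (by omega), if_neg (by omega)]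
  · funext k
    simp [hτ, h1, h2]
  · simp [hτ, haN, haN']
    exact ⟨ha, ha'⟩

theorem locate_spec {ω : Tape} {U : ℕ} {Bx : Fin n → AABox d} {σ : State} {b : AABox d}
    (hU : L.H < U) (hL : LayoutOK L Bx K) (hS : Static L d σ)
    (hb : ∀ i : Fin d, σ.rreg (2 * i) = b.fst i ∧ σ.rreg (2 * i + 1) = b.snd i) :
    Fast ω U (locate d) σ fun τ => SoftFrame σ τ ∧ ∃ lo hi, Located d lo hi τ ∧
      L.Locates lo hi b := by
  refine (Fast.forAx (by omega) (fun m τ => SoftFrame σ τ ∧ ∀ i < m,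
      (τ.na (14 + 8 * i) 0 ≤ L.N ∧ τ.na (15 + 8 * i) 0 ≤ L.N ∧
        (∀ r < L.N, L.X i r < σ.rreg (2 * i) ↔ r < τ.na (14 + 8 * i) 0) ∧
        ∀ r < L.N, L.X i r ≤ σ.rreg (2 * i + 1) ↔ r < τ.na (15 + 8 * i) 0)) ?_
    ⟨⟨fun _ _ => rfl, rfl, rfl, fun _ _ _ => rfl⟩, by simp⟩).mono ?_
  · rintro i hi τ ⟨h1, h2⟩
    have hS' : Static L d τ := hS.of_soft (fun i hi => h1.nreg i (by omega))
      (fun f k hf => h1.na f k (by omega)) fun f j _ => by rw [h1.ra]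
    refine (locateAxis_spec hi hU hL hS').mono ?_
    rintro υ ⟨h3, h4, h5⟩
    rw [h1.rreg] at h5
    refine ⟨⟨fun i hi => (h3.nreg i hi).trans (h1.nreg i hi), h3.rreg.trans h1.rreg,
      h3.ra.trans h1.ra, fun f k hf => (h3.na f k hf).trans (h1.na f k hf)⟩, fun i' hi' => ?_⟩
    by_cases hii : i' = i
    · subst hii; exact h5
    · rw [h4 _ (by omega) (by omega), h4 _ (by omega) (by omega)]
      exact h2 i' (by omega)
  · rintro τ ⟨h1, h2⟩
    refine ⟨h1, fun i => τ.na (14 + 8 * i) 0, fun i => τ.na (15 + 8 * i) 0,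
      fun i _ => ⟨rfl, rfl⟩, fun i => ?_⟩
    have := h2 i i.2
    rwa [(hb i).1, (hb i).2] at this

theorem withBox_rreg (σ : State) (b : AABox d) (i : Fin d) :
    (σ.withBox b).rreg (2 * i) = b.fst i ∧ (σ.withBox b).rreg (2 * i + 1) = b.snd i := by
  have h1 : 2 * (i : ℕ) < 2 * d := by omega
  have h2 : 2 * (i : ℕ) + 1 < 2 * d := by omega
  have e1 : 2 * (i : ℕ) / 2 = i := by omega
  have e2 : (2 * (i : ℕ) + 1) / 2 = i := by omega
  constructor
  · simp [State.withBox, AABox.coords, h1, e1]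
  · simp [State.withBox, AABox.coords, h2, e2]

end RealRAM

namespace RealRAM

variable {d n : ℕ} {L : Layout} {K : ℕ}

/-! ### The operations -/

/-- The memory represents the active set `A` and the multiset `S`. -/
structure Rep (L : Layout) (d : ℕ) (σ : State) (A : Finset (Fin n)) (S : Multiset (Fin n)) :
    Prop where
  static : Static L d σ
  forest : ∃ G g, Forest L d σ (fun _ => A) (fun _ => L.rankWeight S) G g
  count : ∀ j : Fin n, σ.na 0 (L.pos 0 (2 * j)) = S.count j

theorem Fast.mono_time {ω : Tape} {U U' : ℕ} {P : Prog} {σ : State} {Q : State → Prop}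
    (h : Fast ω U P σ Q) (hU : U ≤ U') : Fast ω U' P σ Q :=
  Runs.mono h (Nat.mul_le_mul_left _ hU) fun _ => id

theorem traverse_fast {ω : Tape} {U : ℕ} {cellOp rangeOp : Prog} {lo hi : ℕ → ℕ}
    {J : ℕ → State → Prop} (hV : Visitor ω U L d lo hi cellOp rangeOp J) (hd : 1 ≤ d)
    (hD : L.Decomp d K) (hK : 1 ≤ K) (hlh : ∀ i < d, lo i < hi i ∧ hi i ≤ L.N) (hU : 1 ≤ U)
    {σ : State} (hJ : J (L.start d) σ) :
    Fast ω (U * ((4 * d + 2) * K ^ (d - 1))) (traverse d cellOp rangeOp) σ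
      (J (L.start (d + 1))) :=
  (traverse_spec hV hd hD hK hlh hU hJ).mono (by rw [mul_assoc]) fun _ => id

theorem Rep.of_eq {σ τ : State} {A : Finset (Fin n)} {S : Multiset (Fin n)} (h : Rep L d σ A S)
    (hn : ∀ i < 10, τ.nreg i = σ.nreg i) (hr : τ.ra = σ.ra)
    (ha : ∀ f k, (f < 10 ∨ (2 ≤ f % 8 ∧ f % 8 ≤ 5)) → τ.na f k = σ.na f k) : Rep L d τ A S := by
  obtain ⟨G, g, hF⟩ := h.forest
  exact ⟨h.static.of_soft hn (fun f k hk => ha f k (by omega)) fun _ _ _ => by rw [hr],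
    ⟨G, g, hF.of_ra hr⟩, fun j => by rw [ha _ _ (by omega), h.count j]⟩

theorem Rep.of_soft {σ τ : State} {A : Finset (Fin n)} {S : Multiset (Fin n)} (h : Rep L d σ A S)
    (hf : SoftFrame σ τ) : Rep L d τ A S :=
  h.of_eq (fun i hi => hf.nreg i (by omega)) hf.ra hf.na

theorem rep_withBox {σ : State} {A : Finset (Fin n)} {S : Multiset (Fin n)} (h : Rep L d σ A S)
    (b : AABox d) : Rep L d (σ.withBox b) A S :=
  h.of_eq (fun _ _ => rfl) rfl fun _ _ _ => rfl

theorem rankWeight_cons (j : Fin n) (S : Multiset (Fin n)) (p : Fin d → ℕ) [Decidable (L.InBox j p)] :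
    L.rankWeight (j ::ₘ S) p = (if L.InBox j p then 2 else 1) * L.rankWeight S p := by
  rw [Layout.rankWeight, Layout.rankWeight, Multiset.countP_cons, pow_add]
  split_ifs <;> ring

/-- Boxes arrive by their coordinates, not by their index. The rank of the lower endpoint on axis
`0`, found by the search, serves as the address of the counter of the box. -/
theorem pos_injective {Bx : Fin n → AABox d} (hL : LayoutOK L Bx K) (hd : 1 ≤ d) (j k : Fin n) :
    L.pos 0 (2 * j) = L.pos 0 (2 * k) ↔ j = k := by
  refine ⟨fun h => ?_, fun h => by rw [h]⟩
  have h1 := hL.ranks.Q_pos 0 hd (2 * j) (by have := hL.ranks.end_lt j; omega)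
  have h2 := hL.ranks.Q_pos 0 hd (2 * k) (by have := hL.ranks.end_lt k; omega)
  rw [h, h2] at h1
  exact Fin.ext (by omega)

section
variable {ω : Tape} {U : ℕ} {Bx : Fin n → AABox d} {lo hi : ℕ → ℕ} {σ : State} {j : Fin n}
  {A : Finset (Fin n)} {S : Multiset (Fin n)}

theorem locates_box (hL : LayoutOK L Bx K) (h : L.Locates lo hi (Bx j)) :
    ∀ i < d, lo i = L.pos i (2 * j) ∧ hi i = L.pos i (2 * j + 1) + 1 :=
  fun i hi' => h.of_box hL.ranks ⟨i, hi'⟩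

theorem inBox_iff (hlh : ∀ i < d, lo i = L.pos i (2 * j) ∧ hi i = L.pos i (2 * j + 1) + 1)
    (p : Fin d → ℕ) : (∀ i : Fin d, lo i ≤ p i ∧ p i < hi i) ↔ L.InBox j p := by
  refine forall_congr' fun i => ?_
  rw [(hlh i i.2).1, (hlh i i.2).2, Nat.lt_succ_iff]

/-- The counter of the box. -/
def countE : NExp := .arr 0 (.arr 14 (nc 0))

/-- Multiply the weights in the box by real register `14`. -/
def scaleBox (d : ℕ) : Prog :=
  traverse d (cellScale d) (rangeScale (nc 0) (nv 36) (nv 35 + nc 1))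

theorem scaleBox_spec {S' : Multiset (Fin n)} {f : ℝ} (hU : L.H < U) (hd : 1 ≤ d)
    (hL : LayoutOK L Bx K) (hK : 1 ≤ K) (hS : Static L d σ)
    (hF : ∃ G g, Forest L d σ (fun _ => A) (fun _ => L.rankWeight S) G g)
    (hloc : Located d lo hi σ)
    (hlh : ∀ i < d, lo i = L.pos i (2 * j) ∧ hi i = L.pos i (2 * j + 1) + 1) (hf : 0 < f)
    (h14 : σ.rreg 14 = f) (hc : ∀ j : Fin n, σ.na 0 (L.pos 0 (2 * j)) = S'.count j)
    (hw : ∀ p : Fin d → ℕ, [Decidable (L.InBox j p)] →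
      L.rankWeight S' p = (if L.InBox j p then f else 1) * L.rankWeight S p) :
    Fast ω (U * ((4 * d + 2) * K ^ (d - 1))) (scaleBox d) σ fun τ => Rep L d τ A S' := by
  classical
  refine (traverse_fast (scale_visitor (A := A) (w := L.rankWeight S) hU hd hL hS hloc hlh hf h14)
    hd hL.decomp hK (fun i => lt_size_of_box hL hlh) (by omega) ⟨OpFrame.refl _ _ _ _, ?_⟩).mono ?_
  · obtain ⟨G, g, hF⟩ := hF
    exact ⟨G, g, hF.congr_wt fun c hc p _ => by rw [if_neg (by have := hc.1; omega)]⟩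
  · rintro τ ⟨h1, G, g, hF'⟩
    refine ⟨hS.of_opFrame (by norm_num) h1, ⟨G, g, hF'.congr_wt fun c hc p _ => ?_⟩,
      fun k => by rw [h1.na, hc]⟩
    rw [if_pos hc.2]
    simp only [inBox_iff hlh, hw]

def double (d : ℕ) : Prog :=
  locate d ;; (putN 0 (.arr 14 (nc 0)) (countE + nc 1) ;; .setR 14 (rc 2)) ;; scaleBox d

theorem double_spec (hU : L.H < U) (hd : 1 ≤ d) (hL : LayoutOK L Bx K) (hK : 1 ≤ K)
    (hR : Rep L d σ A S) :
    Fast ω (U * ((4 * d + 2) * K ^ (d - 1))) (double d) (σ.withBox (Bx j))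
      fun τ => Rep L d τ A (j ::ₘ S) := by
  have hV : 1 ≤ (4 * d + 2) * K ^ (d - 1) := Nat.mul_pos (by omega) (Nat.pow_pos hK)
  have hUV : U ≤ U * ((4 * d + 2) * K ^ (d - 1)) := Nat.le_mul_of_pos_right _ hV
  have hR' := rep_withBox hR (Bx j)
  refine Fast.seq (((locate_spec hU hL hR'.static (withBox_rreg σ (Bx j))).mono_time hUV).mono ?_)
  rintro τ ⟨h1, lo, hi, hloc, hb⟩
  have hlh := locates_box hL hb
  have hRτ := hR'.of_soft h1
  refine Fast.seq_wp (by omega) ?_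
  simp only [wp_seq, wp_putN, wp_setR]
  have e : NExp.eval τ (.arr 14 (nc 0)) = L.pos 0 (2 * j) := by
    simp [(hloc 0 hd).1, (hlh 0 hd).1]
  have e2 : NExp.eval τ (countE + nc 1) = S.count j + 1 := by
    simp only [countE, NExp.eval_add, NExp.eval_arr, NExp.eval_const]
    rw [← hRτ.count j, ← e]; simp
  rw [e, e2]
  refine scaleBox_spec (S := S) (j := j) (lo := lo) (hi := hi) (f := 2) hU hd hL hK ?_ ?_ ?_ hlh
    two_pos (by simp) ?_ fun p _ => rankWeight_cons j S p
  · exact hRτ.static.of_soft (fun _ _ => rfl) (fun f k hf => by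
      simp only [State.setR_na, State.putNA_na]; rw [if_neg (by omega)]) fun _ _ _ => by simp
  · obtain ⟨G, g, hF⟩ := hRτ.forest
    exact ⟨G, g, hF.of_ra (by simp)⟩
  · intro i hi'
    simp only [State.setR_na, State.putNA_na]
    rw [if_neg (by omega), if_neg (by omega)]
    exact hloc i hi'
  · intro k
    simp only [State.setR_na, State.putNA_na, true_and, pos_injective hL hd, hRτ.count]
    rw [Multiset.count_cons]
    split_ifs with h
    · rw [h]
    · rfl

def halve (d : ℕ) : Prog :=
  locate d ;; .ite (.nlt (nc 0) countE)
    ((putN 0 (.arr 14 (nc 0)) (countE - nc 1) ;; .setR 14 (rc 1 / rc 2)) ;; scaleBox d) .skip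

theorem halve_spec (hU : L.H < U) (hd : 1 ≤ d) (hL : LayoutOK L Bx K) (hK : 1 ≤ K)
    (hR : Rep L d σ A S) :
    Fast ω (U * ((4 * d + 2) * K ^ (d - 1))) (halve d) (σ.withBox (Bx j))
      fun τ => Rep L d τ A (S.erase j) := by
  have hV : 1 ≤ (4 * d + 2) * K ^ (d - 1) := Nat.mul_pos (by omega) (Nat.pow_pos hK)
  have hUV : U ≤ U * ((4 * d + 2) * K ^ (d - 1)) := Nat.le_mul_of_pos_right _ hV
  have hR' := rep_withBox hR (Bx j)
  refine Fast.seq (((locate_spec hU hL hR'.static (withBox_rreg σ (Bx j))).mono_time hUV).mono ?_)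
  rintro τ ⟨h1, lo, hi, hloc, hb⟩
  have hlh := locates_box hL hb
  have hRτ := hR'.of_soft h1
  have e : NExp.eval τ (.arr 14 (nc 0)) = L.pos 0 (2 * j) := by
    simp [(hloc 0 hd).1, (hlh 0 hd).1]
  have e2 : NExp.eval τ countE = S.count j := by
    simp only [countE, NExp.eval_arr]
    rw [← hRτ.count j, ← e]; simp
  -- The counter decides whether a copy of the box is present. If not, `S.erase j` is `S` and
  -- nothing must be done.
  refine Fast.ite (by omega) (fun hp => ?_) fun hp => ?_
  · simp only [BExp.holds_nlt, NExp.eval_const, e2] at hp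
    have hmem : j ∈ S := Multiset.count_pos.1 hp
    refine Fast.seq_wp (by omega) ?_
    simp only [wp_seq, wp_putN, wp_setR, e, NExp.eval_sub, e2]
    refine scaleBox_spec (S := S) (j := j) (lo := lo) (hi := hi) (f := 1 / 2) hU hd hL hK ?_ ?_ ?_
      hlh (by norm_num) (by simp) ?_ fun p _ => ?_
    · exact hRτ.static.of_soft (fun _ _ => rfl) (fun f k hf => by
        simp only [State.setR_na, State.putNA_na]; rw [if_neg (by omega)]) fun _ _ _ => by simp
    · obtain ⟨G, g, hF⟩ := hRτ.forest
      exact ⟨G, g, hF.of_ra (by simp)⟩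
    · intro i hi'
      simp only [State.setR_na, State.putNA_na]
      rw [if_neg (by omega), if_neg (by omega)]
      exact hloc i hi'
    · intro k
      simp only [State.setR_na, State.putNA_na, true_and, pos_injective hL hd, hRτ.count,
        NExp.eval_const]
      split_ifs with h
      · rw [h, Multiset.count_erase_self]
      · rw [Multiset.count_erase_of_ne h]
    -- Writing `S` as `j ::ₘ S.erase j`, the factor `2` on the points of the box cancels against the
    -- factor `1 / 2`.
    · conv_rhs => rw [← Multiset.cons_erase hmem, rankWeight_cons]
      split_ifs <;> ring
  · simp only [BExp.holds_nlt, NExp.eval_const, e2] at hp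
    refine Fast.of_wp (by omega) ?_
    rw [wp_skip, Multiset.erase_of_notMem]
    · exact hRτ
    · rw [← Multiset.count_eq_zero]; omega

/-- Set the activity of the box to `x`. -/
def flagBox (d x : ℕ) : Prog := locate d ;; .setR 14 (rc x) ;; traverse d (cellFlag d) .skip

/-- Insertion and deletion differ only in the value written into the leaves: `x = 1` with `A' =
insert j A`, and `x = 0` with `A' = A.erase j`. Repeating either one is harmless. -/
theorem flagBox_spec {x : ℕ} {A' : Finset (Fin n)} (hU : L.H < U) (hd : 1 ≤ d)
    (hL : LayoutOK L Bx K) (hK : 1 ≤ K) (hR : Rep L d σ A S)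
    (hx : (x : ℝ) = if j ∈ A' then 1 else 0) (hA : ∀ k, k ≠ j → (k ∈ A' ↔ k ∈ A)) :
    Fast ω (U * ((4 * d + 2) * K ^ (d - 1))) (flagBox d x) (σ.withBox (Bx j))
      fun τ => Rep L d τ A' S := by
  have hV : 1 ≤ (4 * d + 2) * K ^ (d - 1) := Nat.mul_pos (by omega) (Nat.pow_pos hK)
  have hUV : U ≤ U * ((4 * d + 2) * K ^ (d - 1)) := Nat.le_mul_of_pos_right _ hV
  have hR' := rep_withBox hR (Bx j)
  refine Fast.seq (((locate_spec hU hL hR'.static (withBox_rreg σ (Bx j))).mono_time hUV).mono ?_)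
  rintro τ ⟨h1, lo, hi, hloc, hb⟩
  have hlh := locates_box hL hb
  have hRτ := hR'.of_soft h1
  obtain ⟨G, g, hF⟩ := hRτ.forest
  refine Fast.seq_wp (by omega) ?_
  rw [wp_setR]
  have hS : Static L d (τ.setR 14 (RExp.eval τ (rc x))) :=
    hRτ.static.of_soft (fun _ _ => rfl) (fun _ _ _ => rfl) fun _ _ _ => by simp
  refine (traverse_fast (flag_visitor (A := A) (A' := A') (w := L.rankWeight S) hU hL hS hloc
    hlh (by simp [hx]) hA) hd hL.decomp hK (fun i => lt_size_of_box hL hlh) (by omega)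
    ⟨OpFrame.refl _ _ _ _, G, g, ?_⟩).mono ?_
  · refine (hF.of_ra (τ := τ.setR 14 _) rfl).congr_act' fun c hc i _ => ?_
    rw [if_neg (by have := hc.1; omega)]
  · rintro υ ⟨h2, G', g', hF'⟩
    refine ⟨hS.of_opFrame (by norm_num) h2, ⟨G', g', hF'.congr_act' fun c hc i _ => ?_⟩,
      fun k => by rw [h2.na, State.setR_na, hRτ.count]⟩
    rw [if_pos hc.2]

/-- Register `43` tells whether the located box contains no ranks on some axis. -/
def emptyTest (d : ℕ) : Prog :=
  (.setR 15 (rc 0) ;; .setN 43 (nc 0)) ;; forAx (fun i =>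
    .ite (.nlt (.arr (14 + 8 * i) (nc 0)) (.arr (15 + 8 * i) (nc 0))) .skip (.setN 43 (nc 1))) d

theorem emptyTest_spec (hloc : Located d lo hi σ) :
    wp ω (emptyTest d) (fun τ => ∃ y, τ = (σ.setR 15 0).setN 43 y ∧
      (y = 0 ↔ ∀ i < d, lo i < hi i)) σ := by
  simp only [emptyTest, wp_seq, wp_setR, wp_setN]
  refine wp_forAx (fun m τ => ∃ y, τ = (σ.setR 15 0).setN 43 y ∧
    (y = 0 ↔ ∀ i < m, lo i < hi i)) ?_ ⟨0, by simp, by simp⟩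
  rintro i hi' τ ⟨y, rfl, hy⟩
  obtain ⟨h1, h2⟩ := hloc i hi'
  simp only [wp_ite, wp_skip, wp_setN, State.setN_setN, BExp.holds_nlt, NExp.eval_arr,
    NExp.eval_const, State.setN_na, State.setR_na, h1, h2]
  refine ⟨fun h => ⟨y, rfl, ?_⟩, fun h => ⟨1, rfl, ?_⟩⟩
  · rw [hy, Nat.forall_lt_succ_right]
    exact (and_iff_left h).symm
  · simp only [one_ne_zero, false_iff]
    exact fun h' => h (h' i (by omega))

def weight (d : ℕ) : Prog :=
  locate d ;; emptyTest d ;; .ite (.nlt (nv 43) (nc 1))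
    (traverse d (cellQuery d) addRange ;; .setR 0 (rv 15)) (.setR 0 (rc 0))

theorem weight_spec (hU : L.H < U) (hd : 1 ≤ d) (hL : LayoutOK L Bx K) (hK : 1 ≤ K)
    (hR : Rep L d σ A S) (b : AABox d) :
    Fast ω (U * ((4 * d + 2) * K ^ (d - 1))) (weight d) (σ.withBox b) fun τ => Rep L d τ A S ∧
      τ.rreg 0 = AABox.totalWeight Bx S (AABox.vertices Bx A ∩ (b : Set (Fin d → ℝ))) := by
  have hV : 1 ≤ (4 * d + 2) * K ^ (d - 1) := Nat.mul_pos (by omega) (Nat.pow_pos hK)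
  have hUV : U ≤ U * ((4 * d + 2) * K ^ (d - 1)) := Nat.le_mul_of_pos_right _ hV
  have hR' := rep_withBox hR b
  refine Fast.seq (((locate_spec hU hL hR'.static (withBox_rreg σ b)).mono_time hUV).mono ?_)
  rintro τ ⟨h1, lo, hi, hloc, hb⟩
  have hRτ := hR'.of_soft h1
  obtain ⟨G, g, hF⟩ := hRτ.forest
  refine Fast.seq_wp (by omega) (wp_mono ?_ (emptyTest_spec hloc))
  rintro υ ⟨y, rfl, hy⟩
  obtain ⟨υ, hυ⟩ : ∃ υ, υ = (τ.setR 15 0).setN 43 y := ⟨_, rfl⟩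
  rw [← hυ]
  have hS : Static L d υ := hRτ.static.of_soft (fun i hi => by simp [hυ]; omega)
    (fun _ _ _ => by simp [hυ]) fun _ _ _ => by simp [hυ]
  have hF' : Forest L d υ _ _ G g := hF.of_ra (by simp [hυ])
  refine Fast.ite (by omega) (fun hp => ?_) fun hp => ?_
  · simp [hυ] at hp
    rw [hy] at hp
    have hloc' : Located d lo hi υ := hloc.of_na (by simp [hυ])
    refine Fast.seq ((traverse_fast (query_visitor hU hL hS hloc'
      (fun i hi' => ⟨hp i hi', (hb ⟨i, hi'⟩).2.1⟩) hF') hd hL.decomp hK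
      (fun i hi' => ⟨hp i hi', (hb ⟨i, hi'⟩).2.1⟩) (by omega)
      ⟨OpFrame.refl _ _ _ _, rfl, by simp [hυ]⟩).mono ?_)
    rintro φ ⟨h2, h3, h4⟩
    refine Fast.of_wp (by omega) ?_
    rw [wp_setR]
    refine ⟨⟨(hS.of_opFrame (by norm_num) h2).of_soft (fun _ _ => rfl) (fun _ _ _ => rfl)
      fun _ _ _ => by simp, ⟨G, g, hF'.of_ra (by simp [h3])⟩, fun k => ?_⟩, ?_⟩
    · simp [h2.na, hυ, hRτ.count]
    · rw [sum_cellSum hL S hb, ← h4]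
      simp
  -- An arbitrary box may contain no rank at all on some axis. The traversal assumes `lo i < hi i`,
  -- so this case is answered separately, by `0`.
  · simp [hυ] at hp
    have hne : ¬ ∀ i < d, lo i < hi i := fun h => hp (hy.2 h)
    push Not at hne
    obtain ⟨i, hi', hle⟩ := hne
    refine Fast.of_wp (by omega) ?_
    rw [wp_setR]
    refine ⟨⟨hS.of_soft (fun _ _ => rfl) (fun _ _ _ => rfl) fun _ _ _ => by simp,
      ⟨G, g, hF'.of_ra (by simp)⟩, fun k => by simp [hυ, hRτ.count]⟩, ?_⟩
    classical
    rw [Layout.totalWeight_inter hL.ranks A S hb, Finset.filter_eq_empty_iff.2]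
    · simp
    · intro p _ hin
      have := hin ⟨i, hi'⟩
      simp only at this
      omega

end

end RealRAM

namespace RealRAM

variable {d n : ℕ} {L : Layout} {K : ℕ}

/-! ### Sampling -/

/-- The number drawn from `[0, W)` with the help of `u`. -/
noncomputable def pick (W : ℝ) (u : unitInterval) : ℝ := if (u : ℝ) * W < W then u * W else 0

/-- The number `t` selects the `q`-th of the consecutive intervals of lengths `a 0, a 1, …`. -/
def Sel (a : ℕ → ℝ) (q : ℕ) (t : ℝ) : Prop :=
  ∑ p ∈ Finset.range q, a p ≤ t ∧ t < ∑ p ∈ Finset.range (q + 1), a p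

theorem pick_nonneg {W : ℝ} (hW : 0 < W) (u : unitInterval) : 0 ≤ pick W u := by
  rw [pick]
  split_ifs
  · exact mul_nonneg u.2.1 hW.le
  · exact le_rfl

theorem pick_lt {W : ℝ} (hW : 0 < W) (u : unitInterval) : pick W u < W := by
  rw [pick]
  split_ifs with h
  · exact h
  · exact hW

theorem measurable_pick (W : ℝ) : Measurable (pick W) := by
  unfold pick
  refine Measurable.ite (measurableSet_lt ?_ measurable_const) ?_ measurable_const
  all_goals exact measurable_subtype_coe.mul_const W

theorem measurableSet_pick (W x y : ℝ) : MeasurableSet {u | x ≤ pick W u ∧ pick W u < y} :=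
  (measurableSet_le measurable_const (measurable_pick W)).inter
    (measurableSet_lt (measurable_pick W) measurable_const)

/-- Up to the null set `{1}`, where `pick` falls back to `0` to stay below `W`, the event is an
interval of length `(y - x) / W`. -/
theorem volume_pick {W x y : ℝ} (hW : 0 < W) (hx : 0 ≤ x) (hxy : x ≤ y) (hy : y ≤ W) :
    (volume : Measure unitInterval) {u | x ≤ pick W u ∧ pick W u < y} =
      ENNReal.ofReal ((y - x) / W) := by
  have hX : x / W ∈ unitInterval := ⟨by positivity, (div_le_one hW).2 (hxy.trans hy)⟩
  have hY : y / W ∈ unitInterval := ⟨div_nonneg (hx.trans hxy) hW.le, (div_le_one hW).2 hy⟩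
  have h : ({u | x ≤ pick W u ∧ pick W u < y} : Set unitInterval) =ᵐ[volume]
      Set.Ico ⟨x / W, hX⟩ ⟨y / W, hY⟩ := by
    have h1 : ({1}ᶜ : Set unitInterval) ∈ ae (volume : Measure unitInterval) := by
      rw [compl_mem_ae_iff]; exact measure_singleton 1
    filter_upwards [h1] with u hu
    have hu1 : (u : ℝ) < 1 := lt_of_le_of_ne u.2.2 fun e => hu (Subtype.ext e)
    have hp : pick W u = u * W := by rw [pick, if_pos (by nlinarith)]
    refine eq_iff_iff.2 ?_
    change (x ≤ pick W u ∧ pick W u < y) ↔ (x / W ≤ (u : ℝ) ∧ (u : ℝ) < y / W)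
    rw [hp, div_le_iff₀ hW, lt_div_iff₀ hW]
  rw [measure_congr h, unitInterval.volume_Ico, ← sub_div]

theorem Sel.pos {a : ℕ → ℝ} {q : ℕ} {t : ℝ} (h : Sel a q t) : 0 < a q := by
  have := h.1.trans_lt h.2
  rw [Finset.sum_range_succ] at this
  linarith

/-- Prefix sums of nonnegative numbers are monotone, so two of the half-open intervals cannot share
a point. This makes the drawn leaf a function of the random number. -/
theorem Sel.unique {a : ℕ → ℝ} {M q q' : ℕ} {t : ℝ} (ha : ∀ p < M, 0 ≤ a p) (hq : q < M)
    (hq' : q' < M) (h : Sel a q t) (h' : Sel a q' t) : q = q' := by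
  have key : ∀ q q', q < q' → q' < M → Sel a q t → Sel a q' t → False := by
    intro q q' hlt hM h h'
    have h1 : ∑ p ∈ Finset.range (q + 1), a p ≤ ∑ p ∈ Finset.range q', a p :=
      Finset.sum_le_sum_of_subset_of_nonneg (Finset.range_mono hlt) fun p hp _ =>
        ha p ((Finset.mem_range.1 hp).trans hM)
    exact absurd (h.2.trans_le (h1.trans h'.1)) (lt_irrefl _)
  rcases lt_trichotomy q q' with hlt | heq | hlt
  · exact (key q q' hlt hq' h h').elim
  · exact heq
  · exact (key q' q hlt hq h' h).elim

theorem volume_sel {a : ℕ → ℝ} {M q : ℕ} (ha : ∀ p < M, 0 ≤ a p) (hq : q < M)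
    (hW : 0 < ∑ p ∈ Finset.range M, a p) :
    (volume : Measure unitInterval) {u | Sel a q (pick (∑ p ∈ Finset.range M, a p) u)} =
      ENNReal.ofReal (a q / ∑ p ∈ Finset.range M, a p) := by
  have h := volume_pick (x := ∑ p ∈ Finset.range q, a p) (y := ∑ p ∈ Finset.range (q + 1), a p) hW
    (Finset.sum_nonneg fun p hp => ha p ((Finset.mem_range.1 hp).trans hq))
    (by rw [Finset.sum_range_succ]; linarith [ha q hq])
    (Finset.sum_le_sum_of_subset_of_nonneg (Finset.range_mono hq) fun p hp _ =>
        ha p (Finset.mem_range.1 hp))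
  rwa [Finset.sum_range_succ, add_sub_cancel_left, ← Finset.sum_range_succ] at h

/-- Draw a random leaf of the tree at `base`. -/
def drawLeaf (base : NExp) : Prog :=
  (.setN 90 base ;; .rand 12 ;; .setR 12 (rv 12 * sumE (nv 90 + nc 1)) ;;
    .ite (.rlt (rv 12) (sumE (nv 90 + nc 1))) .skip (.setR 12 (rc 0))) ;; descend

theorem drawLeaf_spec {ω : Tape} {U H β : ℕ} {g b : ℕ → ℝ} {σ : State} {base : NExp}
    (hU : H + 1 < U) (hM : σ.nreg 4 = 2 ^ H) (hβ : base.eval σ = β)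
    (ht : TreeRep H (σ.tag β) (σ.sum β) g b)
    (hW : 0 < ∑ q ∈ Finset.range (2 ^ H), b q * g q) :
    Fast ω U (drawLeaf base) σ fun τ => (∀ i < 90, τ.nreg i = σ.nreg i) ∧ τ.na = σ.na ∧
      τ.ra = σ.ra ∧ τ.draws = σ.draws + 1 ∧ ∃ q < 2 ^ H, τ.nreg 91 = 2 ^ H + q ∧
      Sel (fun q => b q * g q) q (pick (∑ q ∈ Finset.range (2 ^ H), b q * g q) (ω σ.draws)) := by
  obtain ⟨W, hWd⟩ : ∃ W, W = ∑ q ∈ Finset.range (2 ^ H), b q * g q := ⟨_, rfl⟩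
  rw [← hWd] at hW ⊢
  have hroot : σ.ra 1 (β + 1) = W := ht.root.trans hWd.symm
  have key : ∀ υ : State, υ.nreg = (σ.setN 90 β).nreg → υ.na = σ.na → υ.ra = σ.ra →
      υ.draws = σ.draws + 1 → υ.rreg 12 = pick W (ω σ.draws) → Fast ω U descend υ fun τ =>
      (∀ i < 90, τ.nreg i = σ.nreg i) ∧ τ.na = σ.na ∧
      τ.ra = σ.ra ∧ τ.draws = σ.draws + 1 ∧ ∃ q < 2 ^ H, τ.nreg 91 = 2 ^ H + q ∧
      Sel (fun q => b q * g q) q (pick W (ω σ.draws)) := by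
    intro υ h1 h2 h3 h4 h5
    refine (descend_spec (β := β) (g := g) (b := b) hU (by simp [h1, hM]) (by simp [h1]) ?_
      (by rw [h5]; exact pick_nonneg hW _)
      (by rw [h5, ← hWd]; exact pick_lt hW _)).mono ?_
    · exact ht.congr (fun x _ _ => by simp [State.tag, h3]) fun x _ _ => by simp [State.sum, h3]
    · rintro τ ⟨h6, q, hq, h7, h8, h9⟩
      refine ⟨fun i hi => ?_, h6.na.trans h2, h6.ra.trans h3, h6.draws.trans h4, q, hq, h7, ?_⟩
      · rw [h6.nreg i (by omega) (by omega), h1]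
        simp; omega
      · rw [h5] at h8 h9
        exact ⟨h8, h9⟩
  refine Fast.seq_wp (by omega) ?_
  simp only [wp_seq, wp_setN, wp_rand, wp_setR, wp_ite, wp_skip, hβ]
  refine ⟨fun h => key _ ?_ ?_ ?_ ?_ ?_, fun h => key _ ?_ ?_ ?_ ?_ ?_⟩
  all_goals first | rfl | simp
  · simp [hroot] at h
    simp [hroot, pick, h]
  · simp [hroot] at h
    simp [pick, not_lt.2 h]

/-- Return a random vertex in the real registers `0, …, d - 1`. -/
def sample (d : ℕ) : Prog :=
  drawLeaf (nc 0) ;; (.setN 60 (nv 91 - nv 4) ;; .setN 61 (.arr 4 (nv 60))) ;;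
  forAx (fun i => drawLeaf (baseI i) ;; putN (16 + 8 * i) (nc 0) (nv 91 - nv 4)) d ;;
  forAx (fun i => .setR i (.arr (3 + i) (.arr (16 + 8 * i) (nc 0)))) d

section
variable {ω : Tape} {U : ℕ} {Bx : Fin n → AABox d} {σ : State}
  {A : Finset (Fin n)} {S : Multiset (Fin n)} {G : ℕ → ℝ} {g : ℕ → ℕ → ℕ → ℝ}

open Classical in
/-- The total weights of the cells. -/
noncomputable def cellWeight (L : Layout) (d : ℕ) (A : Finset (Fin n)) (G : ℕ → ℝ)
    (g : ℕ → ℕ → ℕ → ℝ) (c : ℕ) : ℝ :=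
  (if L.IsCell d c then rootProd L d (L.actVal d A c) (g c) else 0) * G c

/-- The weights of the leaves of the trees of a cell. -/
noncomputable def leafWeight (L : Layout) (d : ℕ) (A : Finset (Fin n)) (g : ℕ → ℕ → ℕ → ℝ)
    (c i r : ℕ) : ℝ := L.actVal d A c i r * g c i r

theorem actVal_nonneg (c i r : ℕ) : 0 ≤ L.actVal d A c i r := by
  rw [Layout.actVal]; split_ifs <;> norm_num

theorem leafWeight_nonneg {W : ℕ → (Fin d → ℕ) → ℝ} (hF : Forest L d σ (fun _ => A) W G g) {c : ℕ}
    (hc : L.IsCell d c) {i r : ℕ} (hi : i < d) (hr : r < 2 ^ L.H) :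
    0 ≤ leafWeight L d A g c i r :=
  mul_nonneg (actVal_nonneg c i r) ((hF.cells c hc i hi).g_pos hr).le

theorem rootProd_nonneg {W : ℕ → (Fin d → ℕ) → ℝ} (hF : Forest L d σ (fun _ => A) W G g) {c : ℕ}
    (hc : L.IsCell d c) : 0 ≤ rootProd L d (L.actVal d A c) (g c) :=
  Finset.prod_nonneg fun _ hi => Finset.sum_nonneg fun _ hr =>
    leafWeight_nonneg hF hc (Finset.mem_range.1 hi) (Finset.mem_range.1 hr)

theorem cellWeight_nonneg {W : ℕ → (Fin d → ℕ) → ℝ} (hF : Forest L d σ (fun _ => A) W G g) {c : ℕ}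
    (hc : c < 2 ^ L.H) : 0 ≤ cellWeight L d A G g c := by
  refine mul_nonneg ?_ (hF.glob.g_pos hc).le
  split_ifs with h
  · exact rootProd_nonneg hF h
  · exact le_rfl

/-- A cell is only drawn if its weight is positive; then no factor of the product vanishes, and
drawing from each of its trees is legitimate. -/
theorem root_pos {W : ℕ → (Fin d → ℕ) → ℝ} (hF : Forest L d σ (fun _ => A) W G g) {c : ℕ}
    (h : 0 < cellWeight L d A G g c) : L.IsCell d c ∧
      ∀ i < d, 0 < ∑ r ∈ Finset.range (2 ^ L.H), leafWeight L d A g c i r := by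
  rw [cellWeight] at h
  have hc : L.IsCell d c := by
    by_contra hc
    rw [if_neg hc, zero_mul] at h
    exact lt_irrefl _ h
  refine ⟨hc, fun i hi => ?_⟩
  refine lt_of_le_of_ne (Finset.sum_nonneg fun r hr =>
    leafWeight_nonneg hF hc hi (Finset.mem_range.1 hr)) fun h0 => ?_
  have h0 : ∑ r ∈ Finset.range (2 ^ L.H), L.actVal d A c i r * g c i r = 0 := h0.symm
  rw [if_pos hc, rootProd, Finset.prod_eq_zero (Finset.mem_range.2 hi) h0, zero_mul] at h
  exact lt_irrefl _ h

/-- The random numbers drawn by `sample` select the rank point `q` of cell `c`. -/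
def Selects (L : Layout) (d : ℕ) (A : Finset (Fin n)) (G : ℕ → ℝ) (g : ℕ → ℕ → ℕ → ℝ) (ω : Tape)
    (D c : ℕ) (q : ℕ → ℕ) : Prop :=
  Sel (cellWeight L d A G g) c
    (pick (∑ c ∈ Finset.range (2 ^ L.H), cellWeight L d A G g c) (ω D)) ∧
  ∀ i < d, Sel (leafWeight L d A g c i) (q i)
    (pick (∑ r ∈ Finset.range (2 ^ L.H), leafWeight L d A g c i r) (ω (D + 1 + i)))

/-- One random number selects the cell and the next `d` select the ranks; their positions on the
tape do not depend on earlier outcomes, which is what makes the draws independent events. -/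
theorem sample_spec (hU : L.H + 1 < U) (hR : Rep L d σ A S)
    (hF : Forest L d σ (fun _ => A) (fun _ => L.rankWeight S) G g)
    (hW : 0 < ∑ c ∈ Finset.range (2 ^ L.H), cellWeight L d A G g c) :
    Fast ω U (sample d) σ fun τ => Rep L d τ A S ∧ ∃ c < 2 ^ L.H, ∃ q : ℕ → ℕ,
      (∀ i < d, q i < 2 ^ L.H) ∧ Selects L d A G g ω σ.draws c q ∧
      ∀ i < d, τ.rreg i = L.X i (q i) := by
  have h4 := hR.static.r4
  refine Fast.seq ((drawLeaf_spec hU h4 (by simp [Layout.base]) hF.glob hW).mono ?_)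
  rintro τ ⟨h1, h2, h3, hdr, c, hc, h91, hsel⟩
  have hsel' : Sel (cellWeight L d A G g) c
    (pick (∑ c ∈ Finset.range (2 ^ L.H), cellWeight L d A G g c) (ω σ.draws)) := hsel
  obtain ⟨hcell, hroot⟩ := root_pos hF hsel'.pos
  refine Fast.seq_wp (by omega) ?_
  simp only [wp_seq, wp_setN]
  obtain ⟨σ₁, hσ₁⟩ : ∃ σ₁, σ₁ = (τ.setN 60 c).setN 61 (L.base (d * c + 1)) := ⟨_, rfl⟩
  have e1 : NExp.eval τ (nv 91 - nv 4) = c := by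
    simp [h91, h1 4 (by norm_num), h4]
  have e2 : NExp.eval (τ.setN 60 c) (.arr 4 (nv 60)) = L.base (d * c + 1) := by
    simp [h2, hR.static.cb c hcell]
  rw [e1, e2, ← hσ₁]
  have hct := (hF.cells c hcell)
  refine Fast.seq ((Fast.forAx (by omega) (fun m υ => (∀ i < 90, υ.nreg i = σ₁.nreg i) ∧
    υ.ra = σ.ra ∧ (∀ f k, (f < 10 ∨ (2 ≤ f % 8 ∧ f % 8 ≤ 5)) → υ.na f k = σ.na f k) ∧
    υ.draws = σ.draws + 1 + m ∧ ∀ i < m, υ.na (16 + 8 * i) 0 < 2 ^ L.H ∧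
      Sel (leafWeight L d A g c i) (υ.na (16 + 8 * i) 0) (pick (∑ r ∈ Finset.range (2 ^ L.H),
        leafWeight L d A g c i r) (ω (σ.draws + 1 + i)))) ?_
    ⟨fun _ _ => rfl, by simp [hσ₁, h3], by simp [hσ₁, h2], by simp [hσ₁, hdr], by simp⟩).mono ?_)
  · rintro i hi υ ⟨k1, k2, k3, k4, k5⟩
    have h4' : υ.nreg 4 = 2 ^ L.H := by
      rw [k1 4 (by norm_num)]; simp [hσ₁, h1 4 (by norm_num), h4]
    have hti : TreeRep L.H (υ.tag (L.base (d * c + 1 + i))) (υ.sum (L.base (d * c + 1 + i)))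
        (g c i) (L.actVal d A c i) :=
      (hct i hi).congr (fun x _ _ => by simp [State.tag, k2]) fun x _ _ => by simp [State.sum, k2]
    refine Fast.seq ((drawLeaf_spec hU h4' (eval_baseI h4'
      (by rw [k1 61 (by norm_num)]; simp [hσ₁])) hti (hroot i hi)).mono ?_)
    rintro φ ⟨l1, l2, l3, l4, q, hq, l5, l6⟩
    refine Fast.of_wp (by omega) ?_
    have e3 : NExp.eval φ (nv 91 - nv 4) = q := by
      simp [l5, l1 4 (by norm_num), h4']
    rw [wp_putN, e3]
    refine ⟨fun i hi => by rw [State.putNA_nreg, l1 i hi, k1 i hi], by simp [l3, k2],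
      fun f k hf => ?_, by simp [l4, k4, add_assoc], fun i' hi' => ?_⟩
    · rw [State.putNA_na, if_neg (by omega), l2, k3 f k hf]
    · by_cases hii : i' = i
      · subst hii
        simp only [State.putNA_na, NExp.eval_const, and_self, if_true]
        exact ⟨hq, by rw [k4] at l6; exact l6⟩
      · rw [State.putNA_na, if_neg (by omega), l2]
        exact k5 i' (by omega)
  · rintro υ ⟨k1, k2, k3, k4, k5⟩
    refine Fast.of_wp (by omega) (wp_mono ?_ (wp_forAx (fun m φ => φ.nreg = υ.nreg ∧ φ.ra = υ.ra ∧
      φ.na = υ.na ∧ ∀ i < m, φ.rreg i = L.X i (υ.na (16 + 8 * i) 0)) ?_ ⟨rfl, rfl, rfl, by simp⟩))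
    · rintro φ ⟨l1, l2, l3, l4⟩
      refine ⟨hR.of_eq (fun i hi => ?_) (l2.trans k2) (by rw [l3]; exact k3), c, hc,
        fun i => υ.na (16 + 8 * i) 0, fun i hi => (k5 i hi).1, ⟨hsel', fun i hi => (k5 i hi).2⟩, l4⟩
      rw [l1, k1 i (by omega), hσ₁, State.setN_nreg, if_neg (by omega), State.setN_nreg,
        if_neg (by omega), h1 i (by omega)]
    · rintro i hi φ ⟨l1, l2, l3, l4⟩
      rw [wp_setR]
      refine ⟨l1, l2, l3, fun i' hi' => ?_⟩
      by_cases hii : i' = i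
      · subst hii
        simp [l3, l2, k2, hR.static.X i' hi]
      · rw [State.setR_rreg, if_neg hii]
        exact l4 i' (by omega)

theorem Selects.inCell (hF : Forest L d σ (fun _ => A) (fun _ => L.rankWeight S) G g) {D c : ℕ}
    {q : ℕ → ℕ} (h : Selects L d A G g ω D c q) :
    L.IsCell d c ∧ ∀ i < d, L.Active d A c i (q i) := by
  refine ⟨(root_pos hF h.1.pos).1, fun i hi => ?_⟩
  by_contra hact
  have := (h.2 i hi).pos
  rw [leafWeight, Layout.actVal, if_neg hact, zero_mul] at this
  exact lt_irrefl _ this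

theorem Selects.mem_verts (hL : LayoutOK L Bx K)
    (hF : Forest L d σ (fun _ => A) (fun _ => L.rankWeight S) G g) {D c : ℕ}
    {q : ℕ → ℕ} (h : Selects L d A G g ω D c q) :
    (fun i : Fin d => q i) ∈ L.verts d A := by
  classical
  obtain ⟨hc, hact⟩ := h.inCell hF
  have hin : L.InCell c (fun i : Fin d => q i) := fun i => (hact i i.2).1
  rw [Layout.verts, Finset.mem_filter, Layout.mem_grid]
  exact ⟨fun i => (hin i).2.trans_le (hL.decomp.entry_interval le_rfl hc.1 hc.2 i.2).2,
    (hL.ranks.vert_iff hL.decomp hc hin).2 fun i => hact i i.2⟩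

theorem totalWeight_vertices (hL : LayoutOK L Bx K)
    (hF : Forest L d σ (fun _ => A) (fun _ => L.rankWeight S) G g) :
    AABox.totalWeight Bx S (AABox.vertices Bx A) =
      ∑ c ∈ Finset.range (2 ^ L.H), cellWeight L d A G g c := by
  classical
  have h1 : AABox.totalWeight Bx S (AABox.vertices Bx A) =
      ∑ c ∈ Finset.Ico (L.start d) (L.start (d + 1)),
        cellSum L d A (L.rankWeight S) (fun _ => 0) (fun _ => 2 ^ L.H) c := by
    rw [Layout.vertices_eq hL.ranks, Layout.verts,
      Layout.totalWeight_image hL.ranks S (Finset.filter_subset _ _), Finset.sum_filter, Layout.sum_grid hL.decomp]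
    refine Finset.sum_congr rfl fun c hc => ?_
    rw [cellSum, Finset.sum_filter]
    refine Finset.sum_congr rfl fun p hp => if_congr ?_ rfl rfl
    rw [Finset.mem_Ico] at hc
    rw [Layout.mem_cellBox] at hp
    refine (and_iff_left fun i => ⟨Nat.zero_le _, ?_⟩).symm
    have h1 := (hL.decomp.entry_interval le_rfl hc.1 hc.2 i.2).2
    exact (hp i).2.trans_le (h1.trans hL.sizeN.le)
  rw [h1]
  have h2 : ∀ c ∈ Finset.Ico (L.start d) (L.start (d + 1)),
      cellSum L d A (L.rankWeight S) (fun _ => 0) (fun _ => 2 ^ L.H) c =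
        cellWeight L d A G g c := by
    intro c hc
    have hc' : L.IsCell d c := Finset.mem_Ico.1 hc
    rw [cellSum_covered hL hF hc', cellWeight, if_pos hc']
    exact fun i hi => ⟨Nat.zero_le _,
      (hL.decomp.entry_interval le_rfl hc'.1 hc'.2 hi).2.trans hL.sizeN.le⟩
  rw [Finset.sum_congr rfl h2]
  refine Finset.sum_subset (fun c hc => ?_) fun c _ hc => ?_
  · exact Finset.mem_range.2 ((Finset.mem_Ico.1 hc).2.trans hL.size)
  · rw [cellWeight, if_neg, zero_mul]
    exact fun h => hc (Finset.mem_Ico.2 h)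

theorem totalWeight_pos (hL : LayoutOK L Bx K) (hne : (AABox.vertices Bx A).Nonempty) :
    0 < AABox.totalWeight Bx S (AABox.vertices Bx A) := by
  classical
  rw [Layout.vertices_eq hL.ranks] at hne ⊢
  rw [Layout.verts] at hne ⊢
  rw [Layout.totalWeight_image hL.ranks S (Finset.filter_subset _ _)]
  exact Finset.sum_pos (fun p _ => by rw [Layout.rankWeight]; positivity) (by simpa only [Set.image_nonempty, Finset.coe_nonempty] using hne)

theorem sample_halts (hU : L.H + 1 < U) (hL : LayoutOK L Bx K) (hR : Rep L d σ A S)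
    (hne : (AABox.vertices Bx A).Nonempty) :
    Fast ω U (sample d) σ fun τ => Rep L d τ A S ∧ τ.point d ∈ AABox.vertices Bx A := by
  obtain ⟨G, g, hF⟩ := hR.forest
  refine (sample_spec hU hR hF ?_).mono ?_
  · rw [← totalWeight_vertices hL hF]; exact totalWeight_pos hL hne
  · rintro τ ⟨h1, c, -, q, -, h2, h3⟩
    refine ⟨h1, ?_⟩
    rw [Layout.vertices_eq hL.ranks]
    exact ⟨_, h2.mem_verts hL hF, funext fun i => (h3 i i.2).symm⟩

/-- The cell `c` of the vertex is drawn with probability `G c * rootProd / W`, where `W` is the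
total weight, and then its rank on axis `i` with probability `g c i (p i)` divided by the root sum
of that tree. In the product over the axes the root sums cancel `rootProd`, and `G c * ∏ g c i (p
i)` is the weight of the vertex. -/
theorem sample_law (hL : LayoutOK L Bx K) (hR : Rep L d σ A S) {v : Fin d → ℝ}
    (hv : v ∈ AABox.vertices Bx A) :
    tapeLaw {ω | ∃ (t : ℕ) (τ : State), Exec ω (sample d) σ t τ ∧ τ.point d = v} =
      ENNReal.ofReal (AABox.weight Bx S v /
        AABox.totalWeight Bx S (AABox.vertices Bx A)) := by
  classical
  have hpos := totalWeight_pos (S := S) hL ⟨v, hv⟩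
  obtain ⟨G, g, hF⟩ := hR.forest
  have htot := totalWeight_vertices hL hF
  rw [Layout.vertices_eq hL.ranks] at hv
  obtain ⟨p, hp, rfl⟩ := hv
  have hp' : p ∈ L.grid d ∧ L.Vert A p := by
    rwa [Finset.mem_coe, Layout.verts, Finset.mem_filter] at hp
  have hpN := Layout.mem_grid.1 hp'.1
  obtain ⟨c, ⟨hc, hpc⟩, -⟩ := hL.decomp.existsUnique_entry p hpN le_rfl
  have hc' : L.IsCell d c := hc
  have hin : L.InCell c p := fun i => hpc i i.2
  have hact := (hL.ranks.vert_iff hL.decomp hc' hin).1 hp'.2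
  obtain ⟨q, hq⟩ : ∃ q : ℕ → ℕ, q = fun i => if h : i < d then p ⟨i, h⟩ else 0 := ⟨_, rfl⟩
  have hqp : ∀ i : Fin d, q i = p i := fun i => by simp [hq]
  have hqH : ∀ i < d, q i < 2 ^ L.H := fun i hi => by
    rw [hqp ⟨i, hi⟩]; exact (hpN _).trans hL.sizeN
  have hcH : c < 2 ^ L.H := hc.2.trans hL.size
  -- Returning the point is equivalent to selecting its own cell and ranks: a vertex lies in one
  -- cell only, rank points are determined by their coordinates, and selections are unique.
  have hset : {ω | ∃ (t : ℕ) (τ : State), Exec ω (sample d) σ t τ ∧ τ.point d = L.toPoint p} =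
      {ω | Selects L d A G g ω σ.draws c q} := by
    ext ω
    obtain ⟨t₀, τ₀, he, -, -, c₁, hc₁, q₁, hq₁, hsel, hX⟩ := sample_spec (ω := ω)
      (Nat.lt_succ_self (L.H + 1)) hR hF (by rw [← htot]; exact hpos)
    have hpt : τ₀.point d = L.toPoint fun i : Fin d => q₁ i := funext fun i => hX i i.2
    constructor
    · rintro ⟨t, τ, he', hτ⟩
      obtain rfl := he'.deterministic he
      rw [hpt] at hτ
      have hv := hsel.mem_verts hL hF
      have hv1 : (fun i : Fin d => q₁ i) ∈ L.grid d := (Finset.mem_filter.1 hv).1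
      have hqq : (fun i : Fin d => q₁ i) = p := Layout.toPoint_injOn hL.ranks hv1 hp'.1 hτ
      obtain ⟨hcell₁, hact₁⟩ := hsel.inCell hF
      have hin₁ : L.InCell c₁ p := by rw [← hqq]; exact fun i => (hact₁ i i.2).1
      obtain rfl := Layout.cell_unique hL.decomp hcell₁ hc' hin₁ hin
      refine ⟨hsel.1, fun i hi => ?_⟩
      have := hsel.2 i hi
      rwa [show q i = q₁ i by rw [hqp ⟨i, hi⟩, ← hqq]]
    · intro h
      refine ⟨t₀, τ₀, he, ?_⟩
      obtain rfl : c₁ = c := Sel.unique (fun c hc => cellWeight_nonneg hF hc) hc₁ hcH hsel.1 h.1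
      rw [hpt]
      congr 1
      funext i
      rw [← hqp]
      exact Sel.unique (fun r hr => leafWeight_nonneg hF hc' i.2 hr) (hq₁ i i.2) (hqH i i.2)
        (hsel.2 i i.2) (h.2 i i.2)
  rw [hset]
  have hleaf : ∀ i < d, 0 < leafWeight L d A g c i (q i) := fun i hi => by
    rw [leafWeight, Layout.actVal, hqp ⟨i, hi⟩, if_pos (hact ⟨i, hi⟩), one_mul]
    have := (hF.cells c hc' i hi).g_pos (hqH i hi)
    rwa [hqp ⟨i, hi⟩] at this
  have hroot : ∀ i < d, 0 < ∑ r ∈ Finset.range (2 ^ L.H), leafWeight L d A g c i r :=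
    fun i hi => Finset.sum_pos' (fun r hr => leafWeight_nonneg hF hc' hi (Finset.mem_range.1 hr))
      ⟨q i, Finset.mem_range.2 (hqH i hi), hleaf i hi⟩
  obtain ⟨t, ht⟩ : ∃ t : ℕ → Set unitInterval, t = fun k => if k = σ.draws then
      {u | Sel (cellWeight L d A G g) c
        (pick (∑ c ∈ Finset.range (2 ^ L.H), cellWeight L d A G g c) u)}
      else {u | Sel (leafWeight L d A g c (k - (σ.draws + 1))) (q (k - (σ.draws + 1)))
        (pick (∑ r ∈ Finset.range (2 ^ L.H), leafWeight L d A g c (k - (σ.draws + 1)) r) u)} :=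
    ⟨_, rfl⟩
  -- The event restricts each of `d + 1` coordinates of the tape separately, so its measure under
  -- the product law is a product.
  have hsets : {ω | Selects L d A G g ω σ.draws c q} =
      Set.pi (Finset.Ico σ.draws (σ.draws + 1 + d)) t := by
    ext ω
    simp only [Selects, Set.mem_pi, Finset.coe_Ico, Set.mem_Ico, Set.mem_ofPred_eq, ht]
    constructor
    · rintro ⟨h1, h2⟩ k ⟨hk1, hk2⟩
      by_cases hk : k = σ.draws
      · rw [if_pos hk, hk]; exact h1
      · rw [if_neg hk]
        have := h2 (k - (σ.draws + 1)) (by omega)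
        rwa [show σ.draws + 1 + (k - (σ.draws + 1)) = k by omega] at this
    · intro h
      refine ⟨?_, fun i hi => ?_⟩
      · have := h σ.draws ⟨le_rfl, by omega⟩
        rwa [if_pos rfl] at this
      · have := h (σ.draws + 1 + i) ⟨by omega, by omega⟩
        rwa [if_neg (by omega), Nat.add_sub_cancel_left] at this
  have hmeas : ∀ k, MeasurableSet (t k) := by
    intro k
    rw [ht]
    simp only
    split_ifs
    · exact measurableSet_pick _ _ _
    · exact measurableSet_pick _ _ _
  rw [hsets, tapeLaw, Measure.infinitePi_pi _ fun k _ => hmeas k,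
    Finset.prod_eq_prod_Ico_succ_bot (by omega), Finset.prod_Ico_eq_prod_range,
    Nat.add_sub_cancel_left]
  have hfac : ∀ i ∈ Finset.range d, (volume : Measure unitInterval) (t (σ.draws + 1 + i)) =
      ENNReal.ofReal (leafWeight L d A g c i (q i) /
        ∑ r ∈ Finset.range (2 ^ L.H), leafWeight L d A g c i r) := by
    intro i hi
    rw [Finset.mem_range] at hi
    rw [ht]
    simp only
    rw [if_neg (by omega), Nat.add_sub_cancel_left]
    exact volume_sel (fun r hr => leafWeight_nonneg hF hc' hi hr) (hqH i hi) (hroot i hi)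
  rw [Finset.prod_congr rfl hfac, ← ENNReal.ofReal_prod_of_nonneg fun i hi =>
    (div_pos (hleaf i (Finset.mem_range.1 hi)) (hroot i (Finset.mem_range.1 hi))).le]
  have hfirst : (volume : Measure unitInterval) (t σ.draws) = ENNReal.ofReal
      (cellWeight L d A G g c / ∑ c ∈ Finset.range (2 ^ L.H), cellWeight L d A G g c) := by
    rw [ht]
    simp only [if_true]
    exact volume_sel (fun c hc => cellWeight_nonneg hF hc) hcH (by rw [← htot]; exact hpos)
  rw [hfirst, ← ENNReal.ofReal_mul (div_nonneg (cellWeight_nonneg hF hcH)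
    (by rw [← htot]; exact hpos.le)), ← htot, Layout.weight_toPoint hL.ranks S hp'.1,
    ← hF.wt c hc' p hin, Finset.prod_div_distrib]
  congr 1
  have e1 : ∏ i ∈ Finset.range d, leafWeight L d A g c i (q i) = ∏ i : Fin d, g c i (p i) := by
    rw [Finset.prod_range]
    refine Finset.prod_congr rfl fun i _ => ?_
    rw [leafWeight, hqp, Layout.actVal, if_pos (hact i), one_mul]
  have e2 : ∏ i ∈ Finset.range d, ∑ r ∈ Finset.range (2 ^ L.H), leafWeight L d A g c i r =
      rootProd L d (L.actVal d A c) (g c) := rfl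
  have e3 : 0 < rootProd L d (L.actVal d A c) (g c) := by
    rw [← e2]; exact Finset.prod_pos fun i hi => hroot i (Finset.mem_range.1 hi)
  rw [e1, e2, cellWeight, if_pos hc']
  field_simp

end

end RealRAM

namespace RealRAM

variable {d n : ℕ} {L L' : Layout} {K s m e : ℕ}

/-! ### Building the decomposition level by level -/

/-- Entry `e` of level `m` has been subdivided correctly, into intervals of length at most `s`. -/
structure EntryOK (L : Layout) (K s m e : ℕ) : Prop where
  first_le : L.first e ≤ L.first (e + 1)
  count : L.first (e + 1) ≤ L.first e + K
  inherit : ∀ f, L.first e ≤ f → f < L.first (e + 1) → ∀ i < m,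
    L.A i f = L.A i e ∧ L.B i f = L.B i e
  interval : ∀ f, L.first e ≤ f → f < L.first (e + 1) →
    L.A m f < L.B m f ∧ L.B m f ≤ L.N ∧ L.B m f ≤ L.A m f + s
  pt_mem : ∀ r < L.N, L.first e ≤ L.pt e r ∧ L.pt e r < L.first (e + 1)
  pt_iff : ∀ r < L.N, ∀ f, L.first e ≤ f → f < L.first (e + 1) →
    (L.A m f ≤ r ∧ r < L.B m f ↔ L.pt e r = f)
  pt_mono : ∀ r r', r ≤ r' → r' < L.N → L.pt e r ≤ L.pt e r'
  single : ∀ f, L.first e ≤ f → f < L.first (e + 1) → ∀ x, L.A m f ≤ x → x < L.B m f →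
    ∀ i < m, L.EndIn i (L.own m x) e → L.B m f = L.A m f + 1

/-- `L'` extends `L`, which is filled up to entry `e` and its descendants below `t`. -/
structure Extends (L L' : Layout) (e t : ℕ) : Prop where
  N : L'.N = L.N
  Q : L'.Q = L.Q
  pos : L'.pos = L.pos
  A : ∀ i, ∀ f < t, L'.A i f = L.A i f
  B : ∀ i, ∀ f < t, L'.B i f = L.B i f
  first : ∀ e' ≤ e, L'.first e' = L.first e'
  pt : ∀ e' < e, ∀ r < L.N, L'.pt e' r = L.pt e' r

theorem Extends.endIn {t i j : ℕ} (h : Extends L L' e t) {e' : ℕ} (he : e' < t) :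
    L'.EndIn i j e' ↔ L.EndIn i j e' := by
  rw [Layout.EndIn, Layout.EndIn, h.pos, h.A i e' he, h.B i e' he]

theorem Extends.own {t : ℕ} (h : Extends L L' e t) (i r : ℕ) : L'.own i r = L.own i r := by
  rw [Layout.own, Layout.own, h.Q]

/-- The conditions on `e'` involve only data of `e'` and of its children, which were written earlier
and are not overwritten. -/
theorem EntryOK.extend {e' t : ℕ} (h : EntryOK L K s m e') (hx : Extends L L' e t) (he : e' < e)
    (ht : L.first (e' + 1) ≤ t) (het : e' < t) : EntryOK L' K s m e' := by
  have f1 := hx.first e' (by omega)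
  have f2 := hx.first (e' + 1) (by omega)
  constructor
  · rw [f1, f2]; exact h.first_le
  · rw [f1, f2]; exact h.count
  · rw [f1, f2]
    intro f h1 h2 i hi
    rw [hx.A i f (by omega), hx.B i f (by omega), hx.A i e' het, hx.B i e' het]
    exact h.inherit f h1 h2 i hi
  · rw [f1, f2, hx.N]
    intro f h1 h2
    rw [hx.A m f (by omega), hx.B m f (by omega)]
    exact h.interval f h1 h2
  · rw [f1, f2, hx.N]
    intro r hr
    rw [hx.pt e' he r hr]
    exact h.pt_mem r hr
  · rw [f1, f2, hx.N]
    intro r hr f h1 h2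
    rw [hx.pt e' he r hr, hx.A m f (by omega), hx.B m f (by omega)]
    exact h.pt_iff r hr f h1 h2
  · rw [hx.N]
    intro r r' hrr hr'
    rw [hx.pt e' he r (by omega), hx.pt e' he r' hr']
    exact h.pt_mono r r' hrr hr'
  · rw [f1, f2]
    intro f h1 h2 x h3 h4 i hi h5
    rw [hx.A m f (by omega)] at h3 ⊢
    rw [hx.B m f (by omega)] at h4 ⊢
    rw [hx.own, hx.endIn het] at h5
    exact h.single f h1 h2 x h3 h4 i hi h5

/-- The levels before `m` and the entries of level `m` before `e` have been subdivided. -/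
structure Tower (L : Layout) (K s m e : ℕ) : Prop where
  start_zero : L.start 0 = 0
  start_one : L.start 1 = 1
  start_le : ∀ m' ≤ m, L.start m' ≤ L.start (m' + 1)
  first_start : ∀ m' ≤ m, L.first (L.start m') = L.start (m' + 1)
  done : ∀ m' < m, ∀ e', L.start m' ≤ e' → e' < L.start (m' + 1) → EntryOK L K s m' e'
  cur : ∀ e', L.start m ≤ e' → e' < e → EntryOK L K s m e'
  ge : L.start m ≤ e
  mono : ∀ e' ≤ e, L.first e' ≤ L.first e
  lt : e < L.first e

namespace Tower

theorem start_mono (h : Tower L K s m e) {a b : ℕ} (hab : a ≤ b) (hb : b ≤ m + 1) :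
    L.start a ≤ L.start b := by
  induction b, hab using Nat.le_induction with
  | base => exact le_rfl
  | succ b h1 ih => exact (ih (by omega)).trans (h.start_le b (by omega))

theorem decomp (h : Tower L K s m e) : L.Decomp m K where
  start_zero := h.start_zero
  start_one := h.start_one
  start_le := h.start_le
  first_start := h.first_start
  first_le := fun m' hm e' h1 h2 => (h.done m' hm e' h1 h2).first_le
  count := fun m' hm e' h1 h2 => (h.done m' hm e' h1 h2).count
  inherit := fun m' hm e' h1 h2 => (h.done m' hm e' h1 h2).inherit
  interval := fun m' hm e' h1 h2 f h3 h4 =>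
    let h5 := (h.done m' hm e' h1 h2).interval f h3 h4
    ⟨h5.1, h5.2.1⟩
  pt_mem := fun m' hm e' h1 h2 => (h.done m' hm e' h1 h2).pt_mem
  pt_iff := fun m' hm e' h1 h2 => (h.done m' hm e' h1 h2).pt_iff
  pt_mono := fun m' hm e' h1 h2 => (h.done m' hm e' h1 h2).pt_mono
  single := fun m' hm e' h1 h2 => (h.done m' hm e' h1 h2).single

theorem length (h : Tower L K s m e) {m' : ℕ} (hm : m' ≤ m) {f : ℕ} (hf : L.start m' ≤ f)
    (hf' : f < L.start (m' + 1)) {i : ℕ} (hi : i < m') : L.B i f ≤ L.A i f + s := by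
  induction m' generalizing f with
  | zero => omega
  | succ m' ih =>
    obtain ⟨e₀, h3, h4, h5, h6⟩ := h.decomp.exists_parent (by omega) hf hf'
    have hok := h.done m' (by omega) e₀ h3 h4
    by_cases him : i = m'
    · subst him
      exact (hok.interval f h5 h6).2.2
    · obtain ⟨h7, h8⟩ := hok.inherit f h5 h6 i (by omega)
      rw [h7, h8]
      exact ih (by omega) h3 h4 (by omega)

/-- One more entry has been subdivided. -/
theorem step (h : Tower L K s m e) (hx : Extends L L' e (L.first e)) (hs : L'.start = L.start)
    (he : e < L.start (m + 1)) (hok : EntryOK L' K s m e) (hlt : e + 1 < L'.first (e + 1)) :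
    Tower L' K s m (e + 1) where
  start_zero := by rw [hs]; exact h.start_zero
  start_one := by rw [hs]; exact h.start_one
  start_le := by rw [hs]; exact h.start_le
  first_start := fun m' hm => by
    rw [hs, hx.first _ ((h.start_mono hm (by omega)).trans h.ge)]
    exact h.first_start m' hm
  done := fun m' hm e' h1 h2 => by
    rw [hs] at h1 h2
    have h3 : e' < e := h2.trans_le ((h.start_mono hm (by omega)).trans h.ge)
    exact (h.done m' hm e' h1 h2).extend hx h3 (h.mono _ h3) (h3.trans h.lt)
  cur := fun e' h1 h2 => by
    rw [hs] at h1
    rcases Nat.lt_succ_iff_lt_or_eq.1 h2 with h3 | rfl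
    · exact (h.cur e' h1 h3).extend hx h3 (h.mono _ h3) (h3.trans h.lt)
    · exact hok
  ge := by rw [hs]; exact h.ge.trans (Nat.le_succ e)
  mono := fun e' h1 => by
    rcases h1.eq_or_lt with rfl | h2
    · exact le_rfl
    · rw [hx.first e' (by omega)]
      refine (h.mono e' (by omega)).trans ?_
      rw [← hx.first e le_rfl]
      exact hok.first_le
  lt := hlt

/-- A level has been finished. -/
theorem next (h : Tower L K s m (L.start (m + 1))) :
    Tower { L with start := Function.update L.start (m + 2) (L.first (L.start (m + 1))) } K s (m + 1)
      (L.start (m + 1)) := by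
  have hst : ∀ k < m + 2,
      Function.update L.start (m + 2) (L.first (L.start (m + 1))) k = L.start k := fun k hk =>
    Function.update_of_ne (by omega) _ _
  have hE : ∀ {m' e' : ℕ}, EntryOK L K s m' e' →
      EntryOK { L with start := Function.update L.start (m + 2) (L.first (L.start (m + 1))) }
        K s m' e' := fun h => ⟨h.1, h.2, h.3, h.4, h.5, h.6, h.7, h.8⟩
  refine ⟨?_, ?_, fun m' hm => ?_, fun m' hm => ?_, fun m' hm e' h1 h2 => ?_, fun e' h1 h2 => ?_, ?_,
    h.mono, h.lt⟩
  · simp only [hst 0 (by omega)]; exact h.start_zero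
  · simp only [hst 1 (by omega)]; exact h.start_one
  · simp only [hst m' (by omega)]
    rcases Nat.lt_succ_iff_lt_or_eq.1 (Nat.lt_succ_of_le hm) with h1 | rfl
    · rw [hst _ (by omega)]; exact h.start_le m' (by omega)
    · rw [Function.update_self]; exact h.lt.le
  · simp only [hst m' (by omega)]
    rcases Nat.lt_succ_iff_lt_or_eq.1 (Nat.lt_succ_of_le hm) with h1 | rfl
    · rw [hst _ (by omega)]; exact h.first_start m' (by omega)
    · rw [Function.update_self]
  · simp only [hst m' (by omega), hst (m' + 1) (by omega)] at h1 h2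
    rcases Nat.lt_succ_iff_lt_or_eq.1 hm with h3 | rfl
    · exact hE (h.done m' h3 e' h1 h2)
    · exact hE (h.cur e' h1 h2)
  · simp only [hst (m + 1) (by omega)] at h1
    omega
  · simp only [hst (m + 1) (by omega)]; exact le_rfl

end Tower

/-! ### Special ranks and the scan that subdivides one entry. -/

/-- The box with endpoint of rank `r` has an endpoint in an earlier interval of entry `e`. -/
def Special (L : Layout) (m e r : ℕ) : Prop := ∃ i < m, L.EndIn i (L.own m r) e

-- A special rank belongs to a box owning one of the at most `s` ranks in one of the `m` earlier
-- intervals, and each box has two ranks on axis `m`.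
open Classical in
theorem card_special {Bx : Fin n → AABox d} (hR : L.Ranks Bx) (hm : m < d)
    (hlen : ∀ i < m, L.B i e ≤ L.A i e + s ∧ L.B i e ≤ L.N) :
    ((Finset.range L.N).filter (Special L m e)).card ≤ 2 * s * m := by
  have hsub : (Finset.range L.N).filter (Special L m e) ⊆
      (Finset.range m).biUnion fun i => (Finset.Ico (L.A i e) (L.B i e)).biUnion fun x =>
        {L.pos m (2 * L.own i x), L.pos m (2 * L.own i x + 1)} := by
    intro r hr
    obtain ⟨hr1, i, hi, hE⟩ := Finset.mem_filter.1 hr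
    rw [Finset.mem_range] at hr1
    have hown : L.own m r < n := hR.own_lt hm hr1
    have hN := hR.N_eq
    have hx : ∃ x ∈ Finset.Ico (L.A i e) (L.B i e), L.own i x = L.own m r := by
      rcases hE with h | h
      · refine ⟨_, Finset.mem_Ico.2 h, ?_⟩
        rw [Layout.own, hR.Q_pos i (by omega) _ (by omega)]; omega
      · refine ⟨_, Finset.mem_Ico.2 h, ?_⟩
        rw [Layout.own, hR.Q_pos i (by omega) _ (by omega)]; omega
    obtain ⟨x, hx1, hx2⟩ := hx
    refine Finset.mem_biUnion.2 ⟨i, Finset.mem_range.2 hi, Finset.mem_biUnion.2 ⟨x, hx1, ?_⟩⟩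
    rw [hx2, Finset.mem_insert, Finset.mem_singleton]
    exact hR.rank_eq hm hr1
  refine (Finset.card_le_card hsub).trans ((Finset.card_biUnion_le_card_mul _ _ (s * 2) ?_).trans ?_)
  · intro i hi
    refine (Finset.card_biUnion_le_card_mul _ _ 2 fun x _ => Finset.card_le_two).trans ?_
    have := (hlen i (Finset.mem_range.1 hi)).1
    rw [Nat.card_Ico]
    exact Nat.mul_le_mul_right _ (by omega)
  · rw [Finset.card_range]
    exact (by ring : m * (s * 2) = 2 * s * m).le

open Classical in
/-- The state of the scan that subdivides an entry, before rank `r`: the intervals `[a f, b f)`,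
`t₀ ≤ f < t`, cover `[0, r)`, and `p x` is the interval that contains `x`.  A new interval begins
when the counter `c` is `0`, at special ranks and (according to `z`) after special ranks. -/
structure Scan (spec : ℕ → Prop) (s t₀ r t c z : ℕ) (a b p : ℕ → ℕ) : Prop where
  le : t₀ ≤ t
  last : 0 < r → t₀ < t ∧ b (t - 1) = r ∧ r ≤ a (t - 1) + (if c = 0 then s else c) ∧
    (z ≠ 0 ↔ spec (r - 1))
  zero : r = 0 → t = t₀ ∧ c = 0 ∧ z = 0
  interval : ∀ f, t₀ ≤ f → f < t → a f < b f ∧ b f ≤ r ∧ b f ≤ a f + s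
  pt_mem : ∀ x < r, t₀ ≤ p x ∧ p x < t
  pt_iff : ∀ x < r, ∀ f, t₀ ≤ f → f < t → (a f ≤ x ∧ x < b f ↔ p x = f)
  pt_mono : ∀ x y, x ≤ y → y < r → p x ≤ p y
  single : ∀ f, t₀ ≤ f → f < t → ∀ x, a f ≤ x → x < b f → spec x → b f = a f + 1
  counter : c < s
  count : ∃ μ, t + (if z = 0 then 0 else 1) ≤ t₀ + μ + 2 * ((Finset.range r).filter spec).card ∧
    r + (if c = 0 then 0 else s) = μ * s + c

namespace Scan
variable {spec : ℕ → Prop} {t₀ r t c z : ℕ} {a b p : ℕ → ℕ}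

theorem init (hs : 0 < s) : Scan spec s t₀ 0 t₀ 0 0 a b p where
  le := le_rfl
  last := fun h => absurd h (lt_irrefl 0)
  zero := fun _ => ⟨rfl, rfl, rfl⟩
  interval := fun f h1 h2 => by omega
  pt_mem := fun x h => by omega
  pt_iff := fun x h => by omega
  pt_mono := fun x y h1 h2 => by omega
  single := fun f h1 h2 => by omega
  counter := hs
  count := ⟨0, by simp, by simp⟩

theorem card_filter_succ (spec : ℕ → Prop) [DecidablePred spec] (r : ℕ) :
    ((Finset.range (r + 1)).filter spec).card =
      ((Finset.range r).filter spec).card + if spec r then 1 else 0 := by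
  rw [Finset.range_add_one, Finset.filter_insert]
  split_ifs
  · rw [Finset.card_insert_of_notMem (by simp)]
  · rfl

/-- The counter runs through `0, …, s - 1`. -/
def tick (s c : ℕ) : ℕ := if c + 1 = s then 0 else c + 1

/-- The hypothesis says that `μ` is `r / s` rounded up, that is the number of ranks so far at which
the counter was `0`. -/
theorem tick_count {μ : ℕ} (hc : c < s) (h : r + (if c = 0 then 0 else s) = μ * s + c) :
    r + 1 + (if tick s c = 0 then 0 else s) =
      (μ + if c = 0 then 1 else 0) * s + tick s c := by
  have h1 : (μ + 1) * s = μ * s + s := by ring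
  have h2 : tick s c = 0 ∧ c + 1 = s ∨ tick s c = c + 1 := by unfold tick; split_ifs <;> omega
  rcases Nat.eq_zero_or_pos c with h0 | h0
  · rw [if_pos h0] at h ⊢
    rw [h1]
    split_ifs <;> omega
  · rw [if_neg h0.ne'] at h ⊢
    rw [add_zero]
    split_ifs <;> omega

/-- A cut happens because the counter is `0`, which is charged to `μ`, or at a special rank or right
after one, which is charged to that rank. Each special rank pays for at most two cuts, the second
being reserved by the term with `z` in `count`. -/
theorem cut (h : Scan spec s t₀ r t c z a b p) (hcut : c = 0 ∨ spec r ∨ z ≠ 0) {z' : ℕ}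
    (hz : z' ≠ 0 ↔ spec r) :
    Scan spec s t₀ (r + 1) (t + 1) (tick s c) z' (Function.update a t r)
      (Function.update b t (r + 1)) (Function.update p r t) := by
  have hc := h.counter
  have ea : ∀ f, f < t → Function.update a t r f = a f := fun f hf =>
    Function.update_of_ne (by omega) _ _
  have eb : ∀ f, f < t → Function.update b t (r + 1) f = b f := fun f hf =>
    Function.update_of_ne (by omega) _ _
  have ep : ∀ x, x < r → Function.update p r t x = p x := fun x hx =>
    Function.update_of_ne (by omega) _ _
  have htick : tick s c = 0 ∨ 1 ≤ tick s c := by omega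
  have hts : tick s c < s := by unfold tick; split_ifs <;> omega
  refine ⟨by have := h.le; omega, fun _ => ?_, fun h0 => by omega, fun f h1 h2 => ?_, fun x hx => ?_,
    fun x hx f h1 h2 => ?_, fun x y hxy hy => ?_, fun f h1 h2 x h3 h4 h5 => ?_, hts, ?_⟩
  · refine ⟨by have := h.le; omega, ?_⟩
    rw [Nat.add_sub_cancel, Function.update_self, Function.update_self]
    refine ⟨rfl, ?_, hz⟩
    split_ifs <;> omega
  · rcases Nat.lt_succ_iff_lt_or_eq.1 h2 with h3 | rfl
    · rw [ea f h3, eb f h3]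
      have := h.interval f h1 h3
      omega
    · rw [Function.update_self, Function.update_self]
      omega
  · rcases Nat.lt_succ_iff_lt_or_eq.1 hx with h3 | rfl
    · rw [ep x h3]
      have := h.pt_mem x h3
      omega
    · rw [Function.update_self]
      have := h.le
      omega
  · rcases Nat.lt_succ_iff_lt_or_eq.1 hx with h3 | rfl <;>
      rcases Nat.lt_succ_iff_lt_or_eq.1 h2 with h4 | rfl
    · rw [ep x h3, ea f h4, eb f h4]
      exact h.pt_iff x h3 f h1 h4
    · rw [ep x h3, Function.update_self, Function.update_self]
      have := h.pt_mem x h3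
      omega
    · rw [Function.update_self, ea f h4, eb f h4]
      have := h.interval f h1 h4
      omega
    · simp
  · rcases Nat.lt_succ_iff_lt_or_eq.1 hy with h3 | rfl
    · rw [ep x (by omega), ep y h3]
      exact h.pt_mono x y hxy h3
    · rcases hxy.lt_or_eq with h3 | rfl
      · rw [Function.update_self, ep x h3]
        exact (h.pt_mem x h3).2.le
      · exact le_rfl
  · rcases Nat.lt_succ_iff_lt_or_eq.1 h2 with h6 | rfl
    · rw [ea f h6] at h3 ⊢
      rw [eb f h6] at h4 ⊢
      exact h.single f h1 h6 x h3 h4 h5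
    · rw [Function.update_self, Function.update_self]
  · obtain ⟨μ, h1, h2⟩ := h.count
    refine ⟨μ + if c = 0 then 1 else 0, ?_, tick_count hc h2⟩
    rw [card_filter_succ]
    by_cases hs : spec r
    · rw [if_neg (hz.2 hs), if_pos hs]
      split_ifs at h1 ⊢ <;> omega
    · rw [if_pos (not_not.1 fun h => hs (hz.1 h)), if_neg hs]
      split_ifs at h1 ⊢ with h3 h4
      · omega
      · omega
      · tauto
      · omega

/-- The current interval may grow: since the counter is not `0`, it is still shorter than `s`, and
it contains no special rank, as such a rank would be alone in its interval and equal to `r - 1`,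
contrary to `z = 0`. -/
theorem extend (h : Scan spec s t₀ r t c z a b p) (hc0 : c ≠ 0) (hs : ¬ spec r) (hz : z = 0) :
    Scan spec s t₀ (r + 1) t (tick s c) 0 a (Function.update b (t - 1) (r + 1))
      (Function.update p r (t - 1)) := by
  have hc := h.counter
  have hr : 0 < r := by
    rcases Nat.eq_zero_or_pos r with h0 | h0
    · exact absurd (h.zero h0).2.1 hc0
    · exact h0
  obtain ⟨ht, hb, hlen, hzs⟩ := h.last hr
  rw [if_neg hc0] at hlen
  have hnot : ¬ spec (r - 1) := fun h' => hzs.2 h' hz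
  have hint := h.interval (t - 1) (by omega) (by omega)
  have eb : ∀ f, f ≠ t - 1 → Function.update b (t - 1) (r + 1) f = b f := fun f hf =>
    Function.update_of_ne hf _ _
  have ep : ∀ x, x < r → Function.update p r (t - 1) x = p x := fun x hx =>
    Function.update_of_ne (by omega) _ _
  have htk : (tick s c = 0 ∧ c + 1 = s) ∨ tick s c = c + 1 := by unfold tick; split_ifs <;> omega
  have hts : tick s c < s := by unfold tick; split_ifs <;> omega
  refine ⟨h.le, fun _ => ?_, fun h0 => by omega, fun f h1 h2 => ?_, fun x hx => ?_,
    fun x hx f h1 h2 => ?_, fun x y hxy hy => ?_, fun f h1 h2 x h3 h4 h5 => ?_, hts, ?_⟩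
  · refine ⟨ht, Function.update_self .., ?_, by simpa using hs⟩
    split_ifs <;> omega
  · by_cases hf : f = t - 1
    · subst hf
      rw [Function.update_self]
      omega
    · rw [eb f hf]
      have := h.interval f h1 h2
      omega
  · rcases Nat.lt_succ_iff_lt_or_eq.1 hx with h3 | rfl
    · rw [ep x h3]; exact h.pt_mem x h3
    · rw [Function.update_self]; omega
  · rcases Nat.lt_succ_iff_lt_or_eq.1 hx with h3 | rfl
    · rw [ep x h3, ← h.pt_iff x h3 f h1 h2]
      by_cases hf : f = t - 1
      · subst hf
        rw [Function.update_self, hb]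
        omega
      · rw [eb f hf]
    · rw [Function.update_self]
      by_cases hf : f = t - 1
      · subst hf
        rw [Function.update_self]
        omega
      · rw [eb f hf]
        have := h.interval f h1 h2
        omega
  · rcases Nat.lt_succ_iff_lt_or_eq.1 hy with h3 | rfl
    · rw [ep x (by omega), ep y h3]
      exact h.pt_mono x y hxy h3
    · rcases hxy.lt_or_eq with h3 | rfl
      · rw [Function.update_self, ep x h3]
        have := (h.pt_mem x h3).2
        omega
      · exact le_rfl
  · by_cases hf : f = t - 1
    · subst hf
      rw [Function.update_self] at h4
      have hxr : x < r := by
        rcases Nat.lt_succ_iff_lt_or_eq.1 h4 with h6 | rfl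
        · exact h6
        · exact absurd h5 hs
      have h6 := h.single (t - 1) h1 h2 x h3 (by omega) h5
      exact absurd (by rwa [show r - 1 = x by omega]) hnot
    · rw [eb f hf] at h4 ⊢
      exact h.single f h1 h2 x h3 h4 h5
  · obtain ⟨μ, h1, h2⟩ := h.count
    refine ⟨μ + if c = 0 then 1 else 0, ?_, tick_count hc h2⟩
    rw [card_filter_succ, if_neg hs, if_neg hc0, if_pos rfl]
    rw [if_pos hz] at h1
    omega

-- From `μ * s ≤ N + s` and `N ≤ 2 * (s * s)` follows `μ ≤ 2 * s + 1`, which is at most `3 * s`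
-- because `c < s` forces `s` to be positive.
open Classical in
theorem bound {N S : ℕ} (h : Scan spec s t₀ N t c z a b p) (hN : N ≤ 2 * (s * s))
    (hS : ((Finset.range N).filter spec).card ≤ S) : t ≤ t₀ + 3 * s + 2 * S := by
  obtain ⟨μ, h1, h2⟩ := h.count
  have hc := h.counter
  have h3 : μ ≤ 3 * s := by
    have h4 : μ * s ≤ (2 * s + 1) * s := by
      have : (2 * s + 1) * s = 2 * (s * s) + s := by ring
      split_ifs at h2 <;> omega
    have := Nat.le_of_mul_le_mul_right h4 (by omega)
    omega
  have h5 : ((Finset.range N).filter spec).card ≤ S := hS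
  omega

end Scan

/-- A complete scan subdivides the entry. -/
theorem EntryOK.of_scan {t c z : ℕ} (hx : L.first e ≤ L.first (e + 1))
    (h : Scan (Special L m e) s (L.first e) L.N t c z (L.A m) (L.B m) (L.pt e))
    (ht : L.first (e + 1) = t) (hK : t ≤ L.first e + K)
    (hinh : ∀ f, L.first e ≤ f → f < t → ∀ i < m, L.A i f = L.A i e ∧ L.B i f = L.B i e) :
    EntryOK L K s m e := by
  subst ht
  exact ⟨hx, hK, hinh, h.interval, h.pt_mem, h.pt_iff, h.pt_mono,
    fun f h1 h2 x h3 h4 i hi h5 => h.single f h1 h2 x h3 h4 ⟨i, hi, h5⟩⟩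

end RealRAM

namespace RealRAM

theorem Fast.loop_fast {ω : Tape} {U V k : ℕ} {p : BExp} {P : Prog} {σ : State} {Q : State → Prop}
    (I : ℕ → State → Prop)
    (hstep : ∀ k σ, I k σ → p.Holds σ → ∃ k', k = k' + 1 ∧ Fast ω U P σ (I k'))
    (hdone : ∀ k σ, I k σ → ¬ p.Holds σ → Q σ) (hU : 1 ≤ U) (hk : k < V) (hI : I k σ) :
    Fast ω (U * V) (.loop p P) σ Q := by
  refine (Runs.loop_uniform I (P.wcost * U) hstep hdone k σ hI).mono ?_ fun _ => id
  calc (k + 1) * (p.cost + P.wcost * U) ≤ V * (p.cost * U + P.wcost * U) :=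
        Nat.mul_le_mul hk (Nat.add_le_add_right (Nat.le_mul_of_pos_right _ hU) _)
    _ = (Prog.loop p P).wcost * (U * V) := by simp only [Prog.wcost]; ring

/-! ### Sorting with a tournament tree -/

/-- The nodes of a tournament tree outside of `E` hold the better of the entries of their
children. -/
def Tour (N : ℕ) (key : ℕ → ℝ) (W : ℕ → ℕ) (E : ℕ → Prop) : Prop :=
  ∀ x, 1 ≤ x → x < N → ¬ E x →
    W x = if key (W (2 * x + 1)) < key (W (2 * x)) then W (2 * x + 1) else W (2 * x)

namespace Tour
variable {N w : ℕ} {key : ℕ → ℝ} {W : ℕ → ℕ} {E E' : ℕ → Prop}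

/-- Recomputing `w` mends `w` and can disturb only its parent. It serves both the bottom-up
construction, with an initial segment as exceptional set, and the repair after a removal, with the
ancestors of a leaf. -/
theorem repair (h : Tour N key W E) (hw : 1 ≤ w)
    (hE : ∀ x, ¬ E' x → x = w ∨ ¬ E x ∧ 2 * x ≠ w ∧ 2 * x + 1 ≠ w) :
    Tour N key (Function.update W w
      (if key (W (2 * w + 1)) < key (W (2 * w)) then W (2 * w + 1) else W (2 * w))) E' := by
  intro x h1 h2 h3
  have hc : ∀ y, y ≠ w → ∀ v, Function.update W w v y = W y := fun y hy v =>
    Function.update_of_ne hy _ _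
  rcases hE x h3 with rfl | ⟨h4, h5, h6⟩
  · rw [Function.update_self, hc _ (by omega), hc _ (by omega)]
  · by_cases hx : x = w
    · subst hx
      rw [Function.update_self, hc _ (by omega), hc _ (by omega)]
    · rw [hc _ hx, hc _ h5, hc _ h6]
      exact h x h1 h2 h4

theorem set_leaf (h : Tour N key W E) (v q : ℕ) (hE : ∀ x, ¬ E' x → ¬ E x ∧ x ≠ v / 2)
    (hv : N ≤ v) : Tour N key (Function.update W v q) E' := by
  intro x h1 h2 h3
  obtain ⟨h4, h5⟩ := hE x h3
  rw [Function.update_of_ne (by omega), Function.update_of_ne (by omega),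
    Function.update_of_ne (by omega)]
  exact h x h1 h2 h4

/-- The number of leaves `N` need not be a power of two: children have larger numbers, so the
descent ends at a number in `[N, 2 * N)` anyway. -/
theorem exists_leaf (h : Tour N key W fun _ => False) {x : ℕ} (hx : 1 ≤ x) (hx' : x < 2 * N) :
    ∃ q < N, W x = W (N + q) := by
  by_cases hN : N ≤ x
  · exact ⟨x - N, by omega, by rw [Nat.add_sub_cancel' hN]⟩
  · rw [h x hx (by omega) not_false]
    split_ifs
    · exact h.exists_leaf (by omega) (by omega)
    · exact h.exists_leaf (by omega) (by omega)
termination_by 2 * N - x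

theorem key_root_le (h : Tour N key W fun _ => False) (x : ℕ) (hx : 1 ≤ x) (hx' : x < 2 * N) :
    key (W 1) ≤ key (W x) := by
  induction x using Nat.strong_induction_on with
  | _ x ih =>
    rcases hx.eq_or_lt with rfl | h1
    · exact le_rfl
    · refine (ih (x / 2) (by omega) (by omega) (by omega)).trans ?_
      rw [h (x / 2) (by omega) (by omega) not_false]
      rcases Nat.mod_two_eq_zero_or_one x with h2 | h2
      · rw [show 2 * (x / 2) = x by omega]
        split_ifs with h3
        · exact h3.le
        · exact le_rfl
      · rw [show 2 * (x / 2) + 1 = x by omega]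
        split_ifs with h3
        · exact le_rfl
        · exact not_lt.1 h3

end Tour

/-- After `r` extractions the ranks below `r` are known; the leaves of the other keys are still in
the tree. -/
structure Extract (N r : ℕ) (key : ℕ → ℝ) (W Q pos : ℕ → ℕ) (X : ℕ → ℝ) : Prop where
  Q_lt : ∀ x < r, Q x < N
  pos_Q : ∀ x < r, pos (Q x) = x
  X_eq : ∀ x < r, X x = key (Q x)
  mono : ∀ x y, x < y → y < r → X x < X y
  leaf : ∀ q < N, W (N + q) = if ∃ x < r, Q x = q then N else q
  rest : ∀ q < N, (∀ x < r, Q x ≠ q) → ∀ x < r, X x < key q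

namespace Extract
variable {N r : ℕ} {key : ℕ → ℝ} {W Q pos : ℕ → ℕ} {X : ℕ → ℝ}

/-- As `r < N`, some key has not been extracted, and it beats the sentinel `N`. The winner is thus a
genuine key, the least of the remaining ones. -/
theorem root (h : Extract N r key W Q pos X) (hT : Tour N key W fun _ => False) (hr : r < N)
    (hbig : ∀ q < N, key q < key N) :
    W 1 < N ∧ (∀ x < r, Q x ≠ W 1) ∧ ∀ q < N, (∀ x < r, Q x ≠ q) → key (W 1) ≤ key q := by
  obtain ⟨q₀, hq₀, hne⟩ : ∃ q < N, ∀ x < r, Q x ≠ q := by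
    by_contra hcon
    push Not at hcon
    have hsub : Finset.range N ⊆ (Finset.range r).image Q := fun q hq => by
      obtain ⟨x, hx, hxq⟩ := hcon q (Finset.mem_range.1 hq)
      exact Finset.mem_image.2 ⟨x, Finset.mem_range.2 hx, hxq⟩
    have h1 := (Finset.card_le_card hsub).trans Finset.card_image_le
    rw [Finset.card_range, Finset.card_range] at h1
    omega
  have hmin : ∀ q < N, (∀ x < r, Q x ≠ q) → key (W 1) ≤ key q := fun q hq hqr => by
    have h1 := hT.key_root_le (N + q) (by omega) (by omega)
    rwa [h.leaf q hq, if_neg (fun ⟨x, hx, hxq⟩ => hqr x hx hxq)] at h1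
  obtain ⟨q, hq, hWq⟩ := hT.exists_leaf (x := 1) le_rfl (by omega)
  rw [h.leaf q hq] at hWq
  split_ifs at hWq with hex
  · have := hmin q₀ hq₀ hne
    rw [hWq] at this
    exact absurd (hbig q₀ hq₀) this.not_gt
  · push Not at hex
    rw [hWq]
    exact ⟨hq, hex, by rw [← hWq]; exact hmin⟩

/-- The extracted key is minimal among the remaining ones, and strictly below the others because
keys are distinct. -/
theorem step (h : Extract N r key W Q pos X) (hT : Tour N key W fun _ => False) (hr : r < N)
    (hbig : ∀ q < N, key q < key N) (hinj : ∀ q < N, ∀ q' < N, key q = key q' → q = q')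
    {W' : ℕ → ℕ} (hW : ∀ q < N, W' (N + q) = if q = W 1 then N else W (N + q)) :
    Extract N (r + 1) key W' (Function.update Q r (W 1)) (Function.update pos (W 1) r)
      (Function.update X r (key (W 1))) := by
  obtain ⟨hw, hne, hmin⟩ := h.root hT hr hbig
  have eQ : ∀ x < r, Function.update Q r (W 1) x = Q x := fun x hx =>
    Function.update_of_ne hx.ne _ _
  have eX : ∀ x < r, Function.update X r (key (W 1)) x = X x := fun x hx =>
    Function.update_of_ne hx.ne _ _
  have eP : ∀ x < r, Function.update pos (W 1) r (Q x) = pos (Q x) := fun x hx =>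
    Function.update_of_ne (hne x hx) _ _
  refine ⟨fun x hx => ?_, fun x hx => ?_, fun x hx => ?_, fun x y hxy hy => ?_, fun q hq => ?_,
    fun q hq hqr x hx => ?_⟩
  · rcases Nat.lt_succ_iff_lt_or_eq.1 hx with h1 | rfl
    · rw [eQ x h1]; exact h.Q_lt x h1
    · rw [Function.update_self]; exact hw
  · rcases Nat.lt_succ_iff_lt_or_eq.1 hx with h1 | rfl
    · rw [eQ x h1, eP x h1]; exact h.pos_Q x h1
    · simp
  · rcases Nat.lt_succ_iff_lt_or_eq.1 hx with h1 | rfl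
    · rw [eQ x h1, eX x h1]; exact h.X_eq x h1
    · simp
  · rcases Nat.lt_succ_iff_lt_or_eq.1 hy with h1 | rfl
    · rw [eX x (by omega), eX y h1]; exact h.mono x y hxy h1
    · rw [eX x hxy, Function.update_self]
      exact h.rest _ hw hne x hxy
  · rw [hW q hq]
    by_cases hqw : q = W 1
    · rw [if_pos hqw, if_pos ⟨r, by omega, by rw [Function.update_self, hqw]⟩]
    · rw [if_neg hqw, h.leaf q hq]
      congr 1
      refine propext ⟨fun ⟨x, hx, hxq⟩ => ⟨x, by omega, by rw [eQ x hx, hxq]⟩, fun ⟨x, hx, hxq⟩ => ?_⟩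
      rcases Nat.lt_succ_iff_lt_or_eq.1 hx with h1 | rfl
      · exact ⟨x, h1, by rw [← eQ x h1, hxq]⟩
      · rw [Function.update_self] at hxq
        exact absurd hxq.symm hqw
  · have hq' : ∀ x < r, Q x ≠ q := fun x hx => by rw [← eQ x hx]; exact hqr x (by omega)
    rcases Nat.lt_succ_iff_lt_or_eq.1 hx with h1 | rfl
    · rw [eX x h1]; exact h.rest q hq hq' x h1
    · rw [Function.update_self]
      refine (hmin q hq hq').lt_of_ne fun he => ?_
      have := hqr x (by omega)
      rw [Function.update_self] at this
      exact this (hinj _ hw _ hq he)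

end Extract

/-- The keys `key q`, `q < N`, have been sorted. -/
structure Sorted (N : ℕ) (key : ℕ → ℝ) (Q pos : ℕ → ℕ) (X : ℕ → ℝ) : Prop where
  pos_lt : ∀ q < N, pos q < N
  Q_lt : ∀ r < N, Q r < N
  Q_pos : ∀ q < N, Q (pos q) = q
  pos_Q : ∀ r < N, pos (Q r) = r
  mono : ∀ r r', r < r' → r' < N → X r < X r'
  X_pos : ∀ q < N, X (pos q) = key q

/-- `Q` maps the `N` ranks injectively into the `N` keys, having the left inverse `pos`; hence it is
onto, and `pos` is a two-sided inverse. -/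
theorem Extract.sorted {N : ℕ} {key : ℕ → ℝ} {W Q pos : ℕ → ℕ} {X : ℕ → ℝ}
    (h : Extract N N key W Q pos X) : Sorted N key Q pos X := by
  have hsurj : ∀ q < N, ∃ x < N, Q x = q := by
    have h1 : Set.SurjOn Q (Finset.range N) (Finset.range N) :=
      Finset.surjOn_of_injOn_of_card_le Q
        (fun x hx => Finset.mem_coe.2 (Finset.mem_range.2 (h.Q_lt x (Finset.mem_range.1 hx))))
        (fun x hx y hy hxy => by
          rw [← h.pos_Q x (Finset.mem_range.1 hx), ← h.pos_Q y (Finset.mem_range.1 hy), hxy]) le_rfl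
    intro q hq
    obtain ⟨x, hx, hxq⟩ := h1 (Finset.mem_coe.2 (Finset.mem_range.2 hq))
    exact ⟨x, Finset.mem_range.1 hx, hxq⟩
  refine ⟨fun q hq => ?_, h.Q_lt, fun q hq => ?_, h.pos_Q, h.mono, fun q hq => ?_⟩ <;>
    obtain ⟨x, hx, rfl⟩ := hsurj q hq
  · rw [h.pos_Q x hx]; exact hx
  · rw [h.pos_Q x hx]
  · rw [h.pos_Q x hx]; exact h.X_eq x hx

end RealRAM

/-! ### The sorting program. -/

namespace RealRAM

namespace State

theorem putNA_na_self (σ : State) (f k v : ℕ) :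
    (σ.putNA f k v).na f = Function.update (σ.na f) k v := by
  funext k'; simp [Function.update_apply]
theorem putNA_na_ne (σ : State) {f f' : ℕ} (k v : ℕ) (h : f' ≠ f) :
    (σ.putNA f k v).na f' = σ.na f' := by
  funext k'; simp [h]
theorem putRA_ra_self (σ : State) (f k : ℕ) (x : ℝ) :
    (σ.putRA f k x).ra f = Function.update (σ.ra f) k x := by
  funext k'; simp [Function.update_apply]
theorem putRA_ra_ne (σ : State) {f f' : ℕ} (k : ℕ) (x : ℝ) (h : f' ≠ f) :
    (σ.putRA f k x).ra f' = σ.ra f' := by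
  funext k'; simp [h]

end State

/-- Only the arrays in `F` and `G`, and registers from `20` on are changed. -/
structure ArrFrame (F G : Set ℕ) (σ τ : State) : Prop where
  nreg : ∀ i < 20, τ.nreg i = σ.nreg i
  na : ∀ f, f ∉ F → τ.na f = σ.na f
  ra : ∀ f, f ∉ G → τ.ra f = σ.ra f
  rheap : ∀ a < σ.nreg 1, τ.rheap a = σ.rheap a

namespace ArrFrame
variable {F G F' G' : Set ℕ} {σ τ υ : State}

theorem refl (σ : State) : ArrFrame F G σ σ :=
  ⟨fun _ _ => rfl, fun _ _ => rfl, fun _ _ => rfl, fun _ _ => rfl⟩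

theorem trans (h : ArrFrame F G σ τ) (h' : ArrFrame F G τ υ) : ArrFrame F G σ υ :=
  ⟨fun i hi => (h'.nreg i hi).trans (h.nreg i hi), fun f hf => (h'.na f hf).trans (h.na f hf),
    fun f hf => (h'.ra f hf).trans (h.ra f hf),
    fun a ha => (h'.rheap a (by rwa [h.nreg 1 (by norm_num)])).trans (h.rheap a ha)⟩

theorem mono (h : ArrFrame F G σ τ) (hF : F ⊆ F') (hG : G ⊆ G') : ArrFrame F' G' σ τ :=
  ⟨h.nreg, fun f hf => h.na f fun h' => hf (hF h'), fun f hf => h.ra f fun h' => hf (hG h'),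
    h.rheap⟩

theorem setN (h : ArrFrame F G σ τ) {i : ℕ} (hi : 20 ≤ i) (v : ℕ) :
    ArrFrame F G σ (τ.setN i v) :=
  h.trans ⟨fun j hj => by simp; omega, fun _ _ => rfl, fun f _ => by rw [State.setN_ra]; omega,
    fun _ _ => rfl⟩

theorem setR (h : ArrFrame F G σ τ) (i : ℕ) (v : ℝ) : ArrFrame F G σ (τ.setR i v) :=
  h.trans ⟨fun _ _ => rfl, fun _ _ => rfl, fun _ _ => rfl, fun _ _ => rfl⟩

theorem putNA (h : ArrFrame F G σ τ) {f : ℕ} (hf : f ∈ F) (k v : ℕ) :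
    ArrFrame F G σ (τ.putNA f k v) :=
  h.trans ⟨fun _ _ => rfl, fun _ hf' => State.putNA_na_ne _ _ _ fun he => hf' (he ▸ hf),
    fun _ _ => rfl, fun _ _ => rfl⟩

theorem putRA (h : ArrFrame F G σ τ) {f : ℕ} (hf : f ∈ G) (k : ℕ) (v : ℝ) :
    ArrFrame F G σ (τ.putRA f k v) :=
  h.trans ⟨fun _ _ => rfl, fun _ _ => rfl,
    fun _ hf' => State.putRA_ra_ne _ _ _ fun he => hf' (he ▸ hf),
    fun _ ha => State.putRA_rheap _ _ _ _ ha⟩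

end ArrFrame

section
variable {ω : Tape} {d n N i : ℕ} {σ : State} {key : ℕ → ℝ}

/-- Load the keys of axis `i` and the leaves of the tournament tree. -/
def loadKeys (d i : ℕ) : Prog :=
  .setR 10 (rc 0) ;; .setN 20 (nc 0) ;; .setN 21 (nc (2 * i)) ;;
  .loop (.nlt (nv 20) (nv 2))
    (.setR 11 (.heap (nv 21)) ;; .setR 12 (.heap (nv 21 + nc 1)) ;;
      .setR 10 (rv 10 + rv 11 * rv 11 + rv 12 * rv 12 + rc 1) ;;
      putR 2 (nv 20) (rv 11) ;; putR 2 (nv 20 + nc 1) (rv 12) ;;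
      putN 5 (nv 2 + nv 20) (nv 20) ;; putN 5 (nv 2 + nv 20 + nc 1) (nv 20 + nc 1) ;;
      .setN 20 (nv 20 + nc 2) ;; .setN 21 (nv 21 + nc (2 * d))) ;;
  putR 2 (nv 2) (rv 10)

/-- The tournament needs a key larger than all others for removed entries. Adding up the squares of
all keys and a `1` for each pair produces one with field operations only. -/
theorem loadKeys_spec {U : ℕ} (hU : n < U) (hN : N = 2 * n) (h2 : σ.nreg 2 = N)
    (h1 : σ.nreg 1 = d * N) (hi : i < d)
    (hkey : ∀ j < n, σ.rheap (j * (2 * d) + 2 * i) = key (2 * j) ∧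
      σ.rheap (j * (2 * d) + 2 * i + 1) = key (2 * j + 1)) :
    Fast ω U (loadKeys d i) σ fun τ => ArrFrame {5} {2} σ τ ∧ (∀ q < N, τ.ra 2 q = key q) ∧
      (∀ q < N, key q < τ.ra 2 N) ∧ ∀ q < N, τ.na 5 (N + q) = q := by
  have hU1 : 1 ≤ U := by omega
  refine Fast.seq_wp hU1 ?_
  simp only [wp_setR]
  refine Fast.seq_wp hU1 ?_
  simp only [wp_setN]
  refine Fast.seq_wp hU1 ?_
  simp only [wp_setN]
  refine Fast.seq (Fast.loop (k := n) (I := fun k τ => ∃ j, n = j + k ∧ τ.nreg 20 = 2 * j ∧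
    τ.nreg 21 = j * (2 * d) + 2 * i ∧ 0 ≤ τ.rreg 10 ∧ (∀ q < 2 * j, τ.ra 2 q = key q) ∧
    (∀ q < 2 * j, key q < τ.rreg 10) ∧ (∀ q < 2 * j, τ.na 5 (N + q) = q) ∧
    ArrFrame {5} {2} σ τ) ?_ ?_ hU ?_)
  · rintro k τ ⟨j, hj, h20, h21, h10, hk1, hk2, hk3, hf⟩ hp
    simp only [BExp.holds_nlt, NExp.eval_reg, h20, hf.nreg 2 (by norm_num), h2] at hp
    have hjn : j < n := by omega
    obtain ⟨k, rfl⟩ : ∃ k', k = k' + 1 := ⟨k - 1, by omega⟩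
    obtain ⟨e1, e2⟩ := hkey j hjn
    have hlt : j * (2 * d) + 2 * i + 1 < σ.nreg 1 := by
      rw [h1, hN]
      nlinarith
    rw [← hf.rheap _ (by omega)] at e1 e2
    -- The squares give `x < x * x + 1` for both new keys and show that the sentinel does not
    -- decrease.
    have s1 := mul_self_nonneg (key (2 * j))
    have s2 := mul_self_nonneg (key (2 * j + 1))
    have s3 := mul_self_nonneg (key (2 * j) - 1)
    have s4 := mul_self_nonneg (key (2 * j + 1) - 1)
    refine ⟨k, rfl, ?_⟩
    simp only [wp_seq, wp_setR, wp_setN, wp_putR, wp_putN]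
    refine ⟨j + 1, by omega, ?_, ?_, ?_, fun q hq => ?_, fun q hq => ?_, fun q hq => ?_,
      ((((((((hf.setR _ _).setR _ _).setR _ _).putRA rfl _ _).putRA rfl _ _).putNA rfl _ _).putNA
        rfl _ _).setN (by norm_num) _).setN (by norm_num) _⟩
    · simp [h20]; ring
    · simp [h21]; ring
    · simp [h21, e1, e2]
      linarith
    · have hc : q < 2 * j ∨ q = 2 * j ∨ q = 2 * j + 1 := by omega
      rcases hc with hc | rfl | rfl
      · simp [h20, hk1 q hc, hc.ne, show q ≠ 2 * j + 1 by omega]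
      · simp [h20, h21, e1]
      · simp [h20, h21, e2]
    · have hc : q < 2 * j ∨ q = 2 * j ∨ q = 2 * j + 1 := by omega
      simp only [State.setN_rreg, State.putNA_rreg, State.putRA_rreg, State.setR_rreg]
      simp [h21, e1, e2]
      rcases hc with hc | rfl | rfl
      · have := hk2 q hc
        linarith
      · nlinarith
      · nlinarith
    · have hc : q < 2 * j ∨ q = 2 * j ∨ q = 2 * j + 1 := by omega
      rcases hc with hc | rfl | rfl
      · simp [h20, hf.nreg 2 (by norm_num), h2, hk3 q hc, hc.ne,
          show N + q ≠ N + 2 * j + 1 by omega]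
      · simp [h20, hf.nreg 2 (by norm_num), h2]
      · simp [h20, hf.nreg 2 (by norm_num), h2, ← add_assoc]
  · rintro k τ ⟨j, hj, h20, h21, h10, hk1, hk2, hk3, hf⟩ hp
    simp only [BExp.holds_nlt, NExp.eval_reg, h20, hf.nreg 2 (by norm_num), h2] at hp
    obtain rfl : j = n := by omega
    rw [← hN] at hk1 hk2 hk3
    refine Fast.of_wp hU1 ?_
    simp only [wp_putR]
    refine ⟨hf.putRA rfl _ _, fun q hq => ?_, fun q hq => ?_, fun q hq => ?_⟩
    · simp [hf.nreg 2 (by norm_num), h2, hk1 q hq, hq.ne]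
    · simpa [hf.nreg 2 (by norm_num), h2] using hk2 q hq
    · simpa using hk3 q hq
  · refine ⟨0, by omega, by simp, by simp, by simp, fun q hq => by omega, fun q hq => by omega,
      fun q hq => by omega, (((ArrFrame.refl σ).setR _ _).setN (by norm_num) _).setN (by norm_num) _⟩

/-- Recompute the node of the tournament tree in register `22`. -/
def repair : Prog :=
  .ite (.rlt (.arr 2 (.arr 5 (nv 22 + nv 22 + nc 1))) (.arr 2 (.arr 5 (nv 22 + nv 22))))
    (putN 5 (nv 22) (.arr 5 (nv 22 + nv 22 + nc 1))) (putN 5 (nv 22) (.arr 5 (nv 22 + nv 22)))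

theorem wp_repair {Q : State → Prop} :
    wp ω repair Q σ ↔ Q (σ.putNA 5 (σ.nreg 22)
      (if σ.ra 2 (σ.na 5 (2 * σ.nreg 22 + 1)) < σ.ra 2 (σ.na 5 (2 * σ.nreg 22))
        then σ.na 5 (2 * σ.nreg 22 + 1) else σ.na 5 (2 * σ.nreg 22))) := by
  simp only [repair, wp_ite, wp_putN, BExp.holds_rlt, RExp.eval_arr, NExp.eval_arr, NExp.eval_add,
    NExp.eval_reg, NExp.eval_const, ← two_mul]
  split_ifs with h <;> simp [h]

/-- Compute all the inner nodes of the tournament tree. -/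
def initTour : Prog :=
  .setN 22 (nv 2 - nc 1) ;; .loop (.nlt (nc 0) (nv 22)) (repair ;; .setN 22 (nv 22 - nc 1))

theorem initTour_spec {U : ℕ} (hU : N < U) (h2 : σ.nreg 2 = N) :
    Fast ω U initTour σ fun τ => ArrFrame {5} {2} σ τ ∧ τ.ra 2 = σ.ra 2 ∧
      (∀ q, τ.na 5 (N + q) = σ.na 5 (N + q)) ∧ Tour N (σ.ra 2) (τ.na 5) fun _ => False := by
  have hU1 : 1 ≤ U := by omega
  refine Fast.seq_wp hU1 ?_
  simp only [wp_setN]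
  refine Fast.loop (k := N - 1) (I := fun k τ => τ.nreg 22 = k ∧ k ≤ N - 1 ∧ ArrFrame {5} {2} σ τ ∧
    τ.ra 2 = σ.ra 2 ∧ (∀ q, τ.na 5 (N + q) = σ.na 5 (N + q)) ∧
    Tour N (σ.ra 2) (τ.na 5) fun x => x ≤ k) ?_ ?_ (by omega) ?_
  · rintro k τ ⟨h22, hk, hf, hra, hleaf, hT⟩ hp
    simp only [BExp.holds_nlt, NExp.eval_reg, NExp.eval_const, h22] at hp
    obtain ⟨k, rfl⟩ : ∃ k', k = k' + 1 := ⟨k - 1, by omega⟩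
    refine ⟨k, rfl, ?_⟩
    simp only [wp_seq, wp_repair, wp_setN]
    refine ⟨by simp [h22], by omega, (hf.putNA rfl _ _).setN (by norm_num) _, by simpa using hra,
      fun q => ?_, ?_⟩
    · simp [h22, show N + q ≠ k + 1 by omega, hleaf]
    · rw [State.setN_na, State.putNA_na_self, h22, hra]
      exact hT.repair (by omega) fun x hx => by omega
  · rintro k τ ⟨h22, hk, hf, hra, hleaf, hT⟩ hp
    simp only [BExp.holds_nlt, NExp.eval_reg, NExp.eval_const, h22] at hp
    exact ⟨hf, hra, hleaf, fun x h1 h3 h4 => hT x h1 h3 (by omega)⟩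
  · refine ⟨by simp [h2], le_rfl, (ArrFrame.refl σ).setN (by norm_num) _, by simp, by simp,
      fun x h1 h3 h4 => by omega⟩

/-- Remove the winner of the tournament in register `24`. -/
def removeWinner : Prog :=
  .setN 22 (nv 2 + nv 24) ;; putN 5 (nv 22) (nv 2) ;; .setN 22 (.half (nv 22)) ;;
  .loop (.nlt (nc 0) (nv 22)) (repair ;; .setN 22 (.half (nv 22)))

/-- Replacing a leaf by the sentinel affects only the nodes above it. Repairing them from below
upwards takes one step per level, at most `H` in all. -/
theorem removeWinner_spec {U H w : ℕ} (hU : H < U) (hH : 2 * N ≤ 2 ^ H) (h2 : σ.nreg 2 = N)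
    (h24 : σ.nreg 24 = w) (hw : w < N) (hT : Tour N (σ.ra 2) (σ.na 5) fun _ => False) :
    Fast ω U removeWinner σ fun τ => ArrFrame {5} {2} σ τ ∧ τ.ra 2 = σ.ra 2 ∧
      τ.nreg 20 = σ.nreg 20 ∧ (∀ q < N, τ.na 5 (N + q) = if q = w then N else σ.na 5 (N + q)) ∧
      Tour N (σ.ra 2) (τ.na 5) fun _ => False := by
  have hU1 : 1 ≤ U := by omega
  refine Fast.seq_wp hU1 ?_
  simp only [wp_setN]
  refine Fast.seq_wp hU1 ?_
  simp only [wp_putN]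
  refine Fast.seq_wp hU1 ?_
  simp only [wp_setN]
  refine Fast.loop (k := H) (I := fun k τ => ∃ v, τ.nreg 22 = v / 2 ∧ v / 2 < 2 ^ k ∧ v / 2 < N ∧
    ArrFrame {5} {2} σ τ ∧ τ.ra 2 = σ.ra 2 ∧ τ.nreg 20 = σ.nreg 20 ∧
    (∀ q < N, τ.na 5 (N + q) = if q = w then N else σ.na 5 (N + q)) ∧
    Tour N (σ.ra 2) (τ.na 5) (Anc v)) ?_ ?_ (by omega) ?_
  · rintro k τ ⟨v, h22, hvk, hvN, hf, hra, h20, hleaf, hT⟩ hp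
    simp only [BExp.holds_nlt, NExp.eval_reg, NExp.eval_const, h22] at hp
    obtain ⟨k, rfl⟩ : ∃ k', k = k' + 1 := by
      cases k with
      | zero => simp at hvk; omega
      | succ k => exact ⟨k, rfl⟩
    refine ⟨k, rfl, ?_⟩
    simp only [wp_seq, wp_repair, wp_setN]
    rw [pow_succ] at hvk
    refine ⟨v / 2, by simp [h22], by omega, by omega, (hf.putNA rfl _ _).setN (by norm_num) _,
      by simpa using hra, by simpa using h20, fun q hq => ?_, ?_⟩
    · simp only [State.setN_na, State.putNA_na, h22]
      rw [if_neg (by omega), hleaf q hq]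
    · rw [State.setN_na, State.putNA_na_self, h22, hra]
      refine hT.repair (by omega) fun x hx => ?_
      by_cases hxv : x = v / 2
      · exact Or.inl hxv
      · refine Or.inr ⟨fun h => ?_, fun h => hx ?_, fun h => hx ?_⟩
        · rw [anc_iff] at h
          tauto
        · rw [anc_iff]; left; omega
        · rw [anc_iff]; left; omega
  · rintro k τ ⟨v, h22, hvk, hvN, hf, hra, h20, hleaf, hT⟩ hp
    simp only [BExp.holds_nlt, NExp.eval_reg, NExp.eval_const, h22] at hp
    refine ⟨hf, hra, h20, hleaf, fun x h1 h3 _ => hT x h1 h3 ?_⟩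
    rintro ⟨k, rfl⟩
    have : v / 2 ^ (k + 1) ≤ v / 2 := by
      rw [pow_succ', ← Nat.div_div_eq_div_mul]
      exact Nat.div_le_self _ _
    omega
  · refine ⟨N + w, by simp [h2, h24], by omega, by omega,
      ((((ArrFrame.refl σ).setN (i := 22) (by norm_num) _).putNA (Set.mem_singleton 5) _ _).setN
        (i := 22) (by norm_num) _), by simp, by simp, fun q hq => ?_, ?_⟩
    · simp [h2, h24]
    · rw [State.setN_na, State.putNA_na_self]
      refine hT.set_leaf _ _ (fun x hx => ⟨not_false, ?_⟩) (by simp [h2])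
      rintro rfl
      exact hx ((anc_iff _ _).2 (Or.inl (by simp [h2, h24])))

/-- Sort the endpoints on axis `i`. -/
def sortAxis (d i : ℕ) : Prog :=
  loadKeys d i ;; initTour ;; .setN 20 (nc 0) ;;
  .loop (.nlt (nv 20) (nv 2))
    (.setN 24 (.arr 5 (nc 1)) ;; putN (10 + 8 * i) (nv 20) (nv 24) ;;
      putN (11 + 8 * i) (nv 24) (nv 20) ;; putR (3 + i) (nv 20) (.arr 2 (nv 24)) ;; removeWinner ;;
      .setN 20 (nv 20 + nc 1))

/-- Repeatedly taking the winner yields the ranks in increasing order: `N` extractions of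
logarithmic cost each. -/
theorem sortAxis_spec {U H : ℕ} (hU : H < U) (hH : 2 * N ≤ 2 ^ H) (hN : N = 2 * n)
    (h2 : σ.nreg 2 = N) (h1 : σ.nreg 1 = d * N) (hi : i < d)
    (hkey : ∀ j < n, σ.rheap (j * (2 * d) + 2 * i) = key (2 * j) ∧
      σ.rheap (j * (2 * d) + 2 * i + 1) = key (2 * j + 1))
    (hinj : ∀ q < N, ∀ q' < N, key q = key q' → q = q') :
    Fast ω (U * (N + 1)) (sortAxis d i) σ fun τ =>
      ArrFrame {5, 10 + 8 * i, 11 + 8 * i} {2, 3 + i} σ τ ∧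
      Sorted N key (τ.na (10 + 8 * i)) (τ.na (11 + 8 * i)) (τ.ra (3 + i)) := by
  have hV : N + 1 ≤ U * (N + 1) := Nat.le_mul_of_pos_left _ (by omega)
  have hU1 : 1 ≤ U * (N + 1) := by omega
  have hF : ({5} : Set ℕ) ⊆ {5, 10 + 8 * i, 11 + 8 * i} := by simp
  have hG : ({2} : Set ℕ) ⊆ {2, 3 + i} := by simp
  refine Fast.seq ((loadKeys_spec (by omega) hN h2 h1 hi hkey).mono ?_)
  rintro τ ⟨hf, hk1, hk2, hleaf⟩
  refine Fast.seq ((initTour_spec (N := N) (by omega) (by rw [hf.nreg 2 (by norm_num), h2])).mono ?_)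
  rintro υ ⟨hf', hra, hleaf', hT⟩
  refine Fast.seq_wp hU1 ?_
  simp only [wp_setN]
  refine Fast.loop_fast (k := N) (I := fun k υ' => ∃ r, N = r + k ∧ υ'.nreg 20 = r ∧
    ArrFrame {5, 10 + 8 * i, 11 + 8 * i} {2, 3 + i} σ υ' ∧ υ'.ra 2 = υ.ra 2 ∧
    Tour N (υ.ra 2) (υ'.na 5) (fun _ => False) ∧
    Extract N r (υ.ra 2) (υ'.na 5) (υ'.na (10 + 8 * i)) (υ'.na (11 + 8 * i)) (υ'.ra (3 + i)))
    ?_ ?_ (by omega) (by omega) ?_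
  · rintro k ρ ⟨r, hr, h20, hf, hra', hT, hE⟩ hp
    have hρ2 : ρ.nreg 2 = N := by rw [hf.nreg 2 (by norm_num), h2]
    simp only [BExp.holds_nlt, NExp.eval_reg, h20, hρ2] at hp
    obtain ⟨k, rfl⟩ : ∃ k', k = k' + 1 := ⟨k - 1, by omega⟩
    refine ⟨k, rfl, ?_⟩
    have hbig : ∀ q < N, υ.ra 2 q < υ.ra 2 N := by
      intro q hq; rw [hra, hk1 q hq]; exact hk2 q hq
    have hinj' : ∀ q < N, ∀ q' < N, υ.ra 2 q = υ.ra 2 q' → q = q' := by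
      intro q hq q' hq'
      rw [hra, hk1 q hq, hk1 q' hq']
      exact hinj q hq q' hq'
    obtain ⟨hw, -, -⟩ := hE.root hT hp hbig
    have hU' : 1 ≤ U := by omega
    refine Fast.seq_wp hU' ?_
    simp only [wp_setN]
    refine Fast.seq_wp hU' ?_
    simp only [wp_putN]
    refine Fast.seq_wp hU' ?_
    simp only [wp_putN]
    refine Fast.seq_wp hU' ?_
    simp only [wp_putR]
    refine Fast.seq ((removeWinner_spec (w := ρ.na 5 1) hU hH (by simpa using hρ2) (by simp)
      hw ?_).mono ?_)
    · rw [State.putRA_ra_ne _ _ _ (by omega), State.putRA_na, State.putNA_na_ne _ _ _ (by omega),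
        State.putNA_na_ne _ _ _ (by omega)]
      simpa [hra'] using hT
    rintro ρ' ⟨hf₁, hra₁, h20₁, hleaf₁, hT₁⟩
    rw [State.putRA_ra_ne _ _ _ (by omega)] at hra₁ hT₁
    simp only [State.putRA_na, State.putNA_na_ne _ _ _ (show 5 ≠ 11 + 8 * i by omega),
      State.putNA_na_ne _ _ _ (show 5 ≠ 10 + 8 * i by omega), State.setN_na] at hleaf₁
    have hQ : ρ'.na (10 + 8 * i) = Function.update (ρ.na (10 + 8 * i)) r (ρ.na 5 1) := by
      rw [hf₁.na _ (by simp; omega), State.putRA_na, State.putNA_na_ne _ _ _ (by omega),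
        State.putNA_na_self]
      simp [h20]
    have hP : ρ'.na (11 + 8 * i) = Function.update (ρ.na (11 + 8 * i)) (ρ.na 5 1) r := by
      rw [hf₁.na _ (by simp; omega), State.putRA_na, State.putNA_na_self,
        State.putNA_na_ne _ _ _ (by omega)]
      simp [h20]
    have hX : ρ'.ra (3 + i) = Function.update (ρ.ra (3 + i)) r (υ.ra 2 (ρ.na 5 1)) := by
      rw [hf₁.ra _ (by simp; omega), State.putRA_ra_self]
      simp [h20, hra']
    simp only [State.putNA_ra] at hra₁ hT₁
    rw [State.setN_ra _ _ _ (by norm_num)] at hra₁ hT₁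
    rw [hra'] at hra₁ hT₁
    refine Fast.of_wp hU' ?_
    simp only [wp_setN]
    refine ⟨r + 1, by omega, ?_, ?_, ?_, ?_, ?_⟩
    · simp [h20₁, h20]
    · exact (((((hf.setN (by norm_num) _).putNA (by simp) _ _).putNA (by simp) _ _).putRA
        (by simp) _ _).trans (hf₁.mono hF hG)).setN (by norm_num) _
    · rw [State.setN_ra _ _ _ (by norm_num), hra₁]
    · rw [State.setN_na]; exact hT₁
    · rw [State.setN_na, State.setN_ra _ _ _ (by norm_num), hQ, hP, hX]
      exact hE.step hT hp hbig hinj' hleaf₁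
  · rintro k ρ ⟨r, hr, h20, hf, hra', hT, hE⟩ hp
    simp only [BExp.holds_nlt, NExp.eval_reg, h20, hf.nreg 2 (by norm_num), h2] at hp
    obtain rfl : r = N := by omega
    have hs := hE.sorted
    refine ⟨hf, hs.pos_lt, hs.Q_lt, hs.Q_pos, hs.pos_Q, hs.mono, fun q hq => ?_⟩
    rw [hs.X_pos q hq, hra, hk1 q hq]
  · refine ⟨0, by omega, by simp, ((hf.trans hf').mono hF hG).setN (by norm_num) _, by simp,
      by rw [hra]; simpa using hT, fun x hx => by omega, fun x hx => by omega, fun x hx => by omega,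
      fun x y _ hy => by omega, fun q hq => ?_, fun q hq _ x hx => by omega⟩
    simp [hleaf', hleaf q hq]

end

end RealRAM

namespace RealRAM

/-! ### Subdividing an entry -/

/-- The layout stored in memory. -/
noncomputable def layoutOf (N H : ℕ) (start : ℕ → ℕ) (σ : State) : Layout where
  N := N
  H := H
  start := start
  Q := fun i => σ.na (10 + 8 * i)
  pos := fun i => σ.na (11 + 8 * i)
  X := fun i => σ.ra (3 + i)
  A := fun i => σ.na (12 + 8 * i)
  B := fun i => σ.na (13 + 8 * i)
  first := σ.na 1
  pt := fun e r => σ.na 3 (σ.na 2 e + r)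

/-- From `σ` to `τ` the table of entries grows; it is not changed below the entry `e`, the
children below `t` and the pointers below `p`. -/
structure Grow (e t p : ℕ) (σ τ : State) : Prop where
  nreg : ∀ i < 20, i ≠ 5 → i ≠ 6 → i ≠ 7 → τ.nreg i = σ.nreg i
  ra : τ.ra = σ.ra
  na : ∀ f x, (12 ≤ f ∧ (f % 8 = 4 ∨ f % 8 = 5) ∧ t ≤ x) ∨ (f = 3 ∧ p ≤ x) ∨ (f = 1 ∧ e < x) ∨
    (f = 2 ∧ e ≤ x) ∨ τ.na f x = σ.na f x

namespace Grow
variable {e t p e' t' p' N H : ℕ} {start : ℕ → ℕ} {σ τ υ : State}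

theorem refl (σ : State) : Grow e t p σ σ := ⟨fun _ _ _ _ _ => rfl, rfl, fun f x => by tauto⟩

theorem trans (h : Grow e t p σ τ) (h' : Grow e' t' p' τ υ) (he : e ≤ e') (ht : t ≤ t')
    (hp : p ≤ p') : Grow e t p σ υ := by
  refine ⟨fun i h1 h2 h3 h4 => (h'.nreg i h1 h2 h3 h4).trans (h.nreg i h1 h2 h3 h4),
    h'.ra.trans h.ra, fun f x => ?_⟩
  have h1 := h.na f x
  have h2 := h'.na f x
  omega

theorem fixed (h : Grow e t p σ τ) {f : ℕ} (h1 : f ≠ 1) (h2 : f ≠ 2) (h3 : f ≠ 3)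
    (h4 : f < 12 ∨ f % 8 ≠ 4 ∧ f % 8 ≠ 5) : τ.na f = σ.na f := by
  funext x
  have := h.na f x
  omega

/-- The pointers of entry `e'` occupy the block of length `N` that begins at `σ.na 2 e'`. By `hp`
these blocks end before `p`, where new pointers are written. -/
theorem extends_layout (h : Grow e t p σ τ)
    (hp : ∀ e' < e, σ.na 2 e' + N ≤ p) :
    Extends (layoutOf N H start σ) (layoutOf N H start τ) e t where
  N := rfl
  Q := funext fun i => h.fixed (by omega) (by omega) (by omega) (by omega)
  pos := funext fun i => h.fixed (by omega) (by omega) (by omega) (by omega)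
  A := fun i f hf => by
    have := h.na (12 + 8 * i) f
    change τ.na (12 + 8 * i) f = σ.na (12 + 8 * i) f
    omega
  B := fun i f hf => by
    have := h.na (13 + 8 * i) f
    change τ.na (13 + 8 * i) f = σ.na (13 + 8 * i) f
    omega
  first := fun e' he => by
    have := h.na 1 e'
    change τ.na 1 e' = σ.na 1 e'
    omega
  pt := fun e' he r hr => by
    have h1 := h.na 2 e'
    have h2 := h.na 3 (σ.na 2 e' + r)
    have h3 := hp e' he
    have h4 : r < N := hr
    have h5 : τ.na 2 e' = σ.na 2 e' := by omega
    change τ.na 3 (τ.na 2 e' + r) = σ.na 3 (σ.na 2 e' + r)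
    rw [h5]
    omega

end Grow

theorem Grow.special {e t p m e' N H : ℕ} {start : ℕ → ℕ} {σ τ : State} (h : Grow e t p σ τ)
    (he : e' < t) :
    Special (layoutOf N H start τ) m e' = Special (layoutOf N H start σ) m e' := by
  have hA : ∀ i, τ.na (12 + 8 * i) e' = σ.na (12 + 8 * i) e' := fun i => by
    have := h.na (12 + 8 * i) e'
    omega
  have hB : ∀ i, τ.na (13 + 8 * i) e' = σ.na (13 + 8 * i) e' := fun i => by
    have := h.na (13 + 8 * i) e'
    omega
  have hQ : ∀ i, τ.na (10 + 8 * i) = σ.na (10 + 8 * i) := fun i =>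
    h.fixed (by omega) (by omega) (by omega) (by omega)
  have hpos : ∀ i, τ.na (11 + 8 * i) = σ.na (11 + 8 * i) := fun i =>
    h.fixed (by omega) (by omega) (by omega) (by omega)
  funext r
  simp only [Special, Layout.EndIn, Layout.own, layoutOf, hA, hB, hQ, hpos]

/-- Raise the flag in register `26` if the endpoint with index `s` on axis `i` is in the
interval of the entry in register `20`. -/
def endTest (i : ℕ) (s : NExp) : Prog :=
  .ite ((BExp.nle (.arr (12 + 8 * i) (nv 20)) (.arr (11 + 8 * i) s)).and
    (.nlt (.arr (11 + 8 * i) s) (.arr (13 + 8 * i) (nv 20)))) (.setN 26 (nc 1)) .skip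

/-- Is the rank in register `23` special for the entry in register `20` of level `m`? -/
def flagSpecial (m : ℕ) : Prog :=
  .setN 24 (.half (.arr (10 + 8 * m) (nv 23))) ;; .setN 26 (nc 0) ;;
  forAx (fun i => endTest i (nv 24 + nv 24) ;; endTest i (nv 24 + nv 24 + nc 1)) m

/-- Copy the intervals on the first `m` axes from the entry in register `20` to the new entry. -/
def copyAxes (m : ℕ) : Prog :=
  forAx (fun i => putN (12 + 8 * i) (nv 7) (.arr (12 + 8 * i) (nv 20)) ;;
    putN (13 + 8 * i) (nv 7) (.arr (13 + 8 * i) (nv 20))) m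

section
variable {ω : Tape} {m : ℕ} {σ : State} {Q : State → Prop} {N H : ℕ} {start : ℕ → ℕ}

theorem wp_flagSpecial
    (h : ∀ o v, (v ≠ 0 ↔ Special (layoutOf N H start σ) m (σ.nreg 20) (σ.nreg 23)) →
      Q ((σ.setN 24 o).setN 26 v)) : wp ω (flagSpecial m) Q σ := by
  simp only [flagSpecial, wp_seq, wp_setN]
  obtain ⟨o, ho⟩ : ∃ o, o = (layoutOf N H start σ).own m (σ.nreg 23) := ⟨_, rfl⟩
  have ho' : NExp.eval σ (.half (.arr (10 + 8 * m) (nv 23))) = o := by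
    rw [ho]; simp [Layout.own, layoutOf]
  rw [ho']
  refine wp_mono ?_ (wp_forAx (I := fun i τ => ∃ v, τ = (σ.setN 24 o).setN 26 v ∧
    (v ≠ 0 ↔ ∃ i' < i, (layoutOf N H start σ).EndIn i' o (σ.nreg 20))) ?_ ?_)
  · rintro τ ⟨v, rfl, hv⟩
    exact h o v (by rw [hv, Special, ho])
  · rintro i hi τ ⟨v, rfl, hv⟩
    have key : ∀ w, (w = v ∨ w = 1) → (w ≠ 0 ↔ v ≠ 0 ∨
        (layoutOf N H start σ).EndIn i o (σ.nreg 20)) →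
        ∃ v', (σ.setN 24 o).setN 26 w = (σ.setN 24 o).setN 26 v' ∧
        (v' ≠ 0 ↔ ∃ i' < i + 1, (layoutOf N H start σ).EndIn i' o (σ.nreg 20)) := by
      intro w _ hw
      refine ⟨w, rfl, ?_⟩
      rw [hw, hv]
      constructor
      · rintro (⟨i', h1, h2⟩ | h2)
        · exact ⟨i', by omega, h2⟩
        · exact ⟨i, by omega, h2⟩
      · rintro ⟨i', h1, h2⟩
        rcases Nat.lt_succ_iff_lt_or_eq.1 h1 with h3 | rfl
        · exact Or.inl ⟨i', h3, h2⟩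
        · exact Or.inr h2
    simp only [Layout.EndIn, layoutOf] at key
    have e1 : o + o = 2 * o := by omega
    constructor <;> intro h1 <;> constructor <;> intro h2 <;>
      simp only [wp_setN, wp_skip, State.setN_setN, NExp.eval_const] <;>
      simp [e1] at h1 h2
    · exact key 1 (Or.inr rfl) (by simp [h1])
    · exact key 1 (Or.inr rfl) (by simp [h1])
    · exact key 1 (Or.inr rfl) (by simp [h2])
    · refine key v (Or.inl rfl) ⟨Or.inl, ?_⟩
      rintro (h3 | h3 | h3)
      · exact h3
      · exact absurd h3.2 (h1 h3.1).not_gt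
      · exact absurd h3.2 (h2 h3.1).not_gt
  · exact ⟨0, rfl, by simp⟩

theorem wp_copyAxes (ht : σ.nreg 7 ≠ σ.nreg 20)
    (h : ∀ τ : State, (∀ i, τ.nreg i = σ.nreg i) → τ.ra = σ.ra →
      (∀ f x, τ.na f x = if x = σ.nreg 7 ∧ ∃ i < m, f = 12 + 8 * i ∨ f = 13 + 8 * i
        then σ.na f (σ.nreg 20) else σ.na f x) → Q τ) :
    wp ω (copyAxes m) Q σ := by
  refine wp_mono ?_ (wp_forAx (I := fun k τ => (∀ i, τ.nreg i = σ.nreg i) ∧ τ.ra = σ.ra ∧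
    ∀ f x, τ.na f x = if x = σ.nreg 7 ∧ ∃ i < k, f = 12 + 8 * i ∨ f = 13 + 8 * i
        then σ.na f (σ.nreg 20) else σ.na f x) ?_ ?_)
  · rintro τ ⟨h1, h2, h3⟩
    exact h τ h1 h2 h3
  · rintro k hk τ ⟨h1, h2, h3⟩
    simp only [wp_seq, wp_putN]
    refine ⟨by simpa using h1, by simpa using h2, fun f x => ?_⟩
    have h4 : ∀ f, τ.na f (σ.nreg 20) = σ.na f (σ.nreg 20) := fun f => by
      rw [h3, if_neg (fun h => ht h.1.symm)]
    simp only [State.putNA_na, NExp.eval_reg, State.putNA_nreg, h1, NExp.eval_arr]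
    by_cases hx : x = σ.nreg 7
    · by_cases hf1 : f = 13 + 8 * k
      · rw [if_pos ⟨hf1, hx⟩, if_neg (by omega), if_pos ⟨hx, k, by omega, Or.inr hf1⟩, h4, hf1]
      · rw [if_neg (fun h => hf1 h.1)]
        by_cases hf2 : f = 12 + 8 * k
        · rw [if_pos ⟨hf2, hx⟩, if_pos ⟨hx, k, by omega, Or.inl hf2⟩, h4, hf2]
        · rw [if_neg (fun h => hf2 h.1), h3]
          congr 1
          refine propext (and_congr Iff.rfl ⟨fun ⟨i, h5, h6⟩ => ⟨i, by omega, h6⟩, fun ⟨i, h5, h6⟩ => ⟨i, ?_, h6⟩⟩)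
          rcases Nat.lt_succ_iff_lt_or_eq.1 h5 with h7 | rfl
          · exact h7
          · tauto
    · rw [if_neg (fun h => hx h.2), if_neg (fun h => hx h.2), h3, if_neg (fun h => hx h.1),
        if_neg (fun h => hx h.1)]
  · exact ⟨fun _ => rfl, rfl, fun f x => by simp⟩

end

/-- Treat the rank in register `23`. -/
def scanStep (m : ℕ) : Prog :=
  flagSpecial m ;;
  .ite ((BExp.nlt (nc 0) (nv 25)).and ((BExp.neq (nv 26) (nc 0)).and (BExp.neq (nv 27) (nc 0))))
    (putN (13 + 8 * m) (nv 7 - nc 1) (nv 23 + nc 1) ;; putN 3 (nv 22 + nv 23) (nv 7 - nc 1))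
    (copyAxes m ;; putN (12 + 8 * m) (nv 7) (nv 23) ;; putN (13 + 8 * m) (nv 7) (nv 23 + nc 1) ;;
      putN 3 (nv 22 + nv 23) (nv 7) ;; .setN 7 (nv 7 + nc 1)) ;;
  .setN 27 (nv 26) ;;
  .ite (BExp.neq (nv 25 + nc 1) (nv 3)) (.setN 25 (nc 0)) (.setN 25 (nv 25 + nc 1)) ;;
  .setN 23 (nv 23 + nc 1)

/-- Entry `e` is being subdivided; the ranks below `r` have been treated. -/
structure Scanning (N H : ℕ) (start : ℕ → ℕ) (s m e t p : ℕ) (σ : State) (r : ℕ) (τ : State) :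
    Prop where
  grow : Grow (e + 1) t p σ τ
  n5 : τ.nreg 5 = σ.nreg 5
  n6 : τ.nreg 6 = σ.nreg 6
  n20 : τ.nreg 20 = e
  n22 : τ.nreg 22 = p
  n23 : τ.nreg 23 = r
  scan : Scan (Special (layoutOf N H start σ) m e) s t r (τ.nreg 7) (τ.nreg 25) (τ.nreg 27)
    (τ.na (12 + 8 * m)) (τ.na (13 + 8 * m)) (fun x => τ.na 3 (p + x))
  inherit : ∀ f, t ≤ f → f < τ.nreg 7 → ∀ i < m,
    τ.na (12 + 8 * i) f = σ.na (12 + 8 * i) e ∧ τ.na (13 + 8 * i) f = σ.na (13 + 8 * i) e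

theorem wp_scanTail {ω : Tape} {Q : State → Prop} {ρ : State}
    (h : Q (((ρ.setN 27 (ρ.nreg 26)).setN 25 (Scan.tick (ρ.nreg 3) (ρ.nreg 25))).setN 23
      (ρ.nreg 23 + 1))) :
    wp ω (.setN 27 (nv 26) ;;
      .ite (BExp.neq (nv 25 + nc 1) (nv 3)) (.setN 25 (nc 0)) (.setN 25 (nv 25 + nc 1)) ;;
      .setN 23 (nv 23 + nc 1)) Q ρ := by
  simp only [wp_seq, wp_setN, wp_ite]
  constructor <;> intro h1 <;> simp at h1
  · simpa [Scan.tick, h1] using h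
  · simpa [Scan.tick, h1] using h

/-- The two branches of the program are `Scan.extend` and `Scan.cut`. Since `e < t`, writing new
children does not touch the entry being subdivided, so the notion of a special rank stays the same
during the scan. -/
theorem scanStep_spec {ω : Tape} {N H : ℕ} {start : ℕ → ℕ} {s m e t p r : ℕ} {σ τ : State}
    (h : Scanning N H start s m e t p σ r τ) (h3 : σ.nreg 3 = s) (het : e < t) :
    wp ω (scanStep m) (Scanning N H start s m e t p σ (r + 1)) τ := by
  rw [scanStep, wp_seq]
  refine wp_flagSpecial (N := N) (H := H) (start := start) fun o v hv => ?_
  rw [h.n20, h.n23, h.grow.special het] at hv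
  have hg := h.grow
  have h20 := h.n20
  have h22 := h.n22
  have h23 := h.n23
  have hle := h.scan.le
  have h3' : τ.nreg 3 = s := by rw [hg.nreg 3 (by omega) (by omega) (by omega) (by omega), h3]
  rw [wp_seq, wp_ite]
  constructor <;> intro hc <;> simp at hc
  · obtain ⟨hc0, hv0, hz0⟩ := hc
    have hr : 0 < r := Nat.pos_of_ne_zero fun h0 => by
      have := (h.scan.zero h0).2.1
      omega
    have hlast := (h.scan.last hr).1
    simp only [wp_seq, wp_putN]
    refine wp_scanTail ?_
    simp only [State.putNA_nreg, State.setN_nreg, NExp.eval_sub, NExp.eval_reg, NExp.eval_add,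
      NExp.eval_const]
    norm_num [h3', h22, h23]
    refine ⟨hg.trans (e' := e + 1) (t' := t) (p' := p) ⟨fun i h1 h2 h4 h5 => ?_, ?_, fun f x => ?_⟩ le_rfl le_rfl le_rfl,
      ?_, ?_, ?_, ?_, ?_, ?_, ?_⟩
    · simp [show i ≠ 23 by omega, show i ≠ 24 by omega, show i ≠ 25 by omega,
        show i ≠ 26 by omega, show i ≠ 27 by omega]
    · simp
    · simp only [State.setN_na, State.putNA_na]
      split_ifs <;> omega
    · simpa using h.n5
    · simpa using h.n6
    · simpa using h20
    · simpa using h22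
    · simp
    · simp only [State.setN_na]
      rw [State.putNA_na_ne _ _ _ (by omega), State.putNA_na_ne _ _ _ (by omega),
        State.putNA_na_ne _ _ _ (by omega), State.putNA_na_self]
      convert h.scan.extend (by omega) (fun hs => hv.2 hs hv0) hz0 using 1
      · simp
      · simp
      · simp [hv0]
      · simp
      · simp
      · funext x
        simp [Function.update_apply, show 3 ≠ 13 + 8 * m by omega]
    · intro f h1 h2 i hi
      simp at h2
      simp only [State.setN_na, State.putNA_na]
      rw [if_neg (by omega), if_neg (by omega), if_neg (by omega), if_neg (by omega)]
      exact h.inherit f h1 h2 i hi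
  · simp only [wp_seq]
    refine wp_copyAxes (by simp [h20]; omega) fun ρ hn₀ hra hna₀ => ?_
    have hn : ∀ i, ρ.nreg i = if i = 26 then v else if i = 24 then o else τ.nreg i := fun i => by
      rw [hn₀]; simp
    have hna : ∀ f x, ρ.na f x = if x = τ.nreg 7 ∧ ∃ i < m, f = 12 + 8 * i ∨ f = 13 + 8 * i
        then τ.na f (τ.nreg 20) else τ.na f x := fun f x => by rw [hna₀]; simp
    change wp ω _ _ ρ
    simp only [wp_seq, wp_putN, wp_setN]
    refine wp_scanTail ?_
    simp only [State.putNA_nreg, State.setN_nreg, NExp.eval_reg, NExp.eval_add,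
      NExp.eval_const, hn]
    norm_num [h3', h22, h23]
    have hna' : ∀ f, (∀ i < m, f ≠ 12 + 8 * i ∧ f ≠ 13 + 8 * i) → ρ.na f = τ.na f := fun f hf => by
      funext x
      rw [hna, if_neg]
      rintro ⟨-, i, hi, h1⟩
      have := hf i hi
      tauto
    refine ⟨hg.trans (e' := e + 1) (t' := t) (p' := p) ⟨fun i h1 h2 h4 h5 => ?_, ?_, fun f x => ?_⟩ le_rfl le_rfl le_rfl,
      ?_, ?_, ?_, ?_, ?_, ?_, ?_⟩
    · simp [hn, h5, show i ≠ 23 by omega, show i ≠ 24 by omega, show i ≠ 25 by omega,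
        show i ≠ 26 by omega, show i ≠ 27 by omega]
    · simpa using hra
    · simp only [State.setN_na, State.putNA_na]
      split_ifs with h1 h2 h3
      · omega
      · omega
      · omega
      · rw [hna]
        split_ifs with h4
        · obtain ⟨h5, i, hi, h6⟩ := h4
          omega
        · omega
    · simpa [hn] using h.n5
    · simpa [hn] using h.n6
    · simpa [hn] using h20
    · simpa [hn] using h22
    · simp
    · simp only [State.setN_na]
      have ha : ((((ρ.putNA (12 + 8 * m) (τ.nreg 7) r).putNA (13 + 8 * m) (τ.nreg 7) (r + 1)).putNA 3
          (p + r) (τ.nreg 7))).na (12 + 8 * m) =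
          Function.update (τ.na (12 + 8 * m)) (τ.nreg 7) r := by
        rw [State.putNA_na_ne _ _ _ (by omega), State.putNA_na_ne _ _ _ (by omega),
          State.putNA_na_self, hna' _ fun i hi => by omega]
      have hb : ((((ρ.putNA (12 + 8 * m) (τ.nreg 7) r).putNA (13 + 8 * m) (τ.nreg 7) (r + 1)).putNA 3
          (p + r) (τ.nreg 7))).na (13 + 8 * m) =
          Function.update (τ.na (13 + 8 * m)) (τ.nreg 7) (r + 1) := by
        rw [State.putNA_na_ne _ _ _ (by omega),
          State.putNA_na_self, State.putNA_na_ne _ _ _ (by omega), hna' _ fun i hi => by omega]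
      rw [ha, hb]
      convert h.scan.cut (by by_contra hcon; push Not at hcon; have := hv.not.2 hcon.2.1; omega) hv
        using 1
      · simp
      · simp
      · simp
      · funext x
        have hx : ρ.na 3 (p + x) = τ.na 3 (p + x) := congrFun (hna' 3 fun i hi => by omega) _
        simp [Function.update_apply, hx, show 3 ≠ 13 + 8 * m by omega, show 3 ≠ 12 + 8 * m by omega]
    · intro f h1 h2 i hi
      simp at h2
      simp only [State.setN_na, State.putNA_na]
      rw [if_neg (by omega), if_neg (by omega), if_neg (by omega), if_neg (by omega), if_neg (by omega),
        if_neg (by omega), hna, hna]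
      rcases h2.lt_or_eq with h4 | rfl
      · rw [if_neg (by omega), if_neg (by omega)]
        exact h.inherit f h1 h4 i hi
      · rw [if_pos ⟨rfl, i, hi, Or.inl rfl⟩, if_pos ⟨rfl, i, hi, Or.inr rfl⟩]
        have h4 := hg.na (12 + 8 * i) e
        have h5 := hg.na (13 + 8 * i) e
        rw [h20]
        omega

end RealRAM

/-! ### The programs that subdivide an entry and a whole level. -/

namespace RealRAM

/-- Subdivide the entry in register `20`. -/
def subdivide (m : ℕ) : Prog :=
  .setN 23 (nc 0) ;; .setN 25 (nc 0) ;; .setN 27 (nc 0) ;; putN 2 (nv 20) (nv 22) ;;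
  .loop (.nlt (nv 23) (nv 2)) (scanStep m) ;;
  .setN 22 (nv 22 + nv 2) ;; .setN 20 (nv 20 + nc 1) ;; putN 1 (nv 20) (nv 7)

section
variable {ω : Tape} {d n N H s K m e t p : ℕ} {start : ℕ → ℕ} {σ σ₀ : State}

-- The interval count from `Scan.bound` is `3 * s + 2 * S` with `S = 2 * s * m` special ranks, which
-- explains the shape of `hK`.
open Classical in
theorem subdivide_spec {U : ℕ} (hU : N < U) (hN0 : 0 < N) (h2 : σ.nreg 2 = N) (h3 : σ.nreg 3 = s)
    (h20 : σ.nreg 20 = e) (h22 : σ.nreg 22 = p) (h7 : σ.nreg 7 = t) (h1 : σ.na 1 e = t)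
    (het : e < t) (hs : 0 < s) (hN : N ≤ 2 * (s * s)) (hK : 3 * s + 2 * (2 * s * m) ≤ K)
    (hspec : ((Finset.range N).filter (Special (layoutOf N H start σ) m e)).card ≤ 2 * s * m) :
    Fast ω U (subdivide m) σ fun τ => Grow e t p σ τ ∧ τ.nreg 5 = σ.nreg 5 ∧
      τ.nreg 6 = σ.nreg 6 ∧ τ.nreg 20 = e + 1 ∧ τ.nreg 22 = p + N ∧ τ.na 2 e = p ∧
      τ.na 1 (e + 1) = τ.nreg 7 ∧ t < τ.nreg 7 ∧ EntryOK (layoutOf N H start τ) K s m e := by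
  have hU1 : 1 ≤ U := by omega
  refine Fast.seq_wp hU1 ?_
  simp only [wp_setN]
  refine Fast.seq_wp hU1 ?_
  simp only [wp_setN]
  refine Fast.seq_wp hU1 ?_
  simp only [wp_setN]
  refine Fast.seq_wp hU1 ?_
  simp only [wp_putN]
  change Fast ω U _ ((((σ.setN 23 0).setN 25 0).setN 27 0).putNA 2 (σ.nreg 20) (σ.nreg 22)) _
  rw [h20, h22]
  obtain ⟨σ₁, hσ₁⟩ : ∃ σ₁, σ₁ = (((σ.setN 23 0).setN 25 0).setN 27 0).putNA 2 e p := ⟨_, rfl⟩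
  rw [← hσ₁]
  have hg : Grow e t p σ σ₁ := by
    refine ⟨fun i h1 h2 h3 h4 => ?_, by simp [hσ₁], fun f x => ?_⟩
    · simp [hσ₁, show i ≠ 23 by omega, show i ≠ 25 by omega, show i ≠ 27 by omega]
    · simp only [hσ₁, State.putNA_na, State.setN_na]
      split_ifs <;> omega
  have hr : ∀ i, i ≠ 23 → i ≠ 25 → i ≠ 27 → σ₁.nreg i = σ.nreg i := fun i h1 h2 h3 => by
    simp [hσ₁, h1, h2, h3]
  refine Fast.mono (Q := fun τ' => ∃ τ, Scanning N H start s m e t p σ₁ N τ ∧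
    τ' = ((τ.setN 22 (τ.nreg 22 + τ.nreg 2)).setN 20 (e + 1)).putNA 1 (e + 1) (τ.nreg 7)) ?_ ?_
  swap
  · rintro τ' ⟨τ, hS, hτ'⟩
    have hτ2 : τ.nreg 2 = N := by
      rw [hS.grow.nreg 2 (by omega) (by omega) (by omega) (by omega), hr 2 (by omega) (by omega)
        (by omega), h2]
    have hlast := (hS.scan.last hN0).1
    have hg' : Grow e t p τ τ' := by
      refine ⟨fun i h1 h2 h3 h4 => ?_, by simp [hτ'], fun f x => ?_⟩
      · simp [hτ', show i ≠ 22 by omega, show i ≠ 20 by omega]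
      · simp only [hτ', State.putNA_na, State.setN_na]
        split_ifs <;> omega
    have h1e := hS.grow.na 1 e
    have h1e' : σ₁.na 1 e = t := by simp [hσ₁, h1]
    have h2e := hS.grow.na 2 e
    have h2e' : σ₁.na 2 e = p := by simp [hσ₁]
    have ht1 : τ'.na 1 e = t := by simp [hτ']; omega
    have ht2 : τ'.na 2 e = p := by simp [hτ']; omega
    have htl : τ'.na 1 (e + 1) = τ.nreg 7 := by simp [hτ']
    have h7' : τ'.nreg 7 = τ.nreg 7 := by simp [hτ']
    have hG : Grow e t p σ τ' :=
      (hg.trans hS.grow (by omega) le_rfl le_rfl).trans hg' le_rfl le_rfl le_rfl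
    have hsp : Special (layoutOf N H start τ') m e = Special (layoutOf N H start σ₁) m e := by
      rw [hG.special het, hg.special het]
    have hA : ∀ i, τ'.na (12 + 8 * i) = τ.na (12 + 8 * i) := fun i => by
      rw [hτ', State.putNA_na_ne _ _ _ (by omega)]; rfl
    have hB : ∀ i, τ'.na (13 + 8 * i) = τ.na (13 + 8 * i) := fun i => by
      rw [hτ', State.putNA_na_ne _ _ _ (by omega)]; rfl
    have hP : τ'.na 3 = τ.na 3 := by
      rw [hτ', State.putNA_na_ne _ _ _ (by omega)]; rfl
    refine ⟨hG, ?_, ?_, ?_, ?_, ht2, by rw [htl, h7'], by rw [h7']; exact hlast, ?_⟩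
    · simp [hτ', hS.n5, hr]
    · simp [hτ', hS.n6, hr]
    · simp [hτ']
    · simp [hτ', hS.n22, hτ2]
    · refine EntryOK.of_scan (t := τ.nreg 7) (c := τ.nreg 25) (z := τ.nreg 27) ?_ ?_ ?_ ?_ ?_
      · change τ'.na 1 e ≤ τ'.na 1 (e + 1)
        omega
      · have h := hS.scan
        rw [← hsp] at h
        simp only [layoutOf, ht1, ht2, hA, hB, hP] at h ⊢
        exact h
      · exact htl
      · have hb := hS.scan.bound (S := 2 * s * m) hN ?_
        · change _ ≤ τ'.na 1 e + K
          omega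
        · rwa [hg.special het]
      · intro f h4 h5 i hi
        change τ'.na 1 e ≤ f at h4
        rw [ht1] at h4
        change τ'.na (12 + 8 * i) f = τ'.na (12 + 8 * i) e ∧
          τ'.na (13 + 8 * i) f = τ'.na (13 + 8 * i) e
        have h6 := hS.inherit f h4 h5 i hi
        have h7 := hS.grow.na (12 + 8 * i) e
        have h8 := hS.grow.na (13 + 8 * i) e
        rw [hA, hB]
        omega
  refine Fast.seq (Fast.loop (k := N) (I := fun k τ => ∃ r, N = r + k ∧
    Scanning N H start s m e t p σ₁ r τ) ?_ ?_ hU ?_)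
  · rintro k τ ⟨r, hrk, hS⟩ hp
    have hτ2 : τ.nreg 2 = N := by
      rw [hS.grow.nreg 2 (by omega) (by omega) (by omega) (by omega), hr 2 (by omega) (by omega)
        (by omega), h2]
    simp only [BExp.holds_nlt, NExp.eval_reg, hS.n23, hτ2] at hp
    obtain ⟨k, rfl⟩ : ∃ k', k = k' + 1 := ⟨k - 1, by omega⟩
    refine ⟨k, rfl, wp_mono ?_ (scanStep_spec hS
      (by rw [hr 3 (by omega) (by omega) (by omega), h3]) het)⟩
    intro τ' hS'
    exact ⟨r + 1, by omega, hS'⟩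
  · rintro k τ ⟨r, hrk, hS⟩ hp
    have hτ2 : τ.nreg 2 = N := by
      rw [hS.grow.nreg 2 (by omega) (by omega) (by omega) (by omega), hr 2 (by omega) (by omega)
        (by omega), h2]
    simp only [BExp.holds_nlt, NExp.eval_reg, hS.n23, hτ2] at hp
    obtain rfl : r = N := by omega
    refine Fast.of_wp hU1 ?_
    simp only [wp_seq, wp_setN, wp_putN]
    exact ⟨τ, hS, by rw [← hS.n20]; rfl⟩
  · refine ⟨0, by omega, Grow.refl _, rfl, rfl, ?_, ?_, ?_, ?_, fun f h4 h5 => ?_⟩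
    · simp [hr, h20]
    · simp [hr, h22]
    · simp [hσ₁]
    · have e1 : σ₁.nreg 7 = t := by simp [hr, h7]
      have e2 : σ₁.nreg 25 = 0 := by simp [hσ₁]
      have e3 : σ₁.nreg 27 = 0 := by simp [hσ₁]
      rw [e1, e2, e3]
      exact Scan.init hs
    · rw [hr 7 (by omega) (by omega) (by omega), h7] at h5
      omega

/-- Subdivide the entries of level `m`. -/
def buildLevel (m : ℕ) : Prog :=
  .setN 5 (nv 6) ;; .setN 6 (nv 7) ;; .setN 20 (nv 5) ;;
  .loop (.nlt (nv 20) (nv 6)) (subdivide m)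

/-- The levels before `m` have been subdivided. -/
def Leveled (N H s K m : ℕ) (σ₀ τ : State) (start : ℕ → ℕ) : Prop :=
  Tower (layoutOf N H start τ) K s m (start m) ∧ (0 < m → τ.nreg 5 = start (m - 1)) ∧
    τ.nreg 6 = start m ∧ τ.nreg 7 = start (m + 1) ∧
    (∀ e' < start m, τ.na 2 e' + N ≤ τ.nreg 22) ∧ Grow 0 0 0 σ₀ τ

theorem Grow.ranks {start' : ℕ → ℕ} {Bx : Fin n → AABox d} {τ : State} (h : Grow e t p σ τ)
    (hR : (layoutOf N H start σ).Ranks Bx) : (layoutOf N H start' τ).Ranks Bx := by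
  have hQ : ∀ i, τ.na (10 + 8 * i) = σ.na (10 + 8 * i) := fun i =>
    h.fixed (by omega) (by omega) (by omega) (by omega)
  have hpos : ∀ i, τ.na (11 + 8 * i) = σ.na (11 + 8 * i) := fun i =>
    h.fixed (by omega) (by omega) (by omega) (by omega)
  obtain ⟨h1, h2, h3, h4, h5, h6, h7, h8⟩ := hR
  constructor <;> simp only [layoutOf, hQ, hpos, h.ra] <;> assumption

/-- A level has at most `K ^ m` entries, and each is scanned once over all `N` ranks. The bound on
special ranks comes from the lengths of the intervals built on earlier levels. -/
theorem buildLevel_spec {Bx : Fin n → AABox d} {τ : State}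
    (hR : (layoutOf N H start σ₀).Ranks Bx) (hN0 : 0 < N) (h2 : σ₀.nreg 2 = N)
    (h3 : σ₀.nreg 3 = s) (hs : 0 < s) (hN : N ≤ 2 * (s * s)) (hK : 3 * s + 2 * (2 * s * m) ≤ K)
    (hm : m < d) {V : ℕ} (hV : K ^ m < V) {st : ℕ → ℕ} (h : Leveled N H s K m σ₀ τ st) :
    Fast ω ((N + 1) * V) (buildLevel m) τ fun υ =>
      ∃ st', Leveled N H s K (m + 1) σ₀ υ st' := by
  obtain ⟨hT, -, h6, h7, hp, hg⟩ := h
  have hV1 : 1 ≤ (N + 1) * V := Nat.mul_pos (by omega) (by omega)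
  have hcard := hT.first_start m le_rfl
  have hlev : st (m + 1) ≤ st m + K ^ m := hT.decomp.card_level le_rfl
  have hle : st m ≤ st (m + 1) := hT.start_le m le_rfl
  refine Fast.seq_wp hV1 ?_
  simp only [wp_setN]
  refine Fast.seq_wp hV1 ?_
  simp only [wp_setN]
  refine Fast.seq_wp hV1 ?_
  simp only [wp_setN]
  refine Fast.loop_fast (k := st (m + 1) - st m) (I := fun k υ => ∃ e, st (m + 1) = e + k ∧
    Tower (layoutOf N H st υ) K s m e ∧ υ.nreg 20 = e ∧ υ.nreg 5 = st m ∧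
    υ.nreg 6 = st (m + 1) ∧ υ.nreg 7 = υ.na 1 e ∧ (∀ e' < e, υ.na 2 e' + N ≤ υ.nreg 22) ∧
    Grow 0 0 0 σ₀ υ) ?_ ?_ (by omega) (by omega) ?_
  · rintro k υ ⟨e, hek, hT, h20, h5, h6, h7, hp, hg⟩ hlt
    simp only [BExp.holds_nlt, NExp.eval_reg, h20, h6] at hlt
    obtain ⟨k, rfl⟩ : ∃ k', k = k' + 1 := ⟨k - 1, by omega⟩
    refine ⟨k, rfl, ?_⟩
    have hge : st m ≤ e := hT.ge
    have hlte : e < υ.na 1 e := hT.lt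
    refine (subdivide_spec (N := N) (H := H) (start := st) (K := K) (t := υ.na 1 e)
      (p := υ.nreg 22) (Nat.lt_succ_self N) hN0
      (by rw [hg.nreg 2 (by omega) (by omega) (by omega) (by omega), h2])
      (by rw [hg.nreg 3 (by omega) (by omega) (by omega) (by omega), h3]) h20 rfl h7 rfl hlte hs hN
      hK ?_).mono ?_
    · refine card_special (hg.ranks hR) hm fun i hi => ⟨hT.length le_rfl hge hlt hi, ?_⟩
      exact (hT.decomp.entry_interval le_rfl hge hlt hi).2
    · rintro ρ ⟨hgρ, n5, n6, n20, n22, hna2, hna1, hlt7, hok⟩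
      refine ⟨e + 1, by omega, hT.step (hgρ.extends_layout hp) rfl hlt hok ?_, n20, by rw [n5, h5],
        by rw [n6, h6], hna1.symm, fun e' he' => ?_, hg.trans hgρ (by omega) (by omega) (by omega)⟩
      · change e + 1 < ρ.na 1 (e + 1)
        omega
      · rcases Nat.lt_succ_iff_lt_or_eq.1 he' with h1 | rfl
        · have h2 := hgρ.na 2 e'
          have h3 := hp e' h1
          omega
        · omega
  · rintro k υ ⟨e, hek, hT, h20, h5, h6, h7, hp, hg⟩ hlt
    simp only [BExp.holds_nlt, NExp.eval_reg, h20, h6] at hlt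
    obtain rfl : e = st (m + 1) := by omega
    have h := Tower.next hT
    refine ⟨Function.update st (m + 2) (υ.na 1 (st (m + 1))), ?_⟩
    have e0 : Function.update st (m + 2) (υ.na 1 (st (m + 1))) (m + 1) = st (m + 1) :=
      Function.update_of_ne (by omega) _ _
    have e1 : Function.update st (m + 2) (υ.na 1 (st (m + 1))) m = st m :=
      Function.update_of_ne (by omega) _ _
    refine ⟨(?_ : Tower (layoutOf N H (Function.update st (m + 2) (υ.na 1 (st (m + 1)))) υ) K s
      (m + 1) (Function.update st (m + 2) (υ.na 1 (st (m + 1))) (m + 1))), fun _ => ?_, ?_, ?_, ?_,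
      hg⟩
    · rw [e0]; exact h
    · rw [Nat.add_sub_cancel, e1, h5]
    · rw [e0, h6]
    · rw [Function.update_self, h7]
    · rw [e0]; exact hp
  · refine ⟨st m, by omega, ?_, by simp [h6], by simp [h6], by simp [h7], ?_, ?_, hg.trans
      (e' := 0) (t' := 0) (p' := 0) ⟨fun i h1 h2 h3 h4 => ?_, rfl, fun f x => by simp⟩ le_rfl le_rfl le_rfl⟩
    · exact hT
    · simp [h7]; exact hcard.symm
    · simpa using hp
    · simp [h2, h3, show i ≠ 20 by omega]

end

end RealRAM

namespace RealRAM

/-! ### Building the data structure -/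

section
variable {ω : Tape} {d n : ℕ}

theorem Layout.Decomp.start_le_pow {L : Layout} {K : ℕ} (h : L.Decomp d K) (hK : 1 ≤ K) {m : ℕ}
    (hm : m ≤ d + 1) : L.start m ≤ m * K ^ d := by
  induction m with
  | zero => rw [h.start_zero, zero_mul]
  | succ m ih =>
    have h1 : L.start (m + 1) ≤ L.start m + K ^ m := h.card_level (by omega)
    have h2 : K ^ m ≤ K ^ d := Nat.pow_le_pow_right hK (by omega)
    have h3 := ih (by omega)
    rw [Nat.succ_mul]
    omega

/-- Fresh memory represents the empty sets. -/
theorem rep_empty {L : Layout} {σ : State} (hs : Static L d σ) (hd : 1 ≤ d)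
    (h0 : ∀ k, σ.na 0 k = 0) (ht : ∀ k, σ.ra 0 k = 0) (hw : ∀ k, σ.ra 1 k = 0) :
    Rep L d σ (∅ : Finset (Fin n)) 0 := by
  have htree : ∀ β : ℕ, ∀ b : ℕ → ℝ, (∀ q, b q = 0) →
      TreeRep L.H (σ.tag β) (σ.sum β) (fun _ => 1) b := by
    intro β b hb
    -- Tags are read as `1` plus the stored word, so zeroed memory is a correct tree and building
    -- never has to visit the nodes.
    have htag : ∀ x, σ.tag β x = 1 := fun x => by simp [State.tag, ht]
    refine ⟨⟨fun x _ _ => by rw [htag]; exact one_pos, fun x _ _ _ => ?_⟩, fun q _ => ?_⟩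
    · simp [State.sum, hw, hb]
    · suffices h : ∀ x, tagProd (σ.tag β) x = 1 from h _
      intro x
      induction x using Nat.strong_induction_on with
      | _ x ih =>
        cases x with
        | zero => rw [tagProd]
        | succ x => rw [tagProd, htag, ih _ (by omega), one_mul]
  have hact : ∀ c i r, L.actVal d (∅ : Finset (Fin n)) c i r = 0 := fun c i r => by
    simp [Layout.actVal, Layout.Active]
  refine ⟨hs, ⟨fun _ => 1, fun _ _ _ => 1, fun c _ i _ => htree _ _ (hact c i), htree _ _ fun c => ?_,
    fun c _ p _ => ?_⟩, fun j => by simp [h0]⟩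
  · split_ifs
    · rw [rootProd]
      exact Finset.prod_eq_zero (Finset.mem_range.2 (by omega : 0 < d)) (by simp [hact])
    · rfl
  · simp [Layout.rankWeight]

/-- The endpoint `q` of the input on axis `i`. -/
noncomputable def sideKey (B : Fin n → AABox d) (i q : ℕ) : ℝ :=
  (initState B).rheap (q / 2 * (2 * d) + (2 * i + q % 2))

theorem sideKey_eq (B : Fin n → AABox d) (i : Fin d) (j : Fin n) {c : ℕ} (hc : c < 2) :
    sideKey B i (2 * j + c) = if c = 1 then (B j).snd i else (B j).fst i := by
  have hi := i.2
  have hj := j.2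
  have e1 : (2 * (j : ℕ) + c) / 2 = j := by omega
  have e2 : (2 * (j : ℕ) + c) % 2 = c := by omega
  have e3 : ((j : ℕ) * (2 * d) + (2 * i + c)) / (2 * d) = j := by
    rw [mul_comm, Nat.mul_add_div (by omega), Nat.div_eq_of_lt (by omega), add_zero]
  have e4 : ((j : ℕ) * (2 * d) + (2 * i + c)) % (2 * d) = 2 * i + c := by
    rw [mul_comm, Nat.mul_add_mod, Nat.mod_eq_of_lt (by omega)]
  have e5 : (2 * (i : ℕ) + c) / 2 = i := by omega
  have e6 : (2 * (i : ℕ) + c) % 2 = c := by omega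
  rw [sideKey, e1, e2]
  simp only [initState, e3, e4, hj, dif_pos, AABox.coords, e5, e6, hi]
  rcases (by omega : c = 0 ∨ c = 1) with rfl | rfl <;> simp

/-- General position is used here: it makes the sorting keys on each axis distinct, so that ranks
are well defined. -/
theorem sideKey_injOn {B : Fin n → AABox d} (hB : AABox.GeneralPosition B) {i : ℕ} (hi : i < d) :
    ∀ q < 2 * n, ∀ q' < 2 * n, sideKey B i q = sideKey B i q' → q = q' := by
  have key : ∀ q (hq : q < 2 * n), sideKey B i q = (fun q : Fin n × Bool =>
      if q.2 then (B q.1).snd ⟨i, hi⟩ else (B q.1).fst ⟨i, hi⟩)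
      (⟨q / 2, by omega⟩, decide (q % 2 = 1)) := by
    intro q hq
    have h1 := sideKey_eq B ⟨i, hi⟩ ⟨q / 2, by omega⟩ (c := q % 2) (by omega)
    simp only [Nat.div_add_mod] at h1
    rw [h1]
    simp
  intro q hq q' hq' h
  rw [key q hq, key q' hq'] at h
  have h2 := hB ⟨i, hi⟩ h
  simp only [Prod.mk.injEq, Fin.mk.injEq, decide_eq_decide] at h2
  omega

theorem ranks_of_sorted {B : Fin n → AABox d} {σ : State} {H : ℕ} {start : ℕ → ℕ}
    (h : ∀ i < d, Sorted (2 * n) (sideKey B i) (σ.na (10 + 8 * i)) (σ.na (11 + 8 * i))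
      (σ.ra (3 + i))) : (layoutOf (2 * n) H start σ).Ranks B where
  N_eq := rfl
  pos_lt := fun i hi => (h i hi).pos_lt
  Q_lt := fun i hi => (h i hi).Q_lt
  Q_pos := fun i hi => (h i hi).Q_pos
  pos_Q := fun i hi => (h i hi).pos_Q
  mono := fun i hi => (h i hi).mono
  lo := fun i j => by
    have h1 := sideKey_eq B i j (c := 0) (by omega)
    simp only [add_zero] at h1
    exact ((h i i.2).X_pos (2 * j) (by omega)).trans (by rw [h1]; simp)
  hi := fun i j => by
    have h1 := sideKey_eq B i j (c := 1) (by omega)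
    exact ((h i i.2).X_pos (2 * j + 1) (by omega)).trans (by rw [h1]; simp)

/-- Compute `2 d n`, `2 n` and the square root of `n`. -/
def prepare (d : ℕ) : Prog :=
  .setN 1 (.times (2 * d) (nv 0)) ;; .setN 2 (nv 0 + nv 0) ;; .setN 3 (nc 0) ;;
  .setN 20 (nc 0) ;;
  .loop (.nlt (nv 20) (nv 0)) (.setN 20 (nv 20 + nv 3 + nv 3 + nc 1) ;; .setN 3 (nv 3 + nc 1))

/-- There is no multiplication of naturals, so the square of the candidate is carried along, by `(j
+ 1) ^ 2 = j ^ 2 + 2 * j + 1`, until it reaches `n`. -/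
theorem prepare_spec {U s : ℕ} {σ : State} (h0 : σ.nreg 0 = n) (hU : n < U) (hs : n ≤ s * s)
    (hs' : ∀ j < s, j * j < n) : Fast ω U (prepare d) σ fun τ => τ.nreg 1 = d * (2 * n) ∧
      τ.nreg 2 = 2 * n ∧ τ.nreg 3 = s ∧ τ.nheap = σ.nheap ∧ τ.rheap = σ.rheap := by
  have hU1 : 1 ≤ U := by omega
  refine Fast.seq_wp hU1 ?_
  simp only [wp_setN]
  refine Fast.seq_wp hU1 ?_
  simp only [wp_setN]
  refine Fast.seq_wp hU1 ?_
  simp only [wp_setN]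
  refine Fast.seq_wp hU1 ?_
  simp only [wp_setN]
  refine Fast.loop (k := n) (I := fun k τ => ∃ j, j ≤ s ∧ n = j + k ∧ τ.nreg 3 = j ∧
    τ.nreg 20 = j * j ∧ τ.nreg 0 = n ∧ τ.nreg 1 = d * (2 * n) ∧ τ.nreg 2 = 2 * n ∧
    τ.nheap = σ.nheap ∧ τ.rheap = σ.rheap) ?_ ?_ hU ?_
  · rintro k τ ⟨j, hj, hjk, h3, h20, h0, h1, h2, hn, hr⟩ hp
    simp only [BExp.holds_nlt, NExp.eval_reg, h20, h0] at hp
    have hjn : j < n := (Nat.le_mul_self j).trans_lt hp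
    obtain ⟨k, rfl⟩ : ∃ k', k = k' + 1 := ⟨k - 1, by omega⟩
    refine ⟨k, rfl, j + 1, ?_, by omega, ?_, ?_, ?_, ?_, ?_, hn, hr⟩
    · rcases hj.lt_or_eq with h | rfl
      · exact h
      · omega
    · simp [h3]
    · simp [h3, h20]; ring
    · simpa using h0
    · simpa using h1
    · simpa using h2
  · rintro k τ ⟨j, hj, hjk, h3, h20, h0, h1, h2, hn, hr⟩ hp
    simp only [BExp.holds_nlt, NExp.eval_reg, h20, h0] at hp
    refine ⟨h1, h2, ?_, hn, hr⟩
    rcases hj.lt_or_eq with h | rfl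
    · exact absurd (hs' j h) hp
    · exact h3
  · refine ⟨0, by omega, by omega, by simp, by simp, by simpa using h0, ?_, ?_, rfl, rfl⟩
    · simp [h0]; ring
    · simp [h0]; ring

theorem sortAll_spec {U H : ℕ} {B : Fin n → AABox d} (hB : AABox.GeneralPosition B) {σ : State}
    (hU : H < U) (hH : 2 * (2 * n) ≤ 2 ^ H) (h2 : σ.nreg 2 = 2 * n) (h1 : σ.nreg 1 = d * (2 * n))
    (hr : σ.rheap = (initState B).rheap) :
    Fast ω (U * (2 * n + 1)) (forAx (sortAxis d) d) σ fun τ =>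
      ArrFrame {f | f = 5 ∨ 10 ≤ f} {f | 2 ≤ f} σ τ ∧ ∀ i < d,
        Sorted (2 * n) (sideKey B i) (τ.na (10 + 8 * i)) (τ.na (11 + 8 * i)) (τ.ra (3 + i)) := by
  refine Fast.forAx (Nat.mul_pos (by omega) (by omega)) (I := fun i τ =>
    ArrFrame {f | f = 5 ∨ 10 ≤ f} {f | 2 ≤ f} σ τ ∧ ∀ i' < i,
      Sorted (2 * n) (sideKey B i') (τ.na (10 + 8 * i')) (τ.na (11 + 8 * i')) (τ.ra (3 + i'))) ?_ ?_
  · rintro i hi τ ⟨hf, hS⟩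
    refine (sortAxis_spec (key := sideKey B i) hU hH rfl (by rw [hf.nreg 2 (by norm_num), h2])
      (by rw [hf.nreg 1 (by norm_num), h1]) hi (fun j hj => ?_) (sideKey_injOn hB hi)).mono ?_
    · have hlt : j * (2 * d) + 2 * i + 1 < σ.nreg 1 := by rw [h1]; nlinarith
      rw [hf.rheap _ (by omega), hf.rheap _ (by omega), hr, sideKey, sideKey,
        show 2 * j / 2 = j by omega, show 2 * j % 2 = 0 by omega, show (2 * j + 1) / 2 = j by omega,
        show (2 * j + 1) % 2 = 1 by omega]
      exact ⟨rfl, rfl⟩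
    · rintro υ ⟨hf', hS'⟩
      refine ⟨hf.trans (hf'.mono ?_ ?_), fun i' hi' => ?_⟩
      · rintro f (rfl | rfl | rfl) <;> simp; omega
      · rintro f (rfl | rfl) <;> simp; omega
      · rcases Nat.lt_succ_iff_lt_or_eq.1 hi' with h | rfl
        · rw [hf'.na _ (by simp; omega), hf'.na _ (by simp; omega), hf'.ra _ (by simp; omega)]
          exact hS i' h
        · exact hS'
  · exact ⟨ArrFrame.refl σ, fun i hi => by omega⟩

/-- Build the tree of entries. -/
def buildEntries (d : ℕ) : Prog :=
  putN 1 (nc 0) (nc 1) ;; .setN 6 (nc 0) ;; .setN 7 (nc 1) ;; .setN 22 (nc 0) ;; forAx buildLevel d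

/-- The last subdivided level has index `d - 1`, which gives the factor `K ^ (d - 1)`; the cells
themselves are written but not scanned. The constant `4 * d + 3` dominates `3 + 4 * m` for all
levels `m < d`. -/
theorem buildEntries_spec {N H s K V : ℕ} {start : ℕ → ℕ} {B : Fin n → AABox d} {σ : State}
    (hR : (layoutOf N H start σ).Ranks B) (hN0 : 0 < N) (h2 : σ.nreg 2 = N) (h3 : σ.nreg 3 = s)
    (hs : 0 < s) (hN : N ≤ 2 * (s * s)) (hK : (4 * d + 3) * s ≤ K) (hV : K ^ (d - 1) < V) :
    Fast ω ((N + 1) * V) (buildEntries d) σ fun τ => (τ.nreg 2 = N ∧ τ.nreg 1 = σ.nreg 1) ∧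
      τ.ra = σ.ra ∧ τ.na 0 = σ.na 0 ∧ ∃ st,
      (layoutOf N H st τ).Ranks B ∧ (layoutOf N H st τ).Decomp d K ∧
      (0 < d → τ.nreg 5 = st (d - 1)) ∧ τ.nreg 6 = st d ∧ τ.nreg 7 = st (d + 1) := by
  have hV1 : 1 ≤ (N + 1) * V := Nat.mul_pos (by omega) (by omega)
  have hK1 : 1 ≤ K := (Nat.mul_pos (by omega) hs).trans_le hK
  refine Fast.seq_wp hV1 ?_
  simp only [wp_putN]
  refine Fast.seq_wp hV1 ?_
  simp only [wp_setN]
  refine Fast.seq_wp hV1 ?_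
  simp only [wp_setN]
  refine Fast.seq_wp hV1 ?_
  simp only [wp_setN]
  change Fast _ _ _ ((((σ.putNA 1 0 1).setN 6 0).setN 7 1).setN 22 0) _
  obtain ⟨σ₀, hσ₀⟩ : ∃ σ₀, σ₀ = (((σ.putNA 1 0 1).setN 6 0).setN 7 1).setN 22 0 := ⟨_, rfl⟩
  rw [← hσ₀]
  -- At the outset there is only the root entry `0`, and its children will begin at entry `1`.
  obtain ⟨st₀, hst₀⟩ : ∃ st₀ : ℕ → ℕ, st₀ = fun k => if k = 0 then 0 else 1 := ⟨_, rfl⟩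
  have hR₀ : (layoutOf N H st₀ σ₀).Ranks B := by
    have hQ : ∀ f, f ≠ 1 → σ₀.na f = σ.na f := fun f hf => by
      simp only [hσ₀, State.setN_na]
      exact State.putNA_na_ne _ _ _ hf
    have hra : σ₀.ra = σ.ra := by simp [hσ₀]
    obtain ⟨h1, h2, h3, h4, h5, h6, h7, h8⟩ := hR
    have e1 : ∀ i, σ₀.na (10 + 8 * i) = σ.na (10 + 8 * i) := fun i => hQ _ (by omega)
    have e2 : ∀ i, σ₀.na (11 + 8 * i) = σ.na (11 + 8 * i) := fun i => hQ _ (by omega)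
    constructor <;> simp only [layoutOf, hra, e1, e2] <;> assumption
  refine Fast.mono (Q := fun τ => ∃ st, Leveled N H s K d σ₀ τ st) ?_ ?_
  · refine Fast.forAx hV1 (I := fun m τ => ∃ st, Leveled N H s K m σ₀ τ st) ?_ ?_
    · rintro m hm τ ⟨st, hL⟩
      refine buildLevel_spec hR₀ hN0 (by simp [hσ₀, h2]) (by simp [hσ₀, h3]) hs hN ?_ hm
        ((Nat.pow_le_pow_right hK1 (by omega)).trans_lt hV) hL
      have : s * m ≤ s * d := Nat.mul_le_mul_left _ hm.le
      nlinarith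
    · refine ⟨st₀, ⟨?_, ?_, ?_, ?_, ?_, ?_, ?_, ?_, ?_⟩, fun h => absurd h (lt_irrefl 0), ?_, ?_, ?_,
        Grow.refl _⟩
      all_goals simp [layoutOf, hst₀, hσ₀]
  · rintro τ ⟨st, hT, h5, h6, h7, -, hg⟩
    refine ⟨⟨?_, ?_⟩, ?_, ?_, st, hg.ranks hR₀, hT.decomp, h5, h6, h7⟩
    · rw [hg.nreg 2 (by omega) (by omega) (by omega) (by omega)]
      simp [hσ₀, h2]
    · rw [hg.nreg 1 (by omega) (by omega) (by omega) (by omega)]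
      simp [hσ₀]
    · rw [hg.ra]
      simp [hσ₀]
    · rw [hg.fixed (by omega) (by omega) (by omega) (by omega), hσ₀]
      exact State.putNA_na_ne _ _ _ (by omega)

/-- Compute the size of the trees. -/
def chooseSize : Prog :=
  .setN 4 (nc 1) ;; .loop (.nle (nv 4) (nv 7 + nv 2)) (.setN 4 (nv 4 + nv 4))

/-- The trees must have room both for all entry numbers and for all ranks; stopping at the first
power of two above `t + N` costs at most a factor `2`. -/
theorem chooseSize_spec {U t N : ℕ} {σ : State} (h7 : σ.nreg 7 = t) (h2 : σ.nreg 2 = N)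
    (hU : t + N < U) (ht : 0 < t) : Fast ω U chooseSize σ fun τ => ∃ H, τ = σ.setN 4 (2 ^ H) ∧
      t + N < 2 ^ H ∧ 2 ^ H ≤ 2 * (t + N) := by
  have hU1 : 1 ≤ U := by omega
  refine Fast.seq_wp hU1 ?_
  simp only [wp_setN]
  refine Fast.loop (k := t + N) (I := fun k τ => ∃ H, t + N = H + k ∧ τ = σ.setN 4 (2 ^ H) ∧
    2 ^ H ≤ 2 * (t + N)) ?_ ?_ hU ?_
  · rintro k τ ⟨H, hk, rfl, hH⟩ hp
    simp [h7, h2] at hp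
    have h1 : H < 2 ^ H := Nat.lt_two_pow_self
    obtain ⟨k, rfl⟩ : ∃ k', k = k' + 1 := ⟨k - 1, by omega⟩
    refine ⟨k, rfl, ?_⟩
    simp only [wp_setN, State.setN_setN]
    exact ⟨H + 1, by omega, by simp [pow_succ, mul_two], by rw [pow_succ]; omega⟩
  · rintro k τ ⟨H, hk, rfl, hH⟩ hp
    simp [h7, h2] at hp
    exact ⟨H, rfl, hp, hH⟩
  · exact ⟨0, by omega, by simp, by simp; omega⟩

/-- Store the addresses of the trees. -/
def placeTrees (d : ℕ) : Prog :=
  .setN 20 (nc 0) ;; .setN 21 (nv 4 + nv 4) ;;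
  .loop (.nlt (nv 20) (nv 7))
    (putN 4 (nv 20) (nv 21) ;; .setN 21 (nv 21 + .times d (nv 4 + nv 4)) ;;
      .setN 20 (nv 20 + nc 1))

theorem placeTrees_spec {U t M : ℕ} {σ : State} (h7 : σ.nreg 7 = t) (h4 : σ.nreg 4 = M)
    (hU : t < U) : Fast ω U (placeTrees d) σ fun τ => (∀ i < 20, τ.nreg i = σ.nreg i) ∧
      τ.ra = σ.ra ∧ (∀ f, f ≠ 4 → τ.na f = σ.na f) ∧
      ∀ c < t, τ.na 4 c = (d * c + 1) * (2 * M) := by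
  have hU1 : 1 ≤ U := by omega
  refine Fast.seq_wp hU1 ?_
  simp only [wp_setN]
  refine Fast.seq_wp hU1 ?_
  simp only [wp_setN]
  refine Fast.loop (k := t) (I := fun k τ => ∃ c, t = c + k ∧ τ.nreg 20 = c ∧
    τ.nreg 21 = (d * c + 1) * (2 * M) ∧ (∀ i < 20, τ.nreg i = σ.nreg i) ∧
      τ.ra = σ.ra ∧ (∀ f, f ≠ 4 → τ.na f = σ.na f) ∧
      ∀ c' < c, τ.na 4 c' = (d * c' + 1) * (2 * M)) ?_ ?_ hU ?_
  · rintro k τ ⟨c, hk, h20, h21, hn, hra, hna, hc⟩ hp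
    simp only [BExp.holds_nlt, NExp.eval_reg, h20, hn 7 (by norm_num), h7] at hp
    obtain ⟨k, rfl⟩ : ∃ k', k = k' + 1 := ⟨k - 1, by omega⟩
    refine ⟨k, rfl, ?_⟩
    simp only [wp_seq, wp_setN, wp_putN]
    refine ⟨c + 1, by omega, by simp [h20], ?_, fun i hi => ?_, by simpa using hra, fun f hf => ?_,
      fun c' hc' => ?_⟩
    · simp [h21, hn 4 (by norm_num), h4]; ring
    · simp [show i ≠ 20 by omega, show i ≠ 21 by omega, hn i hi]
    · simp only [State.setN_na]
      rw [State.putNA_na_ne _ _ _ hf, hna f hf]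
    · simp only [State.setN_na, State.putNA_na, NExp.eval_reg, h20, h21]
      rcases Nat.lt_succ_iff_lt_or_eq.1 hc' with h | rfl
      · rw [if_neg (by omega), hc c' h]
      · rw [if_pos (by simp)]
  · rintro k τ ⟨c, hk, h20, h21, hn, hra, hna, hc⟩ hp
    simp only [BExp.holds_nlt, NExp.eval_reg, h20, hn 7 (by norm_num), h7] at hp
    obtain rfl : c = t := by omega
    exact ⟨hn, hra, hna, hc⟩
  · refine ⟨0, by omega, by simp, by simp [h4]; ring, fun i hi => ?_, by simp, fun f _ => by simp,
      fun c' hc' => by omega⟩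
    simp [show i ≠ 20 by omega, show i ≠ 21 by omega]

/-- Build the data structure. -/
def build (d : ℕ) : Prog :=
  prepare d ;; forAx (sortAxis d) d ;; buildEntries d ;; chooseSize ;; placeTrees d

theorem build_spec {B : Fin n → AABox d} (hB : AABox.GeneralPosition B) (hd : 1 ≤ d) (hn : 1 ≤ n)
    {s K H W : ℕ} (hs : n ≤ s * s) (hs' : ∀ j < s, j * j < n) (hK : K = (4 * d + 3) * s)
    (hH : 2 * (2 * n) ≤ 2 ^ H) (hW₁ : (H + 1) * (2 * n + 1) ≤ W)
    (hW₂ : (2 * n + 1) * (K ^ (d - 1) + 1) ≤ W) (hW₃ : (d + 1) * K ^ d + 2 * n < W) :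
    Fast ω W (build d) (initState B) fun τ => ∃ L : Layout, LayoutOK L B K ∧
      2 ^ L.H ≤ 2 * ((d + 1) * K ^ d + 2 * n) ∧ Rep L d τ (∅ : Finset (Fin n)) 0 := by
  have hs0 : 0 < s := Nat.pos_of_ne_zero fun h => by subst h; omega
  have hK1 : 1 ≤ K := by rw [hK]; exact Nat.mul_pos (by omega) hs0
  refine Fast.seq ((prepare_spec (σ := initState B) (n := n) (by simp [initState]) (by omega) hs
    hs').mono ?_)
  rintro σ₁ ⟨h1, h2, h3, hnh, hrh⟩
  refine Fast.seq (((sortAll_spec hB (Nat.lt_succ_self H) hH h2 h1 hrh).mono_time hW₁).mono ?_)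
  rintro σ₂ ⟨hf, hsort⟩
  -- The height and the level boundaries are placeholders here: the facts about ranks do not involve
  -- them.
  refine Fast.seq (((buildEntries_spec (H := 0) (start := 0) (s := s) (K := K)
    (ranks_of_sorted hsort) (by omega) (by rw [hf.nreg 2 (by norm_num), h2])
    (by rw [hf.nreg 3 (by norm_num), h3]) hs0 (by omega) hK.ge
    (Nat.lt_succ_self _)).mono_time hW₂).mono ?_)
  rintro σ₃ ⟨⟨n2, n1⟩, hra, hna, st, hR, hD, h5, h6, h7⟩
  have htail : st (d + 1) ≤ (d + 1) * K ^ d := hD.start_le_pow hK1 le_rfl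
  have hpos : 0 < st (d + 1) := by
    have e1 : st 1 = 1 := hD.start_one
    have e2 : ∀ m, m ≤ d → 1 ≤ st (m + 1) := by
      intro m
      induction m with
      | zero => intro _; exact e1.ge
      | succ m ih => intro hm; exact (ih (by omega)).trans (hD.start_le (m + 1) hm)
    exact e2 d le_rfl
  refine Fast.seq ((chooseSize_spec h7 n2 (by omega) hpos).mono ?_)
  rintro σ₄ ⟨H', hσ₄, hH1, hH2⟩
  have e4 : σ₄.nreg 4 = 2 ^ H' := by rw [hσ₄]; simp
  refine (placeTrees_spec (t := st (d + 1)) (by rw [hσ₄]; simpa using h7) e4 (by omega)).mono ?_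
  rintro τ ⟨hn, hra', hna', hcb⟩
  have hn3 : ∀ i < 20, i ≠ 4 → τ.nreg i = σ₃.nreg i := fun i hi h4 => by
    rw [hn i hi, hσ₄]; simp [h4]
  have hra3 : τ.ra = σ₃.ra := by rw [hra', hσ₄]; simp
  have hna3 : ∀ f, f ≠ 4 → τ.na f = σ₃.na f := fun f hf => by rw [hna' f hf, hσ₄]; rfl
  -- Tags and sums are stored in the arrays `0` and `1`, beyond the `2 * d * n` words of the input,
  -- and sorting uses only arrays from `2` on.
  have hzero : ∀ f, f < 2 → ∀ k, τ.ra f k = 0 := by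
    intro f hf' k
    rw [hra3, hra, hf.ra f (by simp; omega), State.ra, hrh, h1]
    simp only [initState]
    rw [dif_neg]
    rw [not_lt, Nat.le_div_iff_mul_le (by omega)]
    nlinarith
  obtain ⟨L, hL⟩ : ∃ L, L = layoutOf (2 * n) H' st σ₃ := ⟨_, rfl⟩
  refine ⟨L, ⟨?_, ?_, ?_, ?_⟩, ?_, rep_empty ⟨?_, ?_, ?_, ?_, ?_, ?_, ?_, ?_, ?_, ?_, ?_, ?_⟩ hd ?_ ?_
    ?_⟩
  · rw [hL]; exact ⟨hR.1, hR.2, hR.3, hR.4, hR.5, hR.6, hR.7, hR.8⟩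
  · rw [hL]
    exact ⟨hD.1, hD.2, hD.3, hD.4, hD.5, hD.6, hD.7, hD.8, hD.9, hD.10, hD.11, hD.12⟩
  · rw [hL]; exact (Nat.le_add_right _ _).trans_lt hH1
  · rw [hL]; exact (Nat.le_add_left _ _).trans_lt hH1
  · rw [hL]; exact hH2.trans (by omega)
  · rw [hn3 2 (by omega) (by omega), n2, hL]; rfl
  · rw [hn 4 (by omega), e4, hL]; rfl
  · rw [hn3 5 (by omega) (by omega), h5 hd, hL]; rfl
  · rw [hn3 6 (by omega) (by omega), h6, hL]; rfl
  · rw [hna3 1 (by omega), hL]; exact fun _ => rfl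
  · intro e r _ _ _
    rw [hna3 2 (by omega), hna3 3 (by omega), hL]; rfl
  · rintro c ⟨-, hc⟩
    rw [hL] at hc
    rw [hcb c hc, hL]; rfl
  · intro i _ r; rw [hna3 _ (by omega), hL]; rfl
  · intro i _ r; rw [hna3 _ (by omega), hL]; rfl
  · intro i _ r; rw [hna3 _ (by omega), hL]; rfl
  · intro i _ r; rw [hna3 _ (by omega), hL]; rfl
  · intro i _ r; rw [hra3, hL]; rfl
  · intro k
    rw [hna3 0 (by omega), hna, hf.na 0 (by simp), State.na, hnh]; rfl
  · exact hzero 0 (by omega)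
  · exact hzero 1 (by omega)

end

end RealRAM

namespace RealRAM

/-! ### Running times -/

/-- By minimality `s - 1` is at most the square root, and `1` is at most the square root as well. -/
theorem le_two_mul_sqrt {n s : ℕ} (hn : 1 ≤ n) (hs : ∀ j < s, j * j < n) :
    (s : ℝ) ≤ 2 * √(n : ℝ) := by
  have h1 : (1 : ℝ) ≤ √(n : ℝ) := by
    rw [Real.one_le_sqrt]
    exact_mod_cast hn
  cases s with
  | zero => push_cast; positivity
  | succ j =>
    have h2 : (j : ℝ) ≤ √(n : ℝ) := by
      refine Real.le_sqrt_of_sq_le ?_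
      have := hs j (Nat.lt_succ_self j)
      rw [sq]
      exact_mod_cast this.le
    push_cast
    linarith

/-- The real exponent is handled by `n ^ ((d - 1) / 2) = √n ^ (d - 1)`, after which the bound `s ≤ 2
* √n` is raised to a natural power. -/
theorem pow_le_rpow {n s c d : ℕ} (hd : 1 ≤ d) (hn : 1 ≤ n) (hs : ∀ j < s, j * j < n) :
    (((c * s) ^ (d - 1) : ℕ) : ℝ) ≤ (2 * c) ^ (d - 1) * (n : ℝ) ^ (((d : ℝ) - 1) / 2) := by
  have h1 := le_two_mul_sqrt hn hs
  have h2 : (n : ℝ) ^ (((d : ℝ) - 1) / 2) = √(n : ℝ) ^ (d - 1) := by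
    rw [Real.sqrt_eq_rpow, ← Real.rpow_natCast, ← Real.rpow_mul (Nat.cast_nonneg n),
      Nat.cast_sub hd]
    congr 1
    push_cast
    ring
  rw [h2, ← mul_pow]
  push_cast
  refine pow_le_pow_left₀ (by positivity) ?_ _
  calc (c : ℝ) * s ≤ c * (2 * √(n : ℝ)) := mul_le_mul_of_nonneg_left h1 (Nat.cast_nonneg c)
    _ = 2 * c * √(n : ℝ) := by ring

/-- The factor `2` works because the natural logarithm of `2` exceeds `1 / 2`. -/
theorem natLog_le {n : ℕ} (hn : 1 ≤ n) : (Nat.log 2 n : ℝ) ≤ 2 * Real.log n := by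
  have h1 : (2 : ℝ) ^ Nat.log 2 n ≤ n := by exact_mod_cast Nat.pow_log_le_self 2 (by omega)
  have h2 := Real.log_le_log (by positivity) h1
  rw [Real.log_pow] at h2
  have h3 := Real.log_two_gt_d9
  nlinarith [Nat.cast_nonneg (α := ℝ) (Nat.log 2 n)]

/-- The trees have polynomially many leaves, at most a constant `D` times `n ^ d`, so their height
is at most `D` plus `d` times a logarithm; `1 ≤ Nat.log 2 n` absorbs the additive constants. -/
theorem height_le {H n d K s : ℕ} (hd : 1 ≤ d) (hn : 2 ≤ n) (hK : K = (4 * d + 3) * s) (hs : s ≤ n)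
    (hH : 2 ^ H ≤ 2 * ((d + 1) * K ^ d + 2 * n)) :
    H + 2 ≤ (2 * ((d + 1) * (4 * d + 3) ^ d + 2) + 2 * d + 2) * Nat.log 2 n := by
  obtain ⟨D, hD⟩ : ∃ D, D = 2 * ((d + 1) * (4 * d + 3) ^ d + 2) := ⟨_, rfl⟩
  have hl : 1 ≤ Nat.log 2 n := Nat.log_pos (by norm_num) hn
  have h1 : K ^ d ≤ (4 * d + 3) ^ d * n ^ d := by
    rw [hK, mul_pow]
    exact Nat.mul_le_mul_left _ (Nat.pow_le_pow_left hs d)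
  have h2 : n ≤ n ^ d := Nat.le_self_pow (by omega) n
  have h3 : 2 ^ H ≤ D * n ^ d := by
    refine hH.trans ?_
    rw [hD]
    calc 2 * ((d + 1) * K ^ d + 2 * n)
        ≤ 2 * ((d + 1) * ((4 * d + 3) ^ d * n ^ d) + 2 * n ^ d) := by gcongr
      _ = 2 * ((d + 1) * (4 * d + 3) ^ d + 2) * n ^ d := by ring
  have h4 : n ^ d ≤ 2 ^ ((Nat.log 2 n + 1) * d) := by
    rw [pow_mul]
    exact Nat.pow_le_pow_left (Nat.lt_pow_succ_log_self (by norm_num) n).le d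
  have h5 : 2 ^ H ≤ 2 ^ (D + (Nat.log 2 n + 1) * d) := by
    rw [pow_add]
    exact h3.trans (Nat.mul_le_mul Nat.lt_two_pow_self.le h4)
  have h6 := (Nat.pow_le_pow_iff_right (by norm_num : 1 < 2)).1 h5
  rw [← hD]
  nlinarith

end RealRAM

/-! ### The theorem: the programs and the constant put together. -/

open RealRAM in
theorem mainTheorem11 (d : ℕ) (hd : 1 ≤ d) :
    ∃ (build weight double halve sample insert delete : RealRAM.Prog) (C : ℝ),
      ∀ (n : ℕ), 2 ≤ n → ∀ (B : Fin n → AABox d), AABox.GeneralPosition B →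
        -- `Rep σ A S`: the memory content `σ` represents the active set `A` and the multiset `S`
        ∃ Rep : RealRAM.State → Finset (Fin n) → Multiset (Fin n) → Prop,
          RealRAM.HaltsWithin build (RealRAM.initState B)
            (C * (n : ℝ) ^ (((d : ℝ) + 1) / 2) * Real.log n) (fun τ => Rep τ ∅ 0) ∧
          ∀ (σ : RealRAM.State) (A : Finset (Fin n)) (S : Multiset (Fin n)), Rep σ A S →
            (∀ b : AABox d,
              RealRAM.HaltsWithin weight (σ.withBox b)
                (C * (n : ℝ) ^ (((d : ℝ) - 1) / 2) * Real.log n)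
                (fun τ => Rep τ A S ∧
                  τ.rreg 0 = AABox.totalWeight B S (AABox.vertices B A ∩ (b : Set (Fin d → ℝ))))) ∧
            (∀ j : Fin n,
              RealRAM.HaltsWithin double (σ.withBox (B j))
                (C * (n : ℝ) ^ (((d : ℝ) - 1) / 2) * Real.log n)
                (fun τ => Rep τ A (j ::ₘ S)) ∧
              RealRAM.HaltsWithin halve (σ.withBox (B j))
                (C * (n : ℝ) ^ (((d : ℝ) - 1) / 2) * Real.log n)
                (fun τ => Rep τ A (S.erase j)) ∧
              RealRAM.HaltsWithin insert (σ.withBox (B j))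
                (C * (n : ℝ) ^ (((d : ℝ) - 1) / 2) * Real.log n)
                (fun τ => Rep τ (Insert.insert j A) S) ∧
              RealRAM.HaltsWithin delete (σ.withBox (B j))
                (C * (n : ℝ) ^ (((d : ℝ) - 1) / 2) * Real.log n)
                (fun τ => Rep τ (A.erase j) S)) ∧
            ((AABox.vertices B A).Nonempty →
              RealRAM.HaltsWithin sample σ (C * Real.log n)
                (fun τ => Rep τ A S ∧ τ.point d ∈ AABox.vertices B A) ∧
              ∀ p ∈ AABox.vertices B A,
                RealRAM.tapeLaw {ω | ∃ (t : ℕ) (τ : RealRAM.State),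
                    RealRAM.Exec ω sample σ t τ ∧ τ.point d = p} =
                  ENNReal.ofReal (AABox.weight B S p /
                    AABox.totalWeight B S (AABox.vertices B A))) := by
  -- `E` bounds the height of the trees in units of `Nat.log 2 n`, `F` the loop lengths during
  -- building, and `P` dominates the constants of all the programs.
  obtain ⟨E, hE⟩ : ∃ E, E = 2 * ((d + 1) * (4 * d + 3) ^ d + 2) + 2 * d + 2 := ⟨_, rfl⟩
  obtain ⟨F, hF⟩ : ∃ F, F = 24 + (d + 1) * (4 * d + 3) := ⟨_, rfl⟩
  obtain ⟨P, hP⟩ : ∃ P, P = (build d).wcost + (weight d).wcost + (double d).wcost +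
    (halve d).wcost + (sample d).wcost + (flagBox d 1).wcost + (flagBox d 0).wcost := ⟨_, rfl⟩
  -- In the constant, the factor `2` converts `Nat.log 2 n` to the natural logarithm, and the power
  -- comes from `K ^ (d - 1)` with `K ≤ 2 * (4 * d + 3) * √n`.
  refine ⟨build d, weight d, double d, halve d, sample d, flagBox d 1, flagBox d 0,
    P * (E * (4 * d + 2) + F) * (2 * (2 * ((4 * d + 3 : ℕ) : ℝ)) ^ (d - 1)), fun n hn B hB => ?_⟩
  have hex : ∃ s, n ≤ s * s := ⟨n, Nat.le_mul_self n⟩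
  obtain ⟨s, hs, hs'⟩ : ∃ s, n ≤ s * s ∧ ∀ j < s, j * j < n :=
    ⟨Nat.find hex, Nat.find_spec hex, fun j hj => not_le.1 (Nat.find_min hex hj)⟩
  have hsn : s ≤ n := by
    by_contra h
    have := hs' n (by omega)
    nlinarith
  have hs0 : 0 < s := Nat.pos_of_ne_zero fun h => by subst h; omega
  obtain ⟨K, hK⟩ : ∃ K, K = (4 * d + 3) * s := ⟨_, rfl⟩
  have hK1 : 1 ≤ K := by rw [hK]; exact Nat.mul_pos (by omega) hs0
  obtain ⟨l, hl⟩ : ∃ l, l = Nat.log 2 n := ⟨_, rfl⟩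
  have hl1 : 1 ≤ l := by rw [hl]; exact Nat.log_pos (by norm_num) hn
  obtain ⟨k, hk⟩ : ∃ k, k = K ^ (d - 1) := ⟨_, rfl⟩
  have hk1 : 1 ≤ k := by rw [hk]; exact Nat.pow_pos hK1
  have hl2 : (l : ℝ) ≤ 2 * Real.log n := by rw [hl]; exact natLog_le (by omega)
  have hk2 : (k : ℝ) ≤ (2 * ((4 * d + 3 : ℕ) : ℝ)) ^ (d - 1) * (n : ℝ) ^ (((d : ℝ) - 1) / 2) := by
    rw [hk, hK]; exact pow_le_rpow hd (by omega) hs'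
  have hlog : 0 ≤ Real.log n := Real.log_natCast_nonneg n
  obtain ⟨T, hT⟩ : ∃ T, T = P * (E * (4 * d + 2) + F) := ⟨_, rfl⟩
  obtain ⟨c, hc⟩ : ∃ c : ℝ, c = (2 * ((4 * d + 3 : ℕ) : ℝ)) ^ (d - 1) := ⟨_, rfl⟩
  have hc1 : 1 ≤ c := by
    rw [hc]
    refine one_le_pow₀ ?_
    push_cast
    have : (0 : ℝ) ≤ d := Nat.cast_nonneg d
    linarith
  rw [← hc] at hk2 ⊢
  have hTc : (P : ℝ) * (E * (4 * d + 2) + F) = T := by rw [hT]; push_cast; ring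
  rw [hTc]
  obtain ⟨x, hx⟩ : ∃ x, x = (n : ℝ) ^ (((d : ℝ) - 1) / 2) := ⟨_, rfl⟩
  have hx0 : 0 ≤ x := by rw [hx]; positivity
  have hxn : (n : ℝ) ^ (((d : ℝ) + 1) / 2) = n * x := by
    rw [hx, ← Real.rpow_one_add' (Nat.cast_nonneg n)]
    · congr 1; ring
    · have : (1 : ℝ) ≤ d := by exact_mod_cast hd
      have h2 : 0 < 1 + ((d : ℝ) - 1) / 2 := by linarith
      exact h2.ne'
  rw [hxn, ← hx]
  rw [← hx] at hk2
  have hlk : (l : ℝ) * k ≤ 2 * Real.log n * (c * x) :=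
    mul_le_mul hl2 hk2 (Nat.cast_nonneg k) (by positivity)
  -- the time bounds, in terms of natural numbers
  have hbuild : ((P * (F * (l * (n * k))) : ℕ) : ℝ) ≤ T * (2 * c) * (n * x) * Real.log n := by
    have h1 : P * (F * (l * (n * k))) ≤ T * (l * k * n) := by
      rw [hT]
      calc P * (F * (l * (n * k))) = P * F * (l * k * n) := by ring
        _ ≤ P * (E * (4 * d + 2) + F) * (l * k * n) := by gcongr; omega
    calc ((P * (F * (l * (n * k))) : ℕ) : ℝ) ≤ ((T * (l * k * n) : ℕ) : ℝ) := by exact_mod_cast h1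
      _ = T * (l * k * n) := by push_cast; ring
      _ ≤ T * (2 * Real.log n * (c * x) * n) := by gcongr
      _ = T * (2 * c) * (n * x) * Real.log n := by ring
  have hop : ((P * (E * l * ((4 * d + 2) * k)) : ℕ) : ℝ) ≤ T * (2 * c) * x * Real.log n := by
    have h1 : P * (E * l * ((4 * d + 2) * k)) ≤ T * (l * k) := by
      rw [hT]
      calc P * (E * l * ((4 * d + 2) * k)) = P * (E * (4 * d + 2)) * (l * k) := by ring
        _ ≤ P * (E * (4 * d + 2) + F) * (l * k) := by gcongr; omega
    calc ((P * (E * l * ((4 * d + 2) * k)) : ℕ) : ℝ) ≤ ((T * (l * k) : ℕ) : ℝ) := by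
          exact_mod_cast h1
      _ = T * (l * k) := by push_cast; ring
      _ ≤ T * (2 * Real.log n * (c * x)) := by gcongr
      _ = T * (2 * c) * x * Real.log n := by ring
  have hsamp : ((P * (E * l) : ℕ) : ℝ) ≤ T * (2 * c) * Real.log n := by
    have h1 : P * (E * l) ≤ T * l := by
      rw [hT]
      calc P * (E * l) = P * E * l := by ring
        _ ≤ P * (E * (4 * d + 2) + F) * l := by gcongr; nlinarith
    calc ((P * (E * l) : ℕ) : ℝ) ≤ ((T * l : ℕ) : ℝ) := by exact_mod_cast h1
      _ = T * l := by push_cast; ring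
      _ ≤ T * (c * (2 * Real.log n)) := by
        gcongr
        exact hl2.trans (le_mul_of_one_le_left (by positivity) hc1)
      _ = T * (2 * c) * Real.log n := by ring
  refine ⟨fun σ A S => ∃ L : Layout, LayoutOK L B K ∧
    2 ^ L.H ≤ 2 * ((d + 1) * K ^ d + 2 * n) ∧ Rep L d σ A S, ?_, ?_⟩
  -- For sorting, `l + 3` serves as the bound on the height of the tournament: `4 * n` is at most `2
  -- ^ (l + 3)`.
  · refine HaltsWithin.of_runs (T := P * (F * (l * (n * k)))) (fun ω => ?_) hbuild
    have hlog2 : n < 2 ^ (l + 1) := by rw [hl]; exact Nat.lt_pow_succ_log_self (by norm_num) n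
    have hKd : K ^ d = (4 * d + 3) * s * k := by
      rw [hk, ← hK, ← pow_succ']; congr 1; omega
    have hnk : n ≤ n * k := Nat.le_mul_of_pos_right _ hk1
    have hlnk : n * k ≤ l * (n * k) := Nat.le_mul_of_pos_left _ hl1
    refine Runs.mono (build_spec (W := F * (l * (n * k))) (H := l + 3) hB hd (by omega) hs hs' hK
      ?_ ?_ ?_ ?_) (Nat.mul_le_mul_right _ (by omega)) fun τ => ?_
    · rw [show l + 3 = l + 1 + 2 by ring, pow_add]; omega
    · calc (l + 3 + 1) * (2 * n + 1) ≤ (5 * l) * (3 * n) := Nat.mul_le_mul (by omega) (by omega)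
        _ = 15 * (l * n) := by ring
        _ ≤ F * (l * (n * k)) := Nat.mul_le_mul (by omega) (Nat.mul_le_mul_left _ hnk)
    · rw [← hk]
      calc (2 * n + 1) * (k + 1) ≤ (3 * n) * (2 * k) := Nat.mul_le_mul (by omega) (by omega)
        _ = 6 * (n * k) := by ring
        _ ≤ F * (l * (n * k)) := Nat.mul_le_mul (by omega) hlnk
    · rw [hKd]
      have h1 : (d + 1) * ((4 * d + 3) * s * k) ≤ (d + 1) * (4 * d + 3) * (n * k) := by
        calc (d + 1) * ((4 * d + 3) * s * k) = (d + 1) * (4 * d + 3) * (s * k) := by ring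
          _ ≤ _ := by gcongr
      calc (d + 1) * ((4 * d + 3) * s * k) + 2 * n
          < (d + 1) * (4 * d + 3) * (n * k) + 24 * (n * k) := by omega
        _ = F * (n * k) := by rw [hF]; ring
        _ ≤ F * (l * (n * k)) := Nat.mul_le_mul_left _ hlnk
    · exact fun ⟨L, h1, h2, h3⟩ => ⟨L, h1, h2, h3⟩
  · rintro σ A S ⟨L, hL, hH, hR⟩
    have hU' : L.H + 2 ≤ E * l := by
      rw [hE, hl]; exact height_le hd hn hK hsn hH
    have hU : L.H < E * l := by omega
    have hk' : E * l * ((4 * d + 2) * k) = E * l * ((4 * d + 2) * K ^ (d - 1)) := by rw [hk]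
    refine ⟨fun b => HaltsWithin.of_runs (fun ω => ?_) hop, fun j =>
      ⟨HaltsWithin.of_runs (fun ω => ?_) hop, HaltsWithin.of_runs (fun ω => ?_) hop,
      HaltsWithin.of_runs (fun ω => ?_) hop, HaltsWithin.of_runs (fun ω => ?_) hop⟩,
      fun hne => ⟨HaltsWithin.of_runs (fun ω => ?_) hsamp, fun p hp => sample_law hL hR hp⟩⟩
    · exact Runs.mono (weight_spec hU hd hL hK1 hR b)
        (by rw [hk']; exact Nat.mul_le_mul_right _ (by omega)) fun τ h => ⟨⟨L, hL, hH, h.1⟩, h.2⟩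
    · exact Runs.mono (double_spec hU hd hL hK1 hR)
        (by rw [hk']; exact Nat.mul_le_mul_right _ (by omega)) fun τ h => ⟨L, hL, hH, h⟩
    · exact Runs.mono (halve_spec hU hd hL hK1 hR)
        (by rw [hk']; exact Nat.mul_le_mul_right _ (by omega)) fun τ h => ⟨L, hL, hH, h⟩
    · exact Runs.mono (flagBox_spec (x := 1) (A' := insert j A) hU hd hL hK1 hR (by simp)
        (fun k hk => by simp [hk]))
        (by rw [hk']; exact Nat.mul_le_mul_right _ (by omega)) fun τ h => ⟨L, hL, hH, h⟩
    · exact Runs.mono (flagBox_spec (x := 0) (A' := A.erase j) hU hd hL hK1 hR (by simp)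
        (fun k hk => by simp [hk]))
        (by rw [hk']; exact Nat.mul_le_mul_right _ (by omega)) fun τ h => ⟨L, hL, hH, h⟩
    · exact Runs.mono (sample_halts (U := E * l) (by omega) hL hR hne)
        (Nat.mul_le_mul_right _ (by omega)) fun τ h => ⟨⟨L, hL, hH, h.1⟩, h.2⟩
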